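/- **Proposition 3.4 (reconstruction formula).** Let $k_0>0$ and consider the focusing case $\epsilon=-1$. Let $Q:\mathbb R_x\times\mathbb R_t\to\mathbb C^{m\times m}$ be a $C^3$ function with $Q^T=Q$ solving $$Q_t+Q_{xxx}-3\epsilon\,(Q_xQ^\dagger Q+QQ^\dagger Q_x)=0,$$ with $Q(x,t)\to Q_\pm$ as $x\to\pm\infty$, where $Q_\pm Q_\pm^\dagger=Q_\pm^\dagger Q_\pm=k_0^2I_m$. Assume that for every $T>0$ there is $g\in L^1(\mathbb R)$ such that for $|t|\le T$ and each matrix entry $(i,j)$ one has $(1+|x|)|Q-Q_\pm|+|Q_x|+|Q_{xx}|+|Q_{xxx}|\le g(x)$ for $\pm x\ge 0$ (applied to the $(i,j)$ entries). *Notation.* $k(z)=\frac12(z+\epsilon k_0^2/z)$, $\lambda(z)=\frac12(z-\epsilon k_0^2/z)$, $\gamma(z)=1-\epsilon k_0^2/z^2$, $\theta(x,t;z)=\lambda\,(x+(4k^2+2\epsilon k_0^2)t)$, $D^\pm=\{z:\pm(|z|^2-k_0^2)\operatorname{Im}z>0\}$, $\Sigma=\mathbb R\cup\{|z|=k_0\}$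 oriented so that $D^+$ lies on its left, $\Sigma_0=\Sigma\setminus\{0,\pm ik_0\}$. With $$\underline\sigma_3=\begin{pmatrix}I_m&0\\0&-I_m\end{pmatrix},\quad \underline Q=\begin{pmatrix}0&Q\\ \epsilon Q^\dagger&0\end{pmatrix},\quad M=-ik\underline\sigma_3+\underline Q,$$ $$N=-4ik^3\underline\sigma_3+4k^2\underline Q-2ik(\underline Q^2+\underline Q_x)\underline\sigma_3-\underline Q_{xx}+2\underline Q^3+\underline Q_x\underline Q-\underline Q\,\underline Q_x,$$ let $\Phi=(\phi,\bar\phi)$ and $\Psi=(\bar\psi,\psi)$ be the Jost solutions: $2m\times m$ blocks solving $f_x=Mf$, $f_t=Nf$, normalized by $(\phi e^{i\theta},\bar\phi e^{-i\theta})\to E_-$ as $x\to-\infty$ and $(\bar\psi e^{i\theta},\psi e^{-i\theta})\to E_+$ as $x\to+\infty$, $E_\pm=I_{2m}-\frac iz\underline\sigma_3\underline Q_\pm$ (blockwise; $\phi,\psi$ for $z\in D^+\cup\Sigma_0$, $\bar\phi,\bar\psi$ for $z\in D^-\cup\Sigma_0$). Put $\hat W=\phi e^{i\theta}$, $\bar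 W=\bar\phi e^{-i\theta}$, $\bar V=\bar\psi e^{i\theta}$, $\hat V=\psi e^{-i\theta}$; the superscripts up, dn denote the upper and lower $m\times m$ blocks. On $\Sigma_0$ let $S=\begin{pmatrix}a&\bar b\\ b&\bar a\end{pmatrix}$ be the matrix, independent of $(x,t)$, with $\Phi=\Psi S$, and $\rho=ba^{-1}$, $\bar\rho=\bar b\bar a^{-1}$. The blocks $a,\bar a$ are continued to $D^+$, $D^-$ by $\gamma(z)a(z)=\bar\psi(z^*)^\dagger\phi(z)$ and $\gamma(z)\bar a(z)=\psi(z^*)^\dagger\bar\phi(z)$. (The matrices $(\hat Wa^{-1},\hat V)$ in $D^+$ and $(\bar V,\bar W\bar a^{-1})$ in $D^-$ form the solution of the Riemann–Hilbert problem.) *Spectral assumptions.* $\det a\ne0$ on $\Sigma_0$, and $a^{-1}$ is bounded in $D^+$ near $\pm ik_0$. In $D^+\cap\{\operatorname{Im}z>0\}$ the function $\det a$ has exactly $\mathcal N$ zeros $z_1,\dots,z_{\mathcal N}$, all simple. Put $\zeta_n=z_n$, $\zeta_{\mathcal N+n}=\epsilon k_0^2/z_n^*$ for $1\le n\le\mathcal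 N$. *Conclusion.* There are unique matrices $C_n,\bar C_n\in\mathbb C^{m\times m}$ ($1\le n\le2\mathcal N$), independent of $(x,t)$, such that for all $x,t$ the simple-pole residues (the limits of $z-\zeta_n$, resp. $z-\zeta_n^*$, times the function) satisfy $$\operatorname*{Res}_{z=\zeta_n}\hat Wa^{-1}=e^{2i\theta(\zeta_n)}\hat V(\zeta_n)C_n,\qquad \operatorname*{Res}_{z=\zeta_n^*}\bar W\bar a^{-1}=e^{-2i\theta(\zeta_n^*)}\bar V(\zeta_n^*)\bar C_n .$$ For all $x,t\in\mathbb R$ the following integrals converge absolutely and $$Q(x,t)=Q_++i\sum_{n=1}^{2\mathcal N}e^{-2i\theta(x,t;\zeta_n^*)}\bar V^{up}(x,t;\zeta_n^*)\bar C_n+\frac1{2\pi}\int_\Sigma e^{-2i\theta(x,t;\zeta)}\bar V^{up}(x,t;\zeta)\bar\rho(\zeta)\,d\zeta,$$ $$Q^\dagger(x,t)=Q_+^\dagger-i\epsilon\sum_{n=1}^{2\mathcal N}e^{2i\theta(x,t;\zeta_n)}\hat V^{dn}(x,t;\zeta_n)C_n+\frac{\epsilon}{2\pi}\int_\Sigma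 e^{2i\theta(x,t;\zeta)}\hat V^{dn}(x,t;\zeta)\rho(\zeta)\,d\zeta .$$ Moreover $\bar C_n=\epsilon C_n^\dagger$ for $1\le n\le 2\mathcal N$. -/

import Mathlib

open scoped Matrix Topology
open Filter MeasureTheory

noncomputable section

namespace MMKdV

/-- `m × m` complex matrices. -/
abbrev Sq (m : ℕ) := Matrix (Fin m) (Fin m) ℂ

/-- `2m × m` complex matrices: an upper and a lower `m × m` block. -/
abbrev Col (m : ℕ) := Matrix (Fin m ⊕ Fin m) (Fin m) ℂ

/-- `2m × 2m` complex matrices, in blocks of size `m × m`. -/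
abbrev Blk (m : ℕ) := Matrix (Fin m ⊕ Fin m) (Fin m ⊕ Fin m) ℂ

/-! ### The equation and its boundary conditions -/

/-- Entrywise partial derivative in `x`. -/
def dx {m : ℕ} (Q : ℝ → ℝ → Sq m) (x t : ℝ) : Sq m :=
  Matrix.of fun i j => deriv (fun y => Q y t i j) x

/-- Entrywise partial derivative in `t`. -/
def dt {m : ℕ} (Q : ℝ → ℝ → Sq m) (x t : ℝ) : Sq m :=
  Matrix.of fun i j => deriv (fun s => Q x s i j) t

/-- `Q` is a classical solution on `ℝ × ℝ`, with values in the symmetric matrices, of the focusing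
modified matrix KdV equation, with the non-zero boundary values `Qm` at `x = -∞` and `Qp` at
`x = +∞`.  The field `decay` is the integrability of `Q - Q±` on the half-lines (with
the first moment), and of the derivatives up to order three, locally uniformly in time. -/
structure IsPotential {m : ℕ} (k₀ : ℝ) (Q : ℝ → ℝ → Sq m) (Qm Qp : Sq m) : Prop where
  smooth : ∀ i j, ContDiff ℝ 3 (fun p : ℝ × ℝ => Q p.1 p.2 i j)
  equation : ∀ x t, dt Q x t + dx (dx (dx Q)) x t
    + (3 : ℂ) • (dx Q x t * (Q x t)ᴴ * Q x t + Q x t * (Q x t)ᴴ * dx Q x t) = 0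
  symm : ∀ x t, (Q x t)ᵀ = Q x t
  unitary_minus : Qm * Qmᴴ = ((k₀ : ℂ) ^ 2) • 1 ∧ Qmᴴ * Qm = ((k₀ : ℂ) ^ 2) • 1
  unitary_plus : Qp * Qpᴴ = ((k₀ : ℂ) ^ 2) • 1 ∧ Qpᴴ * Qp = ((k₀ : ℂ) ^ 2) • 1
  tendsto_minus : ∀ t, Tendsto (fun x => Q x t) atBot (𝓝 Qm)
  tendsto_plus : ∀ t, Tendsto (fun x => Q x t) atTop (𝓝 Qp)
  decay : ∀ T : ℝ, ∃ g : ℝ → ℝ, Integrable g ∧ ∀ t, |t| ≤ T → ∀ x i j,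
    (x ≤ 0 → (1 + |x|) * ‖Q x t i j - Qm i j‖ + ‖dx Q x t i j‖ + ‖dx (dx Q) x t i j‖
      + ‖dx (dx (dx Q)) x t i j‖ ≤ g x) ∧
    (0 ≤ x → (1 + |x|) * ‖Q x t i j - Qp i j‖ + ‖dx Q x t i j‖ + ‖dx (dx Q) x t i j‖
      + ‖dx (dx (dx Q)) x t i j‖ ≤ g x)

/-! ### The uniformization variable `z = k + λ`, with `λ² = k² + k₀²` -/

def kz (k₀ : ℝ) (z : ℂ) : ℂ := (z - (k₀ : ℂ) ^ 2 / z) / 2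

def lam (k₀ : ℝ) (z : ℂ) : ℂ := (z + (k₀ : ℂ) ^ 2 / z) / 2

/-- `θ(x,t;z)`.  The limits of the two Lax matrices as `x → ±∞` satisfy
`N± = (4 k² - 2 k₀²) M±`, and `∓ i λ` are the eigenvalues of `M±`. -/
def theta (k₀ x t : ℝ) (z : ℂ) : ℂ :=
  lam k₀ z * ((x : ℂ) + (4 * kz k₀ z ^ 2 - 2 * (k₀ : ℂ) ^ 2) * (t : ℂ))

def gam (k₀ : ℝ) (z : ℂ) : ℂ := 1 + (k₀ : ℂ) ^ 2 / z ^ 2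

/-- The region `Im λ > 0`. -/
def Dplus (k₀ : ℝ) : Set ℂ := {z | 0 < (‖z‖ ^ 2 - k₀ ^ 2) * z.im}

/-- The continuous spectrum `ℝ ∪ {|z| = k₀}` without the branch points `± i k₀` and without the
point `z = 0`, which corresponds to `k = ∞`. -/
def Sigma0 (k₀ : ℝ) : Set ℂ :=
  {z | (z.im = 0 ∨ ‖z‖ = k₀) ∧ z ≠ 0 ∧ z ≠ Complex.I * k₀ ∧ z ≠ -(Complex.I * k₀)}

/-! ### The Lax pair -/

def sigma3 (m : ℕ) : Blk m := Matrix.fromBlocks 1 0 0 (-1)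

/-- The `2m × 2m` matrix with blocks `0, A, -A†, 0`. -/
def under {m : ℕ} (A : Sq m) : Blk m := Matrix.fromBlocks 0 A (-Aᴴ) 0

def laxM {m : ℕ} (k₀ : ℝ) (Q : ℝ → ℝ → Sq m) (z : ℂ) (x t : ℝ) : Blk m :=
  (-(Complex.I * kz k₀ z)) • sigma3 m + under (Q x t)

def laxN {m : ℕ} (k₀ : ℝ) (Q : ℝ → ℝ → Sq m) (z : ℂ) (x t : ℝ) : Blk m :=
  let k := kz k₀ z
  let U := under (Q x t)
  let Ux := under (dx Q x t)
  let Uxx := under (dx (dx Q) x t);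
  (-(4 * Complex.I * k ^ 3)) • sigma3 m + (4 * k ^ 2) • U
    - (2 * Complex.I * k) • ((U * U + Ux) * sigma3 m) - Uxx + (2 : ℂ) • (U * U * U)
    + Ux * U - U * Ux

/-- `f` is a simultaneous solution of `f_x = M f` and `f_t = N f`. -/
def IsLaxSolution {m : ℕ} (k₀ : ℝ) (Q : ℝ → ℝ → Sq m) (z : ℂ) (f : ℝ → ℝ → Col m) : Prop :=
  ∀ x t i j,
    HasDerivAt (fun y => f y t i j) ((laxM k₀ Q z x t * f x t) i j) x ∧
    HasDerivAt (fun s => f x s i j) ((laxN k₀ Q z x t * f x t) i j) t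

/-! ### Jost eigenfunctions -/

/-- The eigenvector matrix `E±(z) = I - (i/z) σ₃ Q±` of the limiting Lax pair. -/
def asymE {m : ℕ} (z : ℂ) (Qpm : Sq m) : Blk m :=
  1 - (Complex.I / z) • (sigma3 m * under Qpm)

/-- Lax solution `f` with `e^{iθ} f → (first m columns of E±)` along `l` for every `t`. -/
def IsJostFst {m : ℕ} (k₀ : ℝ) (Q : ℝ → ℝ → Sq m) (Qpm : Sq m) (l : Filter ℝ) (z : ℂ)
    (f : ℝ → ℝ → Col m) : Prop :=
  IsLaxSolution k₀ Q z f ∧ ∀ t, Tendsto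
    (fun x => Complex.exp (Complex.I * theta k₀ x t z) • f x t) l (𝓝 (asymE z Qpm).toCols₁)

/-- Lax solution `f` with `e^{-iθ} f → (last m columns of E±)` along `l` for every `t`. -/
def IsJostSnd {m : ℕ} (k₀ : ℝ) (Q : ℝ → ℝ → Sq m) (Qpm : Sq m) (l : Filter ℝ) (z : ℂ)
    (f : ℝ → ℝ → Col m) : Prop :=
  IsLaxSolution k₀ Q z f ∧ ∀ t, Tendsto
    (fun x => Complex.exp (-(Complex.I * theta k₀ x t z)) • f x t) l (𝓝 (asymE z Qpm).toCols₂)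

/-- `φ(x,t;z)`, the first column of `Φ` (used for `z` in `D⁺` and on the continuous spectrum). -/
def phi {m : ℕ} (k₀ : ℝ) (Q : ℝ → ℝ → Sq m) (Qm : Sq m) (z : ℂ) : ℝ → ℝ → Col m :=
  Classical.epsilon (IsJostFst k₀ Q Qm atBot z)

/-- `φ̄(x,t;z)`, the second column of `Φ` (for `z` in `D⁻` and on the continuous spectrum). -/
def phiBar {m : ℕ} (k₀ : ℝ) (Q : ℝ → ℝ → Sq m) (Qm : Sq m) (z : ℂ) : ℝ → ℝ → Col m :=
  Classical.epsilon (IsJostSnd k₀ Q Qm atBot z)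

/-- `ψ̄(x,t;z)`, the first column of `Ψ` (for `z` in `D⁻` and on the continuous spectrum). -/
def psiBar {m : ℕ} (k₀ : ℝ) (Q : ℝ → ℝ → Sq m) (Qp : Sq m) (z : ℂ) : ℝ → ℝ → Col m :=
  Classical.epsilon (IsJostFst k₀ Q Qp atTop z)

/-- `ψ(x,t;z)`, the second column of `Ψ` (for `z` in `D⁺` and on the continuous spectrum). -/
def psi {m : ℕ} (k₀ : ℝ) (Q : ℝ → ℝ → Sq m) (Qp : Sq m) (z : ℂ) : ℝ → ℝ → Col m :=
  Classical.epsilon (IsJostSnd k₀ Q Qp atTop z)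

/-- `Ŵ = φ e^{iθ}`. -/
def WHat {m : ℕ} (k₀ : ℝ) (Q : ℝ → ℝ → Sq m) (Qm : Sq m) (x t : ℝ) (z : ℂ) : Col m :=
  Complex.exp (Complex.I * theta k₀ x t z) • phi k₀ Q Qm z x t

/-- `W̄ = φ̄ e^{-iθ}`. -/
def WBar {m : ℕ} (k₀ : ℝ) (Q : ℝ → ℝ → Sq m) (Qm : Sq m) (x t : ℝ) (z : ℂ) : Col m :=
  Complex.exp (-(Complex.I * theta k₀ x t z)) • phiBar k₀ Q Qm z x t

/-- `V̄ = ψ̄ e^{iθ}`. -/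
def VBar {m : ℕ} (k₀ : ℝ) (Q : ℝ → ℝ → Sq m) (Qp : Sq m) (x t : ℝ) (z : ℂ) : Col m :=
  Complex.exp (Complex.I * theta k₀ x t z) • psiBar k₀ Q Qp z x t

/-- `V̂ = ψ e^{-iθ}`. -/
def VHat {m : ℕ} (k₀ : ℝ) (Q : ℝ → ℝ → Sq m) (Qp : Sq m) (x t : ℝ) (z : ℂ) : Col m :=
  Complex.exp (-(Complex.I * theta k₀ x t z)) • psi k₀ Q Qp z x t

/-! ### Scattering data -/

/-- The scattering matrix on the continuous spectrum: the constant matrix `S(z)` with `Φ = Ψ S`,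
where `Φ = (φ, φ̄)` and `Ψ = (ψ̄, ψ)`.  Its blocks are `a, b̄` (upper) and `b, ā` (lower). -/
def scat {m : ℕ} (k₀ : ℝ) (Q : ℝ → ℝ → Sq m) (Qm Qp : Sq m) (z : ℂ) : Blk m :=
  Classical.epsilon fun S : Blk m => ∀ x t,
    Matrix.fromCols (phi k₀ Q Qm z x t) (phiBar k₀ Q Qm z x t)
      = Matrix.fromCols (psiBar k₀ Q Qp z x t) (psi k₀ Q Qp z x t) * S

/-- Reflection coefficient `ρ = b a⁻¹` on the continuous spectrum. -/
def rho {m : ℕ} (k₀ : ℝ) (Q : ℝ → ℝ → Sq m) (Qm Qp : Sq m) (z : ℂ) : Sq m :=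
  (scat k₀ Q Qm Qp z).toBlocks₂₁ * (scat k₀ Q Qm Qp z).toBlocks₁₁⁻¹

/-- Reflection coefficient `ρ̄ = b̄ ā⁻¹` on the continuous spectrum. -/
def rhoBar {m : ℕ} (k₀ : ℝ) (Q : ℝ → ℝ → Sq m) (Qm Qp : Sq m) (z : ℂ) : Sq m :=
  (scat k₀ Q Qm Qp z).toBlocks₁₂ * (scat k₀ Q Qm Qp z).toBlocks₂₂⁻¹

/-- The block `a` continued to `D⁺`, by `γ(z) a(z) = ψ̄(x,t;z*)† φ(x,t;z)`.  The right-hand side does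
not depend on `(x,t)` and is evaluated at the origin; on the continuous spectrum
the same formula gives the block `a` of `S`, because `Ψ(x,t;z*)† Ψ(x,t;z) = γ(z) I`. -/
def aPlus {m : ℕ} (k₀ : ℝ) (Q : ℝ → ℝ → Sq m) (Qm Qp : Sq m) (z : ℂ) : Sq m :=
  (gam k₀ z)⁻¹ • ((psiBar k₀ Q Qp (starRingEnd ℂ z) 0 0)ᴴ * phi k₀ Q Qm z 0 0)

/-- The block `ā` continued to `D⁻`, by `γ(z) ā(z) = ψ(x,t;z*)† φ̄(x,t;z)`. -/
def aMinus {m : ℕ} (k₀ : ℝ) (Q : ℝ → ℝ → Sq m) (Qm Qp : Sq m) (z : ℂ) : Sq m :=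
  (gam k₀ z)⁻¹ • ((psi k₀ Q Qp (starRingEnd ℂ z) 0 0)ᴴ * phiBar k₀ Q Qm z 0 0)

/-- Absence of spectral singularities: `det a ≠ 0` on the continuous spectrum, and `a⁻¹` stays
bounded at the two branch points (where `a` itself may have a pole). -/
def NoSpectralSingularity {m : ℕ} (k₀ : ℝ) (Q : ℝ → ℝ → Sq m) (Qm Qp : Sq m) : Prop :=
  (∀ z ∈ Sigma0 k₀, (scat k₀ Q Qm Qp z).toBlocks₁₁.det ≠ 0) ∧
  ∀ w : ℂ, w = Complex.I * k₀ ∨ w = -(Complex.I * k₀) → ∃ B : ℝ,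
    ∀ᶠ z in 𝓝[Dplus k₀] w, ∀ i j, ‖(aPlus k₀ Q Qm Qp z)⁻¹ i j‖ ≤ B

/-- `det a` has exactly the zeros `z_1, …, z_N` (pairwise distinct) in the part `Im z > 0` of `D⁺`,
and they are simple. -/
def HasSimpleZeros {m N : ℕ} (k₀ : ℝ) (Q : ℝ → ℝ → Sq m) (Qm Qp : Sq m) (z : Fin N → ℂ) : Prop :=
  Function.Injective z ∧
  (∀ w : ℂ, w ∈ Set.range z ↔ w ∈ Dplus k₀ ∧ 0 < w.im ∧ (aPlus k₀ Q Qm Qp w).det = 0) ∧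
  ∀ n, deriv (fun w => (aPlus k₀ Q Qm Qp w).det) (z n) ≠ 0

/-- The `2N` discrete eigenvalues in `D⁺`: `ζ_n = z_n` and `ζ_{N+n} = -k₀²/z_n*`. -/
def zeta {N : ℕ} (k₀ : ℝ) (z : Fin N → ℂ) : Fin N ⊕ Fin N → ℂ :=
  Sum.elim z fun n => -((k₀ : ℂ) ^ 2) / starRingEnd ℂ (z n)

/-- `C` is the norming constant at the simple pole `w ∈ D⁺` of `Ŵ a⁻¹`: for all `x, t`,
`Res_{z = w} Ŵ a⁻¹ = e^{2iθ(w)} V̂(w) C`. -/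
def IsNorming {m : ℕ} (k₀ : ℝ) (Q : ℝ → ℝ → Sq m) (Qm Qp : Sq m) (w : ℂ) (C : Sq m) : Prop :=
  ∀ x t, Tendsto (fun z => (z - w) • (WHat k₀ Q Qm x t z * (aPlus k₀ Q Qm Qp z)⁻¹)) (𝓝[≠] w)
    (𝓝 (Complex.exp (2 * Complex.I * theta k₀ x t w) • (VHat k₀ Q Qp x t w * C)))

/-- `C` is the norming constant at the simple pole `w ∈ D⁻` of `W̄ ā⁻¹`: for all `x, t`,
`Res_{z = w} W̄ ā⁻¹ = e^{-2iθ(w)} V̄(w) C`. -/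
def IsNormingBar {m : ℕ} (k₀ : ℝ) (Q : ℝ → ℝ → Sq m) (Qm Qp : Sq m) (w : ℂ) (C : Sq m) : Prop :=
  ∀ x t, Tendsto (fun z => (z - w) • (WBar k₀ Q Qm x t z * (aMinus k₀ Q Qm Qp z)⁻¹)) (𝓝[≠] w)
    (𝓝 (Complex.exp (-(2 * Complex.I * theta k₀ x t w)) • (VBar k₀ Q Qp x t w * C)))

/-! ### Integration over the contour `Σ = ℝ ∪ {|z| = k₀}` -/

/-- Absolute integrability over `Σ`, entrywise. -/
def IntegrableSigma {m : ℕ} (k₀ : ℝ) (f : ℂ → Sq m) : Prop :=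
  ∀ i j, Integrable (fun s : ℝ => f s i j) ∧
    IntervalIntegrable (fun p : ℝ => f (circleMap 0 k₀ p) i j) volume 0 (2 * Real.pi)

/-- The integral over `Σ`, entrywise, with the orientation for which `D⁺` is on the left: the parts
`|s| > k₀` of the real line to the right, the part `|s| < k₀` to the left, the upper half of the
circle clockwise, the lower half counterclockwise. -/
def integralSigma {m : ℕ} (k₀ : ℝ) (f : ℂ → Sq m) : Sq m :=
  Matrix.of fun i j =>
    (∫ s in {s : ℝ | k₀ < |s|}, f s i j) - (∫ s in {s : ℝ | |s| < k₀}, f s i j)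
    - (∫ p in (0 : ℝ)..Real.pi, deriv (circleMap 0 k₀) p * f (circleMap 0 k₀ p) i j)
    + ∫ p in Real.pi..(2 * Real.pi), deriv (circleMap 0 k₀) p * f (circleMap 0 k₀ p) i j

/-- `e^{-2iθ} V̄^{up} ρ̄`. -/
def kernelUp {m : ℕ} (k₀ : ℝ) (Q : ℝ → ℝ → Sq m) (Qm Qp : Sq m) (x t : ℝ) (z : ℂ) : Sq m :=
  Complex.exp (-(2 * Complex.I * theta k₀ x t z)) •
    ((VBar k₀ Q Qp x t z).toRows₁ * rhoBar k₀ Q Qm Qp z)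

/-- `e^{2iθ} V̂^{dn} ρ`. -/
def kernelDn {m : ℕ} (k₀ : ℝ) (Q : ℝ → ℝ → Sq m) (Qm Qp : Sq m) (x t : ℝ) (z : ℂ) : Sq m :=
  Complex.exp (2 * Complex.I * theta k₀ x t z) •
    ((VHat k₀ Q Qp x t z).toRows₂ * rho k₀ Q Qm Qp z)

end MMKdV

end

section

open scoped Matrix.Norms.Operator
open Asymptotics

namespace MMKdV

/-! ### Volterra equations on half-lines -/

section Volterra

/-! Fix `x` and `t`. On the contour, `Φ = Ψ S` gives `φ a⁻¹ = ψ̄ + ψ ρ`. Its lower block exhibits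
the integrand `e^{2iθ} V̂^{dn} ρ` as the difference of a boundary value from `D⁺` (lower block of `Ŵ
a⁻¹`, meromorphic with simple poles at the `ζ_n`) and one from `D⁻` (lower block of `V̄`,
holomorphic); see `kernelDn_eq`. Both functions behave like `-(i/z) Q†` at infinity and like `-(i/z)
Q₊†` at the origin. Once the principal parts are subtracted, Cauchy's theorem on half-annuli leaves
only the contributions of small and large half-circles, so the integral over `Σ` equals `2π (Q₊† -
Q† + i ∑ residues)` (`integral_contour`, `integralSigma_kernelDn`). This is the formula for `Q†`;
the one for `Q` is its complex conjugate, because `Q` is symmetric.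

The Jost functions come from one Volterra equation. It is a contraction in a sup norm weighted by
`e^{2∫h}` (`volterra_exists`), and it is solved not in matrices but in the Banach algebra of
continuous functions on a compact set of the `z`-plane that are holomorphic inside, so that
regularity in `z` needs no separate argument (`exists_jost_param`). The solution at `t = 0` extends
to the Lax pair by the zero-curvature identity (`zero_curvature_gen`, `frobenius`), and Grönwall's
inequality carries the normalization at `-∞` to all times. Only `φ` is constructed in this way: the
reflection `refl` produces `ψ`, the antilinear map `kap` produces `φ̄` and `ψ̄`, and the sheet
exchange `flip` turns asymptotics at infinity (`large_parameter`) into asymptotics at the origin.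

The symmetry `Qᵀ = Q` makes both Lax matrices infinitesimally symplectic, so the bilinear pairing
`wr` of two solutions is constant. One has `wr ψ φ = -γ a` and `wr φ φ = wr ψ ψ = 0`. At a simple
zero of `det a` the columns of `φ adj(a)` pair to zero with `ψ`, whose columns span a Lagrangian
subspace; hence `φ adj(a) = ψ C'` with `C'` constant, and the norming constant is a multiple of `C'`
(`exists_isNorming`). Differentiating the pairing identities in `z` shows that the norming constants
are symmetric (`isNorming_transpose`). Since `kap` gives `C̄ = -conj C`, it follows that `C̄ = -C†`.
-/

theorem continuous_integral_Iic {B : Type*} [NormedAddCommGroup B] [NormedSpace ℝ B]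
    {F : ℝ → ℝ → B} {b : ℝ → ℝ} (hm : ∀ x, AEStronglyMeasurable (F x) volume)
    (hc : ∀ s, Continuous fun x => F x s) (hb : ∀ X, IntegrableOn b (Set.Iic X))
    (hF : ∀ x s, s ≤ x → ‖F x s‖ ≤ b s) :
    Continuous fun x => ∫ s in Set.Iic x, F x s := by
  rw [continuous_iff_continuousAt]
  intro x₀
  have h1 : (fun x => ∫ s in Set.Iic x, F x s)
      = fun x => ∫ s, (Set.Iic x).indicator (F x) s := by
    funext x
    rw [integral_indicator measurableSet_Iic]
  rw [h1]
  refine continuousAt_of_dominated (bound := (Set.Iic (x₀ + 1)).indicator fun s => |b s|)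
    ?_ ?_ ?_ ?_
  · exact Eventually.of_forall fun x => (hm x).indicator measurableSet_Iic
  · filter_upwards [Iio_mem_nhds (show x₀ < x₀ + 1 by linarith)] with x hx
    refine Eventually.of_forall fun s => ?_
    by_cases hs : s ≤ x
    · rw [Set.indicator_of_mem (show s ∈ Set.Iic x from hs),
        Set.indicator_of_mem (show s ∈ Set.Iic (x₀ + 1) from hs.trans (le_of_lt hx))]
      exact (hF x s hs).trans (le_abs_self _)
    · rw [Set.indicator_of_notMem (show s ∉ Set.Iic x from hs), norm_zero]
      exact Set.indicator_nonneg (fun _ _ => abs_nonneg _) _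
  · exact (integrable_indicator_iff measurableSet_Iic).2 (hb _).abs
  -- The indicator of `Iic x` at `s` is locally constant in `x` near `x₀` unless `s = x₀`, which is
  -- a null set.
  · have : ∀ᵐ s : ℝ, s ≠ x₀ := by
      simp [ae_iff, measure_singleton]
    filter_upwards [this] with s hs
    rcases lt_or_gt_of_ne hs with hs | hs
    · have : (fun x => (Set.Iic x).indicator (F x) s) =ᶠ[𝓝 x₀] fun x => F x s := by
        filter_upwards [Ioi_mem_nhds hs] with x hx
        rw [Set.indicator_of_mem (show s ∈ Set.Iic x from le_of_lt (Set.mem_Ioi.1 hx))]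
      exact ((hc s).continuousAt).congr this.symm
    · have : (fun x => (Set.Iic x).indicator (F x) s) =ᶠ[𝓝 x₀] fun _ => 0 := by
        filter_upwards [Iio_mem_nhds hs] with x hx
        rw [Set.indicator_of_notMem (show s ∉ Set.Iic x from fun h => absurd (Set.mem_Iio.1 hx) (not_lt.2 h))]
      exact continuousAt_const.congr this.symm

variable {h : ℝ → ℝ}

theorem hasDerivAt_integral_Iic {B : Type*} [NormedAddCommGroup B] [NormedSpace ℝ B]
    [CompleteSpace B] {h : ℝ → B} (hh : Continuous h) (hint : ∀ x, IntegrableOn h (Set.Iic x))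
    (x : ℝ) : HasDerivAt (fun y => ∫ s in Set.Iic y, h s) (h x) x := by
  have h1 : (fun y => ∫ s in Set.Iic y, h s)
      = fun y => (∫ s in Set.Iic 0, h s) + ∫ s in (0 : ℝ)..y, h s := by
    funext y
    rw [← intervalIntegral.integral_Iic_sub_Iic (hint 0) (hint y)]
    abel
  rw [h1]
  exact (intervalIntegral.integral_hasDerivAt_right (hh.intervalIntegrable _ _)
    (hh.stronglyMeasurableAtFilter _ _) hh.continuousAt).const_add _

theorem tendsto_integral_Iic_atBot {B : Type*} [NormedAddCommGroup B] [NormedSpace ℝ B]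
    [CompleteSpace B] {h : ℝ → B} (hint : ∀ x, IntegrableOn h (Set.Iic x)) :
    Tendsto (fun y => ∫ s in Set.Iic y, h s) atBot (𝓝 0) := by
  have h1 : (fun y => ∫ s in Set.Iic y, h s)
      = fun y => (∫ s in Set.Iic 0, h s) - ∫ s in y..(0 : ℝ), h s := by
    funext y
    rw [← intervalIntegral.integral_Iic_sub_Iic (hint y) (hint 0)]
    abel
  rw [h1]
  have := intervalIntegral_tendsto_integral_Iic (f := h) (μ := volume) 0 (hint 0) tendsto_id
  simpa using (tendsto_const_nhds (x := ∫ s in Set.Iic 0, h s)).sub this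

/-- With `H(s) = ∫_{-∞}^s h`, the integrand is the derivative of `e^{2H}/2`, which tends to `1/2` at
`-∞`. The factor `2` in the exponent is what later makes the Volterra operator a contraction with
constant `1/2`, whatever the size of `∫ h`. -/
theorem integral_Iic_mul_exp (hh : Continuous h) (hint : ∀ x, IntegrableOn h (Set.Iic x))
    (h0 : ∀ s, 0 ≤ h s) (x : ℝ) :
    IntegrableOn (fun s => h s * Real.exp (2 * ∫ r in Set.Iic s, h r)) (Set.Iic x) ∧
    ∫ s in Set.Iic x, h s * Real.exp (2 * ∫ r in Set.Iic s, h r)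
      ≤ Real.exp (2 * ∫ r in Set.Iic x, h r) / 2 := by
  set H : ℝ → ℝ := fun s => ∫ r in Set.Iic s, h r with hH
  have hd : ∀ s, HasDerivAt H (h s) s := hasDerivAt_integral_Iic hh hint
  have hHc : Continuous H := continuous_iff_continuousAt.2 fun s => (hd s).continuousAt
  have hmono : Monotone H := monotone_of_hasDerivAt_nonneg hd h0
  have hI : IntegrableOn (fun s => h s * Real.exp (2 * H s)) (Set.Iic x) := by
    refine Integrable.mono' ((hint x).mul_const (Real.exp (2 * H x)))
      ((hh.mul (Real.continuous_exp.comp (continuous_const.mul hHc))).aestronglyMeasurable) ?_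
    refine (ae_restrict_iff' measurableSet_Iic).2 (Eventually.of_forall fun s hs => ?_)
    rw [Real.norm_eq_abs, abs_of_nonneg (mul_nonneg (h0 s) (Real.exp_pos _).le)]
    have := hmono (Set.mem_Iic.1 hs)
    gcongr
    exact h0 s
  refine ⟨hI, ?_⟩
  have h2 : ∀ s, HasDerivAt (fun y => Real.exp (2 * H y) / 2) (h s * Real.exp (2 * H s)) s := by
    intro s
    exact (((hd s).const_mul 2).exp.div_const 2).congr_deriv (by ring)
  have hlim : Tendsto (fun y => Real.exp (2 * H y) / 2) atBot (𝓝 (1 / 2)) := by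
    have h3 := tendsto_integral_Iic_atBot hint
    have h4 := ((Real.continuous_exp.tendsto _).comp (h3.const_mul 2)).div_const 2
    simpa using h4
  rw [integral_Iic_of_hasDerivAt_of_tendsto' (fun s _ => h2 s) hI hlim]
  linarith

variable {B : Type*} [NormedRing B] [NormedAlgebra ℝ B]
variable {k : ℝ → ℝ → B}

theorem norm_volterra_le (hh : Continuous h) (hint : ∀ x, IntegrableOn h (Set.Iic x))
    (h0 : ∀ s, 0 ≤ h s) (hb : ∀ x s, s ≤ x → ‖k x s‖ ≤ h s) {u : ℝ → B} {C : ℝ} {x : ℝ}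
    (hu : ∀ s ≤ x, ‖u s‖ ≤ C * Real.exp (2 * ∫ r in Set.Iic s, h r)) :
    ‖∫ s in Set.Iic x, k x s * u s‖ ≤ C / 2 * Real.exp (2 * ∫ r in Set.Iic x, h r) := by
  obtain ⟨hI, hle⟩ := integral_Iic_mul_exp hh hint h0 x
  have hC : 0 ≤ C := by
    by_contra hC
    have := (norm_nonneg _).trans (hu x le_rfl)
    nlinarith [Real.exp_pos (2 * ∫ r in Set.Iic x, h r)]
  calc ‖∫ s in Set.Iic x, k x s * u s‖
      ≤ ∫ s in Set.Iic x, C * (h s * Real.exp (2 * ∫ r in Set.Iic s, h r)) := by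
        refine norm_integral_le_of_norm_le (hI.const_mul C) ?_
        refine (ae_restrict_iff' measurableSet_Iic).2 (Eventually.of_forall fun s hs => ?_)
        calc ‖k x s * u s‖ ≤ ‖k x s‖ * ‖u s‖ := norm_mul_le _ _
          _ ≤ h s * (C * Real.exp (2 * ∫ r in Set.Iic s, h r)) :=
              mul_le_mul (hb x s hs) (hu s hs) (norm_nonneg _) (h0 s)
          _ = _ := by ring
    _ = C * ∫ s in Set.Iic x, h s * Real.exp (2 * ∫ r in Set.Iic s, h r) :=
        integral_const_mul _ _
    _ ≤ C * (Real.exp (2 * ∫ r in Set.Iic x, h r) / 2) := by gcongr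
    _ = _ := by ring

/-- Each substitution of the equation into itself halves the constant in the weighted bound, so `‖u‖
≤ C 2⁻ⁿ e^{2H}` for all `n`. -/
theorem volterra_unique (hh : Continuous h) (hint : ∀ x, IntegrableOn h (Set.Iic x))
    (h0 : ∀ s, 0 ≤ h s) (hb : ∀ x s, s ≤ x → ‖k x s‖ ≤ h s) {u : ℝ → B}
    (hbd : ∀ X, ∃ C, ∀ x ≤ X, ‖u x‖ ≤ C) (hu : ∀ x, u x = ∫ s in Set.Iic x, k x s * u s) (x : ℝ) :
    u x = 0 := by
  obtain ⟨C, hC⟩ := hbd x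
  have hC0 : 0 ≤ C := (norm_nonneg _).trans (hC x le_rfl)
  have hHnn : ∀ y, 0 ≤ ∫ r in Set.Iic y, h r := fun y => integral_nonneg fun s => h0 s
  have key : ∀ n : ℕ, ∀ y ≤ x, ‖u y‖ ≤ C / 2 ^ n * Real.exp (2 * ∫ r in Set.Iic y, h r) := by
    intro n
    induction n with
    | zero =>
      intro y hy
      have := Real.one_le_exp (by linarith [hHnn y] : 0 ≤ 2 * ∫ r in Set.Iic y, h r)
      have := hC y hy
      rw [pow_zero, div_one]
      nlinarith
    | succ n ih =>
      intro y hy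
      rw [hu y]
      have := norm_volterra_le hh hint h0 hb (u := u) (x := y) (fun s hs => ih s (hs.trans hy))
      rwa [div_div, ← pow_succ] at this
  have hlim : Tendsto (fun n : ℕ => C / 2 ^ n * Real.exp (2 * ∫ r in Set.Iic x, h r)) atTop
      (𝓝 0) := by
    have h1 : Tendsto (fun n : ℕ => C * (1 / 2 : ℝ) ^ n) atTop (𝓝 (C * 0)) :=
      (tendsto_pow_atTop_nhds_zero_of_lt_one (by norm_num) (by norm_num)).const_mul C
    have h2 := h1.mul_const (Real.exp (2 * ∫ r in Set.Iic x, h r))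
    simpa [div_eq_mul_inv] using h2
  have := ge_of_tendsto' hlim fun n => key n x le_rfl
  exact norm_le_zero_iff.1 this

-- The unknown is rescaled to `u = e^{2H} v` with `v` bounded on the whole line. For `v` the
-- equation is a fixed-point problem with Lipschitz constant `1/2`. Since `H` is increasing, `u` is
-- bounded on every left half-line.
open BoundedContinuousFunction in
theorem volterra_exists [CompleteSpace B] (hh : Continuous h) (hint : ∀ x, IntegrableOn h (Set.Iic x))
    (h0 : ∀ s, 0 ≤ h s) (hkm : ∀ x, AEStronglyMeasurable (k x) volume)
    (hkc : ∀ s, Continuous fun x => k x s) (hb : ∀ x s, s ≤ x → ‖k x s‖ ≤ h s)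
    {u₀ : ℝ → B} (hu₀ : Continuous u₀) {C₀ : ℝ} (hC₀ : ∀ x, ‖u₀ x‖ ≤ C₀) :
    ∃ u : ℝ → B, Continuous u ∧ (∀ X, ∃ C, ∀ x ≤ X, ‖u x‖ ≤ C) ∧
      ∀ x, u x = u₀ x + ∫ s in Set.Iic x, k x s * u s := by
  set H : ℝ → ℝ := fun s => ∫ r in Set.Iic s, h r with hH
  have hd : ∀ s, HasDerivAt H (h s) s := hasDerivAt_integral_Iic hh hint
  have hHc : Continuous H := continuous_iff_continuousAt.2 fun s => (hd s).continuousAt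
  have hmono : Monotone H := monotone_of_hasDerivAt_nonneg hd h0
  have hHnn : ∀ y, 0 ≤ H y := fun y => integral_nonneg fun s => h0 s
  have hec : Continuous fun x => Real.exp (2 * H x) := by fun_prop
  have hec' : Continuous fun x => Real.exp (-(2 * H x)) := by fun_prop
  have hcancel : ∀ x, Real.exp (-(2 * H x)) * Real.exp (2 * H x) = 1 := fun x => by
    rw [← Real.exp_add]; simp
  have hE1 : ∀ x, Real.exp (-(2 * H x)) ≤ 1 := fun x => by
    rw [Real.exp_le_one_iff]; linarith [hHnn x]
  have hcont : ∀ v : ℝ →ᵇ B,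
      Continuous fun x => ∫ s in Set.Iic x, k x s * (Real.exp (2 * H s) • v s) := by
    intro v
    refine continuous_integral_Iic (b := fun s => ‖v‖ * (h s * Real.exp (2 * H s)))
      (fun x => (hkm x).mul (hec.smul v.continuous).aestronglyMeasurable)
      (fun s => (hkc s).mul continuous_const)
      (fun X => ((integral_Iic_mul_exp hh hint h0 X).1).const_mul _) ?_
    intro x s hs
    calc ‖k x s * (Real.exp (2 * H s) • v s)‖ ≤ ‖k x s‖ * ‖Real.exp (2 * H s) • v s‖ :=
          norm_mul_le _ _
      _ ≤ h s * (Real.exp (2 * H s) * ‖v‖) := by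
          rw [norm_smul, Real.norm_eq_abs, Real.abs_exp]
          gcongr
          · exact h0 s
          · exact hb x s hs
          · exact v.norm_coe_le_norm s
      _ = _ := by ring
  have hbound : ∀ (v : ℝ → B) (D : ℝ), (∀ s, ‖v s‖ ≤ D) → ∀ x,
      ‖Real.exp (-(2 * H x)) • ∫ s in Set.Iic x, k x s * (Real.exp (2 * H s) • v s)‖
        ≤ D / 2 := by
    intro v D hD x
    have := norm_volterra_le hh hint h0 hb (u := fun s => Real.exp (2 * H s) • v s) (C := D)
      (x := x) (fun s _ => by
        rw [norm_smul, Real.norm_eq_abs, Real.abs_exp, mul_comm]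
        exact mul_le_mul_of_nonneg_right (hD s) (Real.exp_pos _).le)
    rw [norm_smul, Real.norm_eq_abs, Real.abs_exp]
    calc _ ≤ Real.exp (-(2 * H x)) * (D / 2 * Real.exp (2 * H x)) := by gcongr
      _ = D / 2 * (Real.exp (-(2 * H x)) * Real.exp (2 * H x)) := by ring
      _ = D / 2 := by rw [hcancel, mul_one]
  let T : (ℝ →ᵇ B) → (ℝ →ᵇ B) := fun v => BoundedContinuousFunction.ofNormedAddCommGroup
    (fun x => Real.exp (-(2 * H x)) • u₀ x
      + Real.exp (-(2 * H x)) • ∫ s in Set.Iic x, k x s * (Real.exp (2 * H s) • v s))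
    ((hec'.smul hu₀).add (hec'.smul (hcont v))) (C₀ + ‖v‖ / 2) (by
      intro x
      refine (norm_add_le _ _).trans (add_le_add ?_ (hbound v _ v.norm_coe_le_norm x))
      rw [norm_smul, Real.norm_eq_abs, Real.abs_exp]
      calc _ ≤ 1 * ‖u₀ x‖ := by gcongr; exact hE1 x
        _ ≤ C₀ := by rw [one_mul]; exact hC₀ x)
  have hTapp : ∀ v x, T v x = Real.exp (-(2 * H x)) • u₀ x
      + Real.exp (-(2 * H x)) • ∫ s in Set.Iic x, k x s * (Real.exp (2 * H s) • v s) :=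
    fun v x => rfl
  have hintg : ∀ (v : ℝ →ᵇ B) x,
      IntegrableOn (fun s => k x s * (Real.exp (2 * H s) • v s)) (Set.Iic x) := by
    intro v x
    refine Integrable.mono' ((integral_Iic_mul_exp hh hint h0 x).1.const_mul ‖v‖)
      ((hkm x).mul (hec.smul v.continuous).aestronglyMeasurable).restrict ?_
    refine (ae_restrict_iff' measurableSet_Iic).2 (Eventually.of_forall fun s hs => ?_)
    calc ‖k x s * (Real.exp (2 * H s) • v s)‖ ≤ ‖k x s‖ * ‖Real.exp (2 * H s) • v s‖ :=
          norm_mul_le _ _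
      _ ≤ h s * (Real.exp (2 * H s) * ‖v‖) := by
          rw [norm_smul, Real.norm_eq_abs, Real.abs_exp]
          gcongr
          · exact h0 s
          · exact hb x s hs
          · exact v.norm_coe_le_norm s
      _ = _ := by ring
  have hT : ContractingWith (1 / 2) T := by
    refine ⟨by
      rw [← NNReal.coe_lt_coe]; norm_num, LipschitzWith.of_dist_le_mul fun v w => ?_⟩
    rw [BoundedContinuousFunction.dist_le (by positivity)]
    intro x
    rw [dist_eq_norm, hTapp, hTapp]
    have h1 : Real.exp (-(2 * H x)) • u₀ x
        + Real.exp (-(2 * H x)) • (∫ s in Set.Iic x, k x s * (Real.exp (2 * H s) • v s))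
        - (Real.exp (-(2 * H x)) • u₀ x
        + Real.exp (-(2 * H x)) • ∫ s in Set.Iic x, k x s * (Real.exp (2 * H s) • w s))
        = Real.exp (-(2 * H x)) •
          ∫ s in Set.Iic x, k x s * (Real.exp (2 * H s) • (v s - w s)) := by
      simp only [smul_sub, mul_sub]
      rw [integral_sub (hintg v x) (hintg w x), smul_sub]
      abel
    rw [h1]
    refine (hbound (fun s => v s - w s) (dist v w) (fun s => ?_) x).trans (le_of_eq ?_)
    · rw [← dist_eq_norm]; exact BoundedContinuousFunction.dist_coe_le_dist s
    · push_cast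
      ring
  obtain ⟨v, hv⟩ : ∃ v, T v = v := ⟨_, hT.fixedPoint_isFixedPt⟩
  refine ⟨fun x => Real.exp (2 * H x) • v x, hec.smul v.continuous, ?_, ?_⟩
  · intro X
    refine ⟨Real.exp (2 * H X) * ‖v‖, fun x hx => ?_⟩
    rw [norm_smul, Real.norm_eq_abs, Real.abs_exp]
    have := hmono hx
    gcongr
    exact v.norm_coe_le_norm x
  · intro x
    have h1 : v x = T v x := by rw [hv]
    simp only
    rw [h1, hTapp, smul_add, smul_smul, smul_smul, mul_comm, hcancel, one_smul, one_smul]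

end Volterra

end MMKdV

namespace MMKdV

/-! ### Linear differential equations -/

theorem integrableOn_Iic_of_continuous {B : Type*} [NormedAddCommGroup B] {h : ℝ → B}
    (hh : Continuous h) {a : ℝ} (h0 : IntegrableOn h (Set.Iic a)) (X : ℝ) :
    IntegrableOn h (Set.Iic X) := by
  refine (h0.union (hh.integrableOn_Icc (a := a) (b := X))).mono_set fun s hs => ?_
  rcases le_total s a with h1 | h1
  · exact Or.inl h1
  · exact Or.inr ⟨h1, hs⟩

/-- Grönwall's uniqueness with a coefficient that is only continuous, hence bounded on each compact
interval; the backward direction follows by reversing time. -/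
theorem eq_zero_of_norm_deriv_le {E : Type*} [NormedAddCommGroup E] [NormedSpace ℝ E]
    {F F' : ℝ → E} {c : ℝ → ℝ} (hc : Continuous c) (hF : ∀ t, HasDerivAt F (F' t) t)
    (hb : ∀ t, ‖F' t‖ ≤ c t * ‖F t‖) {t₀ : ℝ} (h0 : F t₀ = 0) (t : ℝ) : F t = 0 := by
  have fwd : ∀ (G G' : ℝ → E) (d : ℝ → ℝ), Continuous d → (∀ t, HasDerivAt G (G' t) t) →
      (∀ t, ‖G' t‖ ≤ d t * ‖G t‖) → ∀ a, G a = 0 → ∀ b, a ≤ b → G b = 0 := by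
    intro G G' d hd hG hGb a ha b hab
    obtain ⟨K, hK⟩ := (isCompact_Icc (a := a) (b := b)).bddAbove_image hd.continuousOn
    refine eq_zero_of_abs_deriv_le_mul_abs_self_of_eq_zero_right (K := K) (a := a) (b := b)
      (f := G) (f' := G') (fun s _ => (hG s).continuousAt.continuousWithinAt)
      (fun s _ => (hG s).hasDerivWithinAt) ha (fun s hs => ?_) b ⟨hab, le_rfl⟩
    refine (hGb s).trans ?_
    have := hK ⟨s, ⟨hs.1, hs.2.le⟩, rfl⟩
    gcongr
  rcases le_total t₀ t with h | h
  · exact fwd F F' c hc hF hb t₀ h0 t h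
  · have := fwd (fun s => F (-s)) (fun s => -F' (-s)) (fun s => c (-s)) (hc.comp continuous_neg)
      (fun s => by
        have := (hF (-s)).scomp s (hasDerivAt_neg s)
        simpa [Function.comp_def] using this)
      (fun s => by simpa using hb (-s)) (-t₀) (by simpa using h0) (-t) (by linarith)
    simpa using this

section
variable {B : Type*} [NormedRing B] [NormedAlgebra ℝ B] [CompleteSpace B]

theorem linearODE_exists_right {N : ℝ → B} (hN : Continuous N) (F₀ : B) :
    ∃ F : ℝ → B, Continuous F ∧ ∀ t, 0 ≤ t → F t = F₀ + ∫ s in (0 : ℝ)..t, N s * F s := by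
  -- The equation on `[0, ∞)` becomes a Volterra equation on left half-lines when the coefficient is
  -- cut off at `s < 0`. The majorant has to be continuous across `0` and integrable at `-∞`, hence
  -- the artificial tail `‖N 0‖ e^s`.
  set h : ℝ → ℝ := fun s => ‖N (max s 0)‖ * Real.exp (min s 0) with hh
  have hhc : Continuous h := by fun_prop
  have hint : ∀ x, IntegrableOn h (Set.Iic x) := by
    refine integrableOn_Iic_of_continuous hhc (a := 0) ?_
    have h1 : IntegrableOn (fun s => ‖N 0‖ * Real.exp s) (Set.Iic 0) :=
      (integrableOn_exp_Iic 0).const_mul ‖N 0‖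
    refine h1.congr_fun (fun s hs => ?_) measurableSet_Iic
    simp only [hh]
    rw [max_eq_right (Set.mem_Iic.1 hs), min_eq_left (Set.mem_Iic.1 hs)]
  obtain ⟨F, hF, -, hFe⟩ := volterra_exists (k := fun _ s => (Set.Ici (0 : ℝ)).indicator N s)
    (h := h) (u₀ := fun _ => F₀) (C₀ := ‖F₀‖) hhc hint (fun s => by positivity)
    (fun _ => hN.aestronglyMeasurable.indicator measurableSet_Ici) (fun _ => continuous_const)
    (fun _ s _ => by
      by_cases hs : 0 ≤ s
      · rw [Set.indicator_of_mem (show s ∈ Set.Ici (0 : ℝ) from hs)]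
        simp only [hh]
        rw [max_eq_left hs, min_eq_right hs]
        simp
      · rw [Set.indicator_of_notMem (show s ∉ Set.Ici (0 : ℝ) from hs), norm_zero]
        positivity) continuous_const (fun _ => le_rfl)
  refine ⟨F, hF, fun t ht => ?_⟩
  rw [hFe t, intervalIntegral.integral_of_le ht, ← integral_Icc_eq_integral_Ioc]
  congr 1
  have h1 : ∀ s, (Set.Ici (0 : ℝ)).indicator N s * F s
      = (Set.Ici (0 : ℝ)).indicator (fun s => N s * F s) s := fun s => by
    by_cases hs : s ∈ Set.Ici (0 : ℝ) <;> simp [hs]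
  simp_rw [h1]
  rw [setIntegral_indicator measurableSet_Ici, Set.Iic_inter_Ici]

/-- The forward solution and the time-reversed one are glued at `0`. The glued function satisfies
the integral equation on both sides, and this gives differentiability at `0` as well. -/
theorem linearODE_exists {N : ℝ → B} (hN : Continuous N) (F₀ : B) :
    ∃ F : ℝ → B, F 0 = F₀ ∧ ∀ t, HasDerivAt F (N t * F t) t := by
  obtain ⟨F, hF, hFe⟩ := linearODE_exists_right hN F₀
  obtain ⟨G, hG, hGe⟩ := linearODE_exists_right (N := fun t => -N (-t)) (by fun_prop) F₀
  have hF0 : F 0 = F₀ := by simpa using hFe 0 le_rfl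
  have hG0 : G 0 = F₀ := by simpa using hGe 0 le_rfl
  set E : ℝ → B := fun t => if 0 ≤ t then F t else G (-t) with hE
  have hEc : Continuous E := by
    refine Continuous.if_le hF (hG.comp continuous_neg) continuous_const continuous_id ?_
    intro x hx
    rw [← hx]
    simp [hF0, hG0]
  have hEe : ∀ t, E t = F₀ + ∫ s in (0 : ℝ)..t, N s * E s := by
    intro t
    rcases le_or_gt 0 t with ht | ht
    · have : E t = F t := if_pos ht
      rw [this, hFe t ht]
      congr 1
      refine intervalIntegral.integral_congr fun s hs => ?_
      rw [Set.uIcc_of_le ht] at hs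
      simp only [hE, if_pos hs.1]
    · have : E t = G (-t) := if_neg (not_le.2 ht)
      rw [this, hGe (-t) (by linarith)]
      congr 1
      have h2 : ∫ s in (0 : ℝ)..(-t), -N (-s) * G s
          = ∫ s in (0 : ℝ)..(-t), (fun r => -(N r * E r)) (-s) := by
        refine intervalIntegral.integral_congr fun s hs => ?_
        rw [Set.uIcc_of_le (by linarith)] at hs
        simp only [hE]
        rcases eq_or_lt_of_le hs.1 with h0 | h0
        · rw [← h0]; simp [hF0, hG0]
        · rw [if_neg (by linarith)]; simp
      rw [h2, intervalIntegral.integral_comp_neg (f := fun r => -(N r * E r)),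
        intervalIntegral.integral_neg, ← intervalIntegral.integral_symm]
      simp
  refine ⟨E, by simpa using hEe 0, fun t => ?_⟩
  have hc : Continuous fun s => N s * E s := hN.mul hEc
  have h3 : E = fun t => F₀ + ∫ s in (0 : ℝ)..t, N s * E s := funext hEe
  have := (intervalIntegral.integral_hasDerivAt_right (hc.intervalIntegrable 0 t)
    (hc.stronglyMeasurableAtFilter _ _) hc.continuousAt).const_add F₀
  rwa [← h3] at this

end

end MMKdV

namespace MMKdV

/-! ### The propagator of the limiting spectral problem -/

theorem norm_exp_sub_one_le {w : ℂ} (hw : w.re ≤ 0) : ‖Complex.exp w - 1‖ ≤ ‖w‖ := by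
  have h := Convex.norm_image_sub_le_of_norm_deriv_le (f := Complex.exp) (C := 1)
    (s := {w : ℂ | w.re ≤ 0}) (x := 0) (y := w)
    (fun x _ => Complex.differentiableAt_exp) (fun x hx => by
      rw [Complex.deriv_exp, Complex.norm_exp]
      exact Real.exp_le_one_iff.2 hx)
    (convex_halfSpace_re_le 0) (by simp) hw
  simpa using h

/-- `(e^w - 1) / w`, continued to `w = 0`. -/
noncomputable def expSlope (w : ℂ) : ℂ := dslope Complex.exp 0 w

@[fun_prop]
theorem differentiable_expSlope : Differentiable ℂ expSlope := by
  have := (Complex.differentiableOn_dslope (f := Complex.exp) (c := 0) (s := Set.univ)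
    univ_mem).2 Complex.differentiable_exp.differentiableOn
  exact differentiableOn_univ.1 this

@[fun_prop]
theorem continuous_expSlope : Continuous expSlope := differentiable_expSlope.continuous

theorem mul_expSlope (w : ℂ) : w * expSlope w = Complex.exp w - 1 := by
  have := sub_smul_dslope Complex.exp 0 w
  simpa [expSlope] using this

theorem expSlope_zero : expSlope 0 = 1 := by simp [expSlope]

theorem norm_expSlope_le {w : ℂ} (hw : w.re ≤ 0) : ‖expSlope w‖ ≤ 1 := by
  rcases eq_or_ne w 0 with rfl | h
  · simp [expSlope_zero]
  · have h1 := norm_exp_sub_one_le hw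
    rw [← mul_expSlope, norm_mul] at h1
    exact le_of_mul_le_mul_left (by simpa using h1) (norm_pos_iff.2 h)

/-- `∫₀^τ e^{2ilσ} dσ`. -/
noncomputable def oscInt (l : ℂ) (τ : ℝ) : ℂ := τ * expSlope (2 * Complex.I * l * τ)

theorem mul_oscInt (l : ℂ) (τ : ℝ) :
    2 * Complex.I * l * oscInt l τ = Complex.exp (2 * Complex.I * l * τ) - 1 := by
  rw [← mul_expSlope, oscInt]; ring

theorem oscInt_zero_left (τ : ℝ) : oscInt 0 τ = τ := by simp [oscInt, expSlope_zero]

theorem oscInt_add (l : ℂ) (τ σ : ℝ) :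
    oscInt l (τ + σ) = oscInt l τ + Complex.exp (2 * Complex.I * l * τ) * oscInt l σ := by
  rcases eq_or_ne l 0 with rfl | h
  · simp [oscInt_zero_left]
  · have h2 : 2 * Complex.I * l ≠ 0 := by simp [h]
    apply mul_left_cancel₀ h2
    have h3 : Complex.exp (2 * Complex.I * l * ((τ + σ : ℝ) : ℂ))
        = Complex.exp (2 * Complex.I * l * τ) * Complex.exp (2 * Complex.I * l * σ) := by
      rw [← Complex.exp_add]; push_cast; ring_nf
    rw [mul_oscInt, h3]
    linear_combination (-1 : ℂ) * mul_oscInt l τ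
      - Complex.exp (2 * Complex.I * l * τ) * mul_oscInt l σ

theorem hasDerivAt_cexp_real (c : ℂ) (τ : ℝ) :
    HasDerivAt (fun τ : ℝ => Complex.exp (c * τ)) (c * Complex.exp (c * τ)) τ := by
  have h1 : HasDerivAt (fun τ : ℝ => c * (τ : ℂ)) c τ := by
    simpa using (Complex.ofRealCLM.hasDerivAt (x := τ)).const_mul c
  simpa [mul_comm] using h1.cexp

theorem hasDerivAt_oscInt (l : ℂ) (τ : ℝ) :
    HasDerivAt (oscInt l) (Complex.exp (2 * Complex.I * l * τ)) τ := by
  rcases eq_or_ne l 0 with rfl | h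
  · have : oscInt 0 = fun τ : ℝ => (τ : ℂ) := funext oscInt_zero_left
    rw [this]
    simpa using (hasDerivAt_id τ).ofReal_comp
  · have h2 : 2 * Complex.I * l ≠ 0 := by simp [h]
    have : oscInt l = fun τ : ℝ => (2 * Complex.I * l)⁻¹ *
        (Complex.exp (2 * Complex.I * l * τ) - 1) := by
      funext τ
      rw [← mul_oscInt, inv_mul_cancel_left₀ h2]
    rw [this]
    refine (((hasDerivAt_cexp_real (2 * Complex.I * l) τ).sub_const 1).const_mul _).congr_deriv ?_
    rw [inv_mul_cancel_left₀ h2]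

theorem two_I_mul_re (l : ℂ) (τ : ℝ) : (2 * Complex.I * l * τ).re = -(2 * l.im * τ) := by
  simp

theorem norm_exp_osc_le {l : ℂ} (hl : 0 ≤ l.im) {τ : ℝ} (hτ : 0 ≤ τ) :
    ‖Complex.exp (2 * Complex.I * l * τ)‖ ≤ 1 := by
  rw [Complex.norm_exp, two_I_mul_re]
  exact Real.exp_le_one_iff.2 (by have := mul_nonneg hl hτ; nlinarith)

/-- Two bounds are used for different purposes. The bound by `τ` is uniform in `l`, including `l =
0`, and costs a first moment of the potential; the bound by `|l|⁻¹` is uniform in `τ` but fails at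
the branch points. Existence rests on the first, uniqueness on the second. -/
theorem norm_oscInt_le {l : ℂ} (hl : 0 ≤ l.im) {τ : ℝ} (hτ : 0 ≤ τ) : ‖oscInt l τ‖ ≤ τ := by
  rw [oscInt, norm_mul, Complex.norm_real, Real.norm_eq_abs, abs_of_nonneg hτ]
  have : ‖expSlope (2 * Complex.I * l * τ)‖ ≤ 1 :=
    norm_expSlope_le (by rw [two_I_mul_re]; have := mul_nonneg hl hτ; nlinarith)
  nlinarith

theorem norm_oscInt_le_inv {l : ℂ} (hl : 0 ≤ l.im) (h0 : l ≠ 0) {τ : ℝ} (hτ : 0 ≤ τ) :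
    ‖oscInt l τ‖ ≤ ‖l‖⁻¹ := by
  have h1 := congrArg norm (mul_oscInt l τ)
  have h2 : ‖Complex.exp (2 * Complex.I * l * τ) - 1‖ ≤ 2 := by
    refine (norm_sub_le _ _).trans ?_
    have := norm_exp_osc_le hl hτ
    simp only [norm_one]; linarith
  rw [← h1, norm_mul, norm_mul, norm_mul, Complex.norm_I, Complex.norm_ofNat] at h2
  rw [← one_div, le_div_iff₀ (norm_pos_iff.2 h0)]
  linarith

section Propagator

variable {A : Type*} [NormedRing A] [NormedAlgebra ℂ A]

/-- `e^{τ (M + i l)}` when `M² = - l²`. -/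
noncomputable def propagator (M : A) (l : ℂ) (τ : ℝ) : A :=
  ((1 + Complex.exp (2 * Complex.I * l * τ)) / 2) • (1 : A) + oscInt l τ • M

variable {M : A} {l : ℂ}

theorem propagator_zero : propagator M l 0 = 1 := by
  simp [propagator, oscInt]

/-- Since `M²` is a scalar, products stay in the span of `1` and `M`, and comparing coefficients
leaves two scalar identities for the exponentials. -/
theorem propagator_add (hM : M * M = -(l ^ 2) • (1 : A)) (τ σ : ℝ) :
    propagator M l (τ + σ) = propagator M l τ * propagator M l σ := by
  have h3 : Complex.exp (2 * Complex.I * l * ((τ + σ : ℝ) : ℂ))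
      = Complex.exp (2 * Complex.I * l * τ) * Complex.exp (2 * Complex.I * l * σ) := by
    rw [← Complex.exp_add]; push_cast; ring_nf
  have e1 := mul_oscInt l τ
  have e2 := mul_oscInt l σ
  simp only [propagator, mul_add, add_mul, smul_mul_smul_comm, one_mul, mul_one, hM, smul_smul,
    oscInt_add, h3]
  set a := Complex.exp (2 * Complex.I * l * τ)
  set b := Complex.exp (2 * Complex.I * l * σ)
  set s := oscInt l τ
  set r := oscInt l σ
  have key1 : (1 + a * b) / 2 = (1 + a) / 2 * ((1 + b) / 2) + s * r * -(l ^ 2) := by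
    have : s * r * -(l ^ 2) = (a - 1) * (b - 1) / 4 := by
      rw [← e1, ← e2]
      linear_combination (s * r * l ^ 2) * Complex.I_sq * (-1)
    rw [this]; ring
  have key2 : s + a * r = (1 + a) / 2 * r + s * ((1 + b) / 2) := by
    linear_combination (r / 2) * e1 * (-1) + (s / 2) * e2
  rw [key1, key2]
  module

theorem hasDerivAt_propagator (hM : M * M = -(l ^ 2) • (1 : A)) (τ : ℝ) :
    HasDerivAt (propagator M l) ((M + (Complex.I * l) • 1) * propagator M l τ) τ := by
  have h1 := ((((hasDerivAt_cexp_real (2 * Complex.I * l) τ).const_add 1).div_const 2).smul_const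
    (1 : A)).add ((hasDerivAt_oscInt l τ).smul_const M)
  refine h1.congr_deriv ?_
  have e1 := mul_oscInt l τ
  simp only [propagator, mul_add, add_mul, mul_smul_comm, smul_mul_assoc, one_mul, mul_one, hM]
  set a := Complex.exp (2 * Complex.I * l * τ)
  set s := oscInt l τ
  have key1 : 2 * Complex.I * l * a / 2
      = (1 + a) / 2 * (Complex.I * l) + s * -(l ^ 2) := by
    have : s * -(l ^ 2) = (Complex.I * l) * (a - 1) / 2 := by
      rw [← e1]
      linear_combination (s * l ^ 2) * Complex.I_sq * (-1)
    rw [this]; ring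
  have key2 : a = (1 + a) / 2 + s * (Complex.I * l) := by
    linear_combination (-1 / 2 : ℂ) * e1
  rw [key1]
  nth_rewrite 2 [key2]
  module

theorem propagator_comm (τ : ℝ) :
    (M + (Complex.I * l) • 1) * propagator M l τ = propagator M l τ * (M + (Complex.I * l) • 1) := by
  simp only [propagator, mul_add, add_mul, mul_smul_comm, smul_mul_assoc, one_mul,
    mul_one]
  module

/-- Eigenvectors of `M` for `-il` are stationary for the shifted flow. This is why `E` itself is the
inhomogeneous term of the Volterra equation. -/
theorem propagator_mul_eigen {E : A} (hE : M * E = -(Complex.I * l) • E) (τ : ℝ) :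
    propagator M l τ * E = E := by
  have e1 := mul_oscInt l τ
  rw [propagator, add_mul, smul_mul_assoc, smul_mul_assoc, hE, one_mul, smul_smul, ← add_smul]
  have : (1 + Complex.exp (2 * Complex.I * l * τ)) / 2 + oscInt l τ * -(Complex.I * l) = 1 := by
    linear_combination (-1 / 2 : ℂ) * e1
  rw [this, one_smul]

theorem norm_propagator_le (hl : 0 ≤ l.im) {τ : ℝ} (hτ : 0 ≤ τ) :
    ‖propagator M l τ‖ ≤ ‖(1 : A)‖ + ‖M‖ * τ := by
  refine (norm_add_le _ _).trans (add_le_add ?_ ?_)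
  · rw [norm_smul]
    have : ‖(1 + Complex.exp (2 * Complex.I * l * τ)) / 2‖ ≤ 1 := by
      rw [norm_div, Complex.norm_ofNat, div_le_one (by norm_num)]
      refine (norm_add_le _ _).trans ?_
      have := norm_exp_osc_le hl hτ
      simp only [norm_one]; linarith
    nlinarith [norm_nonneg (1 : A)]
  · rw [norm_smul, mul_comm]
    exact mul_le_mul_of_nonneg_left (norm_oscInt_le hl hτ) (norm_nonneg _)

theorem norm_propagator_le_of_ne (hl : 0 ≤ l.im) (h0 : l ≠ 0) {τ : ℝ} (hτ : 0 ≤ τ) :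
    ‖propagator M l τ‖ ≤ ‖(1 : A)‖ + ‖M‖ * ‖l‖⁻¹ := by
  refine (norm_add_le _ _).trans (add_le_add ?_ ?_)
  · rw [norm_smul]
    have : ‖(1 + Complex.exp (2 * Complex.I * l * τ)) / 2‖ ≤ 1 := by
      rw [norm_div, Complex.norm_ofNat, div_le_one (by norm_num)]
      refine (norm_add_le _ _).trans ?_
      have := norm_exp_osc_le hl hτ
      simp only [norm_one]; linarith
    nlinarith [norm_nonneg (1 : A)]
  · rw [norm_smul, mul_comm]
    exact mul_le_mul_of_nonneg_left (norm_oscInt_le_inv hl h0 hτ) (norm_nonneg _)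

end Propagator

end MMKdV

namespace MMKdV

set_option linter.unusedSectionVars false

/-! ### Continuous functions on a compact set, holomorphic in its interior -/

section AnalyticSub

variable {A : Type*} [NormedRing A] [NormedAlgebra ℂ A] {Z : Set ℂ}

open Classical in
/-- Extension of a function on `Z` by zero. -/
noncomputable def extendZero (f : C(Z, A)) (w : ℂ) : A := if h : w ∈ Z then f ⟨w, h⟩ else 0

theorem extendZero_of_mem (f : C(Z, A)) {w : ℂ} (h : w ∈ Z) : extendZero f w = f ⟨w, h⟩ :=
  dif_pos h

theorem continuousOn_extendZero (f : C(Z, A)) : ContinuousOn (extendZero f) Z := by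
  rw [continuousOn_iff_continuous_domRestrict]
  have : Z.domRestrict (extendZero f) = f := by
    funext w; exact extendZero_of_mem f w.2
  rw [this]
  exact f.continuous

variable (A Z) in
/-- Continuous functions on `Z` that are holomorphic in the interior of `Z`. -/
def analyticSub : Subalgebra ℝ C(Z, A) where
  carrier := {f | DifferentiableOn ℂ (extendZero f) (interior Z)}
  mul_mem' {f g} hf hg := by
    refine (DifferentiableOn.mul hf hg).congr fun w hw => ?_
    have := interior_subset hw
    simp [extendZero_of_mem _ this]
  add_mem' {f g} hf hg := by
    refine (DifferentiableOn.add hf hg).congr fun w hw => ?_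
    have := interior_subset hw
    simp [extendZero_of_mem _ this]
  algebraMap_mem' r := by
    refine (differentiableOn_const (algebraMap ℝ A r)).congr fun w hw => ?_
    rw [extendZero_of_mem _ (interior_subset hw)]
    rfl

theorem mem_analyticSub {f : C(Z, A)} {F : ℂ → A} (hF : DifferentiableOn ℂ F (interior Z))
    (h : ∀ z : Z, f z = F z) : f ∈ analyticSub A Z := by
  refine hF.congr fun w hw => ?_
  rw [extendZero_of_mem _ (interior_subset hw), h]

/-- By Weierstrass' theorem uniform limits remain holomorphic. Hence `analyticSub` is a Banach
algebra, and the Volterra theory applies to it word for word. -/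
theorem isClosed_analyticSub [CompactSpace Z] [CompleteSpace A] : IsClosed (analyticSub A Z : Set C(Z, A)) := by
  refine IsSeqClosed.isClosed fun f g hf hg => ?_
  change DifferentiableOn ℂ (extendZero g) (interior Z)
  have h1 := ContinuousMap.tendsto_iff_tendstoUniformly.1 hg
  have h2 : TendstoUniformlyOn (fun n => extendZero (f n)) (extendZero g) atTop (interior Z) := by
    rw [Metric.tendstoUniformlyOn_iff]
    intro ε hε
    filter_upwards [Metric.tendstoUniformly_iff.1 h1 ε hε] with n hn w hw
    rw [extendZero_of_mem _ (interior_subset hw), extendZero_of_mem _ (interior_subset hw)]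
    exact hn _
  exact h2.tendstoLocallyUniformlyOn.differentiableOn (Eventually.of_forall hf) isOpen_interior

instance [CompactSpace Z] [CompleteSpace A] : CompleteSpace (analyticSub A Z) :=
  isClosed_analyticSub.completeSpace_coe

theorem norm_analyticSub [CompactSpace Z] (f : analyticSub A Z) : ‖f‖ = ‖(f : C(Z, A))‖ := rfl

end AnalyticSub

/-! ### Jost solutions depending on the spectral parameter -/

section ParamJost

variable {A : Type*} [NormedRing A] [NormedAlgebra ℂ A] [CompleteSpace A]

theorem mul_integral_Iic {B : Type*} [NormedRing B] [NormedAlgebra ℝ B] [CompleteSpace B]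
    (a : B) {f : ℝ → B} {s : Set ℝ} (hf : IntegrableOn f s) :
    a * ∫ r in s, f r = ∫ r in s, a * f r :=
  ((ContinuousLinearMap.mul ℝ B a).integral_comp_comm hf).symm

/-- A bounded solution of the Volterra equation is a Jost solution. -/
theorem jost_of_volterra {M E : A} {l : ℂ} (hM : M * M = -(l ^ 2) • (1 : A)) (hl : 0 ≤ l.im)
    (hE : M * E = -(Complex.I * l) • E) {D u : ℝ → A} (hD : Continuous D)
    (hDi : IntegrableOn (fun s => (1 + |s|) * ‖D s‖) (Set.Iic 0)) (hu : Continuous u)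
    (hub : ∀ X, ∃ C, ∀ x ≤ X, ‖u x‖ ≤ C)
    (hV : ∀ x, u x = E + ∫ s in Set.Iic x, propagator M l (x - s) * D s * u s) :
    (∀ x, HasDerivAt u ((M + (Complex.I * l) • 1 + D x) * u x) x) ∧ Tendsto u atBot (𝓝 E) := by
  have hpc : Continuous (propagator M l) :=
    continuous_iff_continuousAt.2 fun τ => (hasDerivAt_propagator hM τ).continuousAt
  have hDi' : ∀ X, IntegrableOn (fun s => (1 + |s|) * ‖D s‖) (Set.Iic X) :=
    integrableOn_Iic_of_continuous (by fun_prop) hDi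
  set c : ℝ := ‖(1 : A)‖ + ‖M‖ with hc
  -- For `s ≤ x ≤ 0` one has `x - s ≤ |s|`, so the linear growth of the propagator is absorbed by
  -- the weight `1 + |s|`.
  have hcb : ∀ {τ s : ℝ}, 0 ≤ τ → τ ≤ |s| → ‖propagator M l τ‖ ≤ c * (1 + |s|) := by
    intro τ s h1 h2
    refine (norm_propagator_le hl h1).trans ?_
    have a1 := norm_nonneg (1 : A)
    have a2 := norm_nonneg M
    have a3 := abs_nonneg s
    have := mul_le_mul_of_nonneg_left h2 a2
    rw [hc]; nlinarith
  have hi0 : IntegrableOn (fun s => propagator M l (-s) * D s * u s) (Set.Iic 0) := by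
    obtain ⟨C, hC⟩ := hub 0
    have hC0 : 0 ≤ C := (norm_nonneg _).trans (hC 0 le_rfl)
    refine Integrable.mono' (hDi.const_mul (c * C)) (by
      refine Continuous.aestronglyMeasurable ?_
      fun_prop) ?_
    refine (ae_restrict_iff' measurableSet_Iic).2 (Eventually.of_forall fun s hs => ?_)
    have hs : s ≤ 0 := hs
    calc _ ≤ ‖propagator M l (-s)‖ * ‖D s‖ * ‖u s‖ := norm_mul₃_le
      _ ≤ (c * (1 + |s|)) * ‖D s‖ * C := by
          gcongr
          · exact hcb (by linarith) (neg_le_abs s)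
          · exact hC s hs
      _ = _ := by ring
  have hi : ∀ X, IntegrableOn (fun s => propagator M l (-s) * D s * u s) (Set.Iic X) :=
    integrableOn_Iic_of_continuous (by fun_prop) hi0
  -- The group law pulls `propagator x` out of the convolution; what remains is a product whose
  -- derivative is elementary.
  have hV' : u = fun x => propagator M l x *
      (E + ∫ s in Set.Iic x, propagator M l (-s) * D s * u s) := by
    funext x
    rw [mul_add, propagator_mul_eigen hE, mul_integral_Iic _ (hi x), hV x]
    congr 1
    refine integral_congr_ae (Eventually.of_forall fun s => ?_)
    simp only
    rw [sub_eq_add_neg, propagator_add hM]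
    simp only [mul_assoc]
  constructor
  · intro x
    have h1 := (hasDerivAt_integral_Iic (by fun_prop) hi x).const_add E
    have h2 := (hasDerivAt_propagator hM x).mul h1
    have hux : u x = propagator M l x *
        (E + ∫ s in Set.Iic x, propagator M l (-s) * D s * u s) := congrFun hV' x
    have h3 := h2.congr_of_eventuallyEq (f₁ := u) (Eventually.of_forall fun y => congrFun hV' y)
    refine h3.congr_deriv ?_
    have h4 : propagator M l x * propagator M l (-x) = 1 := by
      rw [← propagator_add hM, add_neg_cancel, propagator_zero]
    rw [mul_assoc (_ + _), ← hux, ← mul_assoc, ← mul_assoc, h4, one_mul, add_mul _ (D x)]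
  · obtain ⟨C, hC⟩ := hub 0
    have hC0 : 0 ≤ C := (norm_nonneg _).trans (hC 0 le_rfl)
    have h1 : Tendsto (fun x => (c * C) * ∫ s in Set.Iic x, (1 + |s|) * ‖D s‖) atBot
        (𝓝 ((c * C) * 0)) := (tendsto_integral_Iic_atBot hDi').const_mul _
    rw [mul_zero] at h1
    rw [tendsto_iff_norm_sub_tendsto_zero]
    refine squeeze_zero' (Eventually.of_forall fun _ => norm_nonneg _) ?_ h1
    filter_upwards [eventually_le_atBot 0] with x hx
    rw [hV x, add_sub_cancel_left, ← integral_const_mul]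
    refine norm_integral_le_of_norm_le ((hDi' x).const_mul (c * C)) ?_
    refine (ae_restrict_iff' measurableSet_Iic).2 (Eventually.of_forall fun s hs => ?_)
    have hs : s ≤ x := hs
    calc _ ≤ ‖propagator M l (x - s)‖ * ‖D s‖ * ‖u s‖ := norm_mul₃_le
      _ ≤ (c * (1 + |s|)) * ‖D s‖ * C := by
          gcongr
          · exact hcb (by linarith) ((by linarith : x - s ≤ -s).trans (neg_le_abs s))
          · exact hC s (hs.trans hx)
      _ = _ := by ring

/-- A solution which tends to zero at `-∞` vanishes, when the propagator is bounded. -/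
theorem jost_unique {M : A} {l : ℂ} (hM : M * M = -(l ^ 2) • (1 : A)) (hl : 0 ≤ l.im)
    (hl0 : l ≠ 0) {D u : ℝ → A} (hD : Continuous D) (hDi : IntegrableOn (fun s => ‖D s‖) (Set.Iic 0))
    (hu : ∀ x, HasDerivAt u ((M + (Complex.I * l) • 1 + D x) * u x) x)
    (hlim : Tendsto u atBot (𝓝 0)) (x : ℝ) : u x = 0 := by
  have hpc : Continuous (propagator M l) :=
    continuous_iff_continuousAt.2 fun τ => (hasDerivAt_propagator hM τ).continuousAt
  have huc : Continuous u := continuous_iff_continuousAt.2 fun y => (hu y).continuousAt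
  set c : ℝ := ‖(1 : A)‖ + ‖M‖ * ‖l‖⁻¹ with hc
  have hcb : ∀ {τ : ℝ}, 0 ≤ τ → ‖propagator M l τ‖ ≤ c :=
    fun h => norm_propagator_le_of_ne hl hl0 h
  have hc0 : 0 ≤ c := by positivity
  have hDi' : ∀ X, IntegrableOn (fun s => c * ‖D s‖) (Set.Iic X) :=
    integrableOn_Iic_of_continuous (by fun_prop) (hDi.const_mul c)
  have hub : ∀ X, ∃ C, ∀ x ≤ X, ‖u x‖ ≤ C := by
    intro X
    have h1 : ∀ᶠ x in atBot, ‖u x‖ < 1 := by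
      simpa using hlim.eventually (Metric.ball_mem_nhds (0 : A) one_pos)
    obtain ⟨a, ha⟩ := eventually_atBot.1 h1
    obtain ⟨C, hC⟩ := (isCompact_Icc (a := a) (b := X)).exists_bound_of_continuousOn
      huc.continuousOn
    refine ⟨max 1 C, fun y hy => ?_⟩
    rcases le_total y a with h | h
    · exact (ha y h).le.trans (le_max_left _ _)
    · exact (hC y ⟨h, hy⟩).trans (le_max_right _ _)
  refine volterra_unique (B := A) (h := fun s => c * ‖D s‖)
    (k := fun x s => propagator M l (x - s) * D s)
    (by fun_prop) hDi' (fun s => by positivity) (fun x s hs => ?_) hub (fun x => ?_) x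
  · refine (norm_mul_le _ _).trans ?_
    gcongr
    exact hcb (by linarith)
  -- Differentiating in `s`, the unperturbed parts cancel because the propagator commutes with its
  -- generator. Integrating from `-∞`, where the product vanishes since the propagator is bounded,
  -- recovers the homogeneous Volterra equation.
  · have hder : ∀ s, HasDerivAt (fun s => propagator M l (x - s) * u s)
        (propagator M l (x - s) * D s * u s) s := by
      intro s
      have h1 : HasDerivAt (fun s => x - s) (-1) s := by
        simpa using (hasDerivAt_id s).const_sub x
      have h2 := ((hasDerivAt_propagator hM (x - s)).scomp s h1).mul (hu s)
      refine h2.congr_deriv ?_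
      simp only [Function.comp_apply]
      rw [propagator_comm, neg_smul, one_smul, add_mul _ (D s), mul_add]
      noncomm_ring
    have hFTC := integral_Iic_of_hasDerivAt_of_tendsto' (a := x) (m := (0 : A))
      (fun s _ => hder s) ?_ ?_
    · simp only [sub_self, propagator_zero, one_mul, sub_zero] at hFTC
      exact hFTC.symm
    · obtain ⟨C, hC⟩ := hub x
      have hC0 : 0 ≤ C := (norm_nonneg _).trans (hC x le_rfl)
      refine Integrable.mono' ((hDi' x).mul_const C) (by
        refine Continuous.aestronglyMeasurable ?_
        fun_prop) ?_
      refine (ae_restrict_iff' measurableSet_Iic).2 (Eventually.of_forall fun s hs => ?_)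
      have hs : s ≤ x := hs
      calc _ ≤ ‖propagator M l (x - s)‖ * ‖D s‖ * ‖u s‖ := norm_mul₃_le
        _ ≤ c * ‖D s‖ * C := by
            gcongr
            · exact hcb (by linarith)
            · exact hC s hs
    · rw [tendsto_zero_iff_norm_tendsto_zero]
      have h1 : Tendsto (fun s => c * ‖u s‖) atBot (𝓝 (c * 0)) :=
        (tendsto_zero_iff_norm_tendsto_zero.1 hlim).const_mul c
      rw [mul_zero] at h1
      refine squeeze_zero' (Eventually.of_forall fun _ => norm_nonneg _) ?_ h1
      filter_upwards [eventually_le_atBot x] with s hs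
      refine (norm_mul_le _ _).trans ?_
      gcongr
      exact hcb (by linarith)


/-- For `x > 0` a kernel growing linearly in `x - s` is not dominated by a function of `s` alone.
Dividing the unknown by `ω(x) = 1 + max(x, 0)` repairs this, because `x - s ≤ ω(x)(1 + |s|) - 1`.
The statement is for a general Banach algebra so that it covers functions of the spectral parameter.
-/
theorem volterra_convolution {B : Type*} [NormedRing B] [NormedAlgebra ℝ B] [CompleteSpace B]
    {κ D : ℝ → B} (hκ : Continuous κ) (hD : Continuous D) {a b : ℝ} (ha : 0 ≤ a) (hb : 0 ≤ b)
    (hκn : ∀ τ, 0 ≤ τ → ‖κ τ‖ ≤ a + b * τ)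
    (hDi : IntegrableOn (fun s => (1 + |s|) * ‖D s‖) (Set.Iic 0)) (E : B) :
    ∃ u : ℝ → B, Continuous u ∧ (∀ X, ∃ C, ∀ x ≤ X, ‖u x‖ ≤ C) ∧ ∀ x,
      IntegrableOn (fun s => κ (x - s) * D s * u s) (Set.Iic x) ∧
      u x = E + ∫ s in Set.Iic x, κ (x - s) * D s * u s := by
  set c : ℝ := a + b with hc
  let ω : ℝ → ℝ := fun x => 1 + max x 0
  have hω1 : ∀ x, 1 ≤ ω x := fun x => by simp [ω]
  have hω0 : ∀ x, 0 < ω x := fun x => by linarith [hω1 x]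
  have hωc : Continuous ω := by fun_prop
  let h : ℝ → ℝ := fun s => c * ((1 + |s|) * ‖D s‖) * ω s
  have hhc : Continuous h := by fun_prop
  have hc0 : 0 ≤ c := by positivity
  have hhi : ∀ X, IntegrableOn h (Set.Iic X) := by
    refine integrableOn_Iic_of_continuous hhc (a := 0) ?_
    have h1 : IntegrableOn (fun s => c * ((1 + |s|) * ‖D s‖)) (Set.Iic 0) := hDi.const_mul c
    refine h1.congr_fun (fun s hs => ?_) measurableSet_Iic
    simp only [h, ω]
    rw [max_eq_right (Set.mem_Iic.1 hs), add_zero, mul_one]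
  have hkb : ∀ x s, s ≤ x → ‖κ (x - s) * D s‖ ≤ ω x * (c * ((1 + |s|) * ‖D s‖)) := by
    intro x s hs
    have h1 : x - s ≤ ω x * (1 + |s|) - 1 := by
      have a1 := neg_le_abs s
      have a2 := le_max_left x 0
      have a3 := le_max_right x 0
      have a4 := mul_nonneg a3 (abs_nonneg s)
      simp only [ω]
      nlinarith
    have h3 : 1 ≤ ω x * (1 + |s|) := by
      have := hω1 x
      nlinarith [abs_nonneg s]
    calc ‖κ (x - s) * D s‖ ≤ ‖κ (x - s)‖ * ‖D s‖ := norm_mul_le _ _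
      _ ≤ (a + b * (x - s)) * ‖D s‖ := by
          gcongr
          exact hκn _ (by linarith)
      _ ≤ (c * (ω x * (1 + |s|))) * ‖D s‖ := by
          gcongr
          have := mul_le_mul_of_nonneg_left (h1.trans (by linarith : _ ≤ ω x * (1 + |s|))) hb
          rw [hc]
          nlinarith
      _ = _ := by ring
  have hωi : Continuous fun x => (ω x)⁻¹ := hωc.inv₀ fun x => (hω0 x).ne'
  obtain ⟨v, hvc, hvb, hv⟩ := volterra_exists (B := B) (h := h)
    (k := fun x s => (ω s * (ω x)⁻¹) • (κ (x - s) * D s)) (u₀ := fun x => (ω x)⁻¹ • E)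
    (C₀ := ‖E‖) hhc hhi (fun s => by have := hω0 s; positivity)
    (fun x => by
      refine Continuous.aestronglyMeasurable ?_
      fun_prop)
    (fun s => by fun_prop)
    (fun x s hs => by
      have h0 : 0 ≤ ω s * (ω x)⁻¹ := mul_nonneg (hω0 s).le (inv_nonneg.2 (hω0 x).le)
      rw [norm_smul, Real.norm_eq_abs, abs_of_nonneg h0]
      calc _ ≤ ω s * (ω x)⁻¹ * (ω x * (c * ((1 + |s|) * ‖D s‖))) :=
            mul_le_mul_of_nonneg_left (hkb x s hs) h0
        _ = h s := by
            have := (hω0 x).ne'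
            simp only [h]
            field_simp)
    (by fun_prop)
    (fun x => by
      rw [norm_smul, norm_inv, Real.norm_eq_abs, abs_of_pos (hω0 x)]
      have : (ω x)⁻¹ ≤ 1 := inv_le_one_of_one_le₀ (hω1 x)
      nlinarith [norm_nonneg E])
  have huc : Continuous fun x => ω x • v x := hωc.smul hvc
  have hub : ∀ X, ∃ C, ∀ x ≤ X, ‖ω x • v x‖ ≤ C := by
    intro X
    obtain ⟨C, hC⟩ := hvb X
    refine ⟨ω X * C, fun x hx => ?_⟩
    have : ω x ≤ ω X := by simp only [ω]; gcongr
    rw [norm_smul, Real.norm_eq_abs, abs_of_pos (hω0 x)]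
    have := hC x hx
    have := (hω0 X).le
    gcongr
  refine ⟨fun x => ω x • v x, huc, hub, fun x => ⟨?_, ?_⟩⟩
  · obtain ⟨C, hC⟩ := hub x
    have hC0 : 0 ≤ C := (norm_nonneg _).trans (hC x le_rfl)
    have h1 : IntegrableOn (fun s => (1 + |s|) * ‖D s‖) (Set.Iic x) :=
      integrableOn_Iic_of_continuous (by fun_prop) hDi x
    refine Integrable.mono' (h1.const_mul (ω x * c * C)) (by
      refine Continuous.aestronglyMeasurable ?_
      fun_prop) ?_
    refine (ae_restrict_iff' measurableSet_Iic).2 (Eventually.of_forall fun s hs => ?_)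
    calc _ ≤ ‖κ (x - s) * D s‖ * ‖ω s • v s‖ := norm_mul_le _ _
      _ ≤ (ω x * (c * ((1 + |s|) * ‖D s‖))) * C := by
          have := hω0 x
          gcongr
          · exact hkb x s hs
          · exact hC s hs
      _ = _ := by ring
  · have h1 := hv x
    have h2 : ∫ s in Set.Iic x, ((ω s * (ω x)⁻¹) • (κ (x - s) * D s)) * v s
        = (ω x)⁻¹ • ∫ s in Set.Iic x, κ (x - s) * D s * (ω s • v s) := by
      rw [← integral_smul]
      refine integral_congr_ae (Eventually.of_forall fun s => ?_)
      simp only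
      rw [smul_mul_assoc, mul_smul_comm, smul_smul, mul_comm (ω s)]
    rw [h2, ← smul_add] at h1
    change ω x • v x = _
    rw [h1, smul_inv_smul₀ (hω0 x).ne']

/-- Used with `ev` the evaluation at a point `z`: a norm-nonincreasing homomorphism commutes with
the integral, so the equation in the function algebra specializes to the equation for that `z`. -/
theorem volterra_map {B : Type*} [NormedRing B] [NormedAlgebra ℝ B] [CompleteSpace B]
    {κ D u : ℝ → B} {E : B} (ev : B → A) (hadd : ∀ f g, ev (f + g) = ev f + ev g)
    (hsmul : ∀ (r : ℝ) f, ev (r • f) = r • ev f) (hmul : ∀ f g, ev (f * g) = ev f * ev g)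
    (hn : ∀ f, ‖ev f‖ ≤ ‖f‖) {x : ℝ}
    (hi : IntegrableOn (fun s => κ (x - s) * D s * u s) (Set.Iic x))
    (hu : u x = E + ∫ s in Set.Iic x, κ (x - s) * D s * u s) :
    ev (u x) = ev E + ∫ s in Set.Iic x, ev (κ (x - s)) * ev (D s) * ev (u s) := by
  let L : B →L[ℝ] A := LinearMap.mkContinuous ⟨⟨ev, hadd⟩, hsmul⟩ 1 fun f => by
    rw [one_mul]; exact hn f
  have h1 : ev (u x) = L E + L (∫ s in Set.Iic x, κ (x - s) * D s * u s) := by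
    rw [← map_add, ← hu]; rfl
  rw [h1, ← L.integral_comp_comm hi]
  congr 1
  refine integral_congr_ae (Eventually.of_forall fun s => ?_)
  simp only
  rw [← hmul, ← hmul]
  rfl

theorem continuous_map {B : Type*} [NormedRing B] [NormedAlgebra ℝ B]
    (ev : B → A) (hadd : ∀ f g, ev (f + g) = ev f + ev g)
    (hsmul : ∀ (r : ℝ) f, ev (r • f) = r • ev f) (hn : ∀ f, ‖ev f‖ ≤ ‖f‖) : Continuous ev :=
  (LinearMap.mkContinuous ⟨⟨ev, hadd⟩, hsmul⟩ 1 fun f => by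
    rw [one_mul]; exact hn f : B →L[ℝ] A).continuous

theorem continuous_propagator_uncurry {Z : Type*} [TopologicalSpace Z] {M : Z → A} {l : Z → ℂ}
    (hM : Continuous M) (hl : Continuous l) :
    Continuous fun p : ℝ × Z => propagator (M p.2) (l p.2) p.1 := by
  have h5 : Continuous fun p : ℝ × Z => 2 * Complex.I * l p.2 * (p.1 : ℂ) := by fun_prop
  have h6 : Continuous fun p : ℝ × Z => expSlope (2 * Complex.I * l p.2 * (p.1 : ℂ)) :=
    continuous_expSlope.comp h5
  have h7 : Continuous fun p : ℝ × Z => (p.1 : ℂ) := Complex.continuous_ofReal.comp continuous_fst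
  have h8 : Continuous fun p : ℝ × Z => M p.2 := hM.comp continuous_snd
  exact (((continuous_const.add h5.cexp).div_const 2).smul continuous_const).add
    ((h7.mul h6).smul h8)

theorem differentiableOn_propagator {U : Set ℂ} {M : ℂ → A} {l : ℂ → ℂ}
    (hM : DifferentiableOn ℂ M U) (hl : DifferentiableOn ℂ l U) (τ : ℝ) :
    DifferentiableOn ℂ (fun z => propagator (M z) (l z) τ) U := by
  have h2 : DifferentiableOn ℂ (fun z => 2 * Complex.I * l z * τ) U := by
    fun_prop
  have h3 : DifferentiableOn ℂ (fun z => expSlope (2 * Complex.I * l z * τ)) U :=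
    differentiable_expSlope.comp_differentiableOn h2
  have h4 : DifferentiableOn ℂ (fun z => (1 + Complex.exp (2 * Complex.I * l z * τ)) / 2) U := by
    fun_prop
  exact (h4.smul (differentiableOn_const (1 : A))).add
    (((differentiableOn_const (τ : ℂ)).mul h3).smul hM)

/-- Joint continuity in `(τ, z)` over a compact `Z` becomes, by currying, continuity of a curve for
the sup norm. Compactness also bounds `‖M z‖`, so the growth in `τ` is uniform over `Z`. -/
theorem exists_propagator_path {Z : Set ℂ} [CompactSpace Z] {M : ℂ → A} {l : ℂ → ℂ}
    (hl : ∀ z ∈ Z, 0 ≤ (l z).im) (hMc : ContinuousOn M Z) (hlc : ContinuousOn l Z)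
    (hMd : DifferentiableOn ℂ M (interior Z)) (hld : DifferentiableOn ℂ l (interior Z)) :
    ∃ (κ : ℝ → analyticSub A Z) (b : ℝ), 0 ≤ b ∧ Continuous κ ∧
      (∀ τ (z : Z), (κ τ : C(Z, A)) z = propagator (M z) (l z) τ) ∧
      ∀ τ, 0 ≤ τ → ‖κ τ‖ ≤ ‖(1 : A)‖ + b * τ := by
  obtain ⟨CM, hCM⟩ := (isCompact_iff_compactSpace.2 inferInstance : IsCompact Z).exists_bound_of_continuousOn
    hMc
  have hMc' : Continuous fun z : Z => M z := continuousOn_iff_continuous_domRestrict.1 hMc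
  have hlc' : Continuous fun z : Z => l z := continuousOn_iff_continuous_domRestrict.1 hlc
  have hjoint : Continuous fun p : ℝ × Z => propagator (M p.2) (l p.2) p.1 :=
    continuous_propagator_uncurry (M := fun z : Z => M z) (l := fun z : Z => l z) hMc' hlc'
  let κ : C(ℝ, C(Z, A)) := ContinuousMap.curry ⟨_, hjoint⟩
  have hκc : Continuous κ := κ.continuous
  have hκm : ∀ τ, κ τ ∈ analyticSub A Z := fun τ =>
    mem_analyticSub (differentiableOn_propagator hMd hld τ) fun z => rfl
  refine ⟨fun τ => ⟨κ τ, hκm τ⟩, |CM|, abs_nonneg _, hκc.subtype_mk _, fun τ z => rfl,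
    fun τ hτ => ?_⟩
  rw [norm_analyticSub, ContinuousMap.norm_le _ (by positivity)]
  intro z
  refine (norm_propagator_le (hl z z.2) hτ).trans ?_
  have := (hCM z z.2).trans (le_abs_self CM)
  gcongr

/-- The Volterra equation is solved once in `analyticSub A Z`. Continuity up to the boundary of `Z`,
holomorphy inside and uniform bounds are properties of the space in which the solution lies. -/
theorem exists_jost_param {Z : Set ℂ} (hZ : IsCompact Z) {M E : ℂ → A} {l : ℂ → ℂ}
    (hM : ∀ z ∈ Z, M z * M z = -(l z ^ 2) • (1 : A)) (hl : ∀ z ∈ Z, 0 ≤ (l z).im)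
    (hE : ∀ z ∈ Z, M z * E z = -(Complex.I * l z) • E z)
    (hMc : ContinuousOn M Z) (hlc : ContinuousOn l Z) (hEc : ContinuousOn E Z)
    (hMd : DifferentiableOn ℂ M (interior Z)) (hld : DifferentiableOn ℂ l (interior Z))
    (hEd : DifferentiableOn ℂ E (interior Z)) {D : ℝ → A} (hD : Continuous D)
    (hDi : IntegrableOn (fun s => (1 + |s|) * ‖D s‖) (Set.Iic 0)) :
    ∃ u : ℝ → ℂ → A, (∀ x, ContinuousOn (u x) Z ∧ DifferentiableOn ℂ (u x) (interior Z)) ∧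
      (∀ X, ∃ C, ∀ x ≤ X, ∀ z ∈ Z, ‖u x z‖ ≤ C) ∧
      ∀ z ∈ Z, (∀ x, HasDerivAt (fun y => u y z)
          ((M z + (Complex.I * l z) • 1 + D x) * u x z) x) ∧
        Tendsto (fun x => u x z) atBot (𝓝 (E z)) := by
  have : CompactSpace Z := isCompact_iff_compactSpace.1 hZ
  have hEc' : Continuous fun z : Z => E z := continuousOn_iff_continuous_domRestrict.1 hEc
  obtain ⟨κ, b, hb, hκc, hκ, hκn⟩ := exists_propagator_path hl hMc hlc hMd hld
  have hcstm : ∀ a, ContinuousMap.const Z a ∈ analyticSub A Z := fun a =>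
    mem_analyticSub (F := fun _ => a) (differentiableOn_const a) fun z => rfl
  have hEm : (⟨fun z => E z, hEc'⟩ : C(Z, A)) ∈ analyticSub A Z :=
    mem_analyticSub hEd fun z => rfl
  let D' : ℝ → analyticSub A Z := fun s => ⟨ContinuousMap.const Z (D s), hcstm _⟩
  have hD'c : Continuous D' := (ContinuousMap.continuous_const'.comp hD).subtype_mk _
  have hDn : ∀ s, ‖D' s‖ ≤ ‖D s‖ := fun s => by
    change ‖ContinuousMap.const Z (D s)‖ ≤ _
    rw [ContinuousMap.norm_le _ (norm_nonneg _)]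
    exact fun _ => le_rfl
  have hDi' : IntegrableOn (fun s => (1 + |s|) * ‖D' s‖) (Set.Iic 0) := by
    refine Integrable.mono' hDi (by
      refine Continuous.aestronglyMeasurable ?_
      fun_prop) (Eventually.of_forall fun s => ?_)
    rw [Real.norm_eq_abs, abs_of_nonneg (by positivity)]
    have := hDn s
    gcongr
  obtain ⟨u, huc, hub, hu⟩ := volterra_convolution hκc hD'c (norm_nonneg _) hb hκn hDi'
    ⟨⟨fun z => E z, hEc'⟩, hEm⟩
  refine ⟨fun x => extendZero (u x : C(Z, A)), fun x => ⟨continuousOn_extendZero _, (u x).2⟩,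
    fun X => ?_, fun z hz => ?_⟩
  · obtain ⟨C, hC⟩ := hub X
    refine ⟨C, fun x hx z hz => ?_⟩
    change ‖extendZero (u x : C(Z, A)) z‖ ≤ C
    rw [extendZero_of_mem _ hz]
    exact (ContinuousMap.norm_coe_le_norm (u x : C(Z, A)) ⟨z, hz⟩).trans (hC x hx)
  · let ev : analyticSub A Z → A := fun f => (f : C(Z, A)) ⟨z, hz⟩
    have hadd : ∀ f g, ev (f + g) = ev f + ev g := fun _ _ => rfl
    have hsmul : ∀ (r : ℝ) f, ev (r • f) = r • ev f := fun _ _ => rfl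
    have hmul : ∀ f g, ev (f * g) = ev f * ev g := fun _ _ => rfl
    have hn : ∀ f, ‖ev f‖ ≤ ‖f‖ := fun f => ContinuousMap.norm_coe_le_norm (f : C(Z, A)) ⟨z, hz⟩
    have hue : (fun x => extendZero (u x : C(Z, A)) z) = fun x => ev (u x) := by
      funext x
      rw [extendZero_of_mem _ hz]
    have huc' : Continuous fun x => ev (u x) := (continuous_map ev hadd hsmul hn).comp huc
    have hV : ∀ x, ev (u x) = E z + ∫ s in Set.Iic x,
        propagator (M z) (l z) (x - s) * D s * ev (u s) := by
      intro x
      rw [volterra_map ev hadd hsmul hmul hn (hu x).1 (hu x).2]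
      congr 1
      refine integral_congr_ae (Eventually.of_forall fun s => ?_)
      simp only
      rw [← hκ (x - s) ⟨z, hz⟩]
      rfl
    have h := jost_of_volterra (hM z hz) (hl z hz) (hE z hz) hD hDi huc' (fun X => by
      obtain ⟨C, hC⟩ := hub X
      exact ⟨C, fun x hx => (hn _).trans (hC x hx)⟩) hV
    rw [hue]
    refine ⟨fun x => ?_, h.2⟩
    change HasDerivAt _ (_ * extendZero (u x : C(Z, A)) z) x
    rw [extendZero_of_mem (u x : C(Z, A)) hz]
    exact h.1 x

end ParamJost

end MMKdV

namespace MMKdV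

/-! ### Matrix-valued functions and their entries -/

section Entries

variable {n p α : Type*} {R : Type*}

theorem hasDerivAt_matrix [Fintype n] [Fintype p] {f : ℝ → Matrix n p ℂ} {f' : Matrix n p ℂ}
    {x : ℝ} : HasDerivAt f f' x ↔ ∀ i j, HasDerivAt (fun y => f y i j) (f' i j) x :=
  (hasDerivAt_pi (𝕜 := ℝ) (φ := fun y i => (f y) i) (φ' := fun i => f' i) (x := x)).trans
    (forall_congr' fun _ => hasDerivAt_pi (𝕜 := ℝ))

theorem tendsto_matrix {l : Filter α} {f : α → Matrix n p ℂ} {F : Matrix n p ℂ} :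
    Tendsto f l (𝓝 F) ↔ ∀ i j, Tendsto (fun y => f y i j) l (𝓝 (F i j)) :=
  tendsto_pi_nhds.trans (forall_congr' fun _ => tendsto_pi_nhds)

theorem continuous_matrix_iff [TopologicalSpace α] {f : α → Matrix n p ℂ} :
    Continuous f ↔ ∀ i j, Continuous fun y => f y i j :=
  continuous_pi_iff.trans (forall_congr' fun _ => continuous_pi_iff)

theorem continuousOn_matrix [TopologicalSpace α] {s : Set α} {f : α → Matrix n p ℂ} :
    ContinuousOn f s ↔ ∀ i j, ContinuousOn (fun y => f y i j) s :=
  continuousOn_pi.trans (forall_congr' fun _ => continuousOn_pi)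

theorem differentiableOn_matrix [Fintype n] [Fintype p] {f : ℂ → Matrix n p ℂ} {s : Set ℂ} :
    DifferentiableOn ℂ f s ↔ ∀ i j, DifferentiableOn ℂ (fun y => f y i j) s :=
  (differentiableOn_pi (𝕜 := ℂ) (Φ := fun y i => (f y) i)).trans
    (forall_congr' fun _ => differentiableOn_pi)

theorem norm_entry_le [Fintype n] [Fintype p] (A : Matrix n p ℂ) (i : n) (j : p) :
    ‖A i j‖ ≤ ‖A‖ := by
  have h1 : ‖A i j‖₊ ≤ ‖A‖₊ := by
    rw [Matrix.linfty_opNNNorm_def]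
    exact (Finset.single_le_sum (f := fun j => ‖A i j‖₊) (fun _ _ => zero_le)
      (Finset.mem_univ j)).trans
      (Finset.le_sup (f := fun i => ∑ j, ‖A i j‖₊) (Finset.mem_univ i))
  exact_mod_cast h1

theorem norm_matrix_le_sum [Fintype n] [Fintype p] (A : Matrix n p ℂ) :
    ‖A‖ ≤ ∑ i, ∑ j, ‖A i j‖ := by
  have h1 : ‖A‖₊ ≤ ∑ i, ∑ j, ‖A i j‖₊ := by
    rw [Matrix.linfty_opNNNorm_def]
    exact Finset.sup_le fun i hi =>
      Finset.single_le_sum (f := fun i => ∑ j, ‖A i j‖₊) (fun _ _ => zero_le) hi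
  have h2 : ((‖A‖₊ : NNReal) : ℝ) ≤ ((∑ i, ∑ j, ‖A i j‖₊ : NNReal) : ℝ) :=
    NNReal.coe_le_coe.2 h1
  push_cast at h2
  exact h2

theorem norm_matrix_le_of_entry_le [Fintype n] [Fintype p] {A : Matrix n p ℂ} {c : ℝ}
    (h : ∀ i j, ‖A i j‖ ≤ c) : ‖A‖ ≤ Fintype.card n * (Fintype.card p * c) := by
  refine (norm_matrix_le_sum A).trans ?_
  calc ∑ i, ∑ j, ‖A i j‖ ≤ ∑ _i : n, ∑ _j : p, c :=
        Finset.sum_le_sum fun i _ => Finset.sum_le_sum fun j _ => h i j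
    _ = _ := by simp

end Entries

/-! ### The uniformization -/

section Uniformization

variable {k₀ : ℝ} {z : ℂ}

/-- The part `Im λ ≥ 0` of the Riemann surface, without the points over `k = ∞` and the branch
points. -/
def Omega (k₀ : ℝ) : Set ℂ :=
  {z | 0 ≤ (‖z‖ ^ 2 - k₀ ^ 2) * z.im ∧ z ≠ 0 ∧ z ≠ Complex.I * k₀ ∧ z ≠ -(Complex.I * k₀)}

theorem norm_I_mul (hk : 0 < k₀) : ‖Complex.I * (k₀ : ℂ)‖ = k₀ := by
  simp [abs_of_pos hk]

theorem Dplus_subset_Omega (hk : 0 < k₀) : Dplus k₀ ⊆ Omega k₀ := by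
  intro z hz
  have hz' : 0 < (‖z‖ ^ 2 - k₀ ^ 2) * z.im := hz
  refine ⟨hz'.le, ?_, ?_, ?_⟩
  · rintro rfl; simp at hz'
  · rintro rfl; rw [norm_I_mul hk] at hz'; simp at hz'
  · rintro rfl; rw [norm_neg, norm_I_mul hk] at hz'; simp at hz'

theorem Sigma0_subset_Omega : Sigma0 k₀ ⊆ Omega k₀ := by
  rintro z ⟨h1, h2, h3, h4⟩
  refine ⟨?_, h2, h3, h4⟩
  rcases h1 with h1 | h1 <;> simp [h1]

theorem Omega_eq (hk : 0 < k₀) : Omega k₀ = Dplus k₀ ∪ Sigma0 k₀ := by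
  refine Set.Subset.antisymm ?_ (Set.union_subset (Dplus_subset_Omega hk) Sigma0_subset_Omega)
  rintro z ⟨h1, h2, h3, h4⟩
  rcases h1.lt_or_eq with h | h
  · exact Or.inl h
  · right
    refine ⟨?_, h2, h3, h4⟩
    rcases mul_eq_zero.1 h.symm with h | h
    · right
      exact (pow_left_inj₀ (norm_nonneg z) hk.le two_ne_zero).1 (sub_eq_zero.1 h)
    · exact Or.inl h

theorem isOpen_Dplus : IsOpen (Dplus k₀) := by
  have : Continuous fun z : ℂ => (‖z‖ ^ 2 - k₀ ^ 2) * z.im :=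
    (by fun_prop : Continuous fun z : ℂ => ‖z‖ ^ 2 - k₀ ^ 2).mul Complex.continuous_im
  exact isOpen_lt continuous_const this

theorem isClosed_lamNonneg : IsClosed {z : ℂ | 0 ≤ (‖z‖ ^ 2 - k₀ ^ 2) * z.im} := by
  have : Continuous fun z : ℂ => (‖z‖ ^ 2 - k₀ ^ 2) * z.im :=
    (by fun_prop : Continuous fun z : ℂ => ‖z‖ ^ 2 - k₀ ^ 2).mul Complex.continuous_im
  exact isClosed_le continuous_const this

/-- The sign of `Im λ` is that of `(|z|² - k₀²) Im z`; this identifies `D⁺` and `Ω` with the regions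
where the propagator stays controlled as `x → -∞`. -/
theorem lam_im (z : ℂ) (hz : z ≠ 0) :
    (lam k₀ z).im = (‖z‖ ^ 2 - k₀ ^ 2) * z.im / (2 * ‖z‖ ^ 2) := by
  have h1 : Complex.normSq z ≠ 0 := by simpa using hz
  have h2 : ‖z‖ ^ 2 = Complex.normSq z := (Complex.normSq_eq_norm_sq z).symm
  have h3 : ((k₀ : ℂ) ^ 2 / z).im = -(k₀ ^ 2 * z.im / Complex.normSq z) := by
    rw [← Complex.ofReal_pow, Complex.div_im, Complex.ofReal_re, Complex.ofReal_im]
    ring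
  have h4 : (lam k₀ z).im = (z.im + ((k₀ : ℂ) ^ 2 / z).im) / 2 := by
    simp only [lam]
    rw [show (2 : ℂ) = ((2 : ℝ) : ℂ) by norm_num, Complex.div_ofReal_im, Complex.add_im]
  rw [h4, h3, h2]
  field_simp
  ring

theorem lam_im_nonneg (hz : z ≠ 0) (h : 0 ≤ (‖z‖ ^ 2 - k₀ ^ 2) * z.im) : 0 ≤ (lam k₀ z).im := by
  rw [lam_im z hz]; positivity

theorem sq_add_ne_zero (h1 : z ≠ Complex.I * k₀) (h2 : z ≠ -(Complex.I * k₀)) :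
    z ^ 2 + (k₀ : ℂ) ^ 2 ≠ 0 := by
  intro h
  have : (z - Complex.I * k₀) * (z + Complex.I * k₀) = 0 := by
    linear_combination h - (k₀ : ℂ) ^ 2 * Complex.I_sq
  rcases mul_eq_zero.1 this with h | h
  · exact h1 (sub_eq_zero.1 h)
  · exact h2 (eq_neg_of_add_eq_zero_left h)

theorem two_mul_lam_mul (hz : z ≠ 0) : 2 * lam k₀ z * z = z ^ 2 + (k₀ : ℂ) ^ 2 := by
  simp only [lam]; field_simp

theorem lam_ne_zero (hz : z ∈ Omega k₀) : lam k₀ z ≠ 0 := by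
  intro h
  have := two_mul_lam_mul (k₀ := k₀) hz.2.1
  rw [h] at this
  exact sq_add_ne_zero hz.2.2.1 hz.2.2.2 (by rw [← this]; ring)

theorem gam_ne_zero (hz : z ∈ Omega k₀) : gam k₀ z ≠ 0 := by
  intro h
  have h0 := hz.2.1
  have : gam k₀ z * z ^ 2 = z ^ 2 + (k₀ : ℂ) ^ 2 := by simp only [gam]; field_simp
  rw [h, zero_mul] at this
  exact sq_add_ne_zero hz.2.2.1 hz.2.2.2 this.symm

theorem lam_sq (hz : z ≠ 0) : lam k₀ z ^ 2 = kz k₀ z ^ 2 + (k₀ : ℂ) ^ 2 := by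
  simp only [lam, kz]; field_simp; ring

theorem lam_sub_kz (z : ℂ) : lam k₀ z - kz k₀ z = (k₀ : ℂ) ^ 2 / z := by
  simp only [lam, kz]; ring

theorem lam_add_kz (z : ℂ) : lam k₀ z + kz k₀ z = z := by
  simp only [lam, kz]; ring

theorem kz_conj (z : ℂ) : kz k₀ (starRingEnd ℂ z) = starRingEnd ℂ (kz k₀ z) := by
  simp [kz, map_ofNat]

theorem lam_conj (z : ℂ) : lam k₀ (starRingEnd ℂ z) = starRingEnd ℂ (lam k₀ z) := by
  simp [lam, map_ofNat]

theorem gam_conj (z : ℂ) : gam k₀ (starRingEnd ℂ z) = starRingEnd ℂ (gam k₀ z) := by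
  simp [gam]

theorem theta_conj (x t : ℝ) (z : ℂ) :
    theta k₀ x t (starRingEnd ℂ z) = starRingEnd ℂ (theta k₀ x t z) := by
  simp [theta, kz_conj, lam_conj, map_ofNat]

/-- The second sheet exchange `z ↦ -k₀²/z`. -/
noncomputable def flip (k₀ : ℝ) (z : ℂ) : ℂ := -((k₀ : ℂ) ^ 2) / z

theorem flip_ne_zero (hk : 0 < k₀) (hz : z ≠ 0) : flip k₀ z ≠ 0 := by
  have : (k₀ : ℂ) ≠ 0 := by exact_mod_cast hk.ne'
  simp [flip, hz, this]

theorem flip_flip (hk : 0 < k₀) (z : ℂ) : flip k₀ (flip k₀ z) = z := by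
  have : (k₀ : ℂ) ≠ 0 := by exact_mod_cast hk.ne'
  rcases eq_or_ne z 0 with rfl | hz
  · simp [flip]
  · simp only [flip]; field_simp

theorem kz_flip (hk : 0 < k₀) (z : ℂ) : kz k₀ (flip k₀ z) = kz k₀ z := by
  have : (k₀ : ℂ) ≠ 0 := by exact_mod_cast hk.ne'
  rcases eq_or_ne z 0 with rfl | hz
  · simp [flip]
  · simp only [flip, kz]; field_simp; ring

theorem lam_flip (hk : 0 < k₀) (z : ℂ) : lam k₀ (flip k₀ z) = -lam k₀ z := by
  have : (k₀ : ℂ) ≠ 0 := by exact_mod_cast hk.ne'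
  rcases eq_or_ne z 0 with rfl | hz
  · simp [flip, lam]
  · simp only [flip, lam]; field_simp; ring

theorem theta_flip (hk : 0 < k₀) (x t : ℝ) (z : ℂ) :
    theta k₀ x t (flip k₀ z) = -theta k₀ x t z := by
  simp only [theta, kz_flip hk, lam_flip hk]; ring

theorem flip_conj (z : ℂ) : flip k₀ (starRingEnd ℂ z) = starRingEnd ℂ (flip k₀ z) := by
  simp [flip]

theorem norm_flip (z : ℂ) : ‖flip k₀ z‖ = k₀ ^ 2 / ‖z‖ := by
  simp [flip]

theorem flip_im (z : ℂ) : (flip k₀ z).im = k₀ ^ 2 * z.im / ‖z‖ ^ 2 := by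
  rw [flip, ← Complex.ofReal_pow, ← Complex.ofReal_neg, Complex.div_im, ← Complex.normSq_eq_norm_sq,
    Complex.ofReal_re, Complex.ofReal_im]
  ring

/-- The map is `z ↦ -(k₀²/|z|²) z`: it inverts the modulus in the circle and reverses the sign of
`Im z`, so the sign of the product does not change. It exchanges the two components of `D⁺`, and the
origin with infinity. -/
theorem conj_flip_mem_lamNonneg (h : z ∈ Omega k₀) :
    0 ≤ (‖starRingEnd ℂ (flip k₀ z)‖ ^ 2 - k₀ ^ 2) * (starRingEnd ℂ (flip k₀ z)).im := by
  have h1 : 0 < ‖z‖ := norm_pos_iff.2 h.2.1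
  rw [Complex.conj_im, RCLike.norm_conj, norm_flip, flip_im]
  have : ((k₀ ^ 2 / ‖z‖) ^ 2 - k₀ ^ 2) * -(k₀ ^ 2 * z.im / ‖z‖ ^ 2)
      = (k₀ ^ 2 / ‖z‖ ^ 2) ^ 2 * ((‖z‖ ^ 2 - k₀ ^ 2) * z.im) := by
    field_simp; ring
  rw [this]
  exact mul_nonneg (by positivity) h.1

theorem conj_flip_mem_Dplus (hk : 0 < k₀) (h : z ∈ Dplus k₀) :
    starRingEnd ℂ (flip k₀ z) ∈ Dplus k₀ := by
  have h0 := Dplus_subset_Omega hk h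
  have h1 : 0 < ‖z‖ := norm_pos_iff.2 h0.2.1
  change 0 < (‖starRingEnd ℂ (flip k₀ z)‖ ^ 2 - k₀ ^ 2) * (starRingEnd ℂ (flip k₀ z)).im
  rw [Complex.conj_im, RCLike.norm_conj, norm_flip, flip_im]
  have : ((k₀ ^ 2 / ‖z‖) ^ 2 - k₀ ^ 2) * -(k₀ ^ 2 * z.im / ‖z‖ ^ 2)
      = (k₀ ^ 2 / ‖z‖ ^ 2) ^ 2 * ((‖z‖ ^ 2 - k₀ ^ 2) * z.im) := by
    field_simp; ring
  rw [this]
  exact mul_pos (by positivity) h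

theorem conj_flip_mem_Omega (hk : 0 < k₀) (h : z ∈ Omega k₀) :
    starRingEnd ℂ (flip k₀ z) ∈ Omega k₀ := by
  have hk' : (k₀ : ℂ) ≠ 0 := by exact_mod_cast hk.ne'
  -- The branch points are the fixed points of `flip`, and conjugation interchanges them.
  have h4 : flip k₀ (Complex.I * k₀) = Complex.I * k₀ := by
    simp only [flip]; field_simp; simp
  have h5 : flip k₀ (-(Complex.I * k₀)) = -(Complex.I * k₀) := by
    simp only [flip]; field_simp; simp
  refine ⟨conj_flip_mem_lamNonneg h, ?_, ?_, ?_⟩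
  · simpa using flip_ne_zero hk h.2.1
  · intro h'
    have := congrArg (fun w => flip k₀ (starRingEnd ℂ w)) h'
    simp only [Complex.conj_conj, flip_flip hk, map_mul, Complex.conj_I, Complex.conj_ofReal,
      neg_mul, h5] at this
    exact h.2.2.2 this
  · intro h'
    have := congrArg (fun w => flip k₀ (starRingEnd ℂ w)) h'
    simp only [Complex.conj_conj, flip_flip hk, map_mul, map_neg, Complex.conj_I,
      Complex.conj_ofReal, neg_mul, neg_neg, h4] at this
    exact h.2.2.1 this

theorem conj_mem_Sigma0 (h : z ∈ Sigma0 k₀) : starRingEnd ℂ z ∈ Sigma0 k₀ := by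
  obtain ⟨h1, h2, h3, h4⟩ := h
  refine ⟨?_, by simpa using h2, ?_, ?_⟩
  · rcases h1 with h1 | h1
    · left; simp [h1]
    · right; simpa using h1
  · intro h'
    apply h4
    have := congrArg (starRingEnd ℂ) h'
    simpa using this
  · intro h'
    apply h3
    have := congrArg (starRingEnd ℂ) h'
    simpa using this

theorem gam_flip (hk : 0 < k₀) (hz : z ≠ 0) :
    gam k₀ (flip k₀ z) = z ^ 2 / (k₀ : ℂ) ^ 2 * gam k₀ z := by
  have : (k₀ : ℂ) ≠ 0 := by exact_mod_cast hk.ne'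
  simp only [gam, flip]; field_simp; ring

theorem differentiableOn_lam {s : Set ℂ} (hs : ∀ z ∈ s, z ≠ 0) :
    DifferentiableOn ℂ (lam k₀) s := by
  unfold lam; fun_prop (disch := exact hs)

theorem differentiableOn_kz {s : Set ℂ} (hs : ∀ z ∈ s, z ≠ 0) :
    DifferentiableOn ℂ (kz k₀) s := by
  unfold kz; fun_prop (disch := exact hs)

theorem differentiableOn_gam {s : Set ℂ} (hs : ∀ z ∈ s, z ≠ 0) :
    DifferentiableOn ℂ (gam k₀) s := by
  unfold gam
  fun_prop (disch := exact fun z hz => pow_ne_zero 2 (hs z hz))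

end Uniformization

end MMKdV

namespace MMKdV

/-! ### Algebra of the Lax pair -/

section Algebra

variable {m : ℕ}

theorem sigma3_mul_self : sigma3 m * sigma3 m = 1 := by
  simp [sigma3, Matrix.fromBlocks_multiply, ← Matrix.fromBlocks_one]

theorem under_mul_sigma3 (A : Sq m) : under A * sigma3 m = -(sigma3 m * under A) := by
  simp [sigma3, under, Matrix.fromBlocks_multiply, Matrix.fromBlocks_neg]

theorem under_conjTranspose (A : Sq m) : (under A)ᴴ = -under A := by
  simp [under, Matrix.fromBlocks_conjTranspose, Matrix.fromBlocks_neg]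

theorem sigma3_conjTranspose : (sigma3 m)ᴴ = sigma3 m := by
  simp [sigma3, Matrix.fromBlocks_conjTranspose]

theorem under_add (A B : Sq m) : under (A + B) = under A + under B := by
  simp [under, Matrix.fromBlocks_add, add_comm]

theorem under_neg (A : Sq m) : under (-A) = -under A := by
  simp [under, Matrix.fromBlocks_neg]

theorem under_sub (A B : Sq m) : under (A - B) = under A - under B := by
  rw [sub_eq_add_neg, under_add, under_neg, ← sub_eq_add_neg]

theorem under_smul (r : ℝ) (A : Sq m) : under (r • A) = r • under A := by
  simp [under, Matrix.fromBlocks_smul]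

theorem under_mul_self {k₀ : ℝ} {A : Sq m}
    (h : A * Aᴴ = ((k₀ : ℂ) ^ 2) • 1 ∧ Aᴴ * A = ((k₀ : ℂ) ^ 2) • 1) :
    under A * under A = -((k₀ : ℂ) ^ 2) • 1 := by
  rw [under, Matrix.fromBlocks_multiply, ← Matrix.fromBlocks_one, Matrix.fromBlocks_smul]
  simp [h.1, h.2]

variable (m) in
/-- `A ↦ under A` as a real-linear map. -/
noncomputable def underL : Sq m →L[ℝ] Blk m :=
  LinearMap.toContinuousLinearMap ⟨⟨under, under_add⟩, under_smul⟩

theorem hasDerivAt_under {q : ℝ → Sq m} {q' : Sq m} {x : ℝ} (h : HasDerivAt q q' x) :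
    HasDerivAt (fun y => under (q y)) (under q') x :=
  (underL m).hasFDerivAt.comp_hasDerivAt x h

theorem continuous_under : Continuous (under : Sq m → Blk m) := (underL m).continuous

theorem norm_under_le (A : Sq m) : ‖under A‖ ≤ ((m + m : ℝ) * (m + m)) * ‖A‖ := by
  have h : ∀ i j, ‖under A i j‖ ≤ ‖A‖ := by
    rintro (i | i) (j | j)
    · simp [under]
    · simpa [under] using norm_entry_le A i j
    · simpa [under] using norm_entry_le A j i
    · simp [under]
  simpa [mul_assoc] using norm_matrix_le_of_entry_le h

/-- The limiting Lax matrix. -/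
noncomputable def limM (k₀ : ℝ) (Qm : Sq m) (z : ℂ) : Blk m :=
  (-(Complex.I * kz k₀ z)) • sigma3 m + under Qm

/-- The cross terms cancel because `σ₃` anticommutes with the off-diagonal part, and unitarity of
`Qm` up to the factor `k₀²` makes the remaining square a scalar. -/
theorem limM_sq {k₀ : ℝ} {Qm : Sq m}
    (h : Qm * Qmᴴ = ((k₀ : ℂ) ^ 2) • 1 ∧ Qmᴴ * Qm = ((k₀ : ℂ) ^ 2) • 1) {z : ℂ} (hz : z ≠ 0) :
    limM k₀ Qm z * limM k₀ Qm z = -(lam k₀ z ^ 2) • (1 : Blk m) := by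
  simp only [limM, mul_add, add_mul, sigma3_mul_self, under_mul_self h,
    smul_mul_assoc, mul_smul_comm, under_mul_sigma3, lam_sq hz]
  match_scalars
  · linear_combination kz k₀ z ^ 2 * Complex.I_sq
  · ring

/-- The columns of `E` diagonalize the limiting matrix with eigenvalues `∓iλ`. The verification
comes down to `λ + k = z` and `λ - k = k₀²/z`. -/
theorem limM_mul_asymE {k₀ : ℝ} {Qm : Sq m}
    (h : Qm * Qmᴴ = ((k₀ : ℂ) ^ 2) • 1 ∧ Qmᴴ * Qm = ((k₀ : ℂ) ^ 2) • 1) {z : ℂ} (hz : z ≠ 0) :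
    limM k₀ Qm z * asymE z Qm = -(Complex.I * lam k₀ z) • (asymE z Qm * sigma3 m) := by
  have e1 : under Qm * (sigma3 m * under Qm) = (k₀ : ℂ) ^ 2 • sigma3 m := by
    rw [← mul_assoc, under_mul_sigma3, neg_mul, mul_assoc, under_mul_self h]
    simp
  have e2 : sigma3 m * (sigma3 m * under Qm) = under Qm := by
    rw [← mul_assoc, sigma3_mul_self, one_mul]
  have e3 : sigma3 m * under Qm * sigma3 m = -under Qm := by
    rw [mul_assoc, under_mul_sigma3, mul_neg, e2]
  simp only [limM, asymE, mul_sub, add_mul, sub_mul, smul_mul_assoc,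
    mul_smul_comm, mul_one, one_mul, e1, e2, e3]
  have h1 : -(Complex.I * kz k₀ z) * (Complex.I / z) = kz k₀ z / z := by
    field_simp; rw [Complex.I_sq]; ring
  have h2 : -(Complex.I * lam k₀ z) * (Complex.I / z) = lam k₀ z / z := by
    field_simp; rw [Complex.I_sq]; ring
  have h3 : (1 : ℂ) = kz k₀ z / z + lam k₀ z / z := by
    rw [← add_div, add_comm, lam_add_kz, div_self hz]
  have h4 : Complex.I * lam k₀ z = Complex.I * kz k₀ z + (Complex.I / z) * (k₀ : ℂ) ^ 2 := by
    have := lam_sub_kz (k₀ := k₀) z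
    linear_combination Complex.I * this
  match_scalars
  · linear_combination h4
  · linear_combination h3 - h1 - h2

theorem limM_mul_asymE_toCols₁ {k₀ : ℝ} {Qm : Sq m}
    (h : Qm * Qmᴴ = ((k₀ : ℂ) ^ 2) • 1 ∧ Qmᴴ * Qm = ((k₀ : ℂ) ^ 2) • 1) {z : ℂ} (hz : z ≠ 0) :
    limM k₀ Qm z * (asymE z Qm).toCols₁ = -(Complex.I * lam k₀ z) • (asymE z Qm).toCols₁ := by
  have h1 := congrArg Matrix.toCols₁ (limM_mul_asymE h hz)
  have h2 : (asymE z Qm * sigma3 m).toCols₁ = (asymE z Qm).toCols₁ := by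
    ext i j
    simp [Matrix.mul_apply, sigma3, Matrix.toCols₁, Matrix.fromBlocks, Matrix.one_apply]
  have h3 : (limM k₀ Qm z * asymE z Qm).toCols₁ = limM k₀ Qm z * (asymE z Qm).toCols₁ := by
    ext i j; simp [Matrix.mul_apply, Matrix.toCols₁]
  have h4 : (-(Complex.I * lam k₀ z) • (asymE z Qm * sigma3 m)).toCols₁
      = -(Complex.I * lam k₀ z) • (asymE z Qm * sigma3 m).toCols₁ := by
    ext i j; simp [Matrix.toCols₁]
  rw [h3, h4, h2] at h1
  exact h1

/-- The time part of the Lax pair, in any algebra. -/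
noncomputable def laxNGen {A : Type*} [Ring A] [Algebra ℂ A] (k : ℂ) (σ U Ux Uxx : A) : A :=
  (-(4 * Complex.I * k ^ 3)) • σ + (4 * k ^ 2) • U
    - (2 * Complex.I * k) • ((U * U + Ux) * σ) - Uxx + (2 : ℂ) • (U * U * U)
    + Ux * U - U * Ux

/-- `N_x` in terms of the derivatives of the potential. -/
noncomputable def laxNGenX {A : Type*} [Ring A] [Algebra ℂ A] (k : ℂ) (σ U Ux Uxx Uxxx : A) : A :=
  (4 * k ^ 2) • Ux - (2 * Complex.I * k) • ((Ux * U + U * Ux + Uxx) * σ) - Uxxx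
    + (2 : ℂ) • (Ux * U * U + U * Ux * U + U * U * Ux) + Uxx * U - U * Uxx

/-- Only `σ² = 1` and the anticommutation of `σ` with `U, Ux, Uxx` matter. Moving `σ` to the left
brings every monomial to a normal form; the equation is used once, to eliminate `Ut`, and the
coefficients then agree identically in `k`. -/
theorem zero_curvature_gen {A : Type*} [Ring A] [Algebra ℂ A] {k : ℂ}
    {σ U Ux Uxx Uxxx Ut : A} (hσ : σ * σ = 1) (h0 : U * σ = -(σ * U)) (h1 : Ux * σ = -(σ * Ux))
    (h2 : Uxx * σ = -(σ * Uxx))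
    (heq : Ut + Uxxx - (3 : ℂ) • (Ux * U * U + U * U * Ux) = 0) :
    Ut + ((-(Complex.I * k)) • σ + U) * laxNGen k σ U Ux Uxx
      = laxNGenX k σ U Ux Uxx Uxxx + laxNGen k σ U Ux Uxx * ((-(Complex.I * k)) • σ + U) := by
  have a0 : ∀ X : A, U * (σ * X) = -(σ * (U * X)) := fun X => by
    rw [← mul_assoc, h0, neg_mul, mul_assoc]
  have a1 : ∀ X : A, Ux * (σ * X) = -(σ * (Ux * X)) := fun X => by
    rw [← mul_assoc, h1, neg_mul, mul_assoc]
  have a3 : ∀ X : A, σ * (σ * X) = X := fun X => by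
    rw [← mul_assoc, hσ, one_mul]
  have heq' : Ut = -Uxxx + (3 : ℂ) • (Ux * U * U + U * U * Ux) := by
    have : Ut = (Ut + Uxxx - (3 : ℂ) • (Ux * U * U + U * U * Ux)) - Uxxx
      + (3 : ℂ) • (Ux * U * U + U * U * Ux) := by abel
    rw [this, heq]; abel
  subst heq'
  simp only [laxNGen, laxNGenX, mul_add, add_mul, mul_sub, sub_mul, smul_mul_assoc, mul_smul_comm,
    mul_assoc, h0, h1, h2, a0, a1, a3, hσ, mul_neg, neg_mul, neg_neg, smul_smul, smul_add,
    smul_neg, smul_sub]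
  have hI : Complex.I * Complex.I = -1 := Complex.I_mul_I
  match_scalars <;> first | ring1 | (ring_nf; simp only [Complex.I_sq]; ring1)

end Algebra

/-! ### Regularity and decay of the potential -/

section Potential

theorem contDiff_partial_fst {F : ℝ × ℝ → ℂ} {n : ℕ} (hF : ContDiff ℝ (n + 1 : ℕ) F) :
    ContDiff ℝ n (fun p : ℝ × ℝ => deriv (fun y => F (y, p.2)) p.1) ∧
    ∀ p : ℝ × ℝ, HasDerivAt (fun y => F (y, p.2)) (deriv (fun y => F (y, p.2)) p.1) p.1 := by
  have hd : ∀ p : ℝ × ℝ, HasDerivAt (fun y => F (y, p.2)) (fderiv ℝ F p (1, 0)) p.1 := by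
    intro p
    have h1 : HasFDerivAt F (fderiv ℝ F p) (p.1, p.2) :=
      (hF.differentiable (by simp) p).hasFDerivAt
    exact h1.comp_hasDerivAt p.1 ((hasDerivAt_id p.1).prodMk (hasDerivAt_const p.1 p.2))
  constructor
  · have h2 : (fun p : ℝ × ℝ => deriv (fun y => F (y, p.2)) p.1)
        = fun p => fderiv ℝ F p (1, 0) := funext fun p => (hd p).deriv
    rw [h2]
    exact (hF.fderiv_right (by simp)).clm_apply contDiff_const
  · intro p
    rw [(hd p).deriv]
    exact hd p

theorem contDiff_partial_snd {F : ℝ × ℝ → ℂ} {n : ℕ} (hF : ContDiff ℝ (n + 1 : ℕ) F) :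
    ContDiff ℝ n (fun p : ℝ × ℝ => deriv (fun y => F (p.1, y)) p.2) ∧
    ∀ p : ℝ × ℝ, HasDerivAt (fun y => F (p.1, y)) (deriv (fun y => F (p.1, y)) p.2) p.2 := by
  have hd : ∀ p : ℝ × ℝ, HasDerivAt (fun y => F (p.1, y)) (fderiv ℝ F p (0, 1)) p.2 := by
    intro p
    have h1 : HasFDerivAt F (fderiv ℝ F p) (p.1, p.2) :=
      (hF.differentiable (by simp) p).hasFDerivAt
    exact h1.comp_hasDerivAt p.2 ((hasDerivAt_const p.2 p.1).prodMk (hasDerivAt_id p.2))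
  constructor
  · have h2 : (fun p : ℝ × ℝ => deriv (fun y => F (p.1, y)) p.2)
        = fun p => fderiv ℝ F p (0, 1) := funext fun p => (hd p).deriv
    rw [h2]
    exact (hF.fderiv_right (by simp)).clm_apply contDiff_const
  · intro p
    rw [(hd p).deriv]
    exact hd p

theorem integrableOn_of_norm_le_Iic {E : Type*} [NormedAddCommGroup E] {q : ℝ → E}
    {g : ℝ → ℝ} (hg : Integrable g) (hq : Continuous q) (hle : ∀ x ≤ 0, ‖q x‖ ≤ g x) :
    IntegrableOn q (Set.Iic 0) :=
  Integrable.mono' hg.integrableOn hq.aestronglyMeasurable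
    ((ae_restrict_iff' measurableSet_Iic).2 (Eventually.of_forall hle))

theorem norm_sub_le_integral_Iic {E : Type*} [NormedAddCommGroup E] [NormedSpace ℝ E]
    [CompleteSpace E] {q q' : ℝ → E} {L : E} {g : ℝ → ℝ} (hg : Integrable g)
    (hq : ∀ x, HasDerivAt q (q' x) x) (hc : Continuous q') (hle : ∀ x ≤ 0, ‖q' x‖ ≤ g x)
    (hL : Tendsto q atBot (𝓝 L)) {x : ℝ} (hx : x ≤ 0) :
    ‖q x - L‖ ≤ ∫ s in Set.Iic x, g s := by
  rw [← integral_Iic_of_hasDerivAt_of_tendsto' (a := x) (fun s _ => hq s)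
    ((integrableOn_of_norm_le_Iic hg hc hle).mono_set (Set.Iic_subset_Iic.2 hx)) hL]
  refine norm_integral_le_of_norm_le hg.integrableOn ?_
  exact (ae_restrict_iff' measurableSet_Iic).2 (Eventually.of_forall fun s hs =>
    hle s (le_trans hs hx))

/-- The derivatives of the potential are only dominated by an integrable function, which need not
tend to zero. A function that is integrable together with its derivative does. -/
theorem tendsto_zero_of_norm_le_Iic {E : Type*} [NormedAddCommGroup E] [NormedSpace ℝ E]
    [CompleteSpace E] {q q' : ℝ → E} {g : ℝ → ℝ} (hg : Integrable g)
    (hq : ∀ x, HasDerivAt q (q' x) x) (hc : Continuous q) (hc' : Continuous q')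
    (hle : ∀ x ≤ 0, ‖q x‖ ≤ g x) (hle' : ∀ x ≤ 0, ‖q' x‖ ≤ g x) :
    Tendsto q atBot (𝓝 0) :=
  tendsto_zero_of_hasDerivAt_of_integrableOn_Iic (a := (0 : ℝ)) (fun x _ => hq x)
    (integrableOn_of_norm_le_Iic hg hc' hle') (integrableOn_of_norm_le_Iic hg hc hle)

variable {m : ℕ} {k₀ : ℝ} {Q : ℝ → ℝ → Sq m} {Qm Qp : Sq m}

theorem contDiff_dx {n : ℕ} {Q : ℝ → ℝ → Sq m}
    (hQ : ∀ i j, ContDiff ℝ (n + 1 : ℕ) (fun p : ℝ × ℝ => Q p.1 p.2 i j)) :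
    (∀ i j, ContDiff ℝ n (fun p : ℝ × ℝ => dx Q p.1 p.2 i j)) ∧
    ∀ x t, HasDerivAt (fun y => Q y t) (dx Q x t) x :=
  ⟨fun i j => (contDiff_partial_fst (hQ i j)).1, fun x t => hasDerivAt_matrix.2 fun i j =>
    (contDiff_partial_fst (hQ i j)).2 (x, t)⟩

theorem continuous_uncurry_of_contDiff {n : ℕ} {Q : ℝ → ℝ → Sq m}
    (hQ : ∀ i j, ContDiff ℝ n (fun p : ℝ × ℝ => Q p.1 p.2 i j)) :
    Continuous fun p : ℝ × ℝ => Q p.1 p.2 :=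
  continuous_matrix_iff.2 fun i j => (hQ i j).continuous

namespace IsPotential

variable (hQ : IsPotential k₀ Q Qm Qp)
include hQ

theorem contDiff₀ (i j) : ContDiff ℝ (2 + 1 : ℕ) (fun p : ℝ × ℝ => Q p.1 p.2 i j) :=
  hQ.smooth i j

theorem contDiff₁ (i j) : ContDiff ℝ (1 + 1 : ℕ) (fun p : ℝ × ℝ => dx Q p.1 p.2 i j) :=
  (contDiff_dx hQ.contDiff₀).1 i j

theorem contDiff₂ (i j) : ContDiff ℝ (0 + 1 : ℕ) (fun p : ℝ × ℝ => dx (dx Q) p.1 p.2 i j) :=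
  (contDiff_dx hQ.contDiff₁).1 i j

theorem hasDerivAt₀ (x t : ℝ) : HasDerivAt (fun y => Q y t) (dx Q x t) x :=
  (contDiff_dx hQ.contDiff₀).2 x t

theorem hasDerivAt₁ (x t : ℝ) : HasDerivAt (fun y => dx Q y t) (dx (dx Q) x t) x :=
  (contDiff_dx hQ.contDiff₁).2 x t

theorem hasDerivAt₂ (x t : ℝ) : HasDerivAt (fun y => dx (dx Q) y t) (dx (dx (dx Q)) x t) x :=
  (contDiff_dx hQ.contDiff₂).2 x t

theorem hasDerivAt_time (x t : ℝ) : HasDerivAt (fun s => Q x s) (dt Q x t) t :=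
  hasDerivAt_matrix.2 fun i j => (contDiff_partial_snd (hQ.contDiff₀ i j)).2 (x, t)

theorem continuous₀ : Continuous fun p : ℝ × ℝ => Q p.1 p.2 :=
  continuous_uncurry_of_contDiff hQ.contDiff₀

theorem continuous₁ : Continuous fun p : ℝ × ℝ => dx Q p.1 p.2 :=
  continuous_uncurry_of_contDiff hQ.contDiff₁

theorem continuous₂ : Continuous fun p : ℝ × ℝ => dx (dx Q) p.1 p.2 :=
  continuous_uncurry_of_contDiff hQ.contDiff₂

theorem continuous₃ : Continuous fun p : ℝ × ℝ => dx (dx (dx Q)) p.1 p.2 :=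
  continuous_uncurry_of_contDiff (contDiff_dx hQ.contDiff₂).1

theorem continuous_time : Continuous fun p : ℝ × ℝ => dt Q p.1 p.2 :=
  continuous_matrix_iff.2 fun i j => (contDiff_partial_snd (hQ.contDiff₀ i j)).1.continuous

theorem exists_bound_left (T : ℝ) : ∃ g : ℝ → ℝ, Integrable g ∧ ∀ t, |t| ≤ T → ∀ x ≤ 0,
    (1 + |x|) * ‖Q x t - Qm‖ ≤ g x ∧ ‖dx Q x t‖ ≤ g x ∧ ‖dx (dx Q) x t‖ ≤ g x ∧
      ‖dx (dx (dx Q)) x t‖ ≤ g x := by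
  obtain ⟨g, hg, hb⟩ := hQ.decay T
  set c : ℝ := Fintype.card (Fin m) * Fintype.card (Fin m) with hc
  refine ⟨fun x => c * g x, hg.const_mul _, fun t ht x hx => ?_⟩
  have h := fun i j => (hb t ht x i j).1 hx
  have h1 : ∀ A : Sq m, (∀ i j, ‖A i j‖ ≤ g x) → ‖A‖ ≤ c * g x := fun A hA => by
    rw [hc, mul_assoc]; exact norm_matrix_le_of_entry_le hA
  have hx1 : 0 < 1 + |x| := by positivity
  refine ⟨?_, h1 _ fun i j => ?_, h1 _ fun i j => ?_, h1 _ fun i j => ?_⟩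
  · have := h1 (((1 + |x| : ℝ)) • (Q x t - Qm)) fun i j => by
      have h2 := h i j
      rw [Matrix.smul_apply, norm_smul, Real.norm_eq_abs, abs_of_pos hx1, Matrix.sub_apply]
      have := norm_nonneg (dx Q x t i j)
      have := norm_nonneg (dx (dx Q) x t i j)
      have := norm_nonneg (dx (dx (dx Q)) x t i j)
      linarith
    rwa [norm_smul, Real.norm_eq_abs, abs_of_pos hx1] at this
  all_goals
    have h2 := h i j
    have := norm_nonneg (dx Q x t i j)
    have := norm_nonneg (dx (dx Q) x t i j)
    have := norm_nonneg (dx (dx (dx Q)) x t i j)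
    have := mul_nonneg hx1.le (norm_nonneg (Q x t i j - Qm i j))
    linarith

theorem integrableOn_left (t : ℝ) :
    IntegrableOn (fun x => (1 + |x|) * ‖Q x t - Qm‖) (Set.Iic 0) ∧
    IntegrableOn (fun x => ‖dx Q x t‖) (Set.Iic 0) ∧
    IntegrableOn (fun x => ‖dx (dx Q) x t‖) (Set.Iic 0) := by
  obtain ⟨g, hg, hb⟩ := hQ.exists_bound_left |t|
  have hp : Continuous fun x : ℝ => (x, t) := by fun_prop
  have c0 : Continuous fun x => Q x t := hQ.continuous₀.comp hp
  have c1 : Continuous fun x => dx Q x t := hQ.continuous₁.comp hp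
  have c2 : Continuous fun x => dx (dx Q) x t := hQ.continuous₂.comp hp
  refine ⟨Integrable.mono' hg.integrableOn ((by fun_prop :
      Continuous fun x => (1 + |x|) * ‖Q x t - Qm‖).aestronglyMeasurable) ?_,
    Integrable.mono' hg.integrableOn c1.norm.aestronglyMeasurable ?_,
    Integrable.mono' hg.integrableOn c2.norm.aestronglyMeasurable ?_⟩ <;>
  refine (ae_restrict_iff' measurableSet_Iic).2 (Eventually.of_forall fun x hx => ?_)
  · rw [Real.norm_eq_abs, abs_of_nonneg (by positivity)]
    exact (hb t le_rfl x hx).1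
  · rw [norm_norm]; exact (hb t le_rfl x hx).2.1
  · rw [norm_norm]; exact (hb t le_rfl x hx).2.2.1

/-- Uniform convergence of the potential and its derivatives at `-∞`. -/
theorem exists_modulus_left (T : ℝ) : ∃ ε : ℝ → ℝ, Tendsto ε atBot (𝓝 0) ∧
    ∀ t, |t| ≤ T → ∀ x ≤ 0, ‖Q x t - Qm‖ ≤ ε x ∧ ‖dx Q x t‖ ≤ ε x ∧ ‖dx (dx Q) x t‖ ≤ ε x := by
  obtain ⟨g, hg, hb⟩ := hQ.exists_bound_left T
  -- The tail integral of the majorant controls each quantity through its next derivative; in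
  -- particular the bound on the third derivative serves to control the second.
  refine ⟨fun x => ∫ s in Set.Iic x, g s, tendsto_integral_Iic_atBot fun x => hg.integrableOn,
    fun t ht x hx => ?_⟩
  have hp : Continuous fun x : ℝ => (x, t) := by fun_prop
  have c1 : Continuous fun x => dx Q x t := hQ.continuous₁.comp hp
  have c2 : Continuous fun x => dx (dx Q) x t := hQ.continuous₂.comp hp
  have c3 : Continuous fun x => dx (dx (dx Q)) x t := hQ.continuous₃.comp hp
  refine ⟨norm_sub_le_integral_Iic hg (fun x => hQ.hasDerivAt₀ x t) c1
    (fun x hx => (hb t ht x hx).2.1) (hQ.tendsto_minus t) hx, ?_, ?_⟩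
  · have h0 := tendsto_zero_of_norm_le_Iic hg (fun x => hQ.hasDerivAt₁ x t) c1 c2
      (fun x hx => (hb t ht x hx).2.1) (fun x hx => (hb t ht x hx).2.2.1)
    simpa using norm_sub_le_integral_Iic hg (fun x => hQ.hasDerivAt₁ x t) c2
      (fun x hx => (hb t ht x hx).2.2.1) h0 hx
  · have h0 := tendsto_zero_of_norm_le_Iic hg (fun x => hQ.hasDerivAt₂ x t) c2 c3
      (fun x hx => (hb t ht x hx).2.2.1) (fun x hx => (hb t ht x hx).2.2.2)
    simpa using norm_sub_le_integral_Iic hg (fun x => hQ.hasDerivAt₂ x t) c3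
      (fun x hx => (hb t ht x hx).2.2.2) h0 hx

end IsPotential

end Potential

end MMKdV

namespace MMKdV

/-! ### Compatible pairs of linear equations -/

section Frobenius

variable {A : Type*} [NormedRing A] [NormedAlgebra ℝ A] [CompleteSpace A]

/-- A curve in `C(J, A)` that is pointwise differentiable with continuous derivative is
differentiable. -/
theorem hasDerivAt_continuousMap {J : Type*} [TopologicalSpace J] [CompactSpace J]
    {G G' : ℝ → C(J, A)} (hG' : Continuous G')
    (h : ∀ y t, HasDerivAt (fun t => G t y) (G' t y) t) (t : ℝ) : HasDerivAt G (G' t) t := by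
  have h1 : G = fun t => G 0 + ∫ s in (0 : ℝ)..t, G' s := by
    funext t
    ext y
    have hev := (ContinuousMap.evalCLM ℝ y : C(J, A) →L[ℝ] A).intervalIntegral_comp_comm
      (hG'.intervalIntegrable (μ := volume) 0 t)
    have hev' : ∫ s in (0 : ℝ)..t, G' s y = (∫ s in (0 : ℝ)..t, G' s) y := hev
    have hy : Continuous fun s => G' s y := 
      (ContinuousMap.evalCLM ℝ y : C(J, A) →L[ℝ] A).continuous.comp hG'
    rw [ContinuousMap.add_apply, ← hev',
      intervalIntegral.integral_eq_sub_of_hasDerivAt (fun s _ => h y s)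
        (hy.intervalIntegrable _ _)]
    abel
  rw [h1]
  exact (intervalIntegral.integral_hasDerivAt_right (hG'.intervalIntegrable _ _)
    (hG'.stronglyMeasurableAtFilter _ _) hG'.continuousAt).const_add _

theorem hasDerivAt_primitive {g : ℝ → A} (hg : Continuous g) (a x : ℝ) :
    HasDerivAt (fun y => ∫ s in a..y, g s) (g x) x :=
  intervalIntegral.integral_hasDerivAt_right (hg.intervalIntegrable _ _)
    (hg.stronglyMeasurableAtFilter _ _) hg.continuousAt

variable {X : ℝ} (hX : 0 < X)

/-- Extension of a function on `[-X, X]` by constants. -/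
noncomputable def extC (g : C(Set.Icc (-X) X, A)) (s : ℝ) : A :=
  g (Set.projIcc (-X) X (by linarith) s)

omit [NormedAlgebra ℝ A] [CompleteSpace A] in
theorem continuous_extC (g : C(Set.Icc (-X) X, A)) : Continuous (extC hX g) :=
  g.continuous.comp continuous_projIcc

omit [NormedAlgebra ℝ A] [CompleteSpace A] in
theorem extC_of_mem (g : C(Set.Icc (-X) X, A)) {s : ℝ} (hs : s ∈ Set.Icc (-X) X) :
    extC hX g s = g ⟨s, hs⟩ := by
  rw [extC, Set.projIcc_of_mem _ hs]

/-- The primitive vanishing at `0`, as an operator on `C([-X, X], A)`. -/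
noncomputable def primC : C(Set.Icc (-X) X, A) →L[ℝ] C(Set.Icc (-X) X, A) :=
  LinearMap.mkContinuous
    { toFun := fun g => ⟨fun y => ∫ s in (0 : ℝ)..y, extC hX g s,
        (continuous_iff_continuousAt.2 fun x =>
          (hasDerivAt_primitive (continuous_extC hX g) 0 x).continuousAt).comp
          continuous_subtype_val⟩
      map_add' := fun f g => by
        ext y
        exact intervalIntegral.integral_add ((continuous_extC hX f).intervalIntegrable _ _)
          ((continuous_extC hX g).intervalIntegrable _ _)
      map_smul' := fun r f => by
        ext y
        exact intervalIntegral.integral_smul r (extC hX f) }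
    X fun g => by
      rw [ContinuousMap.norm_le _ (by positivity)]
      intro y
      have h1 := intervalIntegral.norm_integral_le_of_norm_le_const (a := 0) (b := (y : ℝ))
        (f := extC hX g) (C := ‖g‖) fun s _ => g.norm_coe_le_norm _
      have h2 : |(y : ℝ) - 0| ≤ X := by rw [sub_zero]; exact abs_le.2 y.2
      refine h1.trans ?_
      rw [mul_comm]
      gcongr

theorem primC_apply (g : C(Set.Icc (-X) X, A)) (y : Set.Icc (-X) X) :
    primC hX g y = ∫ s in (0 : ℝ)..y, extC hX g s := rfl

/-- Evaluation at `0`, as a constant function. -/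
noncomputable def evalZeroC : C(Set.Icc (-X) X, A) →L[ℝ] C(Set.Icc (-X) X, A) :=
  LinearMap.mkContinuous
    { toFun := fun g => ContinuousMap.const _ (extC hX g 0)
      map_add' := fun f g => by ext y; rfl
      map_smul' := fun r f => by ext y; rfl }
    1 fun g => by
      rw [ContinuousMap.norm_le _ (by positivity)]
      intro y
      rw [one_mul]
      exact g.norm_coe_le_norm _

omit [CompleteSpace A] in
theorem evalZeroC_apply (g : C(Set.Icc (-X) X, A)) (y : Set.Icc (-X) X) :
    evalZeroC hX g y = extC hX g 0 := rfl

/-- Restriction of a function of two variables, as a curve of functions of the first one. -/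
noncomputable def curveC (X : ℝ) (g : ℝ → ℝ → A) (hg : Continuous fun p : ℝ × ℝ => g p.1 p.2)
    (t : ℝ) : C(Set.Icc (-X) X, A) :=
  ⟨fun y => g y t, hg.comp (continuous_subtype_val.prodMk continuous_const)⟩

omit [NormedAlgebra ℝ A] [CompleteSpace A] in
theorem continuous_curveC (g : ℝ → ℝ → A) (hg : Continuous fun p : ℝ × ℝ => g p.1 p.2) :
    Continuous (curveC X g hg) := by
  refine ContinuousMap.continuous_of_continuous_uncurry _ ?_
  exact hg.comp ((continuous_subtype_val.comp continuous_snd).prodMk continuous_fst)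

/-- A solution of the `t`-equation which solves the `x`-equation at `t = 0` solves it at all
times, on `[-X, X]`. -/
theorem frobenius_Icc {M N Mt Nx : ℝ → ℝ → A} (hMc : Continuous fun p : ℝ × ℝ => M p.1 p.2)
    (hNc : Continuous fun p : ℝ × ℝ => N p.1 p.2) (hMtc : Continuous fun p : ℝ × ℝ => Mt p.1 p.2)
    (hNxc : Continuous fun p : ℝ × ℝ => Nx p.1 p.2)
    (hM : ∀ x t, HasDerivAt (fun s => M x s) (Mt x t) t)
    (hN : ∀ x t, HasDerivAt (fun y => N y t) (Nx x t) x)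
    (hzc : ∀ x t, Mt x t + M x t * N x t = Nx x t + N x t * M x t)
    {f : ℝ → A} (hf : ∀ x, HasDerivAt f (M x 0 * f x) x) :
    ∃ F : ℝ → C(Set.Icc (-X) X, A), (∀ y, F 0 y = f y) ∧
      (∀ t, HasDerivAt F (curveC X N hNc t * F t) t) ∧
      ∀ t, F t = evalZeroC hX (F t) + primC hX (curveC X M hMc t * F t) := by
  have hfc : Continuous f := continuous_iff_continuousAt.2 fun x => (hf x).continuousAt
  -- The `t`-equation for all points of `[-X, X]` at once is a single linear equation in the Banach
  -- algebra `C([-X, X], A)`.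
  obtain ⟨F, hF0, hF⟩ := linearODE_exists (B := C(Set.Icc (-X) X, A))
    (continuous_curveC (X := X) N hNc) ⟨fun y => f y, hfc.comp continuous_subtype_val⟩
  refine ⟨F, fun y => by rw [hF0]; rfl, hF, fun t => ?_⟩
  set n := curveC X N hNc
  set μ := curveC X M hMc
  set μ' := curveC X Mt hMtc
  set n' := curveC X Nx hNxc
  have hμ : ∀ t, HasDerivAt μ (μ' t) t :=
    hasDerivAt_continuousMap (continuous_curveC (X := X) Mt hMtc) fun y t => hM y t
  have hzc' : ∀ t, μ' t + μ t * n t = n' t + n t * μ t := fun t => by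
    ext y
    exact hzc y t
  -- `D` is the defect in the integrated `x`-equation. The integrated form is used because `F` is
  -- not yet known to be differentiable in `x`; the aim is a homogeneous linear equation for `D`.
  set D : ℝ → C(Set.Icc (-X) X, A) := fun t =>
    F t - evalZeroC hX (F t) - primC hX (μ t * F t) with hD
  -- `F - D` is a primitive, hence differentiable in `x`, unlike `F` itself. The identity is the
  -- product rule for `N (F - D)`, integrated from `0`.
  have key : ∀ t, n t * (F t - D t)
      = evalZeroC hX (n t * F t) + primC hX (n' t * (F t - D t) + n t * (μ t * F t)) := by
    intro t
    ext y
    have hG : F t - D t = evalZeroC hX (F t) + primC hX (μ t * F t) := by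
      simp only [hD]; abel
    set G : ℝ → A := fun s => extC hX (F t) 0 + ∫ r in (0 : ℝ)..s, extC hX (μ t * F t) r with hGdef
    have hGd : ∀ s, HasDerivAt G (extC hX (μ t * F t) s) s := fun s =>
      (hasDerivAt_primitive (continuous_extC hX _) 0 s).const_add _
    have hGc : Continuous G := continuous_iff_continuousAt.2 fun s => (hGd s).continuousAt
    have hGy : ∀ y : Set.Icc (-X) X, (F t - D t) y = G y := fun y => by rw [hG]; rfl
    have hNc1 : Continuous fun s => N s t := hNc.comp (continuous_id.prodMk continuous_const)
    have hNxc1 : Continuous fun s => Nx s t := hNxc.comp (continuous_id.prodMk continuous_const)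
    have hec := continuous_extC hX (μ t * F t)
    have hFTC := intervalIntegral.integral_eq_sub_of_hasDerivAt (a := 0) (b := (y : ℝ))
      (fun s _ => (hN s t).mul (hGd s)) ((by fun_prop : Continuous fun s =>
        Nx s t * G s + N s t * extC hX (μ t * F t) s).intervalIntegrable _ _)
    have h0 : (0 : ℝ) ∈ Set.Icc (-X) X := ⟨by linarith, hX.le⟩
    have hG0 : G 0 = extC hX (F t) 0 := by simp [hGdef]
    rw [ContinuousMap.mul_apply, hGy y, ContinuousMap.add_apply, evalZeroC_apply, primC_apply]
    have h2 : ∫ s in (0 : ℝ)..y, extC hX (n' t * (F t - D t) + n t * (μ t * F t)) s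
        = ∫ s in (0 : ℝ)..y, (Nx s t * G s + N s t * extC hX (μ t * F t) s) := by
      refine intervalIntegral.integral_congr fun s hs => ?_
      have hs' : s ∈ Set.Icc (-X) X := (Set.uIcc_subset_Icc h0 y.2) hs
      rw [extC_of_mem hX _ hs', extC_of_mem hX _ hs']
      rw [← hGy ⟨s, hs'⟩]
      rfl
    have h4 : extC hX (n t * F t) 0 = N 0 t * G 0 := by
      rw [hG0, extC_of_mem hX _ h0, extC_of_mem hX _ h0]
      rfl
    rw [h2, hFTC, h4]
    change N y t * G y = N 0 t * G 0 + (N y t * G y - N 0 t * G 0)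
    abel
  -- Zero curvature turns `μ' F + μ n F` into `n' F + n μ F`, and `key` cancels all the terms that
  -- do not contain `D`.
  have hDd : ∀ t, HasDerivAt D (n t * D t - primC hX (n' t * D t)) t := by
    intro t
    have h1 := ((hF t).sub ((evalZeroC hX).hasFDerivAt.comp_hasDerivAt t (hF t))).sub
      ((primC hX).hasFDerivAt.comp_hasDerivAt t ((hμ t).mul (hF t)))
    refine h1.congr_deriv ?_
    have h2 : μ' t * F t + μ t * (n t * F t) = n' t * F t + n t * (μ t * F t) := by
      rw [← mul_assoc, ← add_mul, hzc', add_mul, mul_assoc]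
    have h3 := key t
    rw [mul_sub (n t) (F t) (D t), mul_sub (n' t) (F t) (D t)] at h3
    rw [h2]
    simp only [map_add, map_sub] at h3 ⊢
    have h5 : n t * D t = n t * F t - (n t * F t - n t * D t) := by abel
    rw [h5, h3]
    abel
  have hD0 : D 0 = 0 := by
    ext y
    have h0 : (0 : ℝ) ∈ Set.Icc (-X) X := ⟨by linarith, hX.le⟩
    have hMc1 : Continuous fun s => M s 0 := hMc.comp (continuous_id.prodMk continuous_const)
    have hFTC := intervalIntegral.integral_eq_sub_of_hasDerivAt (a := 0) (b := (y : ℝ))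
      (fun s _ => hf s) ((by fun_prop : Continuous fun s => M s 0 * f s).intervalIntegrable _ _)
    have h2 : ∫ s in (0 : ℝ)..y, extC hX (μ 0 * F 0) s = ∫ s in (0 : ℝ)..y, M s 0 * f s := by
      refine intervalIntegral.integral_congr fun s hs => ?_
      have hs' : s ∈ Set.Icc (-X) X := (Set.uIcc_subset_Icc h0 y.2) hs
      rw [extC_of_mem hX _ hs', hF0]
      rfl
    change F 0 y - evalZeroC hX (F 0) y - primC hX (μ 0 * F 0) y = 0
    rw [evalZeroC_apply, primC_apply, h2, hFTC, extC_of_mem hX _ h0, hF0]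
    change f y - f 0 - (f y - f 0) = 0
    abel
  have hDz := eq_zero_of_norm_deriv_le (F := D) (t₀ := 0)
    (c := fun t => ‖n t‖ + ‖primC (A := A) hX‖ * ‖n' t‖)
    ((continuous_curveC (X := X) N hNc).norm.add
      (continuous_const.mul (continuous_curveC (X := X) Nx hNxc).norm)) hDd (fun t => by
      refine (norm_sub_le _ _).trans ?_
      rw [add_mul, mul_assoc]
      refine add_le_add (norm_mul_le _ _) (((primC hX).le_opNorm (n' t * D t)).trans
        (mul_le_mul_of_nonneg_left (norm_mul_le _ _) (norm_nonneg _)))) hD0 t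
  have : F t - evalZeroC hX (F t) - primC hX (μ t * F t) = 0 := hDz
  rw [sub_sub, sub_eq_zero] at this
  exact this

/-- For each `x` the `t`-equation is solved on its own. On a window around a given point, uniqueness
identifies these solutions with the curve of `frobenius_Icc`, whose integrated `x`-equation can then
be differentiated. -/
theorem frobenius {M N Mt Nx : ℝ → ℝ → A} (hMc : Continuous fun p : ℝ × ℝ => M p.1 p.2)
    (hNc : Continuous fun p : ℝ × ℝ => N p.1 p.2) (hMtc : Continuous fun p : ℝ × ℝ => Mt p.1 p.2)
    (hNxc : Continuous fun p : ℝ × ℝ => Nx p.1 p.2)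
    (hM : ∀ x t, HasDerivAt (fun s => M x s) (Mt x t) t)
    (hN : ∀ x t, HasDerivAt (fun y => N y t) (Nx x t) x)
    (hzc : ∀ x t, Mt x t + M x t * N x t = Nx x t + N x t * M x t)
    {f : ℝ → A} (hf : ∀ x, HasDerivAt f (M x 0 * f x) x) :
    ∃ F : ℝ → ℝ → A, (∀ x, F x 0 = f x) ∧
      (∀ x t, HasDerivAt (fun s => F x s) (N x t * F x t) t) ∧
      ∀ x t, HasDerivAt (fun y => F y t) (M x t * F x t) x := by
  have hNc1 : ∀ x, Continuous fun t => N x t := fun x =>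
    hNc.comp (continuous_const.prodMk continuous_id)
  choose F hF0 hF using fun x => linearODE_exists (hNc1 x) (f x)
  refine ⟨F, hF0, hF, fun x t => ?_⟩
  have hX : 0 < |x| + 1 := by positivity
  obtain ⟨G, hG0, hG, hGe⟩ := frobenius_Icc hX hMc hNc hMtc hNxc hM hN hzc hf
  have hGF : ∀ y : Set.Icc (-(|x| + 1)) (|x| + 1), ∀ t, F y t = G t y := by
    intro y t
    have hd : ∀ t, HasDerivAt (fun t => F y t - G t y) (N y t * F y t - N y t * G t y) t := by
      intro t
      exact (hF y t).sub ((ContinuousMap.evalCLM ℝ y :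
        C(Set.Icc (-(|x| + 1)) (|x| + 1), A) →L[ℝ] A).hasFDerivAt.comp_hasDerivAt t (hG t))
    have := eq_zero_of_norm_deriv_le (c := fun t => ‖N y t‖) (hNc1 y).norm hd
      (fun t => by rw [← mul_sub]; exact norm_mul_le _ _) (t₀ := 0)
      (by rw [hF0, hG0, sub_self]) t
    exact sub_eq_zero.1 this
  have hx : x ∈ Set.Icc (-(|x| + 1)) (|x| + 1) :=
    ⟨by linarith [neg_abs_le x], by linarith [le_abs_self x]⟩
  have h1 : (fun y => F y t) =ᶠ[𝓝 x] fun y => extC hX (G t) 0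
      + ∫ s in (0 : ℝ)..y, extC hX (curveC (|x| + 1) M hMc t * G t) s := by
    have : Set.Ioo (-(|x| + 1)) (|x| + 1) ∈ 𝓝 x := Ioo_mem_nhds
      (by linarith [neg_abs_le x]) (by linarith [le_abs_self x])
    filter_upwards [this] with y hy
    have h2 := DFunLike.congr_fun (hGe t) ⟨y, hy.1.le, hy.2.le⟩
    rw [hGF ⟨y, hy.1.le, hy.2.le⟩ t, h2]
    rfl
  have h3 := ((hasDerivAt_primitive (continuous_extC hX (curveC (|x| + 1) M hMc t * G t)) 0
    x).const_add (extC hX (G t) 0)).congr_of_eventuallyEq h1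
  refine h3.congr_deriv ?_
  rw [extC_of_mem hX _ hx, hGF ⟨x, hx⟩ t]
  rfl

end Frobenius

end MMKdV

namespace MMKdV

/-! ### Completion of columns to square matrices; existence, uniqueness and regularity of `φ` -/

section Pad

variable {m : ℕ}

/-- A `2m × m` matrix, completed by zeros to a square one. -/
def pad (f : Col m) : Blk m := Matrix.fromCols f 0

theorem pad_toCols₁ (f : Col m) : (pad f).toCols₁ = f := by ext i j; rfl

theorem mul_pad (A : Blk m) (f : Col m) : A * pad f = pad (A * f) := by
  rw [pad, Matrix.mul_fromCols, Matrix.mul_zero]; rfl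

theorem pad_smul (c : ℂ) (f : Col m) : pad (c • f) = c • pad f := by
  ext i (j | j) <;> simp [pad]

theorem mul_toCols₁ (A B : Blk m) : (A * B).toCols₁ = A * B.toCols₁ := by
  ext i j; simp [Matrix.mul_apply, Matrix.toCols₁]

theorem hasDerivAt_pad {f : ℝ → Col m} {f' : Col m} {x : ℝ} (h : HasDerivAt f f' x) :
    HasDerivAt (fun y => pad (f y)) (pad f') x := by
  rw [hasDerivAt_matrix] at h ⊢
  rintro i (j | j)
  · exact h i j
  · exact hasDerivAt_const x 0

theorem tendsto_pad {α : Type*} {l : Filter α} {f : α → Col m} {F : Col m}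
    (h : Tendsto f l (𝓝 F)) : Tendsto (fun y => pad (f y)) l (𝓝 (pad F)) := by
  rw [tendsto_matrix] at h ⊢
  rintro i (j | j)
  · exact h i j
  · exact tendsto_const_nhds

theorem differentiableOn_pad {s : Set ℂ} {f : ℂ → Col m} (h : DifferentiableOn ℂ f s) :
    DifferentiableOn ℂ (fun y => pad (f y)) s := by
  rw [differentiableOn_matrix] at h ⊢
  rintro i (j | j)
  · exact h i j
  · exact differentiableOn_const (c := (0 : ℂ))

theorem norm_toCols₁_le (B : Blk m) :
    ‖B.toCols₁‖ ≤ ((m + m : ℝ) * m) * ‖B‖ := by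
  have h : ∀ i j, ‖B.toCols₁ i j‖ ≤ ‖B‖ := fun i j => norm_entry_le B i (Sum.inl j)
  simpa [mul_assoc] using norm_matrix_le_of_entry_le h

end Pad

theorem tendsto_laxNGen {A α : Type*} [NormedRing A] [NormedAlgebra ℂ A] {l : Filter α} (k : ℂ)
    (σ : A) {f g h : α → A} {U V W : A} (hf : Tendsto f l (𝓝 U)) (hg : Tendsto g l (𝓝 V))
    (hh : Tendsto h l (𝓝 W)) :
    Tendsto (fun p => laxNGen k σ (f p) (g p) (h p)) l (𝓝 (laxNGen k σ U V W)) := by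
  exact (((((tendsto_const_nhds.add (hf.const_smul _)).sub
    ((((hf.mul hf).add hg).mul_const σ).const_smul _)).sub hh).add
    (((hf.mul hf).mul hf).const_smul _)).add (hg.mul hf)).sub (hf.mul hg)

theorem continuous_laxNGen {A α : Type*} [NormedRing A] [NormedAlgebra ℂ A] [TopologicalSpace α]
    (k : ℂ) (σ : A) {f g h : α → A} (hf : Continuous f) (hg : Continuous g) (hh : Continuous h) :
    Continuous (fun p => laxNGen k σ (f p) (g p) (h p)) :=
  continuous_iff_continuousAt.2 fun p =>
    tendsto_laxNGen k σ (hf.tendsto p) (hg.tendsto p) (hh.tendsto p)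

theorem continuous_laxNGenX {A α : Type*} [NormedRing A] [NormedAlgebra ℂ A] [TopologicalSpace α]
    (k : ℂ) (σ : A) {f g h w : α → A} (hf : Continuous f) (hg : Continuous g) (hh : Continuous h)
    (hw : Continuous w) :
    Continuous (fun p => laxNGenX k σ (f p) (g p) (h p) (w p)) :=
  (((((hg.const_smul _).sub (((((hg.mul hf).add (hf.mul hg)).add hh).mul
    continuous_const).const_smul _)).sub hw).add (((((hg.mul hf).mul hf).add
    ((hf.mul hg).mul hf)).add ((hf.mul hf).mul hg)).const_smul _)).add (hh.mul hf)).sub (hf.mul hh)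

theorem hasDerivAt_laxNGen {A : Type*} [NormedRing A] [NormedAlgebra ℂ A] (k : ℂ) (σ : A)
    {f g h : ℝ → A} {h' : A} {x : ℝ} (hf : HasDerivAt f (g x) x) (hg : HasDerivAt g (h x) x)
    (hh : HasDerivAt h h' x) :
    HasDerivAt (fun y => laxNGen k σ (f y) (g y) (h y)) (laxNGenX k σ (f x) (g x) (h x) h') x := by
  have h1 := (((((hf.const_smul (4 * k ^ 2)).const_add ((-(4 * Complex.I * k ^ 3)) • σ)).sub
    ((((hf.mul hf).add hg).mul_const σ).const_smul (2 * Complex.I * k))).sub hh).add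
    (((hf.mul hf).mul hf).const_smul (2 : ℂ))).add (hg.mul hf) |>.sub (hf.mul hg)
  refine h1.congr_deriv ?_
  simp only [laxNGenX, add_mul]
  module

section Jost

variable {m : ℕ} {k₀ : ℝ} {Q : ℝ → ℝ → Sq m} {Qm Qp : Sq m}

theorem laxM_add (z : ℂ) (x t : ℝ) (c : ℂ) :
    laxM k₀ Q z x t + c • 1 = limM k₀ Qm z + c • 1 + under (Q x t - Qm) := by
  rw [laxM, limM, under_sub]; abel

namespace IsPotential

variable (hQ : IsPotential k₀ Q Qm Qp)
include hQ

theorem continuous_under_sub (t : ℝ) : Continuous fun x => under (Q x t - Qm) :=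
  continuous_under.comp ((hQ.continuous₀.comp (by fun_prop : Continuous fun x : ℝ => (x, t))).sub
    continuous_const)

theorem integrableOn_under_sub (t : ℝ) :
    IntegrableOn (fun x => (1 + |x|) * ‖under (Q x t - Qm)‖) (Set.Iic 0) := by
  have hc := hQ.continuous_under_sub t
  refine Integrable.mono' ((hQ.integrableOn_left t).1.const_mul ((m + m : ℝ) * (m + m)))
    ((by fun_prop : Continuous fun x =>
      (1 + |x|) * ‖under (Q x t - Qm)‖).aestronglyMeasurable) (Eventually.of_forall fun x => ?_)
  rw [Real.norm_eq_abs, abs_of_nonneg (by positivity)]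
  have := mul_le_mul_of_nonneg_left (norm_under_le (Q x t - Qm)) (by positivity : 0 ≤ 1 + |x|)
  linarith

/-- The Jost function of the `x`-equation at a fixed time, with its dependence on `z`. -/
theorem exists_jost_x (t : ℝ) {Z : Set ℂ} (hZ : IsCompact Z)
    (hZ' : ∀ z ∈ Z, z ≠ 0 ∧ 0 ≤ (‖z‖ ^ 2 - k₀ ^ 2) * z.im) :
    ∃ u : ℝ → ℂ → Col m, (∀ x, ContinuousOn (u x) Z ∧ DifferentiableOn ℂ (u x) (interior Z)) ∧
      (∀ X, ∃ C, ∀ x ≤ X, ∀ z ∈ Z, ‖u x z‖ ≤ C) ∧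
      ∀ z ∈ Z, (∀ x, HasDerivAt (fun y => u y z)
          ((laxM k₀ Q z x t + (Complex.I * lam k₀ z) • 1) * u x z) x) ∧
        Tendsto (fun x => u x z) atBot (𝓝 (asymE z Qm).toCols₁) := by
  have hne : ∀ z ∈ Z, z ≠ 0 := fun z hz => (hZ' z hz).1
  have hlamd := differentiableOn_lam (k₀ := k₀) hne
  have hkzd := differentiableOn_kz (k₀ := k₀) hne
  have hMd : DifferentiableOn ℂ (limM k₀ Qm) Z :=
    ((hkzd.const_mul Complex.I).neg.smul_const (sigma3 m)).add_const _
  have hinv : DifferentiableOn ℂ (fun z : ℂ => Complex.I / z) Z := fun z hz =>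
    ((differentiableAt_const _).div differentiableAt_id (hne z hz)).differentiableWithinAt
  have hEd : DifferentiableOn ℂ (fun z => pad (asymE z Qm).toCols₁) Z := by
    refine differentiableOn_pad ?_
    have h1 : DifferentiableOn ℂ (fun z => asymE z Qm) Z :=
      (differentiableOn_const _).sub (hinv.smul_const _)
    rw [differentiableOn_matrix] at h1 ⊢
    exact fun i j => h1 i (Sum.inl j)
  obtain ⟨u, hu, hub, hue⟩ := exists_jost_param (A := Blk m) hZ (M := fun z => limM k₀ Qm z)
    (E := fun z => pad (asymE z Qm).toCols₁) (l := fun z => lam k₀ z)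
    (fun z hz => limM_sq hQ.unitary_minus (hne z hz))
    (fun z hz => lam_im_nonneg (hne z hz) (hZ' z hz).2)
    (fun z hz => by
      change limM k₀ Qm z * pad (asymE z Qm).toCols₁ = _
      rw [mul_pad, limM_mul_asymE_toCols₁ hQ.unitary_minus (hne z hz), pad_smul])
    hMd.continuousOn hlamd.continuousOn hEd.continuousOn
    (hMd.mono interior_subset) (hlamd.mono interior_subset) (hEd.mono interior_subset)
    (hQ.continuous_under_sub t) (hQ.integrableOn_under_sub t)
  refine ⟨fun x z => (u x z).toCols₁, fun x => ⟨?_, ?_⟩, fun X => ?_, fun z hz => ⟨fun x => ?_, ?_⟩⟩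
  · have := (hu x).1
    exact continuousOn_matrix.2 fun i j => continuousOn_matrix.1 this i (Sum.inl j)
  · have := (hu x).2
    exact differentiableOn_matrix.2 fun i j => differentiableOn_matrix.1 this i (Sum.inl j)
  · obtain ⟨C, hC⟩ := hub X
    refine ⟨((m + m : ℝ) * m) * C, fun x hx z hz => (norm_toCols₁_le _).trans ?_⟩
    exact mul_le_mul_of_nonneg_left (hC x hx z hz) (by positivity)
  · have := (hue z hz).1 x
    rw [← laxM_add] at this
    change HasDerivAt _ (_ * (u x z).toCols₁) x
    rw [← mul_toCols₁]
    exact hasDerivAt_matrix.2 fun i j => hasDerivAt_matrix.1 this i (Sum.inl j)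
  · have := (hue z hz).2
    exact tendsto_matrix.2 fun i j => tendsto_matrix.1 this i (Sum.inl j)

/-- Uniqueness needs a bounded propagator, that is `λ ≠ 0`. This is the reason for removing the
branch points from `Ω`, whereas `exists_jost_x` still applies there. -/
theorem jost_x_unique {t : ℝ} {z : ℂ} (hz : z ∈ Omega k₀) {u : ℝ → Col m}
    (hu : ∀ x, HasDerivAt u ((laxM k₀ Q z x t + (Complex.I * lam k₀ z) • 1) * u x) x)
    (hlim : Tendsto u atBot (𝓝 0)) (x : ℝ) : u x = 0 := by
  have hi : IntegrableOn (fun x => ‖under (Q x t - Qm)‖) (Set.Iic 0) := by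
    refine Integrable.mono' (hQ.integrableOn_under_sub t)
      (hQ.continuous_under_sub t).norm.aestronglyMeasurable (Eventually.of_forall fun x => ?_)
    rw [norm_norm]
    have := mul_nonneg (abs_nonneg x) (norm_nonneg (under (Q x t - Qm)))
    linarith
  have h := jost_unique (A := Blk m) (limM_sq hQ.unitary_minus hz.2.1)
    (lam_im_nonneg hz.2.1 hz.1) (lam_ne_zero hz) (D := fun x => under (Q x t - Qm))
    (u := fun x => pad (u x))
    (hQ.continuous_under_sub t) hi (fun x => by
      rw [← laxM_add, mul_pad]; exact hasDerivAt_pad (hu x))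
    (by
      have h := tendsto_pad hlim
      have h0 : pad (0 : Col m) = 0 := Matrix.fromCols_zero
      rw [h0] at h
      exact h) x
  rw [← pad_toCols₁ (u x), h]
  ext i j; rfl

/-- The limit of the time part of the Lax pair, locally uniformly in time. -/
theorem eventually_laxN_sub (z : ℂ) (T : ℝ) {ε : ℝ} (hε : 0 < ε) : ∀ᶠ x in atBot, ∀ t, |t| ≤ T →
    ‖laxN k₀ Q z x t - (4 * kz k₀ z ^ 2 - 2 * (k₀ : ℂ) ^ 2) • limM k₀ Qm z‖ ≤ ε := by
  obtain ⟨e, he, hb⟩ := hQ.exists_modulus_left T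
  -- Uniformity in `|t| ≤ T` is expressed as convergence along a product with a principal filter.
  set l : Filter (ℝ × ℝ) := atBot ×ˢ 𝓟 {t | |t| ≤ T}
  have hel : Tendsto (fun p : ℝ × ℝ => e p.1) l (𝓝 0) := he.comp tendsto_fst
  have hev : ∀ᶠ p : ℝ × ℝ in l, |p.2| ≤ T ∧ p.1 ≤ 0 := by
    rw [eventually_prod_principal_iff]
    filter_upwards [eventually_le_atBot 0] with x hx t ht using ⟨ht, hx⟩
  have h0 : Tendsto (fun p : ℝ × ℝ => under (Q p.1 p.2)) l (𝓝 (under Qm)) := by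
    refine (continuous_under.tendsto _).comp (tendsto_iff_norm_sub_tendsto_zero.2 ?_)
    exact squeeze_zero' (Eventually.of_forall fun p => norm_nonneg _)
      (hev.mono fun p hp => (hb p.2 hp.1 p.1 hp.2).1) hel
  have h1 : Tendsto (fun p : ℝ × ℝ => under (dx Q p.1 p.2)) l (𝓝 (under 0)) := by
    refine (continuous_under.tendsto _).comp (tendsto_zero_iff_norm_tendsto_zero.2 ?_)
    exact squeeze_zero' (Eventually.of_forall fun p => norm_nonneg _)
      (hev.mono fun p hp => (hb p.2 hp.1 p.1 hp.2).2.1) hel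
  have h2 : Tendsto (fun p : ℝ × ℝ => under (dx (dx Q) p.1 p.2)) l (𝓝 (under 0)) := by
    refine (continuous_under.tendsto _).comp (tendsto_zero_iff_norm_tendsto_zero.2 ?_)
    exact squeeze_zero' (Eventually.of_forall fun p => norm_nonneg _)
      (hev.mono fun p hp => (hb p.2 hp.1 p.1 hp.2).2.2) hel
  have hu0 : under (0 : Sq m) = 0 := by ext (i | i) (j | j) <;> simp [under]
  rw [hu0] at h1 h2
  have hN : Tendsto (fun p : ℝ × ℝ => laxN k₀ Q z p.1 p.2) l
      (𝓝 (laxNGen (kz k₀ z) (sigma3 m) (under Qm) 0 0)) := by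
    exact tendsto_laxNGen (A := Blk m) (kz k₀ z) (sigma3 m) h0 h1 h2
  have hlim : laxNGen (kz k₀ z) (sigma3 m) (under Qm) 0 0
      = (4 * kz k₀ z ^ 2 - 2 * (k₀ : ℂ) ^ 2) • limM k₀ Qm z := by
    simp only [laxNGen, limM, under_mul_self hQ.unitary_minus, add_zero, mul_zero, zero_mul,
      sub_zero, smul_mul_assoc, one_mul]
    module
  rw [hlim] at hN
  have := (tendsto_iff_norm_sub_tendsto_zero.1 hN).eventually (eventually_le_nhds hε)
  rwa [eventually_prod_principal_iff] at this

/-- The upper right block of the algebraic hypothesis is the matrix equation for `Q`, and the lower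
left block is minus its adjoint. -/
theorem zero_curvature (z : ℂ) (x t : ℝ) :
    under (dt Q x t) + laxM k₀ Q z x t * laxN k₀ Q z x t
      = laxNGenX (kz k₀ z) (sigma3 m) (under (Q x t)) (under (dx Q x t)) (under (dx (dx Q) x t))
          (under (dx (dx (dx Q)) x t)) + laxN k₀ Q z x t * laxM k₀ Q z x t := by
  refine zero_curvature_gen sigma3_mul_self (under_mul_sigma3 _) (under_mul_sigma3 _)
    (under_mul_sigma3 _) ?_
  have h := hQ.equation x t
  have h' := congrArg Matrix.conjTranspose h
  simp only [Matrix.conjTranspose_add, Matrix.conjTranspose_smul, Matrix.conjTranspose_mul,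
    Matrix.conjTranspose_conjTranspose, Matrix.conjTranspose_zero] at h'
  have h3 : star (3 : ℂ) = 3 := by simp
  rw [h3] at h'
  simp only [under, Matrix.fromBlocks_multiply, Matrix.fromBlocks_add, Matrix.fromBlocks_smul,
    Matrix.zero_mul, Matrix.mul_zero, add_zero, zero_add, sub_eq_add_neg, Matrix.fromBlocks_neg,
    Matrix.neg_mul, Matrix.mul_neg, neg_neg]
  rw [← Matrix.fromBlocks_zero, Matrix.fromBlocks_inj]
  refine ⟨by simp, ?_, ?_, by simp⟩
  · rw [← h]; module
  · rw [← neg_eq_zero, ← h']; simp only [Matrix.mul_assoc]; module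

/-- Solutions of the `x`-equation at `t = 0` extend to solutions of the Lax pair. -/
theorem exists_lax_extension (z : ℂ) {f : ℝ → Col m}
    (hf : ∀ x, HasDerivAt f (laxM k₀ Q z x 0 * f x) x) :
    ∃ F : ℝ → ℝ → Col m, (∀ x, F x 0 = f x) ∧
      (∀ x t, HasDerivAt (fun s => F x s) (laxN k₀ Q z x t * F x t) t) ∧
      ∀ x t, HasDerivAt (fun y => F y t) (laxM k₀ Q z x t * F x t) x := by
  have hM : Continuous fun p : ℝ × ℝ => laxM k₀ Q z p.1 p.2 :=
    continuous_const.add (continuous_under.comp hQ.continuous₀)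
  have c0 := continuous_under.comp hQ.continuous₀
  have c1 := continuous_under.comp hQ.continuous₁
  have c2 := continuous_under.comp hQ.continuous₂
  have c3 := continuous_under.comp hQ.continuous₃
  obtain ⟨F, hF0, hFt, hFx⟩ := frobenius (A := Blk m) (M := fun x t => laxM k₀ Q z x t)
    (N := fun x t => laxN k₀ Q z x t) (Mt := fun x t => under (dt Q x t))
    (Nx := fun x t => laxNGenX (kz k₀ z) (sigma3 m) (under (Q x t)) (under (dx Q x t))
      (under (dx (dx Q) x t)) (under (dx (dx (dx Q)) x t)))
    hM (continuous_laxNGen _ _ c0 c1 c2) (continuous_under.comp hQ.continuous_time)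
    (continuous_laxNGenX _ _ c0 c1 c2 c3)
    (fun x t => (hasDerivAt_under (hQ.hasDerivAt_time x t)).const_add _)
    (fun x t => hasDerivAt_laxNGen _ _ (hasDerivAt_under (hQ.hasDerivAt₀ x t))
      (hasDerivAt_under (hQ.hasDerivAt₁ x t)) (hasDerivAt_under (hQ.hasDerivAt₂ x t)))
    (fun x t => hQ.zero_curvature z x t) (f := fun x => pad (f x))
    (fun x => by rw [mul_pad]; exact hasDerivAt_pad (hf x))
  refine ⟨fun x t => (F x t).toCols₁, fun x => by
    change (F x 0).toCols₁ = _
    rw [hF0, pad_toCols₁], fun x t => ?_,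
    fun x t => ?_⟩
  · rw [← mul_toCols₁]
    exact hasDerivAt_matrix.2 fun i j => hasDerivAt_matrix.1 (hFt x t) i (Sum.inl j)
  · rw [← mul_toCols₁]
    exact hasDerivAt_matrix.2 fun i j => hasDerivAt_matrix.1 (hFx x t) i (Sum.inl j)

end IsPotential

/-- Uniform smallness is propagated by a linear equation with a small source. -/
theorem norm_le_of_linear_ode {F : Type*} [NormedAddCommGroup F] [NormedSpace ℝ F]
    {h h' : ℝ → F} {K δ T : ℝ} (hK : 0 < K) (hδ : 0 ≤ δ) (hh : ∀ t, HasDerivAt h (h' t) t)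
    (hb : ∀ t, |t| ≤ T → ‖h' t‖ ≤ K * ‖h t‖ + δ) {t : ℝ} (ht : |t| ≤ T) :
    ‖h t‖ ≤ (‖h 0‖ + δ / K) * Real.exp (K * T) := by
  have fwd : ∀ (g g' : ℝ → F), (∀ t, HasDerivAt g (g' t) t) →
      (∀ t, |t| ≤ T → ‖g' t‖ ≤ K * ‖g t‖ + δ) → ∀ t, 0 ≤ t → t ≤ T →
      ‖g t‖ ≤ (‖g 0‖ + δ / K) * Real.exp (K * T) := by
    intro g g' hg hgb t ht0 htT
    have h1 := norm_le_gronwallBound_of_norm_deriv_right_le (f := g) (f' := g') (δ := ‖g 0‖)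
      (K := K) (ε := δ) (a := 0) (b := T)
      (fun s _ => (hg s).continuousAt.continuousWithinAt)
      (fun s _ => (hg s).hasDerivWithinAt) le_rfl
      (fun s hs => hgb s (abs_le.2 ⟨by linarith [hs.1], hs.2.le⟩)) t ⟨ht0, htT⟩
    rw [gronwallBound_of_K_ne_0 hK.ne', sub_zero] at h1
    have h2 : Real.exp (K * t) ≤ Real.exp (K * T) := Real.exp_le_exp.2 (by gcongr)
    have h3 : 0 ≤ δ / K := by positivity
    have h4 := norm_nonneg (g 0)
    nlinarith [Real.exp_pos (K * t)]
  rcases le_total 0 t with h0 | h0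
  · exact fwd h h' hh hb t h0 ((le_abs_self t).trans ht)
  · have := fwd (fun t => h (-t)) (fun t => -h' (-t))
      (fun t => ((hh (-t)).scomp t (hasDerivAt_neg t)).congr_deriv (by simp))
      (fun t ht => by rw [norm_neg]; exact hb _ (by rwa [abs_neg])) (-t) (by linarith)
      ((neg_le_abs t).trans ht)
    simpa using this

theorem hasDerivAt_exp_theta_x (z : ℂ) (x t : ℝ) :
    HasDerivAt (fun y : ℝ => Complex.exp (Complex.I * theta k₀ y t z))
      (Complex.I * lam k₀ z * Complex.exp (Complex.I * theta k₀ x t z)) x := by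
  have h : HasDerivAt (fun y : ℝ => Complex.I * theta k₀ y t z) (Complex.I * lam k₀ z) x := by
    have := (((Complex.ofRealCLM.hasDerivAt (x := x)).add_const
      ((4 * kz k₀ z ^ 2 - 2 * (k₀ : ℂ) ^ 2) * (t : ℂ))).const_mul (lam k₀ z)).const_mul Complex.I
    exact this.congr_deriv (by simp)
  exact h.cexp.congr_deriv (by ring)

theorem hasDerivAt_exp_theta_t (z : ℂ) (x t : ℝ) :
    HasDerivAt (fun s : ℝ => Complex.exp (Complex.I * theta k₀ x s z))
      (Complex.I * (lam k₀ z * (4 * kz k₀ z ^ 2 - 2 * (k₀ : ℂ) ^ 2)) *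
        Complex.exp (Complex.I * theta k₀ x t z)) t := by
  have h : HasDerivAt (fun s : ℝ => Complex.I * theta k₀ x s z)
      (Complex.I * (lam k₀ z * (4 * kz k₀ z ^ 2 - 2 * (k₀ : ℂ) ^ 2))) t := by
    have := ((((Complex.ofRealCLM.hasDerivAt (x := t)).const_mul
      (4 * kz k₀ z ^ 2 - 2 * (k₀ : ℂ) ^ 2)).const_add (x : ℂ)).const_mul (lam k₀ z)).const_mul
      Complex.I
    exact this.congr_deriv (by simp)
  exact h.cexp.congr_deriv (by ring)

/-- Multiplication by an exponential factor shifts a linear equation. -/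
theorem hasDerivAt_smul_linear {c : ℝ → ℂ} {f : ℝ → Col m} {M : Blk m} {a : ℂ} {x : ℝ}
    (hc : HasDerivAt c (a * c x) x) (hf : HasDerivAt f (M * f x) x) :
    HasDerivAt (fun y => c y • f y) ((M + a • 1) * (c x • f x)) x := by
  refine (hc.smul hf).congr_deriv ?_
  rw [Matrix.add_mul, Matrix.mul_smul, Matrix.smul_mul, Matrix.one_mul, smul_smul]

theorem isLaxSolution_iff {z : ℂ} {f : ℝ → ℝ → Col m} : IsLaxSolution k₀ Q z f ↔
    (∀ x t, HasDerivAt (fun y => f y t) (laxM k₀ Q z x t * f x t) x) ∧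
    ∀ x t, HasDerivAt (fun s => f x s) (laxN k₀ Q z x t * f x t) t :=
  ⟨fun h => ⟨fun x t => hasDerivAt_matrix.2 fun i j => (h x t i j).1,
    fun x t => hasDerivAt_matrix.2 fun i j => (h x t i j).2⟩,
   fun h x t i j => ⟨hasDerivAt_matrix.1 (h.1 x t) i j, hasDerivAt_matrix.1 (h.2 x t) i j⟩⟩

namespace IsPotential

variable (hQ : IsPotential k₀ Q Qm Qp)
include hQ

/-- The solution at `t = 0` is extended by compatibility; it remains to see that the normalization
at `-∞` persists. The difference `H = e^{iθ} F - E` solves a linear equation in `t` whose source is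
`(N - N₋) E`, because `E` is annihilated by `N₋ + a`. This source is small uniformly for bounded
`t`, and Grönwall's inequality concludes. -/
theorem exists_isJostFst {z : ℂ} (hz : z ∈ Omega k₀) :
    ∃ f, IsJostFst k₀ Q Qm atBot z f := by
  obtain ⟨u, -, -, hue⟩ := hQ.exists_jost_x 0 (Z := {z}) isCompact_singleton
    (fun w hw => by rw [Set.mem_singleton_iff.1 hw]; exact ⟨hz.2.1, hz.1⟩)
  obtain ⟨hux, hul⟩ := hue z rfl
  have hexp : ∀ x, HasDerivAt (fun y : ℝ => (Complex.exp (Complex.I * theta k₀ y 0 z))⁻¹)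
      (-(Complex.I * lam k₀ z) * (Complex.exp (Complex.I * theta k₀ x 0 z))⁻¹) x := fun x => by
    refine ((hasDerivAt_exp_theta_x (k₀ := k₀) z x 0).inv (Complex.exp_ne_zero _)).congr_deriv ?_
    have := Complex.exp_ne_zero (Complex.I * theta k₀ x 0 z)
    field_simp
  obtain ⟨F, hF0, hFt, hFx⟩ := hQ.exists_lax_extension z
    (f := fun x => (Complex.exp (Complex.I * theta k₀ x 0 z))⁻¹ • u x z) (fun x => by
      refine (hasDerivAt_smul_linear (hexp x) (hux x)).congr_deriv ?_
      congr 1; module)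
  refine ⟨F, isLaxSolution_iff.2 ⟨hFx, hFt⟩, fun t => ?_⟩
  set E := (asymE z Qm).toCols₁ with hEdef
  set c : ℂ := 4 * kz k₀ z ^ 2 - 2 * (k₀ : ℂ) ^ 2 with hc
  set Nm : Blk m := c • limM k₀ Qm z with hNm
  set a : ℂ := Complex.I * (lam k₀ z * c) with ha
  have hE : (Nm + a • 1) * E = 0 := by
    rw [Matrix.add_mul, hNm, Matrix.smul_mul, limM_mul_asymE_toCols₁ hQ.unitary_minus hz.2.1,
      Matrix.smul_mul, Matrix.one_mul, ← hEdef, ha]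
    module
  set H : ℝ → ℝ → Col m := fun x t => Complex.exp (Complex.I * theta k₀ x t z) • F x t - E with hH
  have hHd : ∀ x t, HasDerivAt (fun s => H x s)
      ((laxN k₀ Q z x t + a • 1) * H x t + (laxN k₀ Q z x t - Nm) * E) t := fun x t => by
    refine ((hasDerivAt_smul_linear (hasDerivAt_exp_theta_t (k₀ := k₀) z x t)
      (hFt x t)).sub_const E).congr_deriv ?_
    have h1 : (laxN k₀ Q z x t - Nm) * E = (laxN k₀ Q z x t + a • 1) * E := by
      have : laxN k₀ Q z x t - Nm = (laxN k₀ Q z x t + a • 1) - (Nm + a • 1) := by abel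
      rw [this, Matrix.sub_mul, hE, sub_zero]
    rw [h1, ← Matrix.mul_add]
    simp only [hH, sub_add_cancel]
    rfl
  have hH0 : Tendsto (fun x => ‖H x 0‖) atBot (𝓝 0) := by
    have h1 : (fun x => H x 0) = fun x => u x z - E := by
      funext x
      simp only [hH]
      rw [hF0, smul_inv_smul₀ (Complex.exp_ne_zero _)]
    have h2 := (hul.sub_const E).norm
    rw [sub_self, norm_zero] at h2
    have h3 : (fun x => ‖H x 0‖) = fun x => ‖u x z - E‖ := by
      funext x; exact congrArg norm (congrFun h1 x)
    rw [h3]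
    exact h2
  -- The summand `1` absorbs the deviation of `N` from its limit, which is at most `δ ≤ 1` below.
  set K : ℝ := ‖Nm + a • (1 : Blk m)‖ + 1 with hK
  have hK0 : 0 < K := by positivity
  have hlim : Tendsto (fun x => H x t) atBot (𝓝 0) := by
    refine tendsto_zero_iff_norm_tendsto_zero.2 ?_
    rw [Metric.tendsto_nhds]
    intro ε hε
    have hpos : 0 < Real.exp (K * |t|) := Real.exp_pos _
    -- `δ` is chosen so that the Grönwall bound with initial value `δ` and source `δ ‖E‖` stays
    -- below `ε`.
    obtain ⟨δ, hδ, hδ1⟩ : ∃ δ : ℝ, 0 < δ ∧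
        (δ + δ * ‖E‖ / K) * Real.exp (K * |t|) < ε ∧ δ ≤ 1 := by
      set L := (1 + ‖E‖ / K) * Real.exp (K * |t|) with hL
      have hL0 : 0 < L := by positivity
      refine ⟨min 1 (ε / (2 * L)), by positivity, ?_, min_le_left _ _⟩
      have h1 : min 1 (ε / (2 * L)) * L ≤ ε / (2 * L) * L := by gcongr; exact min_le_right _ _
      have h2 : ε / (2 * L) * L = ε / 2 := by field_simp
      have h3 : (min 1 (ε / (2 * L)) + min 1 (ε / (2 * L)) * ‖E‖ / K) * Real.exp (K * |t|)
        = min 1 (ε / (2 * L)) * L := by rw [hL]; ring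
      rw [h3]; linarith
    filter_upwards [hQ.eventually_laxN_sub z |t| hδ, hH0.eventually (eventually_le_nhds hδ)]
      with x hx hx0
    have hb := norm_le_of_linear_ode (h := fun s => H x s) (K := K) (δ := δ * ‖E‖) (T := |t|)
      hK0 (by positivity) (hHd x) (fun s hs => by
        refine (norm_add_le _ _).trans (add_le_add ((Matrix.linfty_opNorm_mul _ _).trans ?_)
          ((Matrix.linfty_opNorm_mul _ _).trans ?_))
        · refine mul_le_mul_of_nonneg_right ?_ (norm_nonneg _)
          have : laxN k₀ Q z x s + a • 1 = (Nm + a • 1) + (laxN k₀ Q z x s - Nm) := by abel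
          rw [this]
          exact (norm_add_le _ _).trans (add_le_add le_rfl ((hx s hs).trans hδ1.2))
        · exact mul_le_mul_of_nonneg_right (hx s hs) (norm_nonneg _)) le_rfl
    rw [dist_zero_right, norm_norm]
    refine (hb.trans ?_).trans_lt hδ1.1
    gcongr
  have h5 := hlim.add_const E
  simp only [hH, sub_add_cancel, zero_add] at h5
  exact h5

omit hQ in
/-- The `x`-equation of the normalized Jost function. -/
theorem hasDerivAt_exp_smul {z : ℂ} {f : ℝ → ℝ → Col m} (hf : IsLaxSolution k₀ Q z f) (x t : ℝ) :
    HasDerivAt (fun y => Complex.exp (Complex.I * theta k₀ y t z) • f y t)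
      ((laxM k₀ Q z x t + (Complex.I * lam k₀ z) • 1) *
        (Complex.exp (Complex.I * theta k₀ x t z) • f x t)) x :=
  hasDerivAt_smul_linear (hasDerivAt_exp_theta_x z x t) ((isLaxSolution_iff.1 hf).1 x t)

theorem isJostFst_unique {z : ℂ} (hz : z ∈ Omega k₀) {f g : ℝ → ℝ → Col m}
    (hf : IsJostFst k₀ Q Qm atBot z f) (hg : IsJostFst k₀ Q Qm atBot z g) : f = g := by
  funext x t
  have h := hQ.jost_x_unique (t := t) hz (u := fun x =>
    Complex.exp (Complex.I * theta k₀ x t z) • f x t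
      - Complex.exp (Complex.I * theta k₀ x t z) • g x t) (fun x => by
      rw [Matrix.mul_sub]
      exact (hasDerivAt_exp_smul hf.1 x t).sub (hasDerivAt_exp_smul hg.1 x t))
    (by simpa using (hf.2 t).sub (hg.2 t)) x
  have h' : Complex.exp (Complex.I * theta k₀ x t z) • (f x t - g x t) = 0 := by
    rw [smul_sub]; exact h
  exact sub_eq_zero.1 ((smul_eq_zero.1 h').resolve_left (Complex.exp_ne_zero _))

theorem phi_spec {z : ℂ} (hz : z ∈ Omega k₀) : IsJostFst k₀ Q Qm atBot z (phi k₀ Q Qm z) :=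
  Classical.epsilon_spec (hQ.exists_isJostFst hz)

theorem phi_eq {z : ℂ} (hz : z ∈ Omega k₀) {f : ℝ → ℝ → Col m}
    (hf : IsJostFst k₀ Q Qm atBot z f) : phi k₀ Q Qm z = f :=
  hQ.isJostFst_unique hz (hQ.phi_spec hz) hf

theorem WHat_hasDerivAt {z : ℂ} (hz : z ∈ Omega k₀) (x t : ℝ) :
    HasDerivAt (fun y => WHat k₀ Q Qm y t z)
      ((laxM k₀ Q z x t + (Complex.I * lam k₀ z) • 1) * WHat k₀ Q Qm x t z) x :=
  hasDerivAt_exp_smul (hQ.phi_spec hz).1 x t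

/-- At a fixed time the `x`-equation and the limit already determine `Ŵ`. It can therefore be
compared with the Volterra solution built directly at that time, which carries the information on
`z`. -/
theorem WHat_eq {t : ℝ} {z : ℂ} (hz : z ∈ Omega k₀) {u : ℝ → Col m}
    (hu : ∀ x, HasDerivAt u ((laxM k₀ Q z x t + (Complex.I * lam k₀ z) • 1) * u x) x)
    (hlim : Tendsto u atBot (𝓝 (asymE z Qm).toCols₁)) (x : ℝ) : WHat k₀ Q Qm x t z = u x := by
  have h := hQ.jost_x_unique (t := t) hz (u := fun x => WHat k₀ Q Qm x t z - u x) (fun x => by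
      rw [Matrix.mul_sub]
      exact (hQ.WHat_hasDerivAt hz x t).sub (hu x))
    (by
      have := ((hQ.phi_spec hz).2 t).sub hlim
      rw [sub_self] at this
      exact this) x
  exact sub_eq_zero.1 h

/-- Regularity in `z` of the normalized Jost function. -/
theorem WHat_on_compact (x t : ℝ) {Z : Set ℂ} (hZ : IsCompact Z)
    (hZ' : ∀ z ∈ Z, z ≠ 0 ∧ 0 ≤ (‖z‖ ^ 2 - k₀ ^ 2) * z.im) :
    ∃ v : ℂ → Col m, ContinuousOn v Z ∧ DifferentiableOn ℂ v (interior Z) ∧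
      (∃ C, ∀ z ∈ Z, ‖v z‖ ≤ C) ∧ ∀ z ∈ Z ∩ Omega k₀, WHat k₀ Q Qm x t z = v z := by
  obtain ⟨u, huc, hub, hue⟩ := hQ.exists_jost_x t hZ hZ'
  obtain ⟨C, hC⟩ := hub x
  exact ⟨u x, (huc x).1, (huc x).2, ⟨C, fun z hz => hC x le_rfl z hz⟩, fun z hz =>
    hQ.WHat_eq hz.2 (hue z hz.1).1 (hue z hz.1).2 x⟩

theorem WHat_differentiableOn (hk : 0 < k₀) (x t : ℝ) :
    DifferentiableOn ℂ (WHat k₀ Q Qm x t) (Dplus k₀) := by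
  intro z hz
  obtain ⟨r, hr, hsub⟩ := Metric.nhds_basis_closedBall.mem_iff.1 (isOpen_Dplus.mem_nhds hz)
  obtain ⟨v, -, hv, -, hvW⟩ := hQ.WHat_on_compact x t (isCompact_closedBall z r) (fun w hw =>
    ⟨(Dplus_subset_Omega hk (hsub hw)).2.1, (Dplus_subset_Omega hk (hsub hw)).1⟩)
  have hz' : Metric.closedBall z r ∈ 𝓝 z := Metric.closedBall_mem_nhds z hr
  refine DifferentiableAt.differentiableWithinAt ?_
  refine (hv.differentiableAt (interior_mem_nhds.2 hz')).congr_of_eventuallyEq ?_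
  filter_upwards [hz'] with w hw using hvW w ⟨hw, Dplus_subset_Omega hk (hsub hw)⟩

theorem WHat_continuousOn (x t : ℝ) : ContinuousOn (WHat k₀ Q Qm x t) (Omega k₀) := by
  intro z hz
  have hz0 : 0 < ‖z‖ / 2 := by have := norm_pos_iff.2 hz.2.1; positivity
  set Z := Metric.closedBall z (‖z‖ / 2) ∩ {z : ℂ | 0 ≤ (‖z‖ ^ 2 - k₀ ^ 2) * z.im} with hZ
  have hne : ∀ w ∈ Z, w ≠ 0 := by
    rintro w hw rfl
    have := hw.1
    rw [Metric.mem_closedBall, dist_eq_norm, zero_sub, norm_neg] at this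
    linarith
  obtain ⟨v, hv, -, -, hvW⟩ := hQ.WHat_on_compact x t (Z := Z)
    ((isCompact_closedBall z _).inter_right isClosed_lamNonneg) (fun w hw => ⟨hne w hw, hw.2⟩)
  have hm : Z ∈ 𝓝[Omega k₀] z := by
    refine inter_mem (mem_nhdsWithin_of_mem_nhds (Metric.closedBall_mem_nhds z hz0)) ?_
    exact mem_of_superset self_mem_nhdsWithin fun w hw => hw.1
  have hzZ : z ∈ Z := ⟨Metric.mem_closedBall_self hz0.le, hz.1⟩
  have h1 : ContinuousWithinAt v (Omega k₀) z := (hv z hzZ).mono_of_mem_nhdsWithin hm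
  refine h1.congr_of_eventuallyEq ?_ (hvW z ⟨hzZ, hz⟩)
  filter_upwards [hm, self_mem_nhdsWithin] with w hw hw' using hvW w ⟨hw, hw'⟩

/-- The compact set may contain the branch points: the Volterra solution is bounded up to them, and
on `Ω` it agrees with `Ŵ`. -/
theorem WHat_bounded (x t : ℝ) {K : Set ℂ} (hK : IsCompact K) (h0 : 0 ∉ K) :
    ∃ C, ∀ z ∈ K ∩ Omega k₀, ‖WHat k₀ Q Qm x t z‖ ≤ C := by
  obtain ⟨v, -, -, ⟨C, hC⟩, hvW⟩ := hQ.WHat_on_compact x t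
    (Z := K ∩ {z : ℂ | 0 ≤ (‖z‖ ^ 2 - k₀ ^ 2) * z.im}) (hK.inter_right isClosed_lamNonneg)
    (fun w hw => ⟨fun h => h0 (h ▸ hw.1), hw.2⟩)
  refine ⟨C, fun z hz => ?_⟩
  rw [hvW z ⟨⟨hz.1, hz.2.1⟩, hz.2⟩]
  exact hC z ⟨hz.1, hz.2.1⟩

end IsPotential

end Jost

end MMKdV

namespace MMKdV

/-! ### Entrywise complex conjugation -/

section Conj

variable {n p q : Type*}

/-- Entrywise complex conjugate. -/
def cj (A : Matrix n p ℂ) : Matrix n p ℂ := A.map (starRingEnd ℂ)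

theorem cj_apply (A : Matrix n p ℂ) (i : n) (j : p) : cj A i j = starRingEnd ℂ (A i j) := rfl

theorem cj_cj (A : Matrix n p ℂ) : cj (cj A) = A := by ext i j; simp [cj]

theorem cj_neg (A : Matrix n p ℂ) : cj (-A) = -cj A := by ext i j; simp [cj]

theorem cj_add (A B : Matrix n p ℂ) : cj (A + B) = cj A + cj B := by ext i j; simp [cj]

theorem cj_sub (A B : Matrix n p ℂ) : cj (A - B) = cj A - cj B := by ext i j; simp [cj]

theorem cj_zero : cj (0 : Matrix n p ℂ) = 0 := by ext i j; simp [cj]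

theorem cj_smul (c : ℂ) (A : Matrix n p ℂ) : cj (c • A) = starRingEnd ℂ c • cj A := by
  ext i j; simp [cj]

theorem cj_sum {ι : Type*} (s : Finset ι) (f : ι → Matrix n p ℂ) :
    cj (∑ i ∈ s, f i) = ∑ i ∈ s, cj (f i) := by
  ext i j; simp [cj, Matrix.sum_apply]

theorem cj_mul [Fintype p] (A : Matrix n p ℂ) (B : Matrix p q ℂ) : cj (A * B) = cj A * cj B :=
  Matrix.map_mul

theorem cj_one [DecidableEq n] : cj (1 : Matrix n n ℂ) = 1 :=
  Matrix.map_one _ (map_zero _) (map_one _)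

theorem cj_transpose (A : Matrix n p ℂ) : (cj A)ᵀ = Aᴴ := rfl

theorem transpose_cj (A : Matrix n p ℂ) : cj Aᵀ = Aᴴ := rfl

theorem cj_conjTranspose (A : Matrix n p ℂ) : (cj A)ᴴ = Aᵀ := by
  ext i j; simp [cj]

theorem conjTranspose_cj (A : Matrix n p ℂ) : cj Aᴴ = Aᵀ := by
  ext i j; simp [cj]

theorem det_cj [Fintype n] [DecidableEq n] (A : Matrix n n ℂ) :
    (cj A).det = starRingEnd ℂ A.det :=
  ((starRingEnd ℂ).map_det A).symm

theorem cj_inv [Fintype n] [DecidableEq n] (A : Matrix n n ℂ) : cj A⁻¹ = (cj A)⁻¹ := by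
  have h : ∀ B : Matrix n n ℂ, cj B = (Bᴴ)ᵀ := fun B => by ext i j; simp [cj]
  rw [h, h, Matrix.conjTranspose_nonsing_inv, Matrix.transpose_nonsing_inv]

theorem norm_cj [Fintype n] [Fintype p] (A : Matrix n p ℂ) : ‖cj A‖ = ‖A‖ := by
  simp [Matrix.linfty_opNorm_def, cj]

theorem cj_of_symm {A : Matrix n n ℂ} (h : Aᵀ = A) : cj A = Aᴴ := by
  rw [← transpose_cj, h]

theorem continuous_cj : Continuous (cj : Matrix n p ℂ → Matrix n p ℂ) :=
  continuous_id.matrix_map Complex.continuous_conj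

theorem hasDerivAt_cj [Fintype n] [Fintype p] {f : ℝ → Matrix n p ℂ} {f' : Matrix n p ℂ} {x : ℝ}
    (h : HasDerivAt f f' x) : HasDerivAt (fun y => cj (f y)) (cj f') x :=
  hasDerivAt_matrix.2 fun i j => (hasDerivAt_matrix.1 h i j).star

theorem hasDerivAt_mul_matrix [Fintype n] [Fintype p] [Fintype q] {f : ℝ → Matrix n p ℂ}
    {f' : Matrix n p ℂ} {g : ℝ → Matrix p q ℂ} {g' : Matrix p q ℂ} {x : ℝ}
    (hf : HasDerivAt f f' x) (hg : HasDerivAt g g' x) :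
    HasDerivAt (fun y => f y * g y) (f' * g x + f x * g') x := by
  rw [hasDerivAt_matrix] at hf hg ⊢
  intro i j
  have h : HasDerivAt (fun y => ∑ k, f y i k * g y k j)
      (∑ k, (f' i k * g x k j + f x i k * g' k j)) x :=
    HasDerivAt.fun_sum fun k _ => (hf i k).mul (hg k j)
  simp only [Matrix.mul_apply, Matrix.add_apply, ← Finset.sum_add_distrib]
  exact h

theorem tendsto_mul_matrix [Fintype p] {α : Type*} {l : Filter α} {f : α → Matrix n p ℂ}
    {g : α → Matrix p q ℂ} {F : Matrix n p ℂ} {G : Matrix p q ℂ}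
    (hf : Tendsto f l (𝓝 F)) (hg : Tendsto g l (𝓝 G)) :
    Tendsto (fun y => f y * g y) l (𝓝 (F * G)) :=
by
  refine tendsto_matrix.2 fun i j => ?_
  simp only [Matrix.mul_apply]
  exact tendsto_finsetSum _ fun k _ => (tendsto_matrix.1 hf i k).mul (tendsto_matrix.1 hg k j)

end Conj

/-! ### The symplectic form and the symmetries of the Lax pair -/

section SymJ

variable {m : ℕ}

/-- The matrix with blocks `0, 1, -1, 0`. -/
def symJ (m : ℕ) : Blk m := Matrix.fromBlocks 0 1 (-1) 0

theorem symJ_mul_self : symJ m * symJ m = -1 := by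
  simp only [symJ, Matrix.fromBlocks_multiply, ← Matrix.fromBlocks_one, Matrix.fromBlocks_neg]
  congr 1 <;> simp

theorem symJ_mul_symJ_mul (f : Col m) : symJ m * (symJ m * f) = -f := by
  rw [← Matrix.mul_assoc, symJ_mul_self, Matrix.neg_mul, Matrix.one_mul]

theorem symJ_transpose : (symJ m)ᵀ = -symJ m := by
  simp [symJ, Matrix.fromBlocks_transpose, Matrix.fromBlocks_neg]

theorem cj_symJ : cj (symJ m) = symJ m := by
  ext (i | i) (j | j) <;> simp [cj, symJ, Matrix.one_apply, apply_ite]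

theorem symJ_mul_fromRows (a b : Sq m) :
    symJ m * Matrix.fromRows a b = Matrix.fromRows b (-a) := by
  simp [symJ, Matrix.fromBlocks_mul_fromRows]

theorem symJ_mul_eq (f : Col m) : symJ m * f = Matrix.fromRows f.toRows₂ (-f.toRows₁) := by
  rw [← symJ_mul_fromRows, Matrix.fromRows_toRows]

theorem smul_fromRows (c : ℂ) (a b : Sq m) :
    c • Matrix.fromRows a b = Matrix.fromRows (c • a) (c • b) := by
  ext (i | i) j <;> rfl

theorem asymE_toCols₁ (z : ℂ) (A : Sq m) :
    (asymE z A).toCols₁ = Matrix.fromRows 1 (-(Complex.I / z) • Aᴴ) := by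
  ext (i | i) j <;>
  simp [asymE, sigma3, under, Matrix.fromBlocks_multiply, Matrix.toCols₁, Matrix.one_apply]

theorem asymE_toCols₂ (z : ℂ) (A : Sq m) :
    (asymE z A).toCols₂ = Matrix.fromRows (-(Complex.I / z) • A) 1 := by
  ext (i | i) j <;>
  simp [asymE, sigma3, under, Matrix.fromBlocks_multiply, Matrix.toCols₂, Matrix.one_apply]

theorem sigma3_transpose : (sigma3 m)ᵀ = sigma3 m := by
  simp [sigma3, Matrix.fromBlocks_transpose]

theorem symJ_mul_sigma3 : symJ m * sigma3 m = -(sigma3 m * symJ m) := by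
  simp [symJ, sigma3, Matrix.fromBlocks_multiply, Matrix.fromBlocks_neg]

theorem symJ_mul_under {A : Sq m} (h : Aᵀ = A) : symJ m * under A = -((under A)ᵀ * symJ m) := by
  have h1 : (Aᴴ)ᵀ = Aᴴ := by rw [← cj_of_symm h, cj_transpose, cj_of_symm h]
  simp [symJ, under, Matrix.fromBlocks_multiply, Matrix.fromBlocks_neg,
    Matrix.fromBlocks_transpose, h, h1]

theorem under_transpose_mul_sigma3 (A : Sq m) :
    (under A)ᵀ * sigma3 m = -(sigma3 m * (under A)ᵀ) := by
  have := congrArg Matrix.transpose (under_mul_sigma3 A)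
  rw [Matrix.transpose_mul, Matrix.transpose_neg, Matrix.transpose_mul, sigma3_transpose] at this
  rw [this, neg_neg]

/-- Antisymmetry of the time part for an anti-automorphism acting by `σ ↦ σ`, `U ↦ U'`. -/
theorem laxNGen_transpose {k : ℂ} {σ U Ux Uxx : Blk m} (hσ : σᵀ = σ) (h0 : Uᵀ * σ = -(σ * Uᵀ))
    (h1 : Uxᵀ * σ = -(σ * Uxᵀ)) :
    (laxNGen k σ U Ux Uxx)ᵀ = laxNGen k σ Uᵀ (-Uxᵀ) Uxxᵀ := by
  have a0 : ∀ X : Blk m, Uᵀ * (σ * X) = -(σ * (Uᵀ * X)) := fun X => by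
    rw [← mul_assoc, h0, neg_mul, mul_assoc]
  simp only [laxNGen, Matrix.transpose_add, Matrix.transpose_sub, Matrix.transpose_smul,
    Matrix.transpose_mul, hσ, add_mul, mul_assoc, h0, h1, mul_neg, neg_mul, a0, neg_neg]
  module

/-- The matrices satisfying `J N = -Nᵀ J` form the symplectic Lie algebra. Membership of the Lax
pair in it is where the symmetry `Qᵀ = Q` enters. -/
theorem laxNGen_symJ {k : ℂ} {σ U Ux Uxx J : Blk m} (hσ : σᵀ = σ) (hJ : J * σ = -(σ * J))
    (h0 : J * U = -(Uᵀ * J)) (h1 : J * Ux = -(Uxᵀ * J)) (h2 : J * Uxx = -(Uxxᵀ * J))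
    (h3 : Uᵀ * σ = -(σ * Uᵀ)) (h4 : Uxᵀ * σ = -(σ * Uxᵀ)) :
    J * laxNGen k σ U Ux Uxx = -((laxNGen k σ U Ux Uxx)ᵀ * J) := by
  have a0 : ∀ X : Blk m, J * (U * X) = -(Uᵀ * (J * X)) := fun X => by
    rw [← mul_assoc, h0, neg_mul, mul_assoc]
  have a1 : ∀ X : Blk m, J * (Ux * X) = -(Uxᵀ * (J * X)) := fun X => by
    rw [← mul_assoc, h1, neg_mul, mul_assoc]
  have a3 : ∀ X : Blk m, Uᵀ * (σ * X) = -(σ * (Uᵀ * X)) := fun X => by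
    rw [← mul_assoc, h3, neg_mul, mul_assoc]
  have a4 : ∀ X : Blk m, Uxᵀ * (σ * X) = -(σ * (Uxᵀ * X)) := fun X => by
    rw [← mul_assoc, h4, neg_mul, mul_assoc]
  rw [laxNGen_transpose hσ h3 h4]
  simp only [laxNGen, mul_add, add_mul, mul_sub, sub_mul, mul_smul_comm, smul_mul_assoc, mul_assoc,
    a0, a1, h0, h1, h2, hJ, a3, a4, h3, h4, mul_neg, neg_mul, neg_neg]
  module

theorem laxNGen_conjTranspose {k : ℂ} {σ U Ux Uxx : Blk m} (hσ : σᴴ = σ) (hU : Uᴴ = -U)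
    (hUx : Uxᴴ = -Ux) (hUxx : Uxxᴴ = -Uxx) (h0 : U * σ = -(σ * U)) (h1 : Ux * σ = -(σ * Ux)) :
    (laxNGen (starRingEnd ℂ k) σ U Ux Uxx)ᴴ = -laxNGen k σ U Ux Uxx := by
  have a0 : ∀ X : Blk m, U * (σ * X) = -(σ * (U * X)) := fun X => by
    rw [← mul_assoc, h0, neg_mul, mul_assoc]
  simp only [laxNGen, Matrix.conjTranspose_add, Matrix.conjTranspose_sub,
    Matrix.conjTranspose_smul, Matrix.conjTranspose_mul, Matrix.conjTranspose_neg, hσ, hU, hUx, hUxx, add_mul,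
    mul_neg, neg_mul, neg_neg, mul_assoc, h0, h1, a0, ← starRingEnd_apply, map_neg, map_mul, map_pow,
    Complex.conj_conj, Complex.conj_I, map_ofNat]
  module

end SymJ

section Lax

variable {m : ℕ} {k₀ : ℝ} {Q : ℝ → ℝ → Sq m} {Qm Qp : Sq m}

theorem dx_symm (h : ∀ x t, (Q x t)ᵀ = Q x t) (x t : ℝ) : (dx Q x t)ᵀ = dx Q x t := by
  ext i j
  simp only [Matrix.transpose_apply, dx, Matrix.of_apply]
  congr 1
  funext y
  rw [← Matrix.transpose_apply (Q y t), h]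

theorem symJ_mul_laxM (h : ∀ x t, (Q x t)ᵀ = Q x t) (z : ℂ) (x t : ℝ) :
    symJ m * laxM k₀ Q z x t = -((laxM k₀ Q z x t)ᵀ * symJ m) := by
  rw [laxM, Matrix.transpose_add, Matrix.transpose_smul, sigma3_transpose, mul_add, add_mul,
    mul_smul_comm, smul_mul_assoc, symJ_mul_sigma3, symJ_mul_under (h x t)]
  module

theorem symJ_mul_laxN (h : ∀ x t, (Q x t)ᵀ = Q x t) (z : ℂ) (x t : ℝ) :
    symJ m * laxN k₀ Q z x t = -((laxN k₀ Q z x t)ᵀ * symJ m) :=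
  laxNGen_symJ sigma3_transpose symJ_mul_sigma3 (symJ_mul_under (h x t))
    (symJ_mul_under (dx_symm h x t)) (symJ_mul_under (dx_symm (dx_symm h) x t))
    (under_transpose_mul_sigma3 _) (under_transpose_mul_sigma3 _)

theorem laxM_conjTranspose (z : ℂ) (x t : ℝ) :
    (laxM k₀ Q (starRingEnd ℂ z) x t)ᴴ = -laxM k₀ Q z x t := by
  rw [laxM, laxM, kz_conj, Matrix.conjTranspose_add, Matrix.conjTranspose_smul,
    sigma3_conjTranspose, under_conjTranspose, star_neg, star_mul', ← starRingEnd_apply,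
    ← starRingEnd_apply, Complex.conj_conj, Complex.conj_I]
  module

theorem laxN_conjTranspose (z : ℂ) (x t : ℝ) :
    (laxN k₀ Q (starRingEnd ℂ z) x t)ᴴ = -laxN k₀ Q z x t := by
  have h := laxNGen_conjTranspose (k := kz k₀ z) (sigma3_conjTranspose (m := m))
    (under_conjTranspose (Q x t)) (under_conjTranspose (dx Q x t))
    (under_conjTranspose (dx (dx Q) x t)) (under_mul_sigma3 _) (under_mul_sigma3 _)
  rw [← kz_conj] at h
  exact h

/-- If `J M = -Mᵀ J` then `J Mᵀ = -M J`. -/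
theorem symJ_mul_transpose {M : Blk m} (h : symJ m * M = -(Mᵀ * symJ m)) :
    symJ m * Mᵀ = -(M * symJ m) := by
  have h1 : symJ m * (symJ m * M) * symJ m = -(symJ m * Mᵀ * symJ m * symJ m) := by
    rw [h]; noncomm_ring
  rw [← mul_assoc, symJ_mul_self, mul_assoc (symJ m * Mᵀ), symJ_mul_self] at h1
  rw [mul_neg, mul_one, neg_neg, neg_mul, one_mul, neg_mul] at h1
  exact h1.symm

/-- The symplectic symmetry combined with skew-adjointness at the conjugate parameter makes `J ∘
conj` an intertwiner between the parameters `z` and `z*`. -/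
theorem symJ_mul_cj {M M' : Blk m} (h : symJ m * M = -(Mᵀ * symJ m)) (h' : M'ᴴ = -M) :
    symJ m * cj M' = M * symJ m := by
  have : cj M' = -Mᵀ := by
    rw [← Matrix.transpose_neg, ← h', ← cj_transpose, Matrix.transpose_transpose]
  rw [this, mul_neg, symJ_mul_transpose h, neg_neg]

/-- `J` times the complex conjugate. -/
def kap (f : Col m) : Col m := symJ m * cj f

theorem kap_kap (f : Col m) : kap (kap f) = -f := by
  rw [kap, kap, cj_mul, cj_symJ, cj_cj, symJ_mul_symJ_mul]

theorem kap_neg (f : Col m) : kap (-f) = -kap f := by rw [kap, kap, cj_neg, Matrix.mul_neg]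

theorem kap_smul (c : ℂ) (f : Col m) : kap (c • f) = starRingEnd ℂ c • kap f := by
  rw [kap, kap, cj_smul, Matrix.mul_smul]

theorem kap_mul (f : Col m) (C : Sq m) : kap (f * C) = kap f * cj C := by
  rw [kap, kap, cj_mul, Matrix.mul_assoc]

theorem kap_eq (f : Col m) : kap f = Matrix.fromRows (cj f.toRows₂) (-cj f.toRows₁) := by
  rw [kap, symJ_mul_eq]; rfl

theorem continuous_kap : Continuous (kap : Col m → Col m) :=
  continuous_const.matrix_mul continuous_cj

theorem hasDerivAt_kap {f : ℝ → Col m} {f' : Col m} {x : ℝ} (h : HasDerivAt f f' x) :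
    HasDerivAt (fun y => kap (f y)) (kap f') x := by
  refine (hasDerivAt_mul_matrix (hasDerivAt_const x (symJ m)) (hasDerivAt_cj h)).congr_deriv ?_
  rw [Matrix.zero_mul, zero_add]; rfl

/-- This antilinear symmetry halves the work: it exchanges the two kinds of Jost columns, so the
barred functions in `D⁻` are images of the unbarred ones in `D⁺`. -/
theorem IsLaxSolution.kap {z : ℂ} {f : ℝ → ℝ → Col m} (hf : IsLaxSolution k₀ Q z f)
    (h : ∀ x t, (Q x t)ᵀ = Q x t) :
    IsLaxSolution k₀ Q (starRingEnd ℂ z) fun x t => kap (f x t) := by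
  have h1 := isLaxSolution_iff.1 hf
  refine isLaxSolution_iff.2 ⟨fun x t => (hasDerivAt_kap (h1.1 x t)).congr_deriv ?_,
    fun x t => (hasDerivAt_kap (h1.2 x t)).congr_deriv ?_⟩
  · have := symJ_mul_cj (symJ_mul_laxM (k₀ := k₀) h (starRingEnd ℂ z) x t)
      (M' := laxM k₀ Q z x t) (by
        have := laxM_conjTranspose (k₀ := k₀) (Q := Q) (starRingEnd ℂ z) x t
        rwa [Complex.conj_conj] at this)
    rw [MMKdV.kap, MMKdV.kap, cj_mul, ← Matrix.mul_assoc, this, Matrix.mul_assoc]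
  · have := symJ_mul_cj (symJ_mul_laxN (k₀ := k₀) h (starRingEnd ℂ z) x t)
      (M' := laxN k₀ Q z x t) (by
        have := laxN_conjTranspose (k₀ := k₀) (Q := Q) (starRingEnd ℂ z) x t
        rwa [Complex.conj_conj] at this)
    rw [MMKdV.kap, MMKdV.kap, cj_mul, ← Matrix.mul_assoc, this, Matrix.mul_assoc]

theorem IsLaxSolution.mul_const {z : ℂ} {f : ℝ → ℝ → Col m} (hf : IsLaxSolution k₀ Q z f)
    (C : Sq m) : IsLaxSolution k₀ Q z fun x t => f x t * C := by
  have h1 := isLaxSolution_iff.1 hf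
  refine isLaxSolution_iff.2 ⟨fun x t => ?_, fun x t => ?_⟩
  · refine (hasDerivAt_mul_matrix (h1.1 x t) (hasDerivAt_const x C)).congr_deriv ?_
    rw [Matrix.mul_zero, add_zero, Matrix.mul_assoc]
  · refine (hasDerivAt_mul_matrix (h1.2 x t) (hasDerivAt_const t C)).congr_deriv ?_
    rw [Matrix.mul_zero, add_zero, Matrix.mul_assoc]

theorem IsLaxSolution.neg {z : ℂ} {f : ℝ → ℝ → Col m} (hf : IsLaxSolution k₀ Q z f) :
    IsLaxSolution k₀ Q z fun x t => -f x t := by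
  have := hf.mul_const (-1)
  simpa only [Matrix.mul_neg, Matrix.mul_one] using this

/-- The Lax pair depends on `z` only through `k`, which the sheet exchange leaves invariant. -/
theorem IsLaxSolution.flip {z : ℂ} {f : ℝ → ℝ → Col m} (hk : 0 < k₀)
    (hf : IsLaxSolution k₀ Q z f) : IsLaxSolution k₀ Q (flip k₀ z) f := by
  have h1 : ∀ x t, laxM k₀ Q (MMKdV.flip k₀ z) x t = laxM k₀ Q z x t := fun x t => by
    rw [laxM, laxM, kz_flip hk]
  have h2 : ∀ x t, laxN k₀ Q (MMKdV.flip k₀ z) x t = laxN k₀ Q z x t := fun x t => by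
    rw [laxN, laxN, kz_flip hk]
  intro x t i j
  rw [h1, h2]
  exact hf x t i j

/-- The bilinear pairing of solutions of the Lax pair. -/
def wr (g f : Col m) : Sq m := gᵀ * (symJ m * f)

/-- In each variable the derivative of `gᵀ J f` is `gᵀ (Mᵀ J + J M) f`, which vanishes for
symplectic coefficients. The point `(x, t)` is moved first to `(0, t)` and then to the origin. -/
theorem wr_const {z : ℂ} {f g : ℝ → ℝ → Col m} (h : ∀ x t, (Q x t)ᵀ = Q x t)
    (hg : IsLaxSolution k₀ Q z g) (hf : IsLaxSolution k₀ Q z f) (x t : ℝ) :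
    wr (g x t) (f x t) = wr (g 0 0) (f 0 0) := by
  have key : ∀ {g f : ℝ → Col m} {M : ℝ → Blk m}, (∀ x, symJ m * M x = -((M x)ᵀ * symJ m)) →
      (∀ x, HasDerivAt g (M x * g x) x) → (∀ x, HasDerivAt f (M x * f x) x) → ∀ x y,
      wr (g x) (f x) = wr (g y) (f y) := by
    intro g f M hM hg hf
    have hT : ∀ x, HasDerivAt (fun y => (g y)ᵀ) (M x * g x)ᵀ x := fun x =>
      hasDerivAt_matrix.2 fun i j => hasDerivAt_matrix.1 (hg x) j i
    have hd : ∀ x, HasDerivAt (fun y => wr (g y) (f y)) 0 x := fun x => by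
      refine (hasDerivAt_mul_matrix (hT x) (hasDerivAt_mul_matrix
        (hasDerivAt_const x (symJ m)) (hf x))).congr_deriv ?_
      rw [Matrix.zero_mul, zero_add, ← Matrix.mul_assoc (symJ m), hM, Matrix.transpose_mul,
        Matrix.neg_mul, Matrix.mul_neg, Matrix.mul_assoc, Matrix.mul_assoc, add_neg_cancel]
    intro x y
    ext i j
    exact is_const_of_deriv_eq_zero (f := fun x => wr (g x) (f x) i j)
      (fun x => (hasDerivAt_matrix.1 (hd x) i j).differentiableAt)
      (fun x => (hasDerivAt_matrix.1 (hd x) i j).deriv) x y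
  have hf' := isLaxSolution_iff.1 hf
  have hg' := isLaxSolution_iff.1 hg
  rw [key (fun x => symJ_mul_laxM (k₀ := k₀) h z x t) (fun x => hg'.1 x t) (fun x => hf'.1 x t)
    x 0]
  exact key (fun t => symJ_mul_laxN (k₀ := k₀) h z 0 t) (fun t => hg'.2 0 t)
    (fun t => hf'.2 0 t) t 0

end Lax

end MMKdV

namespace MMKdV

/-! ### Reflection of the potential -/

section Refl

variable {m : ℕ} {k₀ : ℝ} {Q : ℝ → ℝ → Sq m} {Qm Qp : Sq m}

/-- The reflected potential `-conj Q(-x, -t)`. -/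
def refl (Q : ℝ → ℝ → Sq m) (x t : ℝ) : Sq m := -cj (Q (-x) (-t))

theorem refl_refl (Q : ℝ → ℝ → Sq m) : refl (refl Q) = Q := by
  funext x t
  simp [refl, cj_neg, cj_cj]

theorem dx_neg (Q : ℝ → ℝ → Sq m) : dx (fun x t => -Q x t) = fun x t => -dx Q x t := by
  funext x t
  ext i j
  simp [dx]

theorem dx_cj_neg (Q : ℝ → ℝ → Sq m) :
    dx (fun x t => cj (Q (-x) (-t))) = fun x t => -cj (dx Q (-x) (-t)) := by
  funext x t
  ext i j
  have h1 : deriv (fun y => Q (-y) (-t) i j) x = -deriv (fun y => Q y (-t) i j) (-x) :=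
    deriv_comp_neg (fun y => Q y (-t) i j) x
  have h2 : deriv (fun y => star (Q (-y) (-t) i j)) x
      = star (deriv (fun y => Q (-y) (-t) i j) x) := deriv.star
  simp only [dx, Matrix.of_apply, Matrix.neg_apply, cj_apply]
  change deriv (fun y => star (Q (-y) (-t) i j)) x = _
  rw [h2, h1, star_neg]
  rfl

theorem dx_refl (Q : ℝ → ℝ → Sq m) : dx (refl Q) = fun x t => cj (dx Q (-x) (-t)) := by
  have : refl Q = fun x t => -(fun x t => cj (Q (-x) (-t))) x t := rfl
  rw [this, dx_neg, dx_cj_neg]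
  simp only [neg_neg]

theorem dx_dx_refl (Q : ℝ → ℝ → Sq m) :
    dx (dx (refl Q)) = fun x t => -cj (dx (dx Q) (-x) (-t)) := by
  rw [dx_refl, dx_cj_neg]

theorem dx_dx_dx_refl (Q : ℝ → ℝ → Sq m) :
    dx (dx (dx (refl Q))) = fun x t => cj (dx (dx (dx Q)) (-x) (-t)) := by
  rw [dx_dx_refl, dx_neg, dx_cj_neg]
  simp only [neg_neg]

theorem dt_refl (Q : ℝ → ℝ → Sq m) : dt (refl Q) = fun x t => cj (dt Q (-x) (-t)) := by
  funext x t
  ext i j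
  have h1 : deriv (fun s => Q (-x) (-s) i j) t = -deriv (fun s => Q (-x) s i j) (-t) :=
    deriv_comp_neg (fun s => Q (-x) s i j) t
  have h2 : deriv (fun s => star (Q (-x) (-s) i j)) t
      = star (deriv (fun s => Q (-x) (-s) i j) t) := deriv.star
  have h3 : deriv (fun s => -star (Q (-x) (-s) i j)) t
      = -deriv (fun s => star (Q (-x) (-s) i j)) t := deriv.fun_neg
  simp only [dt, Matrix.of_apply, cj_apply]
  change deriv (fun s => -star (Q (-x) (-s) i j)) t = _
  rw [h3, h2, h1, star_neg, neg_neg]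
  rfl

theorem cj_unitary {A : Sq m}
    (h : A * Aᴴ = ((k₀ : ℂ) ^ 2) • 1 ∧ Aᴴ * A = ((k₀ : ℂ) ^ 2) • 1) :
    -cj A * (-cj A)ᴴ = ((k₀ : ℂ) ^ 2) • 1 ∧ (-cj A)ᴴ * -cj A = ((k₀ : ℂ) ^ 2) • 1 := by
  have h3 : starRingEnd ℂ ((k₀ : ℂ) ^ 2) = (k₀ : ℂ) ^ 2 := by simp
  have h1 := congrArg cj h.1
  have h2 := congrArg cj h.2
  rw [cj_mul, cj_smul, cj_one, h3] at h1 h2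
  rw [Matrix.conjTranspose_neg, neg_mul_neg, neg_mul_neg, cj_conjTranspose, ← conjTranspose_cj]
  exact ⟨h1, h2⟩

/-- Reversing both variables preserves the equation and exchanges the two ends of the line, so every
result at `-∞` yields one at `+∞`. The conjugation and the sign are there to make the reflected Lax
matrices transposes of the original ones (`laxM_refl`, `laxN_refl`). -/
theorem IsPotential.refl (hQ : IsPotential k₀ Q Qm Qp) :
    IsPotential k₀ (refl Q) (-cj Qp) (-cj Qm) where
  smooth i j := by
    have h := (hQ.smooth i j).comp (contDiff_neg (𝕜 := ℝ) (F := ℝ × ℝ) (n := 3))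
    exact (Complex.conjCLE.contDiff.comp h).neg
  equation x t := by
    have h := congrArg cj (hQ.equation (-x) (-t))
    have h3 : starRingEnd ℂ (3 : ℂ) = 3 := map_ofNat _ _
    simp only [cj_add, cj_smul, cj_mul, cj_zero, h3] at h
    rw [dt_refl, dx_dx_dx_refl, dx_refl]
    rw [← h]
    simp only [MMKdV.refl, Matrix.conjTranspose_neg, mul_neg, neg_mul, neg_neg,
      cj_conjTranspose, conjTranspose_cj]
  symm x t := by
    rw [MMKdV.refl, Matrix.transpose_neg, cj_transpose, cj_of_symm (hQ.symm _ _)]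
  unitary_minus := cj_unitary hQ.unitary_plus
  unitary_plus := cj_unitary hQ.unitary_minus
  tendsto_minus t := by
    have h := (hQ.tendsto_plus (-t)).comp tendsto_neg_atBot_atTop
    exact ((continuous_cj.tendsto _).comp h).neg
  tendsto_plus t := by
    have h := (hQ.tendsto_minus (-t)).comp tendsto_neg_atTop_atBot
    exact ((continuous_cj.tendsto _).comp h).neg
  decay T := by
    obtain ⟨g, hg, hb⟩ := hQ.decay T
    refine ⟨fun x => g (-x), hg.comp_neg, fun t ht x i j => ?_⟩
    have h := hb (-t) (by rwa [abs_neg]) (-x) i j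
    rw [dx_dx_dx_refl, dx_dx_refl, dx_refl]
    have e : ∀ A B : Sq m, ‖(-cj A) i j - (-cj B) i j‖ = ‖A i j - B i j‖ := fun A B => by
      rw [Matrix.neg_apply, Matrix.neg_apply, cj_apply, cj_apply, neg_sub_neg, ← map_sub,
        RCLike.norm_conj, norm_sub_rev]
    simp only [MMKdV.refl, e]
    simp only [Matrix.neg_apply, cj_apply, norm_neg, RCLike.norm_conj]
    rw [abs_neg] at h
    exact ⟨fun hx => h.2 (by linarith), fun hx => h.1 (by linarith)⟩

theorem under_neg_cj (A : Sq m) : under (-cj A) = (under A)ᵀ := by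
  ext (i | i) (j | j) <;> simp [under, cj]

theorem under_cj (A : Sq m) : under (cj A) = -(under A)ᵀ := by
  rw [← under_neg_cj, under_neg, neg_neg]

theorem laxM_refl (z : ℂ) (x t : ℝ) :
    laxM k₀ (refl Q) z x t = (laxM k₀ Q z (-x) (-t))ᵀ := by
  rw [laxM, laxM, refl, under_neg_cj, Matrix.transpose_add, Matrix.transpose_smul, sigma3_transpose]

theorem laxN_refl (z : ℂ) (x t : ℝ) :
    laxN k₀ (refl Q) z x t = (laxN k₀ Q z (-x) (-t))ᵀ := by
  have h := laxNGen_transpose (k := kz k₀ z) (sigma3_transpose (m := m))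
    (under_transpose_mul_sigma3 (Q (-x) (-t))) (under_transpose_mul_sigma3 (dx Q (-x) (-t)))
    (Uxx := under (dx (dx Q) (-x) (-t)))
  refine Eq.trans ?_ h.symm
  rw [laxN, dx_dx_refl, dx_refl]
  simp only [refl, under_neg_cj, under_cj]
  rfl

/-- The sign produced by the chain rule cancels the one in `J M = -Mᵀ J`. -/
theorem IsLaxSolution.refl {z : ℂ} {f : ℝ → ℝ → Col m} (hf : IsLaxSolution k₀ Q z f)
    (h : ∀ x t, (Q x t)ᵀ = Q x t) :
    IsLaxSolution k₀ (refl Q) z fun x t => symJ m * f (-x) (-t) := by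
  have h1 := isLaxSolution_iff.1 hf
  refine isLaxSolution_iff.2 ⟨fun x t => ?_, fun x t => ?_⟩
  · have h2 := (h1.1 (-x) (-t)).scomp x (hasDerivAt_neg x)
    refine (hasDerivAt_mul_matrix (hasDerivAt_const x (symJ m)) h2).congr_deriv ?_
    rw [Matrix.zero_mul, zero_add, neg_one_smul, Matrix.mul_neg, ← Matrix.mul_assoc,
      symJ_mul_laxM h, laxM_refl, Matrix.neg_mul, neg_neg, Matrix.mul_assoc]
  · have h2 := (h1.2 (-x) (-t)).scomp t (hasDerivAt_neg t)
    refine (hasDerivAt_mul_matrix (hasDerivAt_const t (symJ m)) h2).congr_deriv ?_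
    rw [Matrix.zero_mul, zero_add, neg_one_smul, Matrix.mul_neg, ← Matrix.mul_assoc,
      symJ_mul_laxN h, laxN_refl, Matrix.neg_mul, neg_neg, Matrix.mul_assoc]

end Refl

/-! ### The four Jost functions -/

section Jost

variable {m : ℕ} {k₀ : ℝ} {Q : ℝ → ℝ → Sq m} {Qm Qp : Sq m} {z : ℂ}

theorem theta_neg (x t : ℝ) (z : ℂ) : theta k₀ (-x) (-t) z = -theta k₀ x t z := by
  simp only [theta]; push_cast; ring

theorem exp_theta_conj (x t : ℝ) (z : ℂ) : Complex.exp (Complex.I * theta k₀ x t (starRingEnd ℂ z))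
    = starRingEnd ℂ (Complex.exp (-(Complex.I * theta k₀ x t z))) := by
  rw [← Complex.exp_conj, theta_conj, map_neg, map_mul, Complex.conj_I]
  ring_nf

theorem exp_neg_theta_conj (x t : ℝ) (z : ℂ) :
    Complex.exp (-(Complex.I * theta k₀ x t (starRingEnd ℂ z)))
    = starRingEnd ℂ (Complex.exp (Complex.I * theta k₀ x t z)) := by
  rw [← Complex.exp_conj, theta_conj, map_mul, Complex.conj_I]
  ring_nf

theorem IsJostFst.kap {l : Filter ℝ} {A : Sq m} (h : ∀ x t, (Q x t)ᵀ = Q x t) (hA : Aᵀ = A)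
    {f : ℝ → ℝ → Col m} (hf : IsJostFst k₀ Q A l z f) :
    IsJostSnd k₀ Q A l (starRingEnd ℂ z) fun x t => -kap (f x t) := by
  refine ⟨(hf.1.kap h).neg, fun t => ?_⟩
  have h1 := ((continuous_kap.tendsto _).comp (hf.2 t)).neg
  have h2 : -MMKdV.kap (asymE z A).toCols₁ = (asymE (starRingEnd ℂ z) A).toCols₂ := by
    have h4 : cj Aᴴ = A := by rw [conjTranspose_cj, hA]
    have h3 : -(-1 : Sq m) = 1 := neg_neg 1
    rw [asymE_toCols₁, asymE_toCols₂, kap_eq, Matrix.toRows₁_fromRows, Matrix.toRows₂_fromRows,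
      cj_smul, cj_one, h4, Matrix.fromRows_neg, h3, map_neg, map_div₀, Complex.conj_I, neg_smul,
      neg_smul, neg_div, neg_smul, neg_neg]
  rw [h2] at h1
  refine h1.congr fun x => ?_
  simp only [Function.comp_apply]
  rw [kap_smul, exp_neg_theta_conj, smul_neg]

theorem IsJostSnd.kap {l : Filter ℝ} {A : Sq m} (h : ∀ x t, (Q x t)ᵀ = Q x t) (hA : Aᵀ = A)
    {f : ℝ → ℝ → Col m} (hf : IsJostSnd k₀ Q A l z f) :
    IsJostFst k₀ Q A l (starRingEnd ℂ z) fun x t => kap (f x t) := by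
  refine ⟨hf.1.kap h, fun t => ?_⟩
  have h1 := (continuous_kap.tendsto _).comp (hf.2 t)
  have h2 : MMKdV.kap (asymE z A).toCols₂ = (asymE (starRingEnd ℂ z) A).toCols₁ := by
    rw [asymE_toCols₁, asymE_toCols₂, kap_eq, Matrix.toRows₁_fromRows, Matrix.toRows₂_fromRows,
      cj_smul, cj_one, cj_of_symm hA, map_neg, map_div₀, Complex.conj_I]
    congr 1
    module
  rw [h2] at h1
  refine h1.congr fun x => ?_
  simp only [Function.comp_apply]
  rw [kap_smul, exp_theta_conj]

theorem IsJostFst.refl {A : Sq m} (h : ∀ x t, (Q x t)ᵀ = Q x t) (hA : Aᵀ = A)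
    {f : ℝ → ℝ → Col m} (hf : IsJostFst k₀ Q A atBot z f) :
    IsJostSnd k₀ (refl Q) (-cj A) atTop z fun x t => -(symJ m * f (-x) (-t)) := by
  refine ⟨(hf.1.refl h).neg, fun t => ?_⟩
  have h1 := (tendsto_mul_matrix (tendsto_const_nhds (x := symJ m))
    ((hf.2 (-t)).comp tendsto_neg_atTop_atBot)).neg
  have h2 : -(symJ m * (asymE z A).toCols₁) = (asymE z (-cj A)).toCols₂ := by
    rw [asymE_toCols₁, asymE_toCols₂, symJ_mul_fromRows, cj_of_symm hA, Matrix.fromRows_neg,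
      neg_neg]
    congr 1
    module
  rw [h2] at h1
  refine h1.congr fun x => ?_
  simp only [Function.comp_apply]
  rw [theta_neg, mul_neg, Matrix.mul_smul, smul_neg]

theorem IsJostSnd.refl {A : Sq m} (h : ∀ x t, (Q x t)ᵀ = Q x t) (hA : Aᵀ = A)
    {f : ℝ → ℝ → Col m} (hf : IsJostSnd k₀ Q A atTop z f) :
    IsJostFst k₀ (refl Q) (-cj A) atBot z fun x t => symJ m * f (-x) (-t) := by
  refine ⟨hf.1.refl h, fun t => ?_⟩
  have h1 := tendsto_mul_matrix (tendsto_const_nhds (x := symJ m))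
    ((hf.2 (-t)).comp tendsto_neg_atBot_atTop)
  have h2 : symJ m * (asymE z A).toCols₂ = (asymE z (-cj A)).toCols₁ := by
    rw [asymE_toCols₁, asymE_toCols₂, symJ_mul_fromRows, Matrix.conjTranspose_neg,
      cj_conjTranspose, hA]
    congr 1
    module
  rw [h2] at h1
  refine h1.congr fun x => ?_
  simp only [Function.comp_apply]
  rw [theta_neg, mul_neg, neg_neg, Matrix.mul_smul]

namespace IsPotential

variable (hQ : IsPotential k₀ Q Qm Qp)
include hQ

theorem symm_minus : Qmᵀ = Qm := by
  refine tendsto_nhds_unique (f := fun x => (Q x 0)ᵀ) (l := atBot) ?_ ?_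
  · exact (continuous_id.matrix_transpose.tendsto Qm).comp (hQ.tendsto_minus 0)
  · simpa only [hQ.symm] using hQ.tendsto_minus 0

theorem symm_plus : Qpᵀ = Qp := by
  refine tendsto_nhds_unique (f := fun x => (Q x 0)ᵀ) (l := atTop) ?_ ?_
  · exact (continuous_id.matrix_transpose.tendsto Qp).comp (hQ.tendsto_plus 0)
  · simpa only [hQ.symm] using hQ.tendsto_plus 0

theorem refl_symm_minus : (-cj Qp)ᵀ = -cj Qp := hQ.refl.symm_minus

/-- Up to `-J`, `ψ` is the function `φ` of the reflected potential. No separate analysis at `+∞` is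
needed, and holomorphy, bounds and asymptotics of `V̂` are inherited from `Ŵ`. -/
theorem isJostSnd_refl (hz : z ∈ Omega k₀) : IsJostSnd k₀ Q Qp atTop z
    fun x t => -(symJ m * phi k₀ (MMKdV.refl Q) (-cj Qp) z (-x) (-t)) := by
  have h := (hQ.refl.phi_spec hz).refl hQ.refl.symm hQ.refl_symm_minus
  rwa [refl_refl, cj_neg, cj_cj, neg_neg] at h

theorem isJostSnd_unique (hz : z ∈ Omega k₀) {f g : ℝ → ℝ → Col m}
    (hf : IsJostSnd k₀ Q Qp atTop z f) (hg : IsJostSnd k₀ Q Qp atTop z g) : f = g := by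
  have h := hQ.refl.isJostFst_unique hz (hf.refl hQ.symm hQ.symm_plus)
    (hg.refl hQ.symm hQ.symm_plus)
  funext x t
  have h1 : symJ m * f (- -x) (- -t) = symJ m * g (- -x) (- -t) := congrFun (congrFun h (-x)) (-t)
  have h2 := congrArg (fun X : Col m => symJ m * X) h1
  simp only [symJ_mul_symJ_mul, neg_neg] at h2
  exact neg_injective h2

theorem psi_spec (hz : z ∈ Omega k₀) : IsJostSnd k₀ Q Qp atTop z (psi k₀ Q Qp z) :=
  Classical.epsilon_spec ⟨_, hQ.isJostSnd_refl hz⟩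

theorem psi_eq (hz : z ∈ Omega k₀) {f : ℝ → ℝ → Col m} (hf : IsJostSnd k₀ Q Qp atTop z f) :
    psi k₀ Q Qp z = f :=
  hQ.isJostSnd_unique hz (hQ.psi_spec hz) hf

theorem VHat_eq_refl (hz : z ∈ Omega k₀) (x t : ℝ) : VHat k₀ Q Qp x t z
    = -(symJ m * WHat k₀ (MMKdV.refl Q) (-cj Qp) (-x) (-t) z) := by
  rw [VHat, hQ.psi_eq hz (hQ.isJostSnd_refl hz), WHat, theta_neg, mul_neg, Matrix.mul_smul,
    smul_neg]

theorem phiBar_spec (hz : starRingEnd ℂ z ∈ Omega k₀) :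
    IsJostSnd k₀ Q Qm atBot z (phiBar k₀ Q Qm z) := by
  have h := (hQ.phi_spec hz).kap hQ.symm hQ.symm_minus
  rw [Complex.conj_conj] at h
  exact Classical.epsilon_spec ⟨_, h⟩

theorem psiBar_spec (hz : starRingEnd ℂ z ∈ Omega k₀) :
    IsJostFst k₀ Q Qp atTop z (psiBar k₀ Q Qp z) := by
  have h := (hQ.psi_spec hz).kap hQ.symm hQ.symm_plus
  rw [Complex.conj_conj] at h
  exact Classical.epsilon_spec ⟨_, h⟩

theorem phiBar_eq (hz : starRingEnd ℂ z ∈ Omega k₀) (x t : ℝ) :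
    phiBar k₀ Q Qm z x t = -kap (phi k₀ Q Qm (starRingEnd ℂ z) x t) := by
  have h := (hQ.phiBar_spec hz).kap hQ.symm hQ.symm_minus
  rw [hQ.phi_eq hz h, kap_kap, neg_neg]

theorem psiBar_eq (hz : starRingEnd ℂ z ∈ Omega k₀) (x t : ℝ) :
    psiBar k₀ Q Qp z x t = kap (psi k₀ Q Qp (starRingEnd ℂ z) x t) := by
  have h := (hQ.psiBar_spec hz).kap hQ.symm hQ.symm_plus
  rw [hQ.psi_eq hz h, kap_neg, kap_kap, neg_neg]

theorem WBar_eq (hz : starRingEnd ℂ z ∈ Omega k₀) (x t : ℝ) :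
    WBar k₀ Q Qm x t z = -kap (WHat k₀ Q Qm x t (starRingEnd ℂ z)) := by
  rw [WBar, WHat, hQ.phiBar_eq hz, kap_smul, exp_theta_conj, Complex.conj_conj, smul_neg]

theorem VBar_eq (hz : starRingEnd ℂ z ∈ Omega k₀) (x t : ℝ) :
    VBar k₀ Q Qp x t z = kap (VHat k₀ Q Qp x t (starRingEnd ℂ z)) := by
  rw [VBar, VHat, hQ.psiBar_eq hz, kap_smul, exp_neg_theta_conj, Complex.conj_conj]

/-- At `flip z` the sign of `θ` is reversed, so `φ` becomes a second Jost column there; the factor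
`(iz/k₀²) Qm` adjusts the normalization, by unitarity of `Qm`. Applying `kap` then returns from `D⁻`
to `D⁺`. -/
theorem phi_flip (hk : 0 < k₀) (hz : z ∈ Omega k₀) (x t : ℝ) :
    phi k₀ Q Qm (starRingEnd ℂ (flip k₀ z)) x t
      = kap (phi k₀ Q Qm z x t * ((Complex.I * z / (k₀ : ℂ) ^ 2) • Qm)) := by
  have hz0 := hz.2.1
  have hk0 : (k₀ : ℂ) ≠ 0 := by exact_mod_cast hk.ne'
  set C : Sq m := (Complex.I * z / (k₀ : ℂ) ^ 2) • Qm with hC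
  have hs := hQ.phi_spec hz
  have h1 : IsJostSnd k₀ Q Qm atBot (flip k₀ z) fun x t => phi k₀ Q Qm z x t * C := by
    refine ⟨(hs.1.flip hk).mul_const C, fun t => ?_⟩
    have h2 := tendsto_mul_matrix (hs.2 t) (tendsto_const_nhds (x := C))
    have h3 : (asymE z Qm).toCols₁ * C = (asymE (flip k₀ z) Qm).toCols₂ := by
      rw [asymE_toCols₁, asymE_toCols₂, Matrix.fromRows_mul, hC, one_mul, smul_mul_smul_comm,
        hQ.unitary_minus.2, smul_smul, flip]
      congr 1
      · congr 1
        field_simp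
      · have : -(Complex.I / z) * (Complex.I * z / (k₀ : ℂ) ^ 2) * (k₀ : ℂ) ^ 2 = 1 := by
          field_simp; rw [Complex.I_sq, neg_neg]
        rw [this, one_smul]
    rw [h3] at h2
    refine h2.congr fun x => ?_
    rw [theta_flip hk, mul_neg, neg_neg, Matrix.smul_mul]
  rw [hQ.phi_eq (conj_flip_mem_Omega hk hz) (h1.kap hQ.symm hQ.symm_minus)]

theorem psi_flip (hk : 0 < k₀) (hz : z ∈ Omega k₀) (x t : ℝ) :
    psi k₀ Q Qp (starRingEnd ℂ (flip k₀ z)) x t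
      = -kap (psi k₀ Q Qp z x t * ((Complex.I * z / (k₀ : ℂ) ^ 2) • Qpᴴ)) := by
  have hz0 := hz.2.1
  have hk0 : (k₀ : ℂ) ≠ 0 := by exact_mod_cast hk.ne'
  set C : Sq m := (Complex.I * z / (k₀ : ℂ) ^ 2) • Qpᴴ with hC
  have hs := hQ.psi_spec hz
  have h1 : IsJostFst k₀ Q Qp atTop (flip k₀ z) fun x t => psi k₀ Q Qp z x t * C := by
    refine ⟨(hs.1.flip hk).mul_const C, fun t => ?_⟩
    have h2 := tendsto_mul_matrix (hs.2 t) (tendsto_const_nhds (x := C))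
    have h3 : (asymE z Qp).toCols₂ * C = (asymE (flip k₀ z) Qp).toCols₁ := by
      rw [asymE_toCols₁, asymE_toCols₂, Matrix.fromRows_mul, hC, one_mul, smul_mul_smul_comm,
        hQ.unitary_plus.1, smul_smul, flip]
      congr 1
      · have : -(Complex.I / z) * (Complex.I * z / (k₀ : ℂ) ^ 2) * (k₀ : ℂ) ^ 2 = 1 := by
          field_simp; rw [Complex.I_sq, neg_neg]
        rw [this, one_smul]
      · congr 1
        field_simp
    rw [h3] at h2
    refine h2.congr fun x => ?_
    rw [theta_flip hk, mul_neg, Matrix.smul_mul]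
  rw [hQ.psi_eq (conj_flip_mem_Omega hk hz) (h1.kap hQ.symm hQ.symm_plus)]

theorem WHat_flip (hk : 0 < k₀) (hz : z ∈ Omega k₀) (x t : ℝ) :
    WHat k₀ Q Qm x t (starRingEnd ℂ (flip k₀ z))
      = kap (WHat k₀ Q Qm x t z * ((Complex.I * z / (k₀ : ℂ) ^ 2) • Qm)) := by
  rw [WHat, hQ.phi_flip hk hz, exp_theta_conj, theta_flip hk, mul_neg, neg_neg, ← kap_smul, WHat,
    Matrix.smul_mul]

theorem VHat_flip (hk : 0 < k₀) (hz : z ∈ Omega k₀) (x t : ℝ) :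
    VHat k₀ Q Qp x t (starRingEnd ℂ (flip k₀ z))
      = -kap (VHat k₀ Q Qp x t z * ((Complex.I * z / (k₀ : ℂ) ^ 2) • Qpᴴ)) := by
  rw [VHat, hQ.psi_flip hk hz, exp_neg_theta_conj, theta_flip hk, mul_neg, smul_neg, ← kap_smul,
    VHat, Matrix.smul_mul]

theorem VHat_differentiableOn (hk : 0 < k₀) (x t : ℝ) :
    DifferentiableOn ℂ (VHat k₀ Q Qp x t) (Dplus k₀) := by
  have h := hQ.refl.WHat_differentiableOn hk (-x) (-t)
  have h1 : DifferentiableOn ℂ (fun z => -(symJ m * WHat k₀ (MMKdV.refl Q) (-cj Qp) (-x) (-t) z))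
      (Dplus k₀) := by
    refine DifferentiableOn.neg (differentiableOn_matrix.2 fun i j => ?_)
    simp only [Matrix.mul_apply]
    exact DifferentiableOn.fun_sum fun k _ => (differentiableOn_matrix.1 h k j).const_mul _
  exact h1.congr fun z hz => hQ.VHat_eq_refl (Dplus_subset_Omega hk hz) x t

theorem VHat_continuousOn (x t : ℝ) : ContinuousOn (VHat k₀ Q Qp x t) (Omega k₀) := by
  have h := hQ.refl.WHat_continuousOn (-x) (-t)
  have h1 : ContinuousOn (fun z => -(symJ m * WHat k₀ (MMKdV.refl Q) (-cj Qp) (-x) (-t) z))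
      (Omega k₀) := fun z hz => (tendsto_mul_matrix tendsto_const_nhds (h z hz)).neg
  exact h1.congr fun z hz => hQ.VHat_eq_refl hz x t

theorem VHat_bounded (x t : ℝ) {K : Set ℂ} (hK : IsCompact K) (h0 : 0 ∉ K) :
    ∃ C, ∀ z ∈ K ∩ Omega k₀, ‖VHat k₀ Q Qp x t z‖ ≤ C := by
  obtain ⟨C, hC⟩ := hQ.refl.WHat_bounded (-x) (-t) hK h0
  refine ⟨‖symJ m‖ * C, fun z hz => ?_⟩
  rw [hQ.VHat_eq_refl hz.2, norm_neg]
  exact (Matrix.linfty_opNorm_mul _ _).trans (mul_le_mul_of_nonneg_left (hC z hz) (norm_nonneg _))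

end IsPotential

end Jost

end MMKdV

namespace MMKdV

/-! ### The pairing -/

section Pairing

variable {m : ℕ}

theorem wr_transpose (g f : Col m) : (wr g f)ᵀ = -wr f g := by
  rw [wr, wr, Matrix.transpose_mul, Matrix.transpose_mul, Matrix.transpose_transpose,
    symJ_transpose, Matrix.mul_neg, Matrix.neg_mul, Matrix.mul_assoc]

theorem wr_mul_right (g f : Col m) (C : Sq m) : wr g (f * C) = wr g f * C := by
  simp only [wr, Matrix.mul_assoc]

theorem wr_mul_left (g f : Col m) (C : Sq m) : wr (g * C) f = Cᵀ * wr g f := by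
  simp only [wr, Matrix.transpose_mul, Matrix.mul_assoc]

theorem wr_add_right (g f h : Col m) : wr g (f + h) = wr g f + wr g h := by
  simp only [wr, Matrix.mul_add]

theorem wr_smul_right (g f : Col m) (c : ℂ) : wr g (c • f) = c • wr g f := by
  simp only [wr, Matrix.mul_smul]

theorem wr_smul_left (g f : Col m) (c : ℂ) : wr (c • g) f = c • wr g f := by
  simp only [wr, Matrix.transpose_smul, Matrix.smul_mul]

theorem wr_neg_left (g f : Col m) : wr (-g) f = -wr g f := by
  simp only [wr, Matrix.transpose_neg, Matrix.neg_mul]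

theorem wr_neg_right (g f : Col m) : wr g (-f) = -wr g f := by
  simp only [wr, Matrix.mul_neg]

theorem wr_symJ (g f : Col m) : wr (symJ m * g) (symJ m * f) = wr g f := by
  rw [wr, wr, symJ_mul_symJ_mul, Matrix.transpose_mul, symJ_transpose]
  simp only [Matrix.mul_neg, Matrix.neg_mul, neg_neg, Matrix.mul_assoc]

theorem wr_kap (g f : Col m) : wr (kap g) (kap f) = cj (wr g f) := by
  rw [kap, kap, wr_symJ, wr, wr, cj_mul, cj_mul, cj_symJ]; rfl

/-- Converts the sesquilinear expression `ψ̄(z*)† φ(z)` defining `a` into the bilinear pairing of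
`ψ(z)` and `φ(z)`, in which holomorphy in `z` is visible. -/
theorem kap_conjTranspose_mul (f g : Col m) : (kap f)ᴴ * g = -wr f g := by
  have h : (symJ m)ᴴ = -symJ m := by
    rw [← symJ_transpose, ← cj_transpose, cj_symJ]
  rw [kap, Matrix.conjTranspose_mul, cj_conjTranspose, h, wr]
  simp only [Matrix.mul_neg, Matrix.neg_mul, Matrix.mul_assoc]

theorem wr_fromRows (a b c d : Sq m) :
    wr (Matrix.fromRows a b) (Matrix.fromRows c d) = aᵀ * d - bᵀ * c := by
  rw [wr, symJ_mul_fromRows, Matrix.transpose_fromRows, Matrix.fromCols_mul_fromRows,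
    Matrix.mul_neg, sub_eq_add_neg]

theorem wr_eq (g f : Col m) : wr g f = g.toRows₁ᵀ * f.toRows₂ - g.toRows₂ᵀ * f.toRows₁ := by
  conv_lhs => rw [← Matrix.fromRows_toRows g, ← Matrix.fromRows_toRows f]
  exact wr_fromRows _ _ _ _

theorem tendsto_wr {α : Type*} {l : Filter α} {f g : α → Col m} {F G : Col m}
    (hg : Tendsto g l (𝓝 G)) (hf : Tendsto f l (𝓝 F)) :
    Tendsto (fun y => wr (g y) (f y)) l (𝓝 (wr G F)) :=
  tendsto_mul_matrix ((continuous_id.matrix_transpose.tendsto G).comp hg)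
    (tendsto_mul_matrix tendsto_const_nhds hf)

theorem differentiableOn_wr {s : Set ℂ} {f g : ℂ → Col m} (hg : DifferentiableOn ℂ g s)
    (hf : DifferentiableOn ℂ f s) : DifferentiableOn ℂ (fun z => wr (g z) (f z)) s := by
  rw [differentiableOn_matrix] at hf hg ⊢
  intro i j
  simp only [wr, Matrix.mul_apply, Matrix.transpose_apply]
  exact DifferentiableOn.fun_sum fun k _ => (hg k i).mul
    (DifferentiableOn.fun_sum fun l _ => (hf l j).const_mul _)

end Pairing

/-! ### Scattering data -/

section Scattering

variable {m : ℕ} {k₀ : ℝ} {Q : ℝ → ℝ → Sq m} {Qm Qp : Sq m} {z : ℂ}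

namespace IsPotential

variable (hQ : IsPotential k₀ Q Qm Qp)
include hQ

theorem lax_eq_zero {f : ℝ → ℝ → Col m} (hf : IsLaxSolution k₀ Q z f) {x₀ t₀ : ℝ}
    (h : f x₀ t₀ = 0) (x t : ℝ) : f x t = 0 := by
  have h1 := isLaxSolution_iff.1 hf
  have hcM : Continuous fun x => laxM k₀ Q z x t₀ :=
    continuous_const.add (continuous_under.comp (hQ.continuous₀.comp
      (continuous_id.prodMk continuous_const)))
  have hcN : Continuous fun t => laxN k₀ Q z x t := by
    have hp : Continuous fun t : ℝ => (x, t) := continuous_const.prodMk continuous_id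
    exact continuous_laxNGen (A := Blk m) _ _ (continuous_under.comp (hQ.continuous₀.comp hp))
      (continuous_under.comp (hQ.continuous₁.comp hp))
      (continuous_under.comp (hQ.continuous₂.comp hp))
  have h2 := eq_zero_of_norm_deriv_le (F := fun x => f x t₀) hcM.norm (fun x => h1.1 x t₀)
    (fun x => Matrix.linfty_opNorm_mul _ _) h x
  exact eq_zero_of_norm_deriv_le (F := fun t => f x t) hcN.norm (fun t => h1.2 x t)
    (fun t => Matrix.linfty_opNorm_mul _ _) h2 t

/-- Because the pairing is constant, the evaluation at the origin in the definition of `a` may be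
replaced by any `(x, t)`. -/
theorem aPlus_eq (hz : z ∈ Omega k₀) (x t : ℝ) : aPlus k₀ Q Qm Qp z
    = -((gam k₀ z)⁻¹ • wr (psi k₀ Q Qp z x t) (phi k₀ Q Qm z x t)) := by
  rw [wr_const hQ.symm (hQ.psi_spec hz).1 (hQ.phi_spec hz).1, aPlus,
    hQ.psiBar_eq (by rwa [Complex.conj_conj]), Complex.conj_conj, kap_conjTranspose_mul, smul_neg]

theorem wr_psi_phi (hz : z ∈ Omega k₀) (x t : ℝ) :
    wr (psi k₀ Q Qp z x t) (phi k₀ Q Qm z x t) = -(gam k₀ z • aPlus k₀ Q Qm Qp z) := by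
  rw [hQ.aPlus_eq hz x t, smul_neg, smul_inv_smul₀ (gam_ne_zero hz), neg_neg]

theorem wr_VHat_WHat (x t : ℝ) : wr (VHat k₀ Q Qp x t z) (WHat k₀ Q Qm x t z)
    = wr (psi k₀ Q Qp z x t) (phi k₀ Q Qm z x t) := by
  rw [VHat, WHat, wr_smul_left, wr_smul_right, smul_smul, ← Complex.exp_add, neg_add_cancel,
    Complex.exp_zero, one_smul]

theorem aPlus_eq' (hz : z ∈ Omega k₀) (x t : ℝ) : aPlus k₀ Q Qm Qp z
    = -((gam k₀ z)⁻¹ • wr (VHat k₀ Q Qp x t z) (WHat k₀ Q Qm x t z)) := by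
  rw [hQ.wr_VHat_WHat, hQ.aPlus_eq hz x t]

theorem aPlus_differentiableOn (hk : 0 < k₀) :
    DifferentiableOn ℂ (aPlus k₀ Q Qm Qp) (Dplus k₀) := by
  have h1 := differentiableOn_wr (hQ.VHat_differentiableOn hk 0 0)
    (hQ.WHat_differentiableOn hk 0 0)
  have h2 : DifferentiableOn ℂ (fun z => (gam k₀ z)⁻¹) (Dplus k₀) :=
    (differentiableOn_gam fun z hz => (Dplus_subset_Omega hk hz).2.1).fun_inv
      fun z hz => gam_ne_zero (Dplus_subset_Omega hk hz)
  have h3 : DifferentiableOn ℂ (fun z => -((gam k₀ z)⁻¹ •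
      wr (VHat k₀ Q Qp 0 0 z) (WHat k₀ Q Qm 0 0 z))) (Dplus k₀) := by
    rw [differentiableOn_matrix] at h1 ⊢
    exact fun i j => (h2.mul (h1 i j)).neg
  exact h3.congr fun z hz => hQ.aPlus_eq' (Dplus_subset_Omega hk hz) 0 0

theorem aPlus_continuousOn : ContinuousOn (aPlus k₀ Q Qm Qp) (Omega k₀) := by
  have h2 : ContinuousOn (fun z => (gam k₀ z)⁻¹) (Omega k₀) :=
    (differentiableOn_gam fun z hz => hz.2.1).continuousOn.inv₀ fun z hz => gam_ne_zero hz
  have h3 : ContinuousOn (fun z => -((gam k₀ z)⁻¹ •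
      wr (VHat k₀ Q Qp 0 0 z) (WHat k₀ Q Qm 0 0 z))) (Omega k₀) := fun z hz =>
    ((h2 z hz).smul (tendsto_wr (hQ.VHat_continuousOn 0 0 z hz)
      (hQ.WHat_continuousOn 0 0 z hz))).neg
  exact h3.congr fun z hz => hQ.aPlus_eq' hz 0 0

/-- The pairing is a constant `c`, while `e^{2iθ} c` tends at `-∞` to the pairing of the limiting
columns, which vanishes because `Qm` is symmetric. For `t = 0` and `x ≤ 0` the exponential has
modulus at least `1`, since `Im λ ≥ 0`; hence `c = 0`. -/
theorem wr_phi_phi (hz : z ∈ Omega k₀) (x t : ℝ) :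
    wr (phi k₀ Q Qm z x t) (phi k₀ Q Qm z x t) = 0 := by
  have hs := hQ.phi_spec hz
  rw [wr_const hQ.symm hs.1 hs.1]
  set c := wr (phi k₀ Q Qm z 0 0) (phi k₀ Q Qm z 0 0) with hc
  have h1 := tendsto_wr (hs.2 0) (hs.2 0)
  have h2 : wr (asymE z Qm).toCols₁ (asymE z Qm).toCols₁ = 0 := by
    rw [asymE_toCols₁, wr_fromRows, Matrix.transpose_smul,
      ← cj_of_symm hQ.symm_minus, cj_transpose, cj_of_symm hQ.symm_minus]
    simp
  rw [h2] at h1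
  have hexp : ∀ x ≤ 0, 1 ≤ ‖Complex.exp (Complex.I * theta k₀ x 0 z)‖ := fun x hx => by
    rw [Complex.norm_exp]
    have : (Complex.I * theta k₀ x 0 z).re = -((lam k₀ z).im * x) := by
      simp [theta]
    rw [this]
    have := mul_nonpos_of_nonneg_of_nonpos (lam_im_nonneg hz.2.1 hz.1) hx
    exact Real.one_le_exp (by linarith)
  ext i j
  have h3 := (tendsto_matrix.1 h1 i j).norm
  simp only [Matrix.zero_apply, norm_zero] at h3 ⊢
  have h4 : ‖c i j‖ ≤ 0 := by
    refine ge_of_tendsto h3 ?_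
    filter_upwards [eventually_le_atBot 0] with x hx
    rw [wr_smul_left, wr_smul_right, wr_const hQ.symm hs.1 hs.1, ← hc, smul_smul,
      Matrix.smul_apply, smul_eq_mul, norm_mul, norm_mul]
    have := hexp x hx
    exact le_mul_of_one_le_left (norm_nonneg _) (one_le_mul_of_one_le_of_one_le this this)
  exact norm_le_zero_iff.1 h4

theorem wr_psi_psi (hz : z ∈ Omega k₀) (x t : ℝ) :
    wr (psi k₀ Q Qp z x t) (psi k₀ Q Qp z x t) = 0 := by
  rw [hQ.psi_eq hz (hQ.isJostSnd_refl hz), wr_neg_left, wr_neg_right, neg_neg, wr_symJ,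
    hQ.refl.wr_phi_phi hz]

/-- The exponentials of the two columns cancel, so the constant pairing equals its limit at `+∞`,
computed from the columns of `E₊`. -/
theorem wr_psi_psiBar (hz : z ∈ Omega k₀) (hz' : starRingEnd ℂ z ∈ Omega k₀) (x t : ℝ) :
    wr (psi k₀ Q Qp z x t) (psiBar k₀ Q Qp z x t) = -(gam k₀ z • (1 : Sq m)) := by
  have hs := hQ.psi_spec hz
  have hs' := hQ.psiBar_spec hz'
  have h1 := tendsto_wr (hs.2 0) (hs'.2 0)
  have h2 : wr (asymE z Qp).toCols₂ (asymE z Qp).toCols₁ = -(gam k₀ z • (1 : Sq m)) := by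
    rw [asymE_toCols₁, asymE_toCols₂, wr_fromRows, Matrix.transpose_smul, hQ.symm_plus,
      Matrix.transpose_one, smul_mul_smul_comm, hQ.unitary_plus.1, smul_smul, gam]
    have : -(Complex.I / z) * -(Complex.I / z) * (k₀ : ℂ) ^ 2 = -((k₀ : ℂ) ^ 2 / z ^ 2) := by
      have hz0 := hz.2.1
      field_simp; rw [Complex.I_sq, neg_one_mul]
    rw [this, Matrix.one_mul]
    module
  rw [h2] at h1
  refine tendsto_nhds_unique (tendsto_const_nhds (x := wr (psi k₀ Q Qp z x t)
    (psiBar k₀ Q Qp z x t)) (f := atTop (α := ℝ))) (h1.congr fun y => ?_)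
  rw [wr_smul_left, wr_smul_right, smul_smul, ← Complex.exp_add, neg_add_cancel,
    Complex.exp_zero, one_smul, wr_const hQ.symm hs.1 hs'.1, wr_const hQ.symm hs.1 hs'.1 x t]

theorem wr_psiBar_psi (hz : z ∈ Omega k₀) (hz' : starRingEnd ℂ z ∈ Omega k₀) (x t : ℝ) :
    wr (psiBar k₀ Q Qp z x t) (psi k₀ Q Qp z x t) = gam k₀ z • (1 : Sq m) := by
  have h := congrArg Matrix.transpose (hQ.wr_psi_psiBar hz hz' x t)
  rw [wr_transpose, Matrix.transpose_neg, Matrix.transpose_smul, Matrix.transpose_one] at h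
  exact neg_injective h

theorem wr_psiBar_psiBar (hz' : starRingEnd ℂ z ∈ Omega k₀) (x t : ℝ) :
    wr (psiBar k₀ Q Qp z x t) (psiBar k₀ Q Qp z x t) = 0 := by
  rw [hQ.psiBar_eq hz', wr_kap, hQ.wr_psi_psi hz', cj_zero]

/-- A Lax solution is a combination of `ψ̄` and `ψ`. -/
theorem lax_eq_comb (hz : z ∈ Omega k₀) (hz' : starRingEnd ℂ z ∈ Omega k₀) {f : ℝ → ℝ → Col m}
    (hf : IsLaxSolution k₀ Q z f) : ∃ A B : Sq m, ∀ x t,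
      f x t = psiBar k₀ Q Qp z x t * A + psi k₀ Q Qp z x t * B := by
  have hg := gam_ne_zero hz
  set A : Sq m := -((gam k₀ z)⁻¹ • wr (psi k₀ Q Qp z 0 0) (f 0 0)) with hA
  set B : Sq m := (gam k₀ z)⁻¹ • wr (psiBar k₀ Q Qp z 0 0) (f 0 0) with hB
  refine ⟨A, B, fun x t => ?_⟩
  set P : Blk m := Matrix.fromCols (psiBar k₀ Q Qp z x t) (psi k₀ Q Qp z x t) with hP
  -- The four pairings say that the fundamental matrix is symplectic up to the nonzero factor `γ`.
  -- This gives an explicit inverse, and the coefficients of `f` come out as constant pairings.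
  have h1 : Pᵀ * symJ m * P = gam k₀ z • symJ m := by
    rw [Matrix.mul_assoc, hP, Matrix.mul_fromCols, Matrix.transpose_fromCols,
      Matrix.fromRows_mul_fromCols]
    change Matrix.fromBlocks (wr _ _) (wr _ _) (wr _ _) (wr _ _) = _
    rw [hQ.wr_psi_psi hz, hQ.wr_psiBar_psiBar hz', hQ.wr_psi_psiBar hz hz',
      hQ.wr_psiBar_psi hz hz', symJ, Matrix.fromBlocks_smul]
    simp
  have h2 : (-((gam k₀ z)⁻¹ • (symJ m * (Pᵀ * symJ m)))) * P = 1 := by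
    rw [neg_mul, smul_mul_assoc, mul_assoc, h1, mul_smul_comm, symJ_mul_self,
      inv_smul_smul₀ hg, neg_neg]
  have h3 := mul_eq_one_comm.1 h2
  have h4 : Pᵀ * symJ m * f x t = Matrix.fromRows (wr (psiBar k₀ Q Qp z 0 0) (f 0 0))
      (wr (psi k₀ Q Qp z 0 0) (f 0 0)) := by
    rw [Matrix.mul_assoc, hP, Matrix.transpose_fromCols, Matrix.fromRows_mul]
    change Matrix.fromRows (wr _ _) (wr _ _) = _
    rw [wr_const hQ.symm (hQ.psiBar_spec hz').1 hf x t, wr_const hQ.symm (hQ.psi_spec hz).1 hf x t]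
  have h5 : f x t = P * (-((gam k₀ z)⁻¹ • (symJ m * (Pᵀ * symJ m * f x t)))) := by
    have h6 : -((gam k₀ z)⁻¹ • (symJ m * (Pᵀ * symJ m * f x t)))
        = (-((gam k₀ z)⁻¹ • (symJ m * (Pᵀ * symJ m)))) * f x t := by
      rw [Matrix.neg_mul, Matrix.smul_mul, ← Matrix.mul_assoc]
    rw [h6, ← Matrix.mul_assoc, h3, Matrix.one_mul]
  rw [h5, h4, symJ_mul_fromRows, smul_fromRows, Matrix.fromRows_neg, hP,
    Matrix.fromCols_mul_fromRows, hA, hB, smul_neg, neg_neg]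

theorem comb_coeff (hz : z ∈ Omega k₀) (hz' : starRingEnd ℂ z ∈ Omega k₀) {f : Col m}
    {A B : Sq m} {x t : ℝ} (h : f = psiBar k₀ Q Qp z x t * A + psi k₀ Q Qp z x t * B) :
    A = -((gam k₀ z)⁻¹ • wr (psi k₀ Q Qp z x t) f) ∧
      B = (gam k₀ z)⁻¹ • wr (psiBar k₀ Q Qp z x t) f := by
  rw [h, wr_add_right, wr_add_right, wr_mul_right, wr_mul_right, wr_mul_right, wr_mul_right,
    hQ.wr_psi_psi hz, hQ.wr_psiBar_psiBar hz', hQ.wr_psi_psiBar hz hz', hQ.wr_psiBar_psi hz hz']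
  simp only [Matrix.zero_mul, add_zero, zero_add, Matrix.neg_mul, Matrix.smul_mul, Matrix.one_mul,
    smul_neg, neg_neg]
  rw [inv_smul_smul₀ (gam_ne_zero hz), inv_smul_smul₀ (gam_ne_zero hz)]
  exact ⟨rfl, rfl⟩

theorem scat_spec (hz : z ∈ Sigma0 k₀) (x t : ℝ) :
    phi k₀ Q Qm z x t = psiBar k₀ Q Qp z x t * (scat k₀ Q Qm Qp z).toBlocks₁₁
      + psi k₀ Q Qp z x t * (scat k₀ Q Qm Qp z).toBlocks₂₁ ∧
    phiBar k₀ Q Qm z x t = psiBar k₀ Q Qp z x t * (scat k₀ Q Qm Qp z).toBlocks₁₂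
      + psi k₀ Q Qp z x t * (scat k₀ Q Qm Qp z).toBlocks₂₂ := by
  have h1 := Sigma0_subset_Omega hz
  have h2 := Sigma0_subset_Omega (conj_mem_Sigma0 hz)
  obtain ⟨A, B, hAB⟩ := hQ.lax_eq_comb h1 h2 (hQ.phi_spec h1).1
  obtain ⟨A', B', hAB'⟩ := hQ.lax_eq_comb h1 h2 (hQ.phiBar_spec h2).1
  have hex : ∃ S : Blk m, ∀ x t,
      Matrix.fromCols (phi k₀ Q Qm z x t) (phiBar k₀ Q Qm z x t)
        = Matrix.fromCols (psiBar k₀ Q Qp z x t) (psi k₀ Q Qp z x t) * S :=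
    ⟨Matrix.fromBlocks A A' B B', fun x t => by
      rw [Matrix.fromCols_mul_fromBlocks, hAB, hAB']⟩
  have h := Classical.epsilon_spec hex x t
  change _ = _ * scat k₀ Q Qm Qp z at h
  rw [← Matrix.fromBlocks_toBlocks (scat k₀ Q Qm Qp z), Matrix.fromCols_mul_fromBlocks,
    Matrix.fromCols_inj.eq_iff] at h
  exact h

theorem scat_toBlocks₁₁ (hz : z ∈ Sigma0 k₀) :
    (scat k₀ Q Qm Qp z).toBlocks₁₁ = aPlus k₀ Q Qm Qp z := by
  have h1 := Sigma0_subset_Omega hz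
  rw [(hQ.comb_coeff h1 (Sigma0_subset_Omega (conj_mem_Sigma0 hz)) (hQ.scat_spec hz 0 0).1).1,
    ← hQ.aPlus_eq h1]

/-- Applying `kap` to the decomposition of `φ` at `z*` gives one of `φ̄` at `z`, and coefficients
are unique. -/
theorem scat_conj (hz : z ∈ Sigma0 k₀) :
    (scat k₀ Q Qm Qp z).toBlocks₁₂ = -cj (scat k₀ Q Qm Qp (starRingEnd ℂ z)).toBlocks₂₁ ∧
    (scat k₀ Q Qm Qp z).toBlocks₂₂ = cj (scat k₀ Q Qm Qp (starRingEnd ℂ z)).toBlocks₁₁ := by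
  have h1 := Sigma0_subset_Omega hz
  have h2 := Sigma0_subset_Omega (conj_mem_Sigma0 hz)
  have h3 := congrArg kap (hQ.scat_spec (conj_mem_Sigma0 hz) 0 0).1
  have h4 : kap (psiBar k₀ Q Qp (starRingEnd ℂ z) 0 0) = -psi k₀ Q Qp z 0 0 := by
    rw [hQ.psiBar_eq (by rwa [Complex.conj_conj]), Complex.conj_conj, kap_kap]
  have h5 : ∀ f g : Col m, kap (f + g) = kap f + kap g := fun f g => by
    rw [kap, kap, kap, cj_add, Matrix.mul_add]
  rw [h5, kap_mul, kap_mul, h4, ← hQ.psiBar_eq h2] at h3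
  have h6 : phiBar k₀ Q Qm z 0 0 = psiBar k₀ Q Qp z 0 0 *
      (-cj (scat k₀ Q Qm Qp (starRingEnd ℂ z)).toBlocks₂₁) + psi k₀ Q Qp z 0 0 *
      cj (scat k₀ Q Qm Qp (starRingEnd ℂ z)).toBlocks₁₁ := by
    rw [hQ.phiBar_eq h2, h3, Matrix.mul_neg, Matrix.neg_mul]
    abel
  have h7 := hQ.comb_coeff h1 h2 h6
  have h8 := hQ.comb_coeff h1 h2 (hQ.scat_spec hz 0 0).2
  exact ⟨h8.1.trans h7.1.symm, h8.2.trans h7.2.symm⟩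

theorem rhoBar_eq (hz : z ∈ Sigma0 k₀) :
    rhoBar k₀ Q Qm Qp z = -cj (rho k₀ Q Qm Qp (starRingEnd ℂ z)) := by
  rw [rhoBar, rho, (hQ.scat_conj hz).1, (hQ.scat_conj hz).2, cj_mul, cj_inv, Matrix.neg_mul]

theorem aMinus_eq (hz : starRingEnd ℂ z ∈ Omega k₀) :
    aMinus k₀ Q Qm Qp z = cj (aPlus k₀ Q Qm Qp (starRingEnd ℂ z)) := by
  have h1 : ∀ f g : Col m, fᴴ * -kap g = -cj (wr f g) := fun f g => by
    rw [wr, cj_mul, cj_mul, cj_symJ, transpose_cj, Matrix.mul_neg, kap]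
  rw [aMinus, hQ.phiBar_eq hz, h1, hQ.wr_psi_phi hz, cj_neg, neg_neg, cj_smul, ← gam_conj,
    Complex.conj_conj, inv_smul_smul₀]
  have h2 := gam_ne_zero hz
  rw [gam_conj] at h2
  exact fun h => h2 (by rw [h, map_zero])

/-- The two flipped columns contribute `(iz/k₀²)²` to the pairing, and `γ` at the image point
contributes `z²/k₀²`; the quotient leaves the factor `k₀⁻²`. -/
theorem aPlus_flip (hk : 0 < k₀) (hz : z ∈ Omega k₀) :
    aPlus k₀ Q Qm Qp (starRingEnd ℂ (flip k₀ z))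
      = cj ((((k₀ : ℂ) ^ 2)⁻¹) • (Qpᴴ * aPlus k₀ Q Qm Qp z * Qm)) := by
  have hz0 := hz.2.1
  have hk0 : (k₀ : ℂ) ≠ 0 := by exact_mod_cast hk.ne'
  have hw := conj_flip_mem_Omega hk hz
  have hT : (Qpᴴ)ᵀ = Qpᴴ := by rw [← cj_of_symm hQ.symm_plus, cj_transpose, cj_of_symm hQ.symm_plus]
  have h1 : gam k₀ (starRingEnd ℂ (flip k₀ z)) • aPlus k₀ Q Qm Qp (starRingEnd ℂ (flip k₀ z))
      = cj ((z ^ 2 / (k₀ : ℂ) ^ 4 * gam k₀ z) • (Qpᴴ * aPlus k₀ Q Qm Qp z * Qm)) := by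
    have h2 := hQ.wr_psi_phi hw 0 0
    rw [hQ.psi_flip hk hz, hQ.phi_flip hk hz, wr_neg_left, wr_kap, wr_mul_left, wr_mul_right,
      hQ.wr_psi_phi hz, Matrix.transpose_smul, hT] at h2
    rw [← neg_injective h2]
    congr 1
    simp only [Matrix.mul_smul, Matrix.smul_mul, Matrix.mul_neg, Matrix.neg_mul, smul_smul,
      ← Matrix.mul_assoc, ← neg_smul]
    congr 1
    field_simp
    rw [Complex.I_sq]; ring
  have h3 : gam k₀ (starRingEnd ℂ (flip k₀ z)) = starRingEnd ℂ (z ^ 2 / (k₀ : ℂ) ^ 2 * gam k₀ z) := by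
    rw [gam_conj, gam_flip hk hz0]
  rw [← inv_smul_smul₀ (gam_ne_zero hw) (aPlus k₀ Q Qm Qp (starRingEnd ℂ (flip k₀ z))), h1, h3,
    cj_smul, cj_smul, smul_smul, ← map_inv₀, ← map_mul]
  congr 2
  have := gam_ne_zero hz
  field_simp

end IsPotential

end Scattering

end MMKdV

namespace MMKdV

/-! ### Asymptotics for large spectral parameter -/

section LargeParameter

/-- A continuous function with a limit at `-∞` is bounded on half-lines. -/
theorem exists_bound_Iic {E : Type*} [NormedAddCommGroup E] {f : ℝ → E} {L : E}
    (hf : Continuous f) (hL : Tendsto f atBot (𝓝 L)) (X : ℝ) : ∃ C, ∀ s ≤ X, ‖f s‖ ≤ C := by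
  have h1 := hL.norm.eventually (eventually_le_nhds (lt_add_one ‖L‖))
  obtain ⟨a, ha⟩ := eventually_atBot.1 h1
  obtain ⟨C, hC⟩ := (isCompact_Icc (a := a) (b := X)).exists_bound_of_continuousOn hf.continuousOn
  refine ⟨max (‖L‖ + 1) C, fun s hs => ?_⟩
  rcases le_total s a with h | h
  · exact (ha s h).trans (le_max_left _ _)
  · exact (hC s ⟨h, hs⟩).trans (le_max_right _ _)

variable {E : Type*} [NormedAddCommGroup E] [NormedSpace ℂ E] [CompleteSpace E]

/-- A solution of `w' = a w + F` with `Re a ≤ 0` that vanishes at `-∞` is controlled by the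
integral of the source. -/
theorem norm_le_integral_source {w F : ℝ → E} {a : ℂ} (ha : a.re ≤ 0) {h : ℝ → ℝ} {X : ℝ}
    (hw : ∀ x, HasDerivAt w (a • w x + F x) x) (hF : Continuous F)
    (hlim : Tendsto w atBot (𝓝 0)) (hh : IntegrableOn h (Set.Iic X))
    (hFh : ∀ x ≤ X, ‖F x‖ ≤ h x) {x : ℝ} (hx : x ≤ X) : ‖w x‖ ≤ ∫ s in Set.Iic X, h s := by
  set e : ℝ → ℂ := fun s => Complex.exp (a * ((x - s : ℝ) : ℂ)) with he
  have hed : ∀ s, HasDerivAt e (-a * e s) s := fun s => by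
    have h1 : HasDerivAt (fun s : ℝ => a * ((x - s : ℝ) : ℂ)) (-a) s := by
      have := (((hasDerivAt_id s).const_sub x).ofReal_comp).const_mul a
      exact this.congr_deriv (by simp)
    exact h1.cexp.congr_deriv (mul_comm _ _)
  have hen : ∀ s ≤ x, ‖e s‖ ≤ 1 := fun s hs => by
    rw [he, Complex.norm_exp, Real.exp_le_one_iff, Complex.re_mul_ofReal]
    exact mul_nonpos_of_nonpos_of_nonneg ha (by linarith)
  have hvd : ∀ s, HasDerivAt (fun s => e s • w s) (e s • F s) s := fun s => by
    refine ((hed s).smul (hw s)).congr_deriv ?_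
    rw [smul_add, smul_smul, neg_mul, neg_smul, mul_comm]
    abel
  have hec : Continuous e := continuous_iff_continuousAt.2 fun s => (hed s).continuousAt
  have hb : ∀ s ≤ x, ‖e s • F s‖ ≤ h s := fun s hs => by
    rw [norm_smul]
    exact (mul_le_of_le_one_left (norm_nonneg _) (hen s hs)).trans (hFh s (hs.trans hx))
  have hvlim : Tendsto (fun s => e s • w s) atBot (𝓝 0) := by
    refine squeeze_zero_norm' ?_ (tendsto_zero_iff_norm_tendsto_zero.1 hlim)
    filter_upwards [eventually_le_atBot x] with s hs
    rw [norm_smul]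
    exact mul_le_of_le_one_left (norm_nonneg _) (hen s hs)
  have h0 : ∀ s ≤ X, 0 ≤ h s := fun s hs => (norm_nonneg _).trans (hFh s hs)
  have hint : ∀ y ≤ x, ‖e x • w x - e y • w y‖ ≤ ∫ s in Set.Iic X, h s := fun y hy => by
    rw [← intervalIntegral.integral_eq_sub_of_hasDerivAt (fun s _ => hvd s)
      ((hec.smul hF).intervalIntegrable _ _)]
    have hhI : IntegrableOn h (Set.Ioc y x) := hh.mono_set fun s hs => hs.2.trans hx
    refine (intervalIntegral.norm_integral_le_of_norm_le (g := h) hy ?_ ?_).trans ?_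
    · exact Eventually.of_forall fun s hs => hb s hs.2
    · exact (intervalIntegrable_iff_integrableOn_Ioc_of_le hy).2 hhI
    · rw [intervalIntegral.integral_of_le hy]
      exact setIntegral_mono_set hh ((ae_restrict_iff' measurableSet_Iic).2
        (Eventually.of_forall fun s hs => h0 s hs))
        (Eventually.of_forall fun s hs => hs.2.trans hx)
  have hex : e x = 1 := by simp [he]
  have h2 : Tendsto (fun y => ‖e x • w x - e y • w y‖) atBot (𝓝 ‖e x • w x - 0‖) :=
    (tendsto_const_nhds.sub hvlim).norm
  rw [sub_zero, hex, one_smul] at h2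
  refine le_of_tendsto h2 ?_
  filter_upwards [eventually_le_atBot x] with y hy
  have := hint y hy
  rwa [hex, one_smul] at this

/-- A bounded function that is at most half of any of its bounds, up to a constant. -/
theorem le_two_mul_of_le_half {α : Type*} {S : Set α} {f : α → ℝ} {K : ℝ} (hS : S.Nonempty)
    (hb : ∃ M, ∀ s ∈ S, f s ≤ M)
    (h : ∀ M, (∀ s ∈ S, f s ≤ M) → ∀ s ∈ S, f s ≤ K + M / 2) : ∀ s ∈ S, f s ≤ 2 * K := by
  obtain ⟨M, hM⟩ := hb
  have hbdd : BddAbove (f '' S) := ⟨M, by rintro _ ⟨s, hs, rfl⟩; exact hM s hs⟩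
  have h1 : ∀ s ∈ S, f s ≤ sSup (f '' S) := fun s hs => le_csSup hbdd ⟨s, hs, rfl⟩
  have h2 : sSup (f '' S) ≤ K + sSup (f '' S) / 2 :=
    csSup_le (hS.image f) (by rintro _ ⟨s, hs, rfl⟩; exact h _ h1 s hs)
  intro s hs
  linarith [h1 s hs]

end LargeParameter

section LargeParameterAlgebra

variable {A : Type*} [NormedRing A] [NormedAlgebra ℂ A] [CompleteSpace A]

set_option maxHeartbeats 1000000 in
/-- Uniform asymptotics in the spectral parameter for the first Jost column; `q`, `p` are the
off-diagonal entries of the potential. -/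
theorem large_parameter {q p qx px pxx : ℝ → A} {k : ℂ} {X B : ℝ} {h : ℝ → ℝ} (hB : 1 ≤ B)
    (hq : ∀ x, HasDerivAt q (qx x) x) (hp : ∀ x, HasDerivAt p (px x) x)
    (hpx : ∀ x, HasDerivAt px (pxx x) x) (hqxc : Continuous qx) (hpxxc : Continuous pxx)
    (hpxlim : Tendsto px atBot (𝓝 0))
    (hB1 : ‖(1 : A)‖ ≤ B)
    (hqB : ∀ x ≤ X, ‖q x‖ ≤ B) (hpB : ∀ x ≤ X, ‖p x‖ ≤ B) (hpxB : ∀ x ≤ X, ‖px x‖ ≤ B)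
    (hh : IntegrableOn h (Set.Iic X))
    (h1 : ∀ x ≤ X, ‖p x * q x - k • 1‖ ≤ h x) (h2 : ∀ x ≤ X, ‖q x * p x - k • 1‖ ≤ h x)
    (h3 : ∀ x ≤ X, ‖qx x‖ ≤ h x) (h4 : ∀ x ≤ X, ‖px x‖ ≤ h x) (h5 : ∀ x ≤ X, ‖pxx x‖ ≤ h x) :
    ∃ C R : ℝ, 0 ≤ C ∧ 1 ≤ R ∧ ∀ z l : ℂ, R ≤ ‖z‖ → 2 * l * z = z ^ 2 + k → 0 ≤ l.im →
      ∀ u v : ℝ → A, (∀ x, HasDerivAt u ((Complex.I * k / z) • u x + q x * v x) x) →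
      (∀ x, HasDerivAt v ((Complex.I * z) • v x - p x * u x) x) →
      Tendsto u atBot (𝓝 1) →
      Tendsto (fun x => v x + (Complex.I / z) • (p x * u x)) atBot (𝓝 0) →
      ‖u X - 1‖ ≤ C / ‖z‖ ∧ ‖v X + (Complex.I / z) • p X‖ ≤ C / ‖z‖ ^ 2 := by
  set I₀ : ℝ := ∫ s in Set.Iic X, h s with hI₀
  have hh0 : ∀ x ≤ X, 0 ≤ h x := fun x hx => (norm_nonneg _).trans (h3 x hx)
  have hI0 : 0 ≤ I₀ := setIntegral_nonneg measurableSet_Iic fun x hx => hh0 x hx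
  -- `K1` collects the constants of the bootstrap estimate. The threshold `R` is taken so large that
  -- `K1/|z| ≤ 1/2`, which closes it.
  set K1 : ℝ := 9 * B ^ 2 * I₀ + 2 * B + 3 * B * I₀ with hK1
  have hK10 : 0 ≤ K1 := by positivity
  set D : ℝ := B * (2 * B) + (B * B + ‖k‖ * B) * (2 * B) with hD
  have hD0 : 0 ≤ D := by positivity
  set C2 : ℝ := I₀ * (6 * B ^ 2 * I₀ + 2 * B ^ 2 + 4 * B + 2 * D) + 4 * B ^ 2 + B * (K1 * (2 * B))
    with hC2
  have hC20 : 0 ≤ C2 := by positivity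
  refine ⟨K1 * (2 * B) + C2, 1 + 2 * ‖k‖ + 2 * K1, by positivity,
    by linarith [norm_nonneg k], fun z l hz hl him u v hu hv hulim hvlim => ?_⟩
  have hz1 : 1 ≤ ‖z‖ := by linarith [norm_nonneg k]
  have hz0 : z ≠ 0 := by rw [← norm_pos_iff]; linarith
  have hzp : 0 < ‖z‖ := by linarith
  set c : ℂ := Complex.I / z with hc
  set ε : ℝ := ‖z‖⁻¹ with hε
  have hε0 : 0 ≤ ε := by positivity
  have hε1 : ε ≤ 1 := inv_le_one_of_one_le₀ hz1
  have hcn : ‖c‖ = ε := by rw [hc, norm_div, Complex.norm_I, one_div]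
  have hεK : ε * K1 ≤ 1 / 2 := by
    rw [hε, inv_mul_le_iff₀ hzp]; linarith [norm_nonneg k]
  have hln : ‖z‖ / 2 ≤ ‖2 * l‖ := by
    have e1 : ‖2 * l‖ * ‖z‖ = ‖z ^ 2 + k‖ := by rw [← norm_mul, hl]
    have e2 : ‖z‖ ^ 2 - ‖k‖ ≤ ‖z ^ 2 + k‖ := by
      have := norm_sub_le (z ^ 2 + k) k
      rw [add_sub_cancel_right, norm_pow] at this
      linarith
    by_contra! hcon
    have e3 : ‖2 * l‖ * ‖z‖ < ‖z‖ / 2 * ‖z‖ := by gcongr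
    nlinarith [norm_nonneg k]
  have hl0 : l ≠ 0 := by
    rintro rfl
    rw [mul_zero, norm_zero] at hln
    linarith
  set a : ℂ := 2 * Complex.I * l with ha
  have ha0 : a ≠ 0 := by simp [ha, hl0]
  have hare : a.re ≤ 0 := by
    have : a.re = -(2 * l.im) := by simp [ha, Complex.mul_re, Complex.mul_im]
    rw [this]; linarith
  set d : ℂ := a⁻¹ with hd
  have hdn : ‖d‖ ≤ 2 * ε := by
    have e1 : ‖a‖ = ‖2 * l‖ := by
      rw [ha, norm_mul, norm_mul, norm_mul, Complex.norm_I, mul_one]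
    rw [hd, norm_inv, e1, hε, ← inv_inv (2 : ℝ), ← mul_inv]
    refine inv_anti₀ (by positivity) ?_
    linarith
  have hc1 : Complex.I * z * c = -1 := by
    rw [hc]; field_simp; exact Complex.I_sq
  have hac : a = Complex.I * z + c * k := by
    have : a = Complex.I * (2 * l * z) / z := by rw [ha]; field_simp
    rw [this, hl, hc]; field_simp
  have hqc : Continuous q := continuous_iff_continuousAt.2 fun x => (hq x).continuousAt
  have hpc : Continuous p := continuous_iff_continuousAt.2 fun x => (hp x).continuousAt
  have hpxc : Continuous px := continuous_iff_continuousAt.2 fun x => (hpx x).continuousAt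
  have huc : Continuous u := continuous_iff_continuousAt.2 fun x => (hu x).continuousAt
  have hvc : Continuous v := continuous_iff_continuousAt.2 fun x => (hv x).continuousAt
  -- `w` is `v` with its leading term `-(i/z) p u` removed. It satisfies `w' = a w + F` with `a =
  -- 2il`, and `F` is an integrable function of size `1/|z|`.
  set w : ℝ → A := fun x => v x + c • (p x * u x) with hw
  have hwc : Continuous w := by fun_prop
  have hvw : ∀ x, v x = w x - c • (p x * u x) := fun x => by simp [hw]
  set U : ℝ → A := fun x => q x * w x - c • ((q x * p x - k • 1) * u x) with hU
  have hud : ∀ x, HasDerivAt u (U x) x := fun x => by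
    refine (hu x).congr_deriv ?_
    rw [hvw x, mul_div_right_comm, ← hc]
    simp only [hU, mul_sub, sub_mul, smul_sub, mul_smul_comm, smul_mul_assoc, one_mul, mul_assoc]
    module
  set F : ℝ → A := fun x => c • ((p x * q x - k • 1) * w x) + c • (px x * u x)
    - (c ^ 2) • (p x * ((q x * p x - k • 1) * u x)) with hF
  have hFc : Continuous F := by fun_prop
  have hwd : ∀ x, HasDerivAt w (a • w x + F x) x := fun x => by
    refine ((hv x).add (((hp x).mul (hud x)).const_smul c)).congr_deriv ?_
    rw [hvw x, hac]
    simp only [hF, hU, mul_sub, sub_mul, smul_sub, smul_add, mul_smul_comm, smul_mul_assoc, one_mul,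
      mul_assoc, smul_smul, hc1, add_smul]
    module
  have hFb : ∀ M, (∀ x ≤ X, max ‖u x‖ ‖w x‖ ≤ M) → ∀ x ≤ X, ‖F x‖ ≤ 3 * ε * B * M * h x := by
    intro M hM x hx
    have hux := (le_max_left _ _).trans (hM x hx)
    have hwx := (le_max_right _ _).trans (hM x hx)
    have hM0 : 0 ≤ M := (norm_nonneg _).trans hux
    have hhx := hh0 x hx
    have e1 : ‖c • ((p x * q x - k • 1) * w x)‖ ≤ ε * (h x * M) := by
      rw [norm_smul, hcn]; gcongr; exact norm_mul_le_of_le (h1 x hx) hwx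
    have e2 : ‖c • (px x * u x)‖ ≤ ε * (h x * M) := by
      rw [norm_smul, hcn]; gcongr; exact norm_mul_le_of_le (h4 x hx) hux
    have e3 : ‖(c ^ 2) • (p x * ((q x * p x - k • 1) * u x))‖ ≤ ε ^ 2 * (B * (h x * M)) := by
      rw [norm_smul, norm_pow, hcn]; gcongr
      exact norm_mul_le_of_le (hpB x hx) (norm_mul_le_of_le (h2 x hx) hux)
    have e4 : ‖F x‖ ≤ ε * (h x * M) + ε * (h x * M) + ε ^ 2 * (B * (h x * M)) :=
      (norm_sub_le _ _).trans (add_le_add ((norm_add_le _ _).trans (add_le_add e1 e2)) e3)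
    have e5 : 0 ≤ ε * (h x * M) := by positivity
    have e6 : ε * (h x * M) ≤ ε * (h x * M) * B := le_mul_of_one_le_right e5 hB
    have e7 : ε * (ε * (h x * M) * B) ≤ ε * (h x * M) * B :=
      mul_le_of_le_one_left (by positivity) hε1
    have e8 : ε ^ 2 * (B * (h x * M)) = ε * (ε * (h x * M) * B) := by ring
    have e9 : 3 * ε * B * M * h x = 3 * (ε * (h x * M) * B) := by ring
    rw [e8] at e4
    rw [e9]
    linarith
  have hwb : ∀ M, (∀ x ≤ X, max ‖u x‖ ‖w x‖ ≤ M) → ∀ x ≤ X, ‖w x‖ ≤ 3 * ε * B * M * I₀ := by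
    intro M hM x hx
    have := norm_le_integral_source hare hwd hFc hvlim (hh.const_mul (3 * ε * B * M))
      (hFb M hM) hx
    rwa [integral_const_mul] at this
  have hub : ∀ M, (∀ x ≤ X, max ‖u x‖ ‖w x‖ ≤ M) → ∀ x ≤ X,
      ‖u x - 1‖ ≤ ε * (9 * B ^ 2 * I₀ + 2 * B) * M := by
    intro M hM x hx
    -- The term `q w` in `u'` has no integrable bound of its own. An integration by parts writes `w`
    -- as `a⁻¹ (w' - F)`: the derivative falls on `q`, and a factor `d = a⁻¹` of size `1/|z|` is
    -- gained.
    set G : ℝ → A := fun x => -(c • ((q x * p x - k • 1) * u x))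
      - d • (qx x * w x + q x * F x) with hG
    have hGd : ∀ x, HasDerivAt (fun x => (u x - 1) - d • (q x * w x)) ((0 : ℂ) •
        ((u x - 1) - d • (q x * w x)) + G x) x := fun x => by
      refine (((hud x).sub_const 1).sub (((hq x).mul (hwd x)).const_smul d)).congr_deriv ?_
      simp only [hG, hU, mul_add, smul_add, mul_smul_comm, smul_smul, zero_smul, zero_add]
      rw [hd, inv_mul_cancel₀ ha0, one_smul]
      abel
    have hGc : Continuous G := by fun_prop
    have hqw : Tendsto (fun x => q x * w x) atBot (𝓝 0) := by
      refine squeeze_zero_norm' ?_ (by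
        simpa using (tendsto_zero_iff_norm_tendsto_zero.1 hvlim).const_mul B :
        Tendsto (fun x => B * ‖w x‖) atBot (𝓝 0))
      filter_upwards [eventually_le_atBot X] with x hx
      exact norm_mul_le_of_le (hqB x hx) le_rfl
    have hlim : Tendsto (fun x => (u x - 1) - d • (q x * w x)) atBot (𝓝 0) := by
      simpa using (hulim.sub_const 1).sub (hqw.const_smul d)
    have hGb : ∀ x ≤ X, ‖G x‖ ≤ 9 * ε * B ^ 2 * M * h x := by
      intro x hx
      have hux := (le_max_left _ _).trans (hM x hx)
      have hwx := (le_max_right _ _).trans (hM x hx)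
      have hM0 : 0 ≤ M := (norm_nonneg _).trans hux
      have hhx := hh0 x hx
      have e1 : ‖-(c • ((q x * p x - k • 1) * u x))‖ ≤ ε * (h x * M) := by
        rw [norm_neg, norm_smul, hcn]; gcongr; exact norm_mul_le_of_le (h2 x hx) hux
      have e2 : ‖d • (qx x * w x + q x * F x)‖
          ≤ 2 * ε * (h x * M + B * (3 * ε * B * M * h x)) := by
        rw [norm_smul]
        gcongr
        exact (norm_add_le _ _).trans (add_le_add (norm_mul_le_of_le (h3 x hx) hwx)
          (norm_mul_le_of_le (hqB x hx) (hFb M hM x hx)))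
      have e3 : ‖G x‖ ≤ _ := (norm_sub_le _ _).trans (add_le_add e1 e2)
      have e5 : 0 ≤ ε * (h x * M) := by positivity
      have e6 : ε * (h x * M) ≤ ε * (h x * M) * B ^ 2 :=
        le_mul_of_one_le_right e5 (by nlinarith)
      have e7 : ε * (ε * (h x * M) * B ^ 2) ≤ ε * (h x * M) * B ^ 2 :=
        mul_le_of_le_one_left (by positivity) hε1
      have e8 : 2 * ε * (h x * M + B * (3 * ε * B * M * h x))
          = 2 * (ε * (h x * M)) + 6 * (ε * (ε * (h x * M) * B ^ 2)) := by ring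
      have e9 : 9 * ε * B ^ 2 * M * h x = 9 * (ε * (h x * M) * B ^ 2) := by ring
      rw [e8] at e3
      rw [e9]
      linarith
    have e1 := norm_le_integral_source (a := 0) (by simp) hGd hGc hlim
      (hh.const_mul (9 * ε * B ^ 2 * M)) hGb hx
    rw [integral_const_mul, ← hI₀] at e1
    have hwx := (le_max_right _ _).trans (hM x hx)
    have e2 : ‖d • (q x * w x)‖ ≤ 2 * ε * (B * M) := by
      rw [norm_smul]; gcongr; exact norm_mul_le_of_le (hqB x hx) hwx
    have e3 : ‖u x - 1‖ ≤ ‖(u x - 1) - d • (q x * w x)‖ + ‖d • (q x * w x)‖ := by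
      have := norm_add_le ((u x - 1) - d • (q x * w x)) (d • (q x * w x))
      rwa [sub_add_cancel] at this
    linarith
  -- Bootstrap: any bound `M` for `u` and `w` improves to `B + M/2`, so the supremum is at most
  -- `2B`. Finiteness of some bound, needed to start, comes from the limits at `-∞`.
  have hM : ∀ x ∈ Set.Iic X, max ‖u x‖ ‖w x‖ ≤ 2 * B := by
    refine le_two_mul_of_le_half ⟨X, Set.mem_Iic.2 le_rfl⟩ ?_ ?_
    · obtain ⟨Mu, hMu⟩ := exists_bound_Iic huc hulim X
      obtain ⟨Mw, hMw⟩ := exists_bound_Iic hwc hvlim X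
      exact ⟨max Mu Mw, fun s hs => max_le_max (hMu s hs) (hMw s hs)⟩
    · intro M hM x hx
      have hM0 : 0 ≤ M := (norm_nonneg _).trans ((le_max_left _ _).trans (hM x hx))
      have e1 := hub M hM x hx
      have e2 := hwb M hM x hx
      have e3 : ‖u x‖ ≤ ‖u x - 1‖ + ‖(1 : A)‖ := by
        have := norm_add_le (u x - 1) 1
        rwa [sub_add_cancel] at this
      have e4 : ε * K1 * M ≤ 1 / 2 * M := by gcongr
      have e5 : ε * K1 * M = ε * (9 * B ^ 2 * I₀ + 2 * B) * M + 3 * ε * B * M * I₀ := by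
        rw [hK1]; ring
      have e6 : 0 ≤ 3 * ε * B * M * I₀ := by positivity
      have e7 : 0 ≤ ε * (9 * B ^ 2 * I₀ + 2 * B) * M := by positivity
      refine max_le ?_ ?_ <;> linarith
  have hu1 : ‖u X - 1‖ ≤ ε * (K1 * (2 * B)) := by
    refine (hub _ hM X le_rfl).trans ?_
    have : 0 ≤ ε * (3 * B * I₀) * (2 * B) := by positivity
    have e1 : ε * (9 * B ^ 2 * I₀ + 2 * B) * (2 * B) + ε * (3 * B * I₀) * (2 * B)
        = ε * (K1 * (2 * B)) := by rw [hK1]; ring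
    linarith
  have hwb' : ∀ x ≤ X, ‖w x‖ ≤ ε * (6 * B ^ 2 * I₀) := fun x hx =>
    (hwb _ hM x hx).trans (le_of_eq (by ring))
  have hUb : ∀ x ≤ X, ‖U x‖ ≤ D := fun x hx => by
    have hux := (le_max_left _ _).trans (hM x hx)
    have hwx := (le_max_right _ _).trans (hM x hx)
    have e1 : ‖q x * w x‖ ≤ B * (2 * B) := norm_mul_le_of_le (hqB x hx) hwx
    have e2 : ‖(q x * p x - k • 1) * u x‖ ≤ (B * B + ‖k‖ * B) * (2 * B) := by
      refine norm_mul_le_of_le ((norm_sub_le _ _).trans (add_le_add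
        (norm_mul_le_of_le (hqB x hx) (hpB x hx)) ?_)) hux
      rw [norm_smul]; gcongr
    have e3 : ‖c • ((q x * p x - k • 1) * u x)‖ ≤ (B * B + ‖k‖ * B) * (2 * B) := by
      rw [norm_smul, hcn]
      exact (mul_le_of_le_one_left (norm_nonneg _) hε1).trans e2
    exact (norm_sub_le (q x * w x) (c • ((q x * p x - k • 1) * u x))).trans (add_le_add e1 e3)
  -- The term `c px u` of `F` is only of order `1/|z|`. Adding `c d px u` to `w` moves the
  -- derivative onto `px u` and leaves a source of order `1/|z|²`; this is where the second
  -- derivative of the potential is needed.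
  set F2 : ℝ → A := fun x => c • ((p x * q x - k • 1) * w x)
    - (c ^ 2) • (p x * ((q x * p x - k • 1) * u x)) + (c * d) • (pxx x * u x + px x * U x) with hF2
  have hyd : ∀ x, HasDerivAt (fun x => w x + (c * d) • (px x * u x))
      (a • (w x + (c * d) • (px x * u x)) + F2 x) x := fun x => by
    refine ((hwd x).add (((hpx x).mul (hud x)).const_smul (c * d))).congr_deriv ?_
    have : a • (c * d) • (px x * u x) = c • (px x * u x) := by
      rw [smul_smul, hd]; congr 1; field_simp
    rw [smul_add a (w x) ((c * d) • (px x * u x)), this]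
    simp only [hF, hF2]
    abel
  have hF2c : Continuous F2 := by fun_prop
  have hylim : Tendsto (fun x => w x + (c * d) • (px x * u x)) atBot (𝓝 0) := by
    simpa using hvlim.add ((hpxlim.mul hulim).const_smul (c * d))
  have hF2b : ∀ x ≤ X, ‖F2 x‖ ≤ ε ^ 2 * (6 * B ^ 2 * I₀ + 2 * B ^ 2 + 4 * B + 2 * D) * h x := by
    intro x hx
    have hux := (le_max_left _ _).trans (hM x hx)
    have hhx := hh0 x hx
    have e1 : ‖c • ((p x * q x - k • 1) * w x)‖ ≤ ε * (h x * (ε * (6 * B ^ 2 * I₀))) := by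
      rw [norm_smul, hcn]; gcongr; exact norm_mul_le_of_le (h1 x hx) (hwb' x hx)
    have e3 : ‖(c ^ 2) • (p x * ((q x * p x - k • 1) * u x))‖ ≤ ε ^ 2 * (B * (h x * (2 * B))) := by
      rw [norm_smul, norm_pow, hcn]; gcongr
      exact norm_mul_le_of_le (hpB x hx) (norm_mul_le_of_le (h2 x hx) hux)
    have e4 : ‖(c * d) • (pxx x * u x + px x * U x)‖ ≤ ε * (2 * ε) * (h x * (2 * B) + h x * D) := by
      rw [norm_smul, norm_mul, hcn]; gcongr
      exact (norm_add_le _ _).trans (add_le_add (norm_mul_le_of_le (h5 x hx) hux)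
        (norm_mul_le_of_le (h4 x hx) (hUb x hx)))
    have e5 := (norm_add_le (c • ((p x * q x - k • 1) * w x)
      - (c ^ 2) • (p x * ((q x * p x - k • 1) * u x))) _).trans
      (add_le_add ((norm_sub_le _ _).trans (add_le_add e1 e3)) e4)
    refine e5.trans (le_of_eq ?_)
    ring
  have hy := norm_le_integral_source hare hyd hF2c hylim (hh.const_mul _) hF2b le_rfl
  rw [integral_const_mul, ← hI₀] at hy
  have hwX : ‖w X‖ ≤ ε ^ 2 * (I₀ * (6 * B ^ 2 * I₀ + 2 * B ^ 2 + 4 * B + 2 * D) + 4 * B ^ 2) := by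
    have hux := (le_max_left _ _).trans (hM X (Set.mem_Iic.2 le_rfl))
    have e1 : ‖(c * d) • (px X * u X)‖ ≤ ε * (2 * ε) * (B * (2 * B)) := by
      rw [norm_smul, norm_mul, hcn]; gcongr
      exact norm_mul_le_of_le (hpxB X le_rfl) hux
    have e2 := norm_sub_le (w X + (c * d) • (px X * u X)) ((c * d) • (px X * u X))
    rw [add_sub_cancel_right] at e2
    refine (e2.trans (add_le_add hy e1)).trans (le_of_eq ?_)
    ring
  have hC20' : 0 ≤ K1 * (2 * B) := by positivity
  constructor
  · rw [div_eq_inv_mul]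
    refine hu1.trans ?_
    gcongr
    linarith
  · have e1 : v X + c • p X = w X - c • (p X * (u X - 1)) := by
      rw [hvw]; simp only [mul_sub, mul_one, smul_sub]; abel
    have e2 : ‖c • (p X * (u X - 1))‖ ≤ ε * (B * (ε * (K1 * (2 * B)))) := by
      rw [norm_smul, hcn]; gcongr; exact norm_mul_le_of_le (hpB X le_rfl) hu1
    rw [e1, div_eq_inv_mul, ← inv_pow]
    refine ((norm_sub_le _ _).trans (add_le_add hwX e2)).trans ?_
    have : 0 ≤ ε ^ 2 * (K1 * (2 * B)) := by positivity
    rw [hC2]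
    have e3 : ε ^ 2 * (K1 * (2 * B) + (I₀ * (6 * B ^ 2 * I₀ + 2 * B ^ 2 + 4 * B + 2 * D)
        + 4 * B ^ 2 + B * (K1 * (2 * B)))) = ε ^ 2 * (K1 * (2 * B)) + (ε ^ 2 * (I₀ *
        (6 * B ^ 2 * I₀ + 2 * B ^ 2 + 4 * B + 2 * D) + 4 * B ^ 2)
        + ε * (B * (ε * (K1 * (2 * B))))) := by ring
    rw [e3]
    linarith

end LargeParameterAlgebra

end MMKdV

namespace MMKdV

/-! ### Large-`z` asymptotics of the Jost functions of the Lax pair -/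

section LargeZ

variable {m : ℕ} {k₀ : ℝ} {Q : ℝ → ℝ → Sq m} {Qm Qp : Sq m} {z : ℂ}

/-- The diagonal coefficients are `i(λ - k) = i k₀²/z` and `i(λ + k) = iz`: the upper block varies
slowly and the lower one rapidly, which is the system treated in `large_parameter`. -/
theorem toRows_laxM_mul (hz : z ≠ 0) (x t : ℝ) (f : Col m) :
    ((laxM k₀ Q z x t + (Complex.I * lam k₀ z) • 1) * f).toRows₁
      = (Complex.I * (k₀ : ℂ) ^ 2 / z) • f.toRows₁ + Q x t * f.toRows₂ ∧
    ((laxM k₀ Q z x t + (Complex.I * lam k₀ z) • 1) * f).toRows₂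
      = (Complex.I * z) • f.toRows₂ - (Q x t)ᴴ * f.toRows₁ := by
  have h1 : laxM k₀ Q z x t + (Complex.I * lam k₀ z) • 1
      = Matrix.fromBlocks ((Complex.I * (k₀ : ℂ) ^ 2 / z) • 1) (Q x t) (-(Q x t)ᴴ)
        ((Complex.I * z) • 1) := by
    rw [laxM, sigma3, under, ← Matrix.fromBlocks_one, Matrix.fromBlocks_smul,
      Matrix.fromBlocks_smul, Matrix.fromBlocks_add, Matrix.fromBlocks_add]
    have e1 := lam_sub_kz (k₀ := k₀) z
    have e2 := lam_add_kz (k₀ := k₀) z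
    rw [Matrix.fromBlocks_inj]
    refine ⟨?_, by simp, by simp, ?_⟩
    · rw [mul_div_assoc, ← e1]; module
    · nth_rw 3 [← e2]; module
  have h2 : (laxM k₀ Q z x t + (Complex.I * lam k₀ z) • 1) * f = Matrix.fromRows
      ((Complex.I * (k₀ : ℂ) ^ 2 / z) • f.toRows₁ + Q x t * f.toRows₂)
      ((Complex.I * z) • f.toRows₂ - (Q x t)ᴴ * f.toRows₁) := by
    conv_lhs => rw [h1, ← Matrix.fromRows_toRows f]
    rw [Matrix.fromBlocks_mul_fromRows]
    congr 1
    · rw [Matrix.smul_mul, Matrix.one_mul]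
    · rw [Matrix.smul_mul, Matrix.one_mul, Matrix.neg_mul]; abel
  rw [h2, Matrix.toRows₁_fromRows, Matrix.toRows₂_fromRows]
  exact ⟨rfl, rfl⟩

theorem norm_conjTranspose_le (A : Sq m) : ‖Aᴴ‖ ≤ (m * m : ℝ) * ‖A‖ := by
  have h : ∀ i j, ‖Aᴴ i j‖ ≤ ‖A‖ := fun i j => by
    rw [Matrix.conjTranspose_apply, norm_star]; exact norm_entry_le A j i
  simpa [mul_assoc] using norm_matrix_le_of_entry_le h

theorem hasDerivAt_conjTranspose {f : ℝ → Sq m} {f' : Sq m} {x : ℝ} (h : HasDerivAt f f' x) :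
    HasDerivAt (fun y => (f y)ᴴ) f'ᴴ x :=
  hasDerivAt_matrix.2 fun i j => (hasDerivAt_matrix.1 h j i).star

namespace IsPotential

variable (hQ : IsPotential k₀ Q Qm Qp)
include hQ

theorem tendsto_dx_minus (t : ℝ) : Tendsto (fun x => dx Q x t) atBot (𝓝 0) := by
  obtain ⟨e, he, hb⟩ := hQ.exists_modulus_left |t|
  refine squeeze_zero_norm' ?_ he
  filter_upwards [eventually_le_atBot 0] with x hx using (hb t le_rfl x hx).2.1

theorem WHat_large (x t : ℝ) : ∃ C R : ℝ, 0 ≤ C ∧ 1 ≤ R ∧ ∀ z ∈ Omega k₀, R ≤ ‖z‖ →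
    ‖(WHat k₀ Q Qm x t z).toRows₁ - 1‖ ≤ C / ‖z‖ ∧
    ‖(WHat k₀ Q Qm x t z).toRows₂ + (Complex.I / z) • (Q x t)ᴴ‖ ≤ C / ‖z‖ ^ 2 := by
  set c : ℝ := (m * m : ℝ) with hc
  have hc0 : 0 ≤ c := by positivity
  have hpt : Continuous fun x : ℝ => (x, t) := by fun_prop
  have c0 : Continuous fun x => Q x t := hQ.continuous₀.comp hpt
  have c1 : Continuous fun x => dx Q x t := hQ.continuous₁.comp hpt
  have c2 : Continuous fun x => dx (dx Q) x t := hQ.continuous₂.comp hpt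
  obtain ⟨B0, hB0⟩ := exists_bound_Iic c0 (hQ.tendsto_minus t) x
  obtain ⟨B1, hB1⟩ := exists_bound_Iic c1 (hQ.tendsto_dx_minus t) x
  obtain ⟨i0, i1, i2⟩ := hQ.integrableOn_left t
  have i0' : IntegrableOn (fun s => ‖Q s t - Qm‖) (Set.Iic x) := by
    refine integrableOn_Iic_of_continuous (a := 0) (by fun_prop) ?_ x
    refine Integrable.mono' i0 ((by fun_prop :
      Continuous fun s => ‖Q s t - Qm‖).aestronglyMeasurable) (Eventually.of_forall fun s => ?_)
    rw [norm_norm]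
    have := mul_nonneg (abs_nonneg s) (norm_nonneg (Q s t - Qm))
    linarith
  have i1' := integrableOn_Iic_of_continuous (by fun_prop) i1 x
  have i2' := integrableOn_Iic_of_continuous (by fun_prop) i2 x
  set D : ℝ := 2 * (c * (|B0| + ‖Qm‖)) + 0 with hD
  set h : ℝ → ℝ := fun s => D * ‖Q s t - Qm‖ + (1 + c) * ‖dx Q s t‖ + c * ‖dx (dx Q) s t‖ with hh
  have hhi : IntegrableOn h (Set.Iic x) :=
    ((i0'.const_mul D).add (i1'.const_mul (1 + c))).add (i2'.const_mul c)
  set B : ℝ := 1 + ‖(1 : Sq m)‖ + (1 + c) * |B0| + c * |B1| with hB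
  have hD0 : 0 ≤ D := by positivity
  have hp0 : ∀ s, 0 ≤ D * ‖Q s t - Qm‖ := fun s => by positivity
  have hp1 : ∀ s, 0 ≤ c * ‖dx Q s t‖ := fun s => by positivity
  have hp2 : ∀ s, 0 ≤ c * ‖dx (dx Q) s t‖ := fun s => by positivity
  have hp3 : 0 ≤ c * |B0| := by positivity
  have hp4 : 0 ≤ c * |B1| := by positivity
  have hp5 := norm_nonneg (1 : Sq m)
  have hq0 : ∀ s ≤ x, ‖Q s t‖ ≤ |B0| := fun s hs => (hB0 s hs).trans (le_abs_self _)
  -- Unitarity of `Qm` makes this defect linear in `Q - Qm`, hence integrable at `-∞`.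
  have hQQ : ∀ s ≤ x, ‖(Q s t)ᴴ * Q s t - ((k₀ : ℂ) ^ 2) • 1‖ ≤ D * ‖Q s t - Qm‖ := by
    intro s hs
    have e1 : (Q s t)ᴴ * Q s t - ((k₀ : ℂ) ^ 2) • 1
        = (Q s t - Qm)ᴴ * Q s t + Qmᴴ * (Q s t - Qm) := by
      rw [← hQ.unitary_minus.2, Matrix.conjTranspose_sub]; noncomm_ring
    rw [e1]
    have e2 := norm_mul_le_of_le (norm_conjTranspose_le (Q s t - Qm)) (hq0 s hs)
    have e3 := norm_mul_le_of_le (norm_conjTranspose_le Qm) (le_refl ‖Q s t - Qm‖)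
    have e4 : 0 ≤ c * |B0| * ‖Q s t - Qm‖ := by positivity
    have e5 : 0 ≤ c * ‖Qm‖ * ‖Q s t - Qm‖ := by positivity
    have e6 := (norm_add_le _ _).trans (add_le_add e2 e3)
    refine e6.trans ?_
    rw [hD]; linarith
  have hQQ' : ∀ s ≤ x, ‖Q s t * (Q s t)ᴴ - ((k₀ : ℂ) ^ 2) • 1‖ ≤ D * ‖Q s t - Qm‖ := by
    intro s hs
    have e1 : Q s t * (Q s t)ᴴ - ((k₀ : ℂ) ^ 2) • 1
        = Q s t * (Q s t - Qm)ᴴ + (Q s t - Qm) * Qmᴴ := by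
      rw [← hQ.unitary_minus.1, Matrix.conjTranspose_sub]; noncomm_ring
    rw [e1]
    have e2 := norm_mul_le_of_le (hq0 s hs) (norm_conjTranspose_le (Q s t - Qm))
    have e3 := norm_mul_le_of_le (le_refl ‖Q s t - Qm‖) (norm_conjTranspose_le Qm)
    have e4 : 0 ≤ c * |B0| * ‖Q s t - Qm‖ := by positivity
    have e5 : 0 ≤ c * ‖Qm‖ * ‖Q s t - Qm‖ := by positivity
    have e6 := (norm_add_le _ _).trans (add_le_add e2 e3)
    refine e6.trans ?_
    rw [hD]; linarith
  have hctl : Tendsto (fun s => (dx Q s t)ᴴ) atBot (𝓝 0) := by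
    have := (continuous_id.matrix_conjTranspose.tendsto (0 : Sq m)).comp (hQ.tendsto_dx_minus t)
    simpa only [Function.comp_def, id, Matrix.conjTranspose_zero] using this
  obtain ⟨C, R, hC, hR, key⟩ := large_parameter (A := Sq m) (q := fun s => Q s t)
    (p := fun s => (Q s t)ᴴ) (qx := fun s => dx Q s t) (px := fun s => (dx Q s t)ᴴ)
    (pxx := fun s => (dx (dx Q) s t)ᴴ) (k := (k₀ : ℂ) ^ 2) (X := x) (B := B) (h := h)
    (by rw [hB]; nlinarith [abs_nonneg B0])
    (fun s => hQ.hasDerivAt₀ s t) (fun s => hasDerivAt_conjTranspose (hQ.hasDerivAt₀ s t))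
    (fun s => hasDerivAt_conjTranspose (hQ.hasDerivAt₁ s t)) c1 c2.matrix_conjTranspose hctl
    (by rw [hB]; nlinarith [abs_nonneg B0])
    (fun s hs => by
      have := hq0 s hs
      rw [hB]; nlinarith)
    (fun s hs => by
      have e1 := (norm_conjTranspose_le (Q s t)).trans (mul_le_mul_of_nonneg_left (hq0 s hs) hc0)
      rw [hB]; nlinarith [abs_nonneg B0])
    (fun s hs => by
      have e1 := (norm_conjTranspose_le (dx Q s t)).trans (mul_le_mul_of_nonneg_left
        ((hB1 s hs).trans (le_abs_self _)) hc0)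
      rw [hB]; nlinarith [abs_nonneg B0])
    hhi
    (fun s hs => (hQQ s hs).trans (by
      have := hp1 s; have := hp2 s; have := norm_nonneg (dx Q s t)
      simp only [hh]; linarith))
    (fun s hs => (hQQ' s hs).trans (by
      have := hp1 s; have := hp2 s; have := norm_nonneg (dx Q s t)
      simp only [hh]; linarith))
    (fun s hs => by
      have := hp0 s; have := hp1 s; have := hp2 s
      simp only [hh]; linarith)
    (fun s hs => (norm_conjTranspose_le _).trans (by
      have := hp0 s; have := hp2 s; have := norm_nonneg (dx Q s t)
      simp only [hh]; linarith))
    (fun s hs => (norm_conjTranspose_le _).trans (by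
      have := hp0 s; have := hp1 s; have := norm_nonneg (dx Q s t)
      simp only [hh]; linarith))
  refine ⟨C, R, hC, hR, fun z hz hzR => ?_⟩
  have hz0 := hz.2.1
  have hW := fun x => hQ.WHat_hasDerivAt hz x t
  have hlim := (hQ.phi_spec hz).2 t
  rw [asymE_toCols₁] at hlim
  have hlim1 : Tendsto (fun x => (WHat k₀ Q Qm x t z).toRows₁) atBot (𝓝 1) :=
    tendsto_matrix.2 fun i j => tendsto_matrix.1 hlim (Sum.inl i) j
  have hlim2 : Tendsto (fun x => (WHat k₀ Q Qm x t z).toRows₂) atBot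
      (𝓝 (-(Complex.I / z) • Qmᴴ)) :=
    tendsto_matrix.2 fun i j => tendsto_matrix.1 hlim (Sum.inr i) j
  refine key z (lam k₀ z) hzR (two_mul_lam_mul hz0) (lam_im_nonneg hz0 hz.1)
    (fun x => (WHat k₀ Q Qm x t z).toRows₁) (fun x => (WHat k₀ Q Qm x t z).toRows₂)
    (fun x => ?_) (fun x => ?_) hlim1 ?_
  · rw [← (toRows_laxM_mul hz0 x t _).1]
    exact hasDerivAt_matrix.2 fun i j => hasDerivAt_matrix.1 (hW x) (Sum.inl i) j
  · rw [← (toRows_laxM_mul hz0 x t _).2]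
    exact hasDerivAt_matrix.2 fun i j => hasDerivAt_matrix.1 (hW x) (Sum.inr i) j
  · have h1 : Tendsto (fun x => (Q x t)ᴴ) atBot (𝓝 Qmᴴ) :=
      (continuous_id.matrix_conjTranspose.tendsto Qm).comp (hQ.tendsto_minus t)
    have h2 := hlim2.add ((tendsto_mul_matrix h1 hlim1).const_smul (Complex.I / z))
    rw [Matrix.mul_one, neg_smul, neg_add_cancel] at h2
    exact h2

theorem VHat_large (x t : ℝ) : ∃ C R : ℝ, 0 ≤ C ∧ 1 ≤ R ∧ ∀ z ∈ Omega k₀, R ≤ ‖z‖ →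
    ‖(VHat k₀ Q Qp x t z).toRows₂ - 1‖ ≤ C / ‖z‖ ∧
    ‖(VHat k₀ Q Qp x t z).toRows₁ + (Complex.I / z) • Q x t‖ ≤ C / ‖z‖ ^ 2 := by
  obtain ⟨C, R, hC, hR, h⟩ := hQ.refl.WHat_large (-x) (-t)
  refine ⟨C, R, hC, hR, fun z hz hzR => ?_⟩
  have h1 := h z hz hzR
  rw [hQ.VHat_eq_refl hz, symJ_mul_eq, Matrix.fromRows_neg, Matrix.toRows₁_fromRows,
    Matrix.toRows₂_fromRows]
  have e1 : (MMKdV.refl Q (-x) (-t))ᴴ = -Q x t := by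
    rw [MMKdV.refl, neg_neg, neg_neg, Matrix.conjTranspose_neg, cj_conjTranspose, hQ.symm]
  rw [e1, smul_neg] at h1
  refine ⟨by rw [neg_neg]; exact h1.1, ?_⟩
  have e2 := h1.2
  rw [← norm_neg, neg_add, neg_neg] at e2
  exact e2

end IsPotential

end LargeZ

end MMKdV

namespace MMKdV

/-! ### The functions `a`, `Ŵ a⁻¹` and `V̂` near infinity and near the origin -/

section Transmission

variable {m : ℕ} {k₀ : ℝ} {Q : ℝ → ℝ → Sq m} {Qm Qp : Sq m} {z : ℂ}

theorem norm_transpose_le (A : Sq m) : ‖Aᵀ‖ ≤ (m * m : ℝ) * ‖A‖ := by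
  refine (norm_matrix_le_of_entry_le (c := ‖A‖)
    fun i j => norm_entry_le A j i).trans (le_of_eq ?_)
  simp [mul_assoc]

theorem isBigO_transpose {α : Type*} {l : Filter α} {f : α → Sq m} {g : α → ℂ}
    (h : f =O[l] g) : (fun a => (f a)ᵀ) =O[l] g :=
  (IsBigO.of_bound (m * m : ℝ) (Eventually.of_forall fun a => norm_transpose_le (f a))).trans h

theorem isBigO_cj {α : Type*} {l : Filter α} {f : α → Sq m} {g : α → ℂ}
    (h : f =O[l] g) : (fun a => cj (f a)) =O[l] g :=
  (IsBigO.of_bound 1 (Eventually.of_forall fun a => by rw [norm_cj, one_mul])).trans h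

/-- Neighbourhoods of infinity in `Ω`. -/
noncomputable def atInf (k₀ : ℝ) : Filter ℂ := Bornology.cobounded ℂ ⊓ 𝓟 (Omega k₀)

theorem eventually_mem_atInf : ∀ᶠ z in atInf k₀, z ∈ Omega k₀ :=
  mem_inf_of_right (mem_principal_self _)

theorem eventually_le_norm_atInf (R : ℝ) : ∀ᶠ z in atInf k₀, R ≤ ‖z‖ :=
  mem_inf_of_left ((tendsto_norm_cobounded_atTop.eventually_ge_atTop R))

theorem tendsto_inv_atInf : Tendsto (fun z : ℂ => z⁻¹) (atInf k₀) (𝓝 0) :=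
  (tendsto_inv₀_cobounded).mono_left inf_le_left

theorem isBigO_inv_one : (fun z : ℂ => z⁻¹) =O[atInf k₀] (fun _ => (1 : ℂ)) :=
  tendsto_inv_atInf.isBigO_one ℂ

theorem isBigO_inv_sq : (fun z : ℂ => (z ^ 2)⁻¹) =O[atInf k₀] (fun z : ℂ => z⁻¹) := by
  have h := (isBigO_refl (fun z : ℂ => z⁻¹) (atInf k₀)).mul (isBigO_inv_one (k₀ := k₀))
  refine (h.congr (fun z => ?_) fun z => ?_)
  · rw [pow_two, mul_inv]
  · rw [mul_one]

theorem isBigO_of_bound_atInf {f : ℂ → Sq m} {n : ℕ} {C R : ℝ}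
    (h : ∀ z ∈ Omega k₀, R ≤ ‖z‖ → ‖f z‖ ≤ C / ‖z‖ ^ n) :
    f =O[atInf k₀] (fun z => (z ^ n)⁻¹) := by
  refine IsBigO.of_bound C ?_
  filter_upwards [eventually_mem_atInf, eventually_le_norm_atInf R] with z h1 h2
  refine (h z h1 h2).trans (le_of_eq ?_)
  rw [norm_inv, norm_pow, div_eq_mul_inv]

/-- Asymptotics at the origin are those at infinity pulled back along this map, so the limit `z → 0`
of the Volterra equation is never examined. -/
theorem tendsto_conj_flip (hk : 0 < k₀) :
    Tendsto (fun z => starRingEnd ℂ (flip k₀ z)) (𝓝[Omega k₀] 0) (atInf k₀) := by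
  refine tendsto_inf.2 ⟨?_, tendsto_principal.2 ?_⟩
  · rw [← tendsto_norm_atTop_iff_cobounded]
    have h : Tendsto (fun z : ℂ => k₀ ^ 2 * ‖z‖⁻¹) (𝓝[Omega k₀] 0) atTop := by
      refine Tendsto.const_mul_atTop (by positivity) ?_
      refine tendsto_inv_nhdsGT_zero.comp (tendsto_nhdsWithin_iff.2 ⟨?_, ?_⟩)
      · have := (continuous_norm (E := ℂ)).tendsto 0
        rw [norm_zero] at this
        exact this.mono_left nhdsWithin_le_nhds
      · filter_upwards [self_mem_nhdsWithin] with z hz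
        exact norm_pos_iff.2 hz.2.1
    refine h.congr fun z => ?_
    rw [RCLike.norm_conj, norm_flip, div_eq_mul_inv]
  · filter_upwards [self_mem_nhdsWithin] with z hz
    exact conj_flip_mem_Omega hk hz

theorem I_mul_conj_flip (hk : 0 < k₀) (z : ℂ) :
    starRingEnd ℂ (Complex.I * starRingEnd ℂ (flip k₀ z) / (k₀ : ℂ) ^ 2) = Complex.I / z := by
  have : (k₀ : ℂ) ≠ 0 := by exact_mod_cast hk.ne'
  simp only [map_div₀, map_mul, map_pow, Complex.conj_I, Complex.conj_ofReal, Complex.conj_conj,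
    flip]
  by_cases hz : z = 0
  · simp [hz]
  · field_simp

theorem isBigO_I_div_mul_conj_flip (hk : 0 < k₀) :
    (fun z => (Complex.I / z) * (((starRingEnd ℂ (flip k₀ z))⁻¹) * 1))
      =O[𝓝[Omega k₀] 0] (fun _ => (1 : ℂ)) := by
  refine IsBigO.of_bound (k₀ ^ 2)⁻¹ ?_
  filter_upwards [self_mem_nhdsWithin] with z hz
  have : 0 < ‖z‖ := norm_pos_iff.2 hz.2.1
  rw [norm_mul, norm_div, Complex.norm_I, mul_one, norm_inv, RCLike.norm_conj, norm_flip,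
    norm_one]
  refine le_of_eq ?_
  field_simp

namespace IsPotential

variable (h : IsPotential k₀ Q Qm Qp)

section
include h

theorem WHat_isBigO (x t : ℝ) :
    (fun z => (WHat k₀ Q Qm x t z).toRows₁ - 1) =O[atInf k₀] (fun z : ℂ => z⁻¹) ∧
    (fun z => (WHat k₀ Q Qm x t z).toRows₂ + (Complex.I / z) • (Q x t)ᴴ) =O[atInf k₀]
      (fun z : ℂ => (z ^ 2)⁻¹) := by
  obtain ⟨C, R, -, -, hC⟩ := h.WHat_large x t
  refine ⟨?_, isBigO_of_bound_atInf fun z hz hR => (hC z hz hR).2⟩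
  refine (isBigO_of_bound_atInf (n := 1) (C := C) (R := R) fun z hz hR => ?_).congr_right
    fun z => by rw [pow_one]
  rw [pow_one]; exact (hC z hz hR).1

theorem VHat_isBigO (x t : ℝ) :
    (fun z => (VHat k₀ Q Qp x t z).toRows₂ - 1) =O[atInf k₀] (fun z : ℂ => z⁻¹) ∧
    (fun z => (VHat k₀ Q Qp x t z).toRows₁ + (Complex.I / z) • Q x t) =O[atInf k₀]
      (fun z : ℂ => (z ^ 2)⁻¹) := by
  obtain ⟨C, R, -, -, hC⟩ := h.VHat_large x t
  refine ⟨?_, isBigO_of_bound_atInf fun z hz hR => (hC z hz hR).2⟩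
  refine (isBigO_of_bound_atInf (n := 1) (C := C) (R := R) fun z hz hR => ?_).congr_right
    fun z => by rw [pow_one]
  rw [pow_one]; exact (hC z hz hR).1

end

theorem isBigO_smul_const (A : Sq m) :
    (fun z : ℂ => (Complex.I / z) • A) =O[atInf k₀] (fun z : ℂ => z⁻¹) := by
  refine IsBigO.of_bound ‖A‖ (Eventually.of_forall fun z => ?_)
  rw [norm_smul, norm_div, Complex.norm_I, norm_inv, one_div, mul_comm]

theorem isBigO_of_sub {f g : ℂ → Sq m} (hf : (fun z => f z - g z) =O[atInf k₀] (fun z : ℂ => z⁻¹))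
    {b : ℂ → ℂ} (hg : g =O[atInf k₀] b) (hb : (fun z : ℂ => z⁻¹) =O[atInf k₀] b) :
    f =O[atInf k₀] b :=
  ((hf.trans hb).add hg).congr_left fun z => sub_add_cancel _ _

include h

/-- In the pairing, the lower block of `V̂` meets the upper block of `Ŵ`, both close to the
identity; the other product is of two blocks of order `1/z`, and `γ` is `1 + O(z⁻²)`. -/
theorem aPlus_isBigO :
    (fun z => aPlus k₀ Q Qm Qp z - 1) =O[atInf k₀] (fun z : ℂ => z⁻¹) := by
  obtain ⟨hW1, hW2⟩ := h.WHat_isBigO 0 0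
  obtain ⟨hV2, hV1⟩ := h.VHat_isBigO 0 0
  have hone : (fun _ : ℂ => (1 : Sq m)) =O[atInf k₀] (fun _ => (1 : ℂ)) := isBigO_const_const _ one_ne_zero _
  have hW2' : (fun z => (WHat k₀ Q Qm 0 0 z).toRows₂) =O[atInf k₀] (fun z : ℂ => z⁻¹) :=
    ((hW2.trans isBigO_inv_sq).sub (isBigO_smul_const (Q 0 0)ᴴ)).congr_left fun z =>
      add_sub_cancel_right _ _
  have hV1' : (fun z => (VHat k₀ Q Qp 0 0 z).toRows₁) =O[atInf k₀] (fun z : ℂ => z⁻¹) :=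
    ((hV1.trans isBigO_inv_sq).sub (isBigO_smul_const (Q 0 0))).congr_left fun z =>
      add_sub_cancel_right _ _
  have hV2t := isBigO_transpose hV2
  have hV2b : (fun z => (VHat k₀ Q Qp 0 0 z).toRows₂ᵀ) =O[atInf k₀] (fun _ => (1 : ℂ)) :=
    isBigO_transpose (isBigO_of_sub hV2 hone isBigO_inv_one)
  have hγ : Tendsto (fun z => gam k₀ z) (atInf k₀) (𝓝 1) := by
    have h1 := (tendsto_inv_atInf (k₀ := k₀)).pow 2
    have h2 := (h1.const_mul ((k₀ : ℂ) ^ 2)).const_add 1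
    simp only [ne_eq, OfNat.ofNat_ne_zero, not_false_eq_true, zero_pow, mul_zero, add_zero] at h2
    refine h2.congr fun z => ?_
    rw [gam, inv_pow, div_eq_mul_inv]
  have hγi : (fun z => (gam k₀ z)⁻¹) =O[atInf k₀] (fun _ => (1 : ℂ)) := by
    have := hγ.inv₀ one_ne_zero
    exact this.isBigO_one ℂ
  have hγ1 : (fun z => (gam k₀ z)⁻¹ * (1 - gam k₀ z)) =O[atInf k₀] (fun z : ℂ => z⁻¹) := by
    have h1 : (fun z : ℂ => 1 - gam k₀ z) =O[atInf k₀] (fun z : ℂ => z⁻¹) := by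
      refine (((isBigO_inv_sq (k₀ := k₀)).const_mul_left (-(k₀ : ℂ) ^ 2))).congr_left fun z => ?_
      rw [gam, div_eq_mul_inv]; ring
    exact (hγi.mul h1).congr_right fun z => one_mul _
  have hmain : (fun z => (gam k₀ z)⁻¹ • ((VHat k₀ Q Qp 0 0 z).toRows₂ᵀ *
        ((WHat k₀ Q Qm 0 0 z).toRows₁ - 1) + ((VHat k₀ Q Qp 0 0 z).toRows₂ - 1)ᵀ
        - (VHat k₀ Q Qp 0 0 z).toRows₁ᵀ * (WHat k₀ Q Qm 0 0 z).toRows₂)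
      + ((gam k₀ z)⁻¹ * (1 - gam k₀ z)) • (1 : Sq m)) =O[atInf k₀] (fun z : ℂ => z⁻¹) := by
    refine IsBigO.add ?_ ?_
    · refine ((hγi.smul (((hV2b.mul hW1).congr_right fun z => one_mul _).add hV2t |>.sub
        (((isBigO_transpose hV1').trans isBigO_inv_one).mul hW2' |>.congr_right
          fun z => one_mul _)))).congr_right fun z => ?_
      rw [smul_eq_mul, one_mul]
    · exact (hγ1.smul hone).congr_right fun z => by rw [smul_eq_mul, mul_one]
  refine hmain.congr' ?_ EventuallyEq.rfl
  filter_upwards [eventually_mem_atInf] with z hz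
  have hg := gam_ne_zero hz
  rw [h.aPlus_eq' hz 0 0, wr_eq, Matrix.transpose_sub, Matrix.transpose_one,
    mul_sub, mul_one]
  match_scalars <;> field_simp <;> ring

theorem aPlus_inv_isBigO :
    (fun z => (aPlus k₀ Q Qm Qp z)⁻¹ - 1) =O[atInf k₀] (fun z : ℂ => z⁻¹) ∧
    Tendsto (fun z => (aPlus k₀ Q Qm Qp z)⁻¹) (atInf k₀) (𝓝 1) := by
  have h1 := h.aPlus_isBigO
  have ht : Tendsto (fun z => aPlus k₀ Q Qm Qp z) (atInf k₀) (𝓝 1) := by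
    have := (h1.trans_tendsto tendsto_inv_atInf).add_const 1
    rw [zero_add] at this
    exact this.congr fun z => sub_add_cancel _ _
  have hti : Tendsto (fun z => (aPlus k₀ Q Qm Qp z)⁻¹) (atInf k₀) (𝓝 1) := by
    have hc : ContinuousAt Ring.inverse ((1 : (Sq m)ˣ) : Sq m) := NormedRing.inverse_continuousAt 1
    have h3 := hc.tendsto.comp ht
    rw [Units.val_one, Ring.inverse_one] at h3
    refine h3.congr fun z => ?_
    rw [Matrix.nonsing_inv_eq_ringInverse]; rfl
  refine ⟨?_, hti⟩
  have hev : ∀ᶠ z in atInf k₀, (aPlus k₀ Q Qm Qp z).det ≠ 0 := by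
    have hd : Tendsto (fun z => (aPlus k₀ Q Qm Qp z).det) (atInf k₀) (𝓝 1) := by
      have := ((Continuous.matrix_det continuous_id).tendsto (1 : Sq m)).comp ht
      rw [id, Matrix.det_one] at this
      exact this
    exact hd.eventually_ne one_ne_zero
  have h4 := ((hti.isBigO_one ℂ).mul h1.neg_left).congr_right fun z => one_mul _
  refine h4.congr' ?_ EventuallyEq.rfl
  filter_upwards [hev] with z hz
  rw [neg_sub, mul_sub, mul_one, Matrix.nonsing_inv_mul _ (isUnit_iff_ne_zero.2 hz)]

theorem transmission_isBigO (x t : ℝ) :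
    (fun z => (WHat k₀ Q Qm x t z * (aPlus k₀ Q Qm Qp z)⁻¹).toRows₁ - 1) =O[atInf k₀]
      (fun z : ℂ => z⁻¹) ∧
    (fun z => (WHat k₀ Q Qm x t z * (aPlus k₀ Q Qm Qp z)⁻¹).toRows₂ + (Complex.I / z) • (Q x t)ᴴ)
      =O[atInf k₀] (fun z : ℂ => (z ^ 2)⁻¹) := by
  obtain ⟨hW1, hW2⟩ := h.WHat_isBigO x t
  obtain ⟨ha, hat⟩ := h.aPlus_inv_isBigO
  have hb := hat.isBigO_one ℂ
  constructor
  · refine (((hW1.mul hb).congr_right fun z => mul_one _).add ha).congr_left fun z => ?_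
    change _ = (WHat k₀ Q Qm x t z).toRows₁ * (aPlus k₀ Q Qm Qp z)⁻¹ - 1
    noncomm_ring
  · refine (((hW2.mul hb).congr_right fun z => mul_one _).sub
      (((isBigO_smul_const (Q x t)ᴴ).mul ha).congr_right fun z => ?_)).congr_left fun z => ?_
    · rw [pow_two, mul_inv]
    · change _ = (WHat k₀ Q Qm x t z).toRows₂ * (aPlus k₀ Q Qm Qp z)⁻¹ + _
      noncomm_ring

/-- The factors `Qm` produced by `Ŵ` and by `a⁻¹` cancel, and only `Qp` survives. This is why the
behaviour at the origin, and with it the constant term of the reconstruction formula, involves `Q₊`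
alone. -/
theorem transmission_conj_flip (hk : 0 < k₀) (hz : z ∈ Omega k₀) (x t : ℝ) :
    WHat k₀ Q Qm x t z * (aPlus k₀ Q Qm Qp z)⁻¹
      = kap ((Complex.I * starRingEnd ℂ (flip k₀ z) / (k₀ : ℂ) ^ 2) •
        (WHat k₀ Q Qm x t (starRingEnd ℂ (flip k₀ z)) *
          (aPlus k₀ Q Qm Qp (starRingEnd ℂ (flip k₀ z)))⁻¹ * Qp)) := by
  have hk0 : (k₀ : ℂ) ≠ 0 := by exact_mod_cast hk.ne'
  set w := starRingEnd ℂ (flip k₀ z) with hw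
  have hwz : starRingEnd ℂ (flip k₀ w) = z := by
    rw [hw, flip_conj, flip_flip hk, Complex.conj_conj]
  have hwO : w ∈ Omega k₀ := conj_flip_mem_Omega hk hz
  have e1 := h.WHat_flip hk hwO x t
  have e2 := h.aPlus_flip hk hwO
  rw [hwz] at e1 e2
  have i1 : (Qpᴴ)⁻¹ = ((k₀ : ℂ) ^ 2)⁻¹ • Qp := by
    refine Matrix.inv_eq_right_inv ?_
    rw [Matrix.mul_smul, h.unitary_plus.2, smul_smul, inv_mul_cancel₀ (pow_ne_zero 2 hk0), one_smul]
  have i2 : Qm * Qm⁻¹ = 1 := by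
    refine Matrix.mul_nonsing_inv _ ((Matrix.isUnit_iff_isUnit_det _).1 ?_)
    refine IsUnit.of_mul_eq_one (((k₀ : ℂ) ^ 2)⁻¹ • Qmᴴ) ?_
    rw [mul_smul_comm, h.unitary_minus.1, smul_smul, inv_mul_cancel₀ (pow_ne_zero 2 hk0), one_smul]
  rw [e1, e2, ← cj_inv, ← kap_mul]
  congr 1
  have e3 : (((k₀ : ℂ) ^ 2)⁻¹ • (Qpᴴ * aPlus k₀ Q Qm Qp w * Qm))⁻¹
      = Qm⁻¹ * (aPlus k₀ Q Qm Qp w)⁻¹ * Qp := by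
    have : (((k₀ : ℂ) ^ 2)⁻¹ • (Qpᴴ * aPlus k₀ Q Qm Qp w * Qm))
        = (((k₀ : ℂ) ^ 2)⁻¹ • Qpᴴ) * (aPlus k₀ Q Qm Qp w * Qm) := by
      rw [smul_mul_assoc, Matrix.mul_assoc]
    rw [this, Matrix.mul_inv_rev, Matrix.mul_inv_rev]
    congr 1
    refine Matrix.inv_eq_right_inv ?_
    rw [Matrix.smul_mul, h.unitary_plus.2, smul_smul, inv_mul_cancel₀ (pow_ne_zero 2 hk0), one_smul]
  rw [e3]
  simp only [Matrix.mul_smul, Matrix.smul_mul]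
  congr 1
  calc WHat k₀ Q Qm x t w * Qm * (Qm⁻¹ * (aPlus k₀ Q Qm Qp w)⁻¹ * Qp)
      = WHat k₀ Q Qm x t w * ((Qm * Qm⁻¹) * (aPlus k₀ Q Qm Qp w)⁻¹ * Qp) := by
        simp only [Matrix.mul_assoc]
    _ = _ := by rw [i2, Matrix.one_mul, Matrix.mul_assoc]

/-- Under `kap` the upper block at infinity, which tends to `1`, becomes the lower block at the
origin; the prefactor `i/z` and `Qp` yield the leading term. -/
theorem transmission_isBigO_zero (hk : 0 < k₀) (x t : ℝ) :
    (fun z => (WHat k₀ Q Qm x t z * (aPlus k₀ Q Qm Qp z)⁻¹).toRows₂ + (Complex.I / z) • Qpᴴ)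
      =O[𝓝[Omega k₀] 0] (fun _ => (1 : ℂ)) := by
  have h1 : (fun z : ℂ => cj ((WHat k₀ Q Qm x t (starRingEnd ℂ (flip k₀ z)) *
      (aPlus k₀ Q Qm Qp (starRingEnd ℂ (flip k₀ z)))⁻¹).toRows₁ - 1)) =O[𝓝[Omega k₀] 0]
      (fun z => (starRingEnd ℂ (flip k₀ z))⁻¹) :=
    isBigO_cj ((h.transmission_isBigO x t).1.comp_tendsto (tendsto_conj_flip hk))
  have h2 : (fun z : ℂ => (Complex.I / z) • (cj ((WHat k₀ Q Qm x t (starRingEnd ℂ (flip k₀ z)) *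
      (aPlus k₀ Q Qm Qp (starRingEnd ℂ (flip k₀ z)))⁻¹).toRows₁ - 1) * -Qpᴴ))
      =O[𝓝[Omega k₀] 0] (fun z => (Complex.I / z) * (((starRingEnd ℂ (flip k₀ z))⁻¹) * 1)) :=
    (isBigO_refl (fun z : ℂ => Complex.I / z) _).smul
      (h1.mul (isBigO_const_const _ one_ne_zero _))
  refine (h2.trans (isBigO_I_div_mul_conj_flip hk)).congr' ?_ EventuallyEq.rfl
  filter_upwards [self_mem_nhdsWithin] with z hz
  rw [h.transmission_conj_flip hk hz x t, kap_eq]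
  have : ∀ (c : ℂ) (f : Col m), (c • f).toRows₁ = c • f.toRows₁ := fun _ _ => rfl
  have h' : ∀ (f : Col m) (A : Sq m), (f * A).toRows₁ = f.toRows₁ * A := fun _ _ => rfl
  rw [Matrix.toRows₂_fromRows, this, cj_smul, I_mul_conj_flip hk, h' (_ * _) Qp, cj_mul,
    cj_of_symm h.symm_plus, cj_sub, cj_one, mul_neg, sub_mul, one_mul]
  module

theorem VHat_isBigO_zero (hk : 0 < k₀) (x t : ℝ) :
    (fun z => (VHat k₀ Q Qp x t z).toRows₁ + (Complex.I / z) • Qp)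
      =O[𝓝[Omega k₀] 0] (fun _ => (1 : ℂ)) := by
  have h1 : (fun z : ℂ => cj ((VHat k₀ Q Qp x t (starRingEnd ℂ (flip k₀ z))).toRows₂ - 1))
      =O[𝓝[Omega k₀] 0] (fun z => (starRingEnd ℂ (flip k₀ z))⁻¹) :=
    isBigO_cj ((h.VHat_isBigO x t).1.comp_tendsto (tendsto_conj_flip hk))
  have h2 : (fun z : ℂ => (Complex.I / z) • (cj ((VHat k₀ Q Qp x t
      (starRingEnd ℂ (flip k₀ z))).toRows₂ - 1) * -Qp))
      =O[𝓝[Omega k₀] 0] (fun z => (Complex.I / z) * (((starRingEnd ℂ (flip k₀ z))⁻¹) * 1)) :=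
    (isBigO_refl (fun z : ℂ => Complex.I / z) _).smul
      (h1.mul (isBigO_const_const _ one_ne_zero _))
  refine (h2.trans (isBigO_I_div_mul_conj_flip hk)).congr' ?_ EventuallyEq.rfl
  filter_upwards [self_mem_nhdsWithin] with z hz
  have hwz : starRingEnd ℂ (flip k₀ (starRingEnd ℂ (flip k₀ z))) = z := by
    rw [flip_conj, flip_flip hk, Complex.conj_conj]
  have e1 := h.VHat_flip hk (conj_flip_mem_Omega hk hz) x t
  rw [hwz] at e1
  rw [e1, kap_eq]
  have h0 : ∀ (f : Col m), (-f).toRows₁ = -f.toRows₁ := fun _ => rfl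
  have h' : ∀ (f : Col m) (A : Sq m), (f * A).toRows₂ = f.toRows₂ * A := fun _ _ => rfl
  rw [h0, Matrix.toRows₁_fromRows, h', cj_mul, cj_smul, I_mul_conj_flip hk,
    conjTranspose_cj, h.symm_plus, cj_sub, cj_one, mul_neg, sub_mul, one_mul,
    mul_smul_comm]
  module

end IsPotential

end Transmission

end MMKdV

namespace MMKdV

/-! ### Residues and norming constants -/

section MatrixCalculus

variable {n p q : Type*} [Fintype n] [Fintype p] [Fintype q]

theorem hasDerivAt_matrix_complex {f : ℂ → Matrix n p ℂ} {f' : Matrix n p ℂ} {w : ℂ} :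
    HasDerivAt f f' w ↔ ∀ i j, HasDerivAt (fun z => f z i j) (f' i j) w :=
  hasDerivAt_pi.trans (forall_congr' fun _ => hasDerivAt_pi)

theorem hasDerivAt_mul_matrix_complex {f : ℂ → Matrix n p ℂ}
    {f' : Matrix n p ℂ} {g : ℂ → Matrix p q ℂ} {g' : Matrix p q ℂ} {x : ℂ}
    (hf : HasDerivAt f f' x) (hg : HasDerivAt g g' x) :
    HasDerivAt (fun y => f y * g y) (f' * g x + f x * g') x := by
  refine hasDerivAt_matrix_complex.2 fun i j => ?_
  have h : HasDerivAt (fun y => ∑ k, f y i k * g y k j)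
      (∑ k, (f' i k * g x k j + f x i k * g' k j)) x :=
    HasDerivAt.fun_sum fun k _ =>
      (hasDerivAt_matrix_complex.1 hf i k).mul (hasDerivAt_matrix_complex.1 hg k j)
  simp only [Matrix.mul_apply, Matrix.add_apply, ← Finset.sum_add_distrib]
  exact h

theorem differentiableAt_det [DecidableEq n] {A : ℂ → Matrix n n ℂ} {w : ℂ}
    (h : ∀ i j, DifferentiableAt ℂ (fun z => A z i j) w) :
    DifferentiableAt ℂ (fun z => (A z).det) w := by
  simp only [Matrix.det_apply]
  refine DifferentiableAt.fun_sum fun σ _ => DifferentiableAt.const_smul ?_ _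
  exact DifferentiableAt.fun_finsetProd fun i _ => h _ _

theorem differentiableAt_adjugate [DecidableEq n] {A : ℂ → Matrix n n ℂ} {w : ℂ}
    (h : DifferentiableAt ℂ A w) : DifferentiableAt ℂ (fun z => (A z).adjugate) w := by
  have h' : ∀ i j, DifferentiableAt ℂ (fun z => A z i j) w := fun i j =>
    (hasDerivAt_matrix_complex.1 h.hasDerivAt i j).differentiableAt
  refine differentiableAt_pi.2 fun i => differentiableAt_pi.2 fun j => ?_
  simp only [Matrix.adjugate_apply]
  refine differentiableAt_det fun k l => ?_
  by_cases hk : k = j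
  · subst hk; simp
  · simpa [hk, Matrix.updateRow_ne hk] using h' k l

end MatrixCalculus

section Norming

variable {m : ℕ} {k₀ : ℝ} {Q : ℝ → ℝ → Sq m} {Qm Qp : Sq m} {w : ℂ}

theorem hasDerivAt_wr {f g : ℂ → Col m} {f' g' : Col m} (hg : HasDerivAt g g' w)
    (hf : HasDerivAt f f' w) :
    HasDerivAt (fun z => wr (g z) (f z)) (wr g' (f w) + wr (g w) f') w := by
  have hT : HasDerivAt (fun y => (g y)ᵀ) g'ᵀ w :=
    hasDerivAt_matrix_complex.2 fun i j => hasDerivAt_matrix_complex.1 hg j i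
  refine (hasDerivAt_mul_matrix_complex hT (hasDerivAt_mul_matrix_complex
    (hasDerivAt_const w (symJ m)) hf)).congr_deriv ?_
  rw [Matrix.zero_mul, zero_add]; rfl

-- A Lagrangian subspace is its own annihilator. The columns of `kap ψ` span the Hermitian
-- complement of those of `ψ`, and pairing with `ψ` is the Hermitian product with `kap ψ` up to
-- sign. So the component of `f` orthogonal to `ψ` is orthogonal to `kap ψ` too, and vanishes.
open scoped ComplexOrder in
theorem eq_mul_of_wr_eq_zero {ψ f : Col m} (hψ : wr ψ ψ = 0)
    (hinj : ∀ U : Sq m, ψ * U = 0 → U = 0) (hf : wr ψ f = 0) : ∃ C : Sq m, f = ψ * C := by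
  set P := ψᴴ * ψ with hP
  have hdet : P.det ≠ 0 := by
    intro h0
    obtain ⟨v, hv, hv0⟩ := Matrix.exists_mulVec_eq_zero_iff.2 h0
    have h1 : ψ.mulVec v = 0 := Matrix.conjTranspose_mul_self_mulVec_eq_zero ψ v |>.1 hv0
    have h2 : (Matrix.of fun i _ => v i : Sq m) = 0 := hinj _ (by
      ext i j
      exact congrFun h1 i)
    exact hv (funext fun i => congrFun (congrFun h2 i) i)
  refine ⟨P⁻¹ * (ψᴴ * f), sub_eq_zero.1 ?_⟩
  set g := f - ψ * (P⁻¹ * (ψᴴ * f)) with hg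
  have hg1 : ψᴴ * g = 0 := by
    rw [hg, Matrix.mul_sub, ← Matrix.mul_assoc, ← hP, ← Matrix.mul_assoc,
      Matrix.mul_nonsing_inv _ (isUnit_iff_ne_zero.2 hdet), Matrix.one_mul, sub_self]
  have hg2 : (kap ψ)ᴴ * g = 0 := by
    rw [kap_conjTranspose_mul, hg, sub_eq_add_neg, wr_add_right, wr_neg_right, wr_mul_right, hf, hψ,
      Matrix.zero_mul, neg_zero, add_zero, neg_zero]
  have hκ : (kap ψ)ᴴ * ψ = 0 := by rw [kap_conjTranspose_mul, hψ, neg_zero]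
  have hκ' : ψᴴ * kap ψ = 0 := by
    have := congrArg Matrix.conjTranspose hκ
    rwa [Matrix.conjTranspose_mul, Matrix.conjTranspose_conjTranspose,
      Matrix.conjTranspose_zero] at this
  have hκκ : (kap ψ)ᴴ * kap ψ = cj P := by
    rw [kap_conjTranspose_mul, wr, kap, symJ_mul_symJ_mul, Matrix.mul_neg, neg_neg, hP, cj_mul,
      conjTranspose_cj]
  set B := Matrix.fromCols ψ (kap ψ) with hB
  have hBB : Bᴴ * B = Matrix.fromBlocks P 0 0 (cj P) := by
    rw [hB, Matrix.conjTranspose_fromCols_eq_fromRows_conjTranspose, Matrix.fromRows_mul_fromCols,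
      ← hP, hκ, hκ', hκκ]
  have hBg : Bᴴ * g = 0 := by
    rw [hB, Matrix.conjTranspose_fromCols_eq_fromRows_conjTranspose, Matrix.fromRows_mul, hg1, hg2,
      Matrix.fromRows_zero]
  have hdB : IsUnit (Bᴴ).det := by
    have h1 : (Bᴴ * B).det ≠ 0 := by
      rw [hBB, Matrix.det_fromBlocks_zero₂₁, det_cj]
      exact mul_ne_zero hdet ((map_ne_zero _).2 hdet)
    rw [Matrix.det_mul] at h1
    exact isUnit_iff_ne_zero.2 (left_ne_zero_of_mul h1)
  calc g = (Bᴴ)⁻¹ * (Bᴴ * g) := by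
        rw [← Matrix.mul_assoc, Matrix.nonsing_inv_mul _ hdB, Matrix.one_mul]
    _ = 0 := by rw [hBg, Matrix.mul_zero]

/-- `w` is a simple zero of `det a` in `D⁺`. -/
structure IsSimpleZero (k₀ : ℝ) (Q : ℝ → ℝ → Sq m) (Qm Qp : Sq m) (w : ℂ) : Prop where
  mem : w ∈ Dplus k₀
  det_eq : (aPlus k₀ Q Qm Qp w).det = 0
  deriv_ne : deriv (fun w => (aPlus k₀ Q Qm Qp w).det) w ≠ 0

namespace IsPotential

variable (hQ : IsPotential k₀ Q Qm Qp) (hk : 0 < k₀)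
include hQ hk

theorem differentiableAt_aPlus (hw : w ∈ Dplus k₀) : DifferentiableAt ℂ (aPlus k₀ Q Qm Qp) w :=
  (hQ.aPlus_differentiableOn hk).differentiableAt (isOpen_Dplus.mem_nhds hw)

theorem differentiableAt_det_aPlus (hw : w ∈ Dplus k₀) :
    DifferentiableAt ℂ (fun w => (aPlus k₀ Q Qm Qp w).det) w :=
  differentiableAt_det fun i j =>
    (hasDerivAt_matrix_complex.1 (hQ.differentiableAt_aPlus hk hw).hasDerivAt i j).differentiableAt

omit hk in
-- If a combination of the columns vanishes at one point it vanishes everywhere, and the normalized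
-- lower block tends to the identity at `+∞`.
theorem psi_mul_eq_zero {z : ℂ} (hz : z ∈ Omega k₀) {x t : ℝ} {U : Sq m}
    (h : psi k₀ Q Qp z x t * U = 0) : U = 0 := by
  have h1 := hQ.lax_eq_zero ((hQ.psi_spec hz).1.mul_const U) h
  have h2 := tendsto_mul_matrix ((hQ.psi_spec hz).2 0) (tendsto_const_nhds (x := U))
  have h3 : (asymE z Qp).toCols₂ * U = 0 := by
    refine tendsto_nhds_unique h2 ?_
    refine tendsto_const_nhds.congr fun x => ?_
    rw [Matrix.smul_mul, h1, smul_zero]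
  rw [asymE_toCols₂, Matrix.fromRows_mul, Matrix.one_mul] at h3
  exact congrArg Matrix.toRows₂ h3

omit hk in
theorem VHat_mul_eq_zero {z : ℂ} (hz : z ∈ Omega k₀) {x t : ℝ} {U : Sq m}
    (h : VHat k₀ Q Qp x t z * U = 0) : U = 0 := by
  rw [VHat, Matrix.smul_mul] at h
  exact hQ.psi_mul_eq_zero hz ((smul_eq_zero.1 h).resolve_left (Complex.exp_ne_zero _))

/-- With `a⁻¹ = adj(a)/det a`, a simple zero of the determinant gives at most a simple pole, without
any hypothesis on the rank of `a`. -/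
theorem residue_transmission (hw : IsSimpleZero k₀ Q Qm Qp w) (x t : ℝ) :
    Tendsto (fun z => (z - w) • (WHat k₀ Q Qm x t z * (aPlus k₀ Q Qm Qp z)⁻¹)) (𝓝[≠] w)
      (𝓝 ((deriv (fun w => (aPlus k₀ Q Qm Qp w).det) w)⁻¹ •
        (WHat k₀ Q Qm x t w * (aPlus k₀ Q Qm Qp w).adjugate))) := by
  have hd := (hQ.differentiableAt_det_aPlus hk hw.mem).hasDerivAt
  have h1 := (hasDerivAt_iff_tendsto_slope.1 hd).inv₀ hw.deriv_ne
  have h2 : Tendsto (fun z => WHat k₀ Q Qm x t z) (𝓝[≠] w) (𝓝 (WHat k₀ Q Qm x t w)) :=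
    ((hQ.WHat_differentiableOn hk x t).differentiableAt
      (isOpen_Dplus.mem_nhds hw.mem)).continuousAt.tendsto.mono_left nhdsWithin_le_nhds
  have h3 : Tendsto (fun z => (aPlus k₀ Q Qm Qp z).adjugate) (𝓝[≠] w)
      (𝓝 (aPlus k₀ Q Qm Qp w).adjugate) :=
    (differentiableAt_adjugate (hQ.differentiableAt_aPlus hk
      hw.mem)).continuousAt.tendsto.mono_left nhdsWithin_le_nhds
  have h4 := tendsto_mul_matrix h2 h3
  have h5 := tendsto_matrix.2 fun i j => h1.mul (tendsto_matrix.1 h4 i j)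
  refine Tendsto.congr' ?_ h5
  filter_upwards [self_mem_nhdsWithin] with z hz
  have hzw : z - w ≠ 0 := sub_ne_zero.2 hz
  ext i j
  have e : (WHat k₀ Q Qm x t z * (aPlus k₀ Q Qm Qp z)⁻¹)
      = (aPlus k₀ Q Qm Qp z).det⁻¹ • (WHat k₀ Q Qm x t z * (aPlus k₀ Q Qm Qp z).adjugate) := by
    rw [Matrix.inv_def, Ring.inverse_eq_inv', Matrix.mul_smul]
  rw [e, slope_def_field, hw.det_eq, sub_zero, inv_div, smul_smul, div_eq_mul_inv]
  rfl

/-- For `K = adj a` one has `a K = (det a) K`-free of remainder, that is `a K = 0` at the zero, so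
`φ K` pairs to zero with `ψ` and equals `ψ C` at the origin. Both sides solve the Lax pair, so the
same constant works at every `(x, t)`. -/
theorem exists_isNorming (hw : IsSimpleZero k₀ Q Qm Qp w) : ∃ C, IsNorming k₀ Q Qm Qp w C := by
  have hwO := Dplus_subset_Omega hk hw.mem
  set K : Sq m := (aPlus k₀ Q Qm Qp w).adjugate with hK
  have haK : aPlus k₀ Q Qm Qp w * K = 0 := by
    rw [hK, Matrix.mul_adjugate, hw.det_eq, zero_smul]
  obtain ⟨C, hC⟩ := eq_mul_of_wr_eq_zero (hQ.wr_psi_psi hwO 0 0)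
    (fun U => hQ.psi_mul_eq_zero hwO) (f := phi k₀ Q Qm w 0 0 * K) (by
      rw [wr_mul_right, hQ.wr_psi_phi hwO, Matrix.neg_mul, Matrix.smul_mul, haK, smul_zero,
        neg_zero])
  have hall : ∀ x t, phi k₀ Q Qm w x t * K = psi k₀ Q Qp w x t * C := by
    have h1 := isLaxSolution_iff.1 ((hQ.phi_spec hwO).1.mul_const K)
    have h2 := isLaxSolution_iff.1 ((hQ.psi_spec hwO).1.mul_const C)
    have h3 : IsLaxSolution k₀ Q w fun x t => phi k₀ Q Qm w x t * K - psi k₀ Q Qp w x t * C := by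
      refine isLaxSolution_iff.2 ⟨fun x t => ((h1.1 x t).sub (h2.1 x t)).congr_deriv ?_,
        fun x t => ((h1.2 x t).sub (h2.2 x t)).congr_deriv ?_⟩ <;> rw [Matrix.mul_sub]
    intro x t
    exact sub_eq_zero.1 (hQ.lax_eq_zero h3 (sub_eq_zero.2 hC) x t)
  set d := deriv (fun w => (aPlus k₀ Q Qm Qp w).det) w
  refine ⟨d⁻¹ • C, fun x t => ?_⟩
  have h := hQ.residue_transmission hk hw x t
  convert h using 2
  rw [WHat, VHat, Matrix.smul_mul (M := phi k₀ Q Qm w x t), hall, Matrix.mul_smul, Matrix.smul_mul,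
    smul_smul, smul_smul, smul_smul, mul_right_comm, ← Complex.exp_add, mul_comm]
  congr 3
  ring_nf

theorem isNorming_unique (hw : w ∈ Dplus k₀) {C C' : Sq m} (h : IsNorming k₀ Q Qm Qp w C)
    (h' : IsNorming k₀ Q Qm Qp w C') : C = C' := by
  have h1 := tendsto_nhds_unique (h 0 0) (h' 0 0)
  have h2 := smul_right_injective (Col m) (Complex.exp_ne_zero _) h1
  refine sub_eq_zero.1 (hQ.VHat_mul_eq_zero (Dplus_subset_Omega hk hw) (x := 0) (t := 0) ?_)
  rw [Matrix.mul_sub, sub_eq_zero]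
  exact h2

/-- With `V = V̂` and `G = Ŵ adj(a)`, one has `G = V E` at `w`, where `E` is a scalar multiple of
`C`. Differentiating `wr V V = 0`, `wr G G = 0` and `wr V G = -γ det a` at `w` and eliminating `wr V
G'` leaves `γ (det a)' (E - Eᵀ) = 0`; the terms with `wr V' V` drop out because that matrix is
symmetric. -/
theorem isNorming_transpose (hw : IsSimpleZero k₀ Q Qm Qp w) {C : Sq m}
    (h : IsNorming k₀ Q Qm Qp w C) : Cᵀ = C := by
  have hwO := Dplus_subset_Omega hk hw.mem
  have hnhds := isOpen_Dplus.mem_nhds hw.mem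
  set d := deriv (fun w => (aPlus k₀ Q Qm Qp w).det) w with hd
  set e := Complex.exp (2 * Complex.I * theta k₀ 0 0 w)
  have he : e ≠ 0 := Complex.exp_ne_zero _
  set V := fun z => VHat k₀ Q Qp 0 0 z with hV
  set G := fun z => WHat k₀ Q Qm 0 0 z * (aPlus k₀ Q Qm Qp z).adjugate with hG
  set E := (d * e) • C with hE
  have hGw : G w = V w * E := by
    have h1 := tendsto_nhds_unique (h 0 0) (hQ.residue_transmission hk hw 0 0)
    rw [hE, Matrix.mul_smul, mul_smul, h1, smul_inv_smul₀ hw.deriv_ne]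
  have dV : HasDerivAt V (deriv V w) w :=
    ((hQ.VHat_differentiableOn hk 0 0).differentiableAt hnhds).hasDerivAt
  have dG : HasDerivAt G (deriv G w) w :=
    (hasDerivAt_mul_matrix_complex
      ((hQ.WHat_differentiableOn hk 0 0).differentiableAt hnhds).hasDerivAt
      (differentiableAt_adjugate (hQ.differentiableAt_aPlus hk
        hw.mem)).hasDerivAt).differentiableAt.hasDerivAt
  set V' := deriv V w
  set G' := deriv G w
  have hVV : wr V' (V w) + wr (V w) V' = 0 := by
    refine (hasDerivAt_wr dV dV).unique ((hasDerivAt_const w (0 : Sq m)).congr_of_eventuallyEq ?_)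
    filter_upwards [hnhds] with z hz
    rw [hV]
    simp only [VHat]
    rw [wr_smul_left, wr_smul_right, hQ.wr_psi_psi (Dplus_subset_Omega hk hz), smul_zero, smul_zero]
  have hVG : wr V' (G w) + wr (V w) G' = (-(gam k₀ w * d)) • (1 : Sq m) := by
    have hγ : HasDerivAt (fun z => -(gam k₀ z * (aPlus k₀ Q Qm Qp z).det)) (-(gam k₀ w * d)) w := by
      have h1 : DifferentiableAt ℂ (gam k₀) w :=
        (differentiableOn_gam (s := Dplus k₀) fun z hz =>
          (Dplus_subset_Omega hk hz).2.1).differentiableAt hnhds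
      refine (h1.hasDerivAt.mul (hQ.differentiableAt_det_aPlus hk
        hw.mem).hasDerivAt).neg.congr_deriv ?_
      rw [hw.det_eq, mul_zero, zero_add]
    have hγ' : HasDerivAt (fun z => (-(gam k₀ z * (aPlus k₀ Q Qm Qp z).det)) • (1 : Sq m))
        ((-(gam k₀ w * d)) • (1 : Sq m)) w :=
      hasDerivAt_matrix_complex.2 fun i j => hγ.mul_const _
    refine (hasDerivAt_wr dV dG).unique (hγ'.congr_of_eventuallyEq ?_)
    filter_upwards [hnhds] with z hz
    rw [hV, hG]
    simp only
    rw [wr_mul_right, hQ.wr_VHat_WHat, hQ.wr_psi_phi (Dplus_subset_Omega hk hz), Matrix.neg_mul,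
      Matrix.smul_mul, Matrix.mul_adjugate, smul_smul, neg_smul]
  have hGG : wr G' (G w) + wr (G w) G' = 0 := by
    refine (hasDerivAt_wr dG dG).unique ((hasDerivAt_const w (0 : Sq m)).congr_of_eventuallyEq ?_)
    filter_upwards [hnhds] with z hz
    rw [hG]
    simp only [WHat]
    rw [wr_mul_left, wr_mul_right, wr_smul_left, wr_smul_right,
      hQ.wr_phi_phi (Dplus_subset_Omega hk hz), smul_zero, smul_zero, Matrix.zero_mul,
      Matrix.mul_zero]
  have hA : (wr V' (V w))ᵀ = wr V' (V w) := by
    rw [wr_transpose]; exact (eq_neg_of_add_eq_zero_left hVV).symm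
  rw [hGw, wr_mul_right] at hVG
  rw [hGw, wr_mul_right, wr_mul_left, ← neg_neg (wr G' (V w)), ← wr_transpose,
    eq_sub_of_add_eq' hVG, Matrix.transpose_sub, Matrix.transpose_mul, hA, Matrix.transpose_smul,
    Matrix.transpose_one] at hGG
  have h2 : (gam k₀ w * d) • (E - Eᵀ) = 0 := by
    rw [← hGG]
    simp only [mul_sub, sub_mul, neg_mul, mul_smul_comm, smul_mul_assoc, mul_one, one_mul, mul_assoc,
      smul_sub]
    module
  have h3 := (smul_eq_zero.1 h2).resolve_left (mul_ne_zero (gam_ne_zero hwO) hw.deriv_ne)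
  rw [hE, Matrix.transpose_smul, ← smul_sub] at h3
  exact (sub_eq_zero.1 ((smul_eq_zero.1 h3).resolve_left (mul_ne_zero hw.deriv_ne he))).symm

omit hk in
theorem bar_transmission_eq {z : ℂ} (hz : starRingEnd ℂ z ∈ Omega k₀) (x t : ℝ) :
    WBar k₀ Q Qm x t z * (aMinus k₀ Q Qm Qp z)⁻¹
      = -kap (WHat k₀ Q Qm x t (starRingEnd ℂ z) * (aPlus k₀ Q Qm Qp (starRingEnd ℂ z))⁻¹) := by
  rw [hQ.WBar_eq hz, hQ.aMinus_eq hz, kap_mul, cj_inv, Matrix.neg_mul]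

omit hk hQ in
theorem tendsto_conj_punctured (w : ℂ) :
    Tendsto (starRingEnd ℂ) (𝓝[≠] (starRingEnd ℂ w)) (𝓝[≠] w) := by
  refine tendsto_nhdsWithin_iff.2 ⟨?_, ?_⟩
  · have := (Complex.continuous_conj.tendsto (starRingEnd ℂ w))
    rw [Complex.conj_conj] at this
    exact this.mono_left nhdsWithin_le_nhds
  · filter_upwards [self_mem_nhdsWithin] with z hz h
    exact hz (by rw [Set.mem_singleton_iff] at h ⊢; rw [← h, Complex.conj_conj])

omit hk hQ in
theorem exp_two_theta_conj (x t : ℝ) (z : ℂ) :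
    starRingEnd ℂ (Complex.exp (2 * Complex.I * theta k₀ x t z))
      = Complex.exp (-(2 * Complex.I * theta k₀ x t (starRingEnd ℂ z))) := by
  rw [← Complex.exp_conj, theta_conj, map_mul, map_mul, Complex.conj_I, map_ofNat, mul_neg, neg_mul]

/-- The whole residue condition at `w*` is the image under `kap` of the one at `w`, the limits being
transported along conjugation. -/
theorem isNormingBar_iff (hw : w ∈ Dplus k₀) {C : Sq m} :
    IsNormingBar k₀ Q Qm Qp (starRingEnd ℂ w) C ↔ IsNorming k₀ Q Qm Qp w (-cj C) := by
  have hwO := Dplus_subset_Omega hk hw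
  have hlim : ∀ x t, kap (Complex.exp (2 * Complex.I * theta k₀ x t w) •
      (VHat k₀ Q Qp x t w * -cj C)) = -(Complex.exp (-(2 * Complex.I *
        theta k₀ x t (starRingEnd ℂ w))) • (VBar k₀ Q Qp x t (starRingEnd ℂ w) * C)) := by
    intro x t
    rw [hQ.VBar_eq (by rwa [Complex.conj_conj]), Complex.conj_conj, kap_smul, kap_mul, cj_neg,
      cj_cj, exp_two_theta_conj, Matrix.mul_neg, smul_neg]
  constructor
  · intro h x t
    have h1 := ((continuous_kap.tendsto _).comp (h x t)).comp
      (by simpa using tendsto_conj_punctured (starRingEnd ℂ w))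
    have h2 := congrArg kap (hlim x t)
    rw [kap_kap, kap_neg, neg_inj] at h2
    rw [← h2] at h1
    refine h1.congr' ?_
    filter_upwards [nhdsWithin_le_nhds (isOpen_Dplus.mem_nhds hw)] with z hz
    have hzO := Dplus_subset_Omega hk hz
    simp only [Function.comp]
    rw [hQ.bar_transmission_eq (by rwa [Complex.conj_conj]), Complex.conj_conj, kap_smul, kap_neg,
      kap_kap, neg_neg, ← map_sub, Complex.conj_conj]
  · intro h x t
    have h1 := (((continuous_kap.tendsto _).comp (h x t)).comp (tendsto_conj_punctured w)).neg
    rw [hlim, neg_neg] at h1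
    refine h1.congr' ?_
    have hev : ∀ᶠ z in 𝓝[≠] (starRingEnd ℂ w), starRingEnd ℂ z ∈ Dplus k₀ :=
      (tendsto_conj_punctured w).eventually (nhdsWithin_le_nhds (isOpen_Dplus.mem_nhds hw))
    filter_upwards [hev] with z hz
    have hzO := Dplus_subset_Omega hk hz
    simp only [Function.comp]
    rw [hQ.bar_transmission_eq hzO, kap_smul, map_sub, Complex.conj_conj, smul_neg]

/-! ### The discrete spectrum -/

theorem det_aPlus_flip :
    ∃ c : ℂ, c ≠ 0 ∧ ∀ z ∈ Omega k₀, (aPlus k₀ Q Qm Qp (starRingEnd ℂ (flip k₀ z))).det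
      = starRingEnd ℂ (c * (aPlus k₀ Q Qm Qp z).det) := by
  have hk0 : ((k₀ : ℂ) ^ 2) ≠ 0 := pow_ne_zero 2 (by exact_mod_cast hk.ne')
  refine ⟨(((k₀ : ℂ) ^ 2)⁻¹) ^ Fintype.card (Fin m) * ((Qpᴴ).det * Qm.det), ?_, fun z hz => ?_⟩
  · refine mul_ne_zero (pow_ne_zero _ (inv_ne_zero hk0)) (mul_ne_zero ?_ ?_)
    · have := congrArg Matrix.det hQ.unitary_plus.2
      rw [Matrix.det_mul, Matrix.det_smul, Matrix.det_one, mul_one] at this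
      exact left_ne_zero_of_mul (this ▸ pow_ne_zero _ hk0)
    · have := congrArg Matrix.det hQ.unitary_minus.1
      rw [Matrix.det_mul, Matrix.det_smul, Matrix.det_one, mul_one] at this
      exact left_ne_zero_of_mul (this ▸ pow_ne_zero _ hk0)
  · rw [hQ.aPlus_flip hk hz, det_cj, Matrix.det_smul, Matrix.det_mul, Matrix.det_mul]
    congr 1; ring

/-- By `det_aPlus_flip`, `det a` at the image point is the conjugate of a nonzero multiple of `det
a`. Written as a holomorphic function after two conjugations, it has nonzero derivative by the chain
rule. -/
theorem isSimpleZero_conj_flip (hw : IsSimpleZero k₀ Q Qm Qp w) :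
    IsSimpleZero k₀ Q Qm Qp (starRingEnd ℂ (flip k₀ w)) := by
  obtain ⟨c, hc, hflip⟩ := hQ.det_aPlus_flip hk
  have hwO := Dplus_subset_Omega hk hw.mem
  have hmem := conj_flip_mem_Dplus hk hw.mem
  refine ⟨hmem, by rw [hflip w hwO, hw.det_eq, mul_zero, map_zero], ?_⟩
  set D := fun w => (aPlus k₀ Q Qm Qp w).det with hD
  set u := starRingEnd ℂ (flip k₀ w) with hu
  have hu0 : u ≠ 0 := (Dplus_subset_Omega hk hmem).2.1
  have hfu : flip k₀ u = starRingEnd ℂ w := by rw [hu, flip_conj, flip_flip hk]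
  have h1 : HasDerivAt (starRingEnd ℂ ∘ D ∘ starRingEnd ℂ)
      (starRingEnd ℂ (deriv D w)) (flip k₀ u) := by
    rw [hfu]
    exact ((hQ.differentiableAt_det_aPlus hk hw.mem).hasDerivAt).conj_conj
  have h2 : HasDerivAt (flip k₀) ((k₀ : ℂ) ^ 2 / u ^ 2) u := by
    have := (hasDerivAt_inv hu0).const_mul (-(k₀ : ℂ) ^ 2)
    refine (this.congr_deriv ?_).congr_of_eventuallyEq (Eventually.of_forall fun z => ?_)
    · rw [div_eq_mul_inv]; ring
    · simp only [flip, div_eq_mul_inv]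
  have h3 := (h1.comp u h2).const_mul (starRingEnd ℂ c)
  have h4 : D =ᶠ[𝓝 u] fun z => starRingEnd ℂ c *
      ((starRingEnd ℂ ∘ D ∘ starRingEnd ℂ) ∘ flip k₀) z := by
    filter_upwards [isOpen_Dplus.mem_nhds hmem] with z hz
    have hz' := conj_flip_mem_Omega hk (Dplus_subset_Omega hk hz)
    have := hflip _ hz'
    rw [flip_conj, flip_flip hk, Complex.conj_conj, map_mul] at this
    exact this
  have h5 := h3.congr_of_eventuallyEq h4
  rw [h5.deriv]
  refine mul_ne_zero ((map_ne_zero _).2 hc) (mul_ne_zero ((map_ne_zero _).2 hw.deriv_ne)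
    (div_ne_zero (pow_ne_zero 2 (by exact_mod_cast hk.ne')) (pow_ne_zero 2 hu0)))

omit hQ hk in
theorem zeta_inr {N : ℕ} (z : Fin N → ℂ) (n : Fin N) :
    zeta k₀ z (Sum.inr n) = starRingEnd ℂ (flip k₀ (z n)) := by
  simp [zeta, flip]

theorem isSimpleZero_zeta {N : ℕ} {z : Fin N → ℂ} (hz : HasSimpleZeros k₀ Q Qm Qp z)
    (n : Fin N ⊕ Fin N) : IsSimpleZero k₀ Q Qm Qp (zeta k₀ z n) := by
  have hl : ∀ n, IsSimpleZero k₀ Q Qm Qp (z n) := fun n => by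
    obtain ⟨h1, -, h3⟩ := (hz.2.1 (z n)).1 ⟨n, rfl⟩
    exact ⟨h1, h3, hz.2.2 n⟩
  rcases n with n | n
  · exact hl n
  · rw [zeta_inr]; exact hQ.isSimpleZero_conj_flip hk (hl n)

omit hk in
theorem zeta_injective (hk : 0 < k₀) {N : ℕ} {z : Fin N → ℂ} (hz : HasSimpleZeros k₀ Q Qm Qp z) :
    Function.Injective (zeta k₀ z) := by
  have him : ∀ n, 0 < (z n).im := fun n => ((hz.2.1 (z n)).1 ⟨n, rfl⟩).2.1
  have him' : ∀ n, (zeta k₀ z (Sum.inr n)).im < 0 := fun n => by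
    rw [zeta_inr, Complex.conj_im, flip_im, neg_lt_zero]
    have : 0 < ‖z n‖ := norm_pos_iff.2 fun h => (him n).ne' (by rw [h, Complex.zero_im])
    have := him n
    positivity
  rintro (a | a) (b | b) hab
  · exact congrArg Sum.inl (hz.1 hab)
  · have := him' b
    rw [← hab] at this
    exact absurd (him a) (not_lt.2 this.le)
  · have := him' a
    rw [hab] at this
    exact absurd (him b) (not_lt.2 this.le)
  · rw [zeta_inr, zeta_inr] at hab
    have := congrArg (flip k₀) ((starRingEnd ℂ).injective hab)
    rw [flip_flip hk, flip_flip hk] at this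
    exact congrArg Sum.inr (hz.1 this)

/-- The hypothesis lists the zeros with `Im z > 0`; one with `Im z < 0` would be carried to such a
zero by `z ↦ -k₀²/z*`. -/
theorem det_aPlus_ne_zero {N : ℕ} {z : Fin N → ℂ} (hz : HasSimpleZeros k₀ Q Qm Qp z) {u : ℂ}
    (hu : u ∈ Dplus k₀) (hne : ∀ n, u ≠ zeta k₀ z n) : (aPlus k₀ Q Qm Qp u).det ≠ 0 := by
  intro h0
  have hup : ∀ v ∈ Dplus k₀, 0 < v.im → (aPlus k₀ Q Qm Qp v).det = 0 → ∃ n, z n = v :=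
    fun v hv hi hd => (hz.2.1 v).2 ⟨hv, hi, hd⟩
  have him : u.im ≠ 0 := fun h => by
    have : 0 < (‖u‖ ^ 2 - k₀ ^ 2) * u.im := hu
    rw [h, mul_zero] at this
    exact this.ne rfl
  rcases lt_or_gt_of_ne him with hi | hi
  · obtain ⟨c, -, hflip⟩ := hQ.det_aPlus_flip hk
    have huO := Dplus_subset_Omega hk hu
    obtain ⟨n, hn⟩ := hup _ (conj_flip_mem_Dplus hk hu) (by
      rw [Complex.conj_im, flip_im, neg_pos]
      have : 0 < ‖u‖ := norm_pos_iff.2 huO.2.1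
      exact div_neg_of_neg_of_pos (mul_neg_of_pos_of_neg (by positivity) hi) (by positivity))
      (by rw [hflip u huO, h0, mul_zero, map_zero])
    refine hne (Sum.inr n) ?_
    rw [zeta_inr, hn, flip_conj, flip_flip hk, Complex.conj_conj]
  · obtain ⟨n, hn⟩ := hup u hu hi h0
    exact hne (Sum.inl n) hn.symm

end IsPotential

end Norming

end MMKdV

namespace MMKdV

/-! ### Cauchy's theorem for half-annuli -/

section Cauchy

theorem tendsto_integral_shrink {u : ℝ → ℂ} {a b M : ℝ} (hab : a < b)
    (hu : ContinuousOn u (Set.Icc a b)) (hM : ∀ x ∈ Set.Icc a b, ‖u x‖ ≤ M) :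
    Tendsto (fun δ : ℝ => ∫ x in (a + δ)..(b - δ), u x) (𝓝[>] 0) (𝓝 (∫ x in a..b, u x)) := by
  have hint : ∀ p ∈ Set.Icc a b, ∀ q ∈ Set.Icc a b, IntervalIntegrable u volume p q :=
    fun p hp q hq => (hu.mono (Set.uIcc_subset_Icc hp hq)).intervalIntegrable
  have h0 : Tendsto (fun δ : ℝ => M * δ + M * δ) (𝓝[>] 0) (𝓝 0) := by
    have : Continuous fun δ : ℝ => M * δ + M * δ := by fun_prop
    have := this.tendsto 0
    simp only [mul_zero, add_zero] at this
    exact this.mono_left nhdsWithin_le_nhds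
  refine tendsto_iff_norm_sub_tendsto_zero.2 (squeeze_zero' (Eventually.of_forall fun δ =>
    norm_nonneg _) ?_ h0)
  filter_upwards [Ioo_mem_nhdsGT (show (0 : ℝ) < b - a by linarith)] with δ hδ
  have ha : a ∈ Set.Icc a b := ⟨le_rfl, hab.le⟩
  have hb : b ∈ Set.Icc a b := ⟨hab.le, le_rfl⟩
  have ha' : a + δ ∈ Set.Icc a b := ⟨by linarith [hδ.1], by linarith [hδ.2]⟩
  have hb' : b - δ ∈ Set.Icc a b := ⟨by linarith [hδ.2], by linarith [hδ.1]⟩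
  have e : (∫ x in (a + δ)..(b - δ), u x) - ∫ x in a..b, u x
      = -((∫ x in a..(a + δ), u x) + ∫ x in (b - δ)..b, u x) := by
    rw [← intervalIntegral.integral_add_adjacent_intervals (hint a ha _ ha') (hint _ ha' b hb),
      ← intervalIntegral.integral_add_adjacent_intervals (hint _ ha' _ hb') (hint _ hb' b hb)]
    ring
  rw [e, norm_neg]
  refine (norm_add_le _ _).trans (add_le_add ?_ ?_)
  · have := intervalIntegral.norm_integral_le_of_norm_le_const (a := a) (b := a + δ) (f := u)
      (C := M) fun x hx => hM x (Set.uIcc_subset_Icc ha ha' (Set.uIoc_subset_uIcc hx))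
    rwa [add_sub_cancel_left, abs_of_pos hδ.1] at this
  · have := intervalIntegral.norm_integral_le_of_norm_le_const (a := b - δ) (b := b) (f := u)
      (C := M) fun x hx => hM x (Set.uIcc_subset_Icc hb' hb (Set.uIoc_subset_uIcc hx))
    rwa [sub_sub_cancel, abs_of_pos hδ.1] at this

/-- Cauchy's theorem for a rectangle, for a bounded function which may be discontinuous at one
point of each vertical side. -/
theorem integral_boundary_rect_eq_zero_of_bounded {f : ℂ → ℂ} {a b c d y₀ M : ℝ} (hab : a < b)
    (hc : c < y₀) (hd : y₀ < d)
    (hcont : ContinuousOn f {w | w.re ∈ Set.Icc a b ∧ w.im ∈ Set.Icc c d ∧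
      ¬(w.im = y₀ ∧ (w.re = a ∨ w.re = b))})
    (hM : ∀ w : ℂ, w.re ∈ Set.Icc a b → w.im ∈ Set.Icc c d → ¬(w.im = y₀ ∧ (w.re = a ∨ w.re = b)) →
      ‖f w‖ ≤ M)
    (hdiff : DifferentiableOn ℂ f {w | w.re ∈ Set.Ioo a b ∧ w.im ∈ Set.Ioo c d}) :
    (∫ x : ℝ in a..b, f (x + c * Complex.I)) - (∫ x : ℝ in a..b, f (x + d * Complex.I))
      + Complex.I • (∫ y : ℝ in c..d, f (b + y * Complex.I))
      - Complex.I • (∫ y : ℝ in c..d, f (a + y * Complex.I)) = 0 := by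
  have hcd : c < d := hc.trans hd
  have re_eq : ∀ x y : ℝ, ((x : ℂ) + y * Complex.I).re = x := fun x y => by simp
  have im_eq : ∀ x y : ℝ, ((x : ℂ) + y * Complex.I).im = y := fun x y => by simp
  -- Rectangles with slightly moved vertical sides avoid the exceptional points, so the usual
  -- theorem applies to them; `δ → 0` follows.
  have key : ∀ᶠ δ : ℝ in 𝓝[>] 0,
      (∫ x : ℝ in (a + δ)..(b - δ), f (x + c * Complex.I))
      - (∫ x : ℝ in (a + δ)..(b - δ), f (x + d * Complex.I))
      + Complex.I • (∫ y : ℝ in c..d, f ((b - δ : ℝ) + y * Complex.I))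
      - Complex.I • (∫ y : ℝ in c..d, f ((a + δ : ℝ) + y * Complex.I)) = 0 := by
    filter_upwards [Ioo_mem_nhdsGT (show (0 : ℝ) < (b - a) / 2 by linarith)] with δ hδ
    have h1 : a + δ ≤ b - δ := by linarith [hδ.2]
    have := Complex.integral_boundary_rect_eq_zero_of_continuousOn_of_differentiableOn f
      ((a + δ : ℝ) + c * Complex.I) ((b - δ : ℝ) + d * Complex.I) ?_ ?_
    · simpa only [re_eq, im_eq] using this
    · rw [re_eq, re_eq, im_eq, im_eq, Set.uIcc_of_le h1, Set.uIcc_of_le hcd.le]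
      refine hcont.mono fun w hw => ?_
      rw [Complex.mem_reProdIm] at hw
      refine ⟨⟨by linarith [hw.1.1, hδ.1], by linarith [hw.1.2, hδ.1]⟩, hw.2, fun h => ?_⟩
      rcases h.2 with h | h
      · linarith [hw.1.1, hδ.1]
      · linarith [hw.1.2, hδ.1]
    · rw [re_eq, re_eq, im_eq, im_eq, min_eq_left h1, max_eq_right h1, min_eq_left hcd.le,
        max_eq_right hcd.le]
      refine hdiff.mono fun w hw => ?_
      rw [Complex.mem_reProdIm] at hw
      exact ⟨⟨by linarith [hw.1.1, hδ.1], by linarith [hw.1.2, hδ.1]⟩, hw.2⟩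
  have hhor : ∀ y ∈ Set.Icc c d, y ≠ y₀ →
      Tendsto (fun δ : ℝ => ∫ x : ℝ in (a + δ)..(b - δ), f (x + y * Complex.I)) (𝓝[>] 0)
        (𝓝 (∫ x : ℝ in a..b, f (x + y * Complex.I))) := fun y hy hy0 => by
    have hmem : ∀ x ∈ Set.Icc a b, ((x : ℂ) + y * Complex.I) ∈ {w : ℂ | w.re ∈ Set.Icc a b ∧
        w.im ∈ Set.Icc c d ∧ ¬(w.im = y₀ ∧ (w.re = a ∨ w.re = b))} := fun x hx =>
      ⟨by rwa [re_eq], by rwa [im_eq], fun h => hy0 (by rw [← h.1, im_eq])⟩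
    refine tendsto_integral_shrink hab (hcont.comp (by fun_prop) hmem) fun x hx =>
      hM _ (hmem x hx).1 (hmem x hx).2.1 (hmem x hx).2.2
  -- Dominated convergence with the constant bound; the exceptional height `y₀` is a null set.
  have hver : ∀ (x₀ : ℝ) (ξ : ℝ → ℝ), (x₀ ∈ Set.Icc a b) → Tendsto ξ (𝓝[>] 0) (𝓝 x₀) →
      (∀ᶠ δ in 𝓝[>] (0 : ℝ), ξ δ ∈ Set.Ioo a b) →
      Tendsto (fun δ : ℝ => ∫ y : ℝ in c..d, f (ξ δ + y * Complex.I)) (𝓝[>] 0)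
        (𝓝 (∫ y : ℝ in c..d, f (x₀ + y * Complex.I))) := fun x₀ ξ hx₀ hξ hmem => by
    have hmem' : ∀ x ∈ Set.Ioo a b, ∀ y ∈ Set.Icc c d, ((x : ℂ) + y * Complex.I) ∈
        {w : ℂ | w.re ∈ Set.Icc a b ∧ w.im ∈ Set.Icc c d ∧
          ¬(w.im = y₀ ∧ (w.re = a ∨ w.re = b))} := fun x hx y hy =>
      ⟨by rw [re_eq]; exact ⟨hx.1.le, hx.2.le⟩, by rwa [im_eq], fun h => by
        rw [re_eq] at h
        rcases h.2 with h | h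
        · exact hx.1.ne' h
        · exact hx.2.ne h⟩
    have hsub : Set.uIoc c d ⊆ Set.Icc c d := by
      rw [Set.uIoc_of_le hcd.le]; exact Set.Ioc_subset_Icc_self
    refine intervalIntegral.tendsto_integral_filter_of_dominated_convergence (fun _ => M) ?_ ?_
      intervalIntegrable_const ?_
    · filter_upwards [hmem] with δ hδ
      have : ContinuousOn (fun y : ℝ => f (ξ δ + y * Complex.I)) (Set.Icc c d) :=
        hcont.comp (by fun_prop) (hmem' _ hδ)
      exact (this.mono hsub).aestronglyMeasurable measurableSet_uIoc
    · filter_upwards [hmem] with δ hδ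
      refine Eventually.of_forall fun y hy => ?_
      have := hmem' _ hδ y (hsub hy)
      exact hM _ this.1 this.2.1 this.2.2
    · have hne : ∀ᵐ y : ℝ, y ≠ y₀ := by
        rw [ae_iff]; simp
      filter_upwards [hne] with y hy0 hy
      have hx : ((x₀ : ℂ) + y * Complex.I) ∈ {w : ℂ | w.re ∈ Set.Icc a b ∧ w.im ∈ Set.Icc c d ∧
          ¬(w.im = y₀ ∧ (w.re = a ∨ w.re = b))} :=
        ⟨by rwa [re_eq], by rw [im_eq]; exact hsub hy, fun h => hy0 (by rw [← h.1, im_eq])⟩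
      refine (hcont _ hx).tendsto.comp (tendsto_nhdsWithin_iff.2 ⟨?_, ?_⟩)
      · exact ((Complex.continuous_ofReal.tendsto x₀).comp hξ).add_const _
      · filter_upwards [hmem] with δ hδ
        exact hmem' _ hδ y (hsub hy)
  have hev : ∀ᶠ δ in 𝓝[>] (0 : ℝ), δ ∈ Set.Ioo 0 (b - a) :=
    Ioo_mem_nhdsGT (by linarith)
  have hid : Tendsto (fun δ : ℝ => δ) (𝓝[>] 0) (𝓝 0) := tendsto_id.mono_left nhdsWithin_le_nhds
  have v1 := hver b (fun δ => b - δ) ⟨hab.le, le_rfl⟩ (by simpa using hid.const_sub b)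
    (hev.mono fun δ hδ => ⟨by linarith [hδ.2], by linarith [hδ.1]⟩)
  have v2 := hver a (fun δ => a + δ) ⟨le_rfl, hab.le⟩ (by simpa using hid.const_add a)
    (hev.mono fun δ hδ => ⟨by linarith [hδ.1], by linarith [hδ.2]⟩)
  have lim := (((hhor c ⟨le_rfl, hcd.le⟩ hc.ne).sub (hhor d ⟨hcd.le, le_rfl⟩ hd.ne')).add
    (v1.const_smul Complex.I)).sub (v2.const_smul Complex.I)
  exact tendsto_nhds_unique lim (tendsto_const_nhds.congr' (key.mono fun δ hδ => hδ.symm))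

/-- The integral of `g` over an arc of the circle of radius `r` around the origin. -/
noncomputable def arcIntegral (g : ℂ → ℂ) (r c d : ℝ) : ℂ :=
  ∫ p in c..d, deriv (circleMap 0 r) p * g (circleMap 0 r p)

/-- The integral of `g` over the two segments `r₁ ≤ |s| ≤ r₂` of the real line. -/
noncomputable def segIntegral (g : ℂ → ℂ) (r₁ r₂ : ℝ) : ℂ :=
  ∫ s : ℝ in r₁..r₂, (g s + g (-s : ℝ))

/-- The exponential maps a rectangle onto the half-annulus, radii to horizontal sides and
half-circles to vertical ones. The branch point on a half-circle is the midpoint of a vertical side,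
where boundedness replaces continuity. The sign `σ = e^{iθ}` distinguishes the upper half-plane from
the lower. -/
theorem cauchy_half_annulus {g : ℂ → ℂ} {U V : Set ℂ} {r₁ r₂ θ M : ℝ} {σ : ℝ} (hr₁ : 0 < r₁)
    (hr : r₁ < r₂) (hσ : σ = 1 ∨ σ = -1) (hθ : Complex.exp (θ * Complex.I) = σ)
    (hg : ContinuousOn g U) (hg' : DifferentiableOn ℂ g V)
    (hM : ∀ z ∈ U, r₁ ≤ ‖z‖ → ‖z‖ ≤ r₂ → ‖g z‖ ≤ M)
    (hU : ∀ r p : ℝ, r ∈ Set.Icc r₁ r₂ → p ∈ Set.Icc θ (θ + Real.pi) →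
      ¬(p = θ + Real.pi / 2 ∧ (r = r₁ ∨ r = r₂)) → circleMap 0 r p ∈ U)
    (hV : ∀ r p : ℝ, r ∈ Set.Ioo r₁ r₂ → p ∈ Set.Ioo θ (θ + Real.pi) → circleMap 0 r p ∈ V) :
    σ * segIntegral g r₁ r₂ + arcIntegral g r₂ θ (θ + Real.pi)
      - arcIntegral g r₁ θ (θ + Real.pi) = 0 := by
  have hr₂ : 0 < r₂ := hr₁.trans hr
  have hpi := Real.pi_pos
  have hexp : ∀ w : ℂ, Complex.exp w = circleMap 0 (Real.exp w.re) w.im := fun w => by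
    rw [circleMap, zero_add, Complex.ofReal_exp, ← Complex.exp_add, Complex.re_add_im]
  have hlog : ∀ {x : ℝ}, x ∈ Set.Icc (Real.log r₁) (Real.log r₂) ↔ Real.exp x ∈ Set.Icc r₁ r₂ :=
    fun {x} => by rw [Set.mem_Icc, Set.mem_Icc, Real.log_le_iff_le_exp hr₁, Real.le_log_iff_exp_le hr₂]
  have hlog' : ∀ {x : ℝ}, x ∈ Set.Ioo (Real.log r₁) (Real.log r₂) ↔ Real.exp x ∈ Set.Ioo r₁ r₂ :=
    fun {x} => by rw [Set.mem_Ioo, Set.mem_Ioo, Real.log_lt_iff_lt_exp hr₁, Real.lt_log_iff_exp_lt hr₂]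
  have hUw : ∀ w : ℂ, w.re ∈ Set.Icc (Real.log r₁) (Real.log r₂) →
      w.im ∈ Set.Icc θ (θ + Real.pi) →
      ¬(w.im = θ + Real.pi / 2 ∧ (w.re = Real.log r₁ ∨ w.re = Real.log r₂)) →
      Complex.exp w ∈ U := fun w h1 h2 h3 => by
    rw [hexp]
    refine hU _ _ (hlog.1 h1) h2 fun h => h3 ⟨h.1, h.2.imp (fun e => ?_) fun e => ?_⟩ <;>
    rw [← e, Real.log_exp]
  have main := integral_boundary_rect_eq_zero_of_bounded
    (f := fun w => g (Complex.exp w) * Complex.exp w) (a := Real.log r₁) (b := Real.log r₂)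
    (c := θ) (d := θ + Real.pi) (y₀ := θ + Real.pi / 2) (M := M * r₂)
    (Real.log_lt_log hr₁ hr) (by linarith) (by linarith) ?_ ?_ ?_
  · have hseg : ∀ (q : ℝ) (τ : ℝ), (τ = 1 ∨ τ = -1) → Complex.exp (q * Complex.I) = τ →
        (∀ r ∈ Set.Icc r₁ r₂, ((τ * r : ℝ) : ℂ) ∈ U) →
        (∫ x : ℝ in Real.log r₁..Real.log r₂, g (Complex.exp (x + q * Complex.I)) *
          Complex.exp (x + q * Complex.I)) = τ * ∫ s : ℝ in r₁..r₂, g (τ * s : ℝ) := by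
      intro q τ _ hq hmem
      have hc : ContinuousOn (fun s : ℝ => (τ : ℂ) * g (τ * s : ℝ)) (Set.Icc r₁ r₂) :=
        continuousOn_const.mul (hg.comp (by fun_prop) hmem)
      have := intervalIntegral.integral_deriv_smul_comp' (a := Real.log r₁) (b := Real.log r₂)
        (f := Real.exp) (f' := Real.exp) (g := fun s : ℝ => (τ : ℂ) * g (τ * s : ℝ))
        (fun x _ => Real.hasDerivAt_exp x) Real.continuous_exp.continuousOn (by
          refine hc.mono ?_
          rintro _ ⟨x, hx, rfl⟩
          rw [Set.uIcc_of_le (Real.log_le_log hr₁ hr.le)] at hx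
          exact hlog.1 hx)
      rw [Real.exp_log hr₁, Real.exp_log hr₂, intervalIntegral.integral_const_mul] at this
      rw [← this]
      refine intervalIntegral.integral_congr fun x _ => ?_
      simp only [Function.comp, Complex.exp_add, hq, Complex.real_smul]
      push_cast
      ring_nf
    have harc : ∀ r, 0 < r → Complex.I • (∫ y : ℝ in θ..(θ + Real.pi),
        g (Complex.exp (Real.log r + y * Complex.I)) * Complex.exp (Real.log r + y * Complex.I))
        = arcIntegral g r θ (θ + Real.pi) := by
      intro r hr0
      rw [arcIntegral, ← intervalIntegral.integral_smul]
      refine intervalIntegral.integral_congr fun y _ => ?_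
      have : Complex.exp (Real.log r + y * Complex.I) = circleMap 0 r y := by
        rw [hexp]; simp [Real.exp_log hr0]
      simp only [this, deriv_circleMap, smul_eq_mul]
      ring
    have hcm : ∀ (r q τ : ℝ), Complex.exp (q * Complex.I) = τ → circleMap 0 r q = (τ * r : ℝ) :=
      fun r q τ hq => by rw [circleMap, zero_add, hq]; push_cast; ring
    have hθ' : Complex.exp ((θ + Real.pi : ℝ) * Complex.I) = ((-σ : ℝ) : ℂ) := by
      push_cast
      rw [add_mul, Complex.exp_add, hθ, Complex.exp_pi_mul_I]; ring
    have hm1 : ∀ r ∈ Set.Icc r₁ r₂, ((σ * r : ℝ) : ℂ) ∈ U := fun r hr' => by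
      rw [← hcm r θ σ hθ]
      exact hU r θ hr' ⟨le_rfl, by linarith⟩ fun h => by linarith [h.1]
    have hm2 : ∀ r ∈ Set.Icc r₁ r₂, ((-σ * r : ℝ) : ℂ) ∈ U := fun r hr' => by
      rw [← hcm r _ (-σ) hθ']
      exact hU r _ hr' ⟨by linarith, le_rfl⟩ fun h => by linarith [h.1]
    have hi : ∀ τ : ℝ, (∀ r ∈ Set.Icc r₁ r₂, ((τ * r : ℝ) : ℂ) ∈ U) →
        IntervalIntegrable (fun s : ℝ => g (τ * s : ℝ)) volume r₁ r₂ := fun τ hτ =>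
      ContinuousOn.intervalIntegrable (by
        rw [Set.uIcc_of_le hr.le]
        exact hg.comp (by fun_prop) hτ)
    rw [hseg θ σ hσ hθ hm1, hseg _ (-σ) (by rcases hσ with h | h <;> simp [h]) hθ' hm2,
      harc r₁ hr₁, harc r₂ hr₂] at main
    rw [← main]
    have hsum : segIntegral g r₁ r₂ = (∫ s : ℝ in r₁..r₂, g (σ * s : ℝ))
        + ∫ s : ℝ in r₁..r₂, g (-σ * s : ℝ) := by
      rw [← intervalIntegral.integral_add (hi σ hm1) (hi (-σ) hm2), segIntegral]
      refine intervalIntegral.integral_congr fun s _ => ?_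
      rcases hσ with h | h <;> simp [h, add_comm]
    rw [hsum]
    push_cast
    ring
  · refine (hg.comp Complex.continuous_exp.continuousOn fun w hw => hUw w hw.1 hw.2.1 hw.2.2).mul
      Complex.continuous_exp.continuousOn
  · intro w h1 h2 h3
    have h4 := hlog.1 h1
    have hn : ‖Complex.exp w‖ = Real.exp w.re := Complex.norm_exp w
    have h5 := hM _ (hUw w h1 h2 h3) (hn ▸ h4.1) (hn ▸ h4.2)
    rw [norm_mul]
    exact mul_le_mul h5 (hn ▸ h4.2) (norm_nonneg _) ((norm_nonneg _).trans h5)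
  · refine (hg'.comp Complex.differentiable_exp.differentiableOn fun w hw => ?_).mul
      Complex.differentiable_exp.differentiableOn
    rw [hexp]
    exact hV _ _ (hlog'.1 hw.1) hw.2

/-- Since `dz = i z dp`, the integrand in the angle is `i z g(z)`, which converges uniformly to `iα`
on the arcs. -/
theorem tendsto_arcIntegral {g : ℂ → ℂ} {α : ℂ} {c d : ℝ} (hcd : c ≤ d) {l : Filter ℝ}
    {F : Filter ℂ} (hF : Tendsto (fun z => z * g z) F (𝓝 α))
    (hl : ∀ s ∈ F, ∀ᶠ r in l, ∀ p ∈ Set.Icc c d, circleMap 0 r p ∈ s)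
    (hc : ∀ᶠ r in l, ContinuousOn (fun p => g (circleMap 0 r p)) (Set.Icc c d)) :
    Tendsto (fun r => arcIntegral g r c d) l (𝓝 (Complex.I * (d - c) * α)) := by
  refine Metric.tendsto_nhds.2 fun ε hε => ?_
  have hε' : 0 < ε / (d - c + 1) := div_pos hε (by linarith)
  filter_upwards [hl _ (Metric.tendsto_nhds.1 hF _ hε'), hc] with r hr hcr
  have hcont : ContinuousOn (fun p => Complex.I * (circleMap 0 r p * g (circleMap 0 r p)))
      (Set.uIcc c d) := by
    rw [Set.uIcc_of_le hcd]
    exact continuousOn_const.mul ((continuous_circleMap 0 r).continuousOn.mul hcr)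
  have e1 : arcIntegral g r c d - Complex.I * (d - c) * α
      = ∫ p in c..d, (Complex.I * (circleMap 0 r p * g (circleMap 0 r p)) - Complex.I * α) := by
    rw [intervalIntegral.integral_sub hcont.intervalIntegrable intervalIntegrable_const,
      intervalIntegral.integral_const, arcIntegral, Complex.real_smul]
    congr 1
    · refine intervalIntegral.integral_congr fun p _ => ?_
      simp only [deriv_circleMap]; ring
    · push_cast; ring
  rw [dist_eq_norm, e1]
  refine (intervalIntegral.norm_integral_le_of_norm_le_const (C := ε / (d - c + 1))
    fun p hp => ?_).trans_lt ?_
  · rw [Set.uIoc_of_le hcd] at hp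
    have : dist _ _ < _ := hr p ⟨hp.1.le, hp.2⟩
    rw [← mul_sub, norm_mul, Complex.norm_I, one_mul, ← dist_eq_norm]
    exact this.le
  · rw [abs_of_nonneg (by linarith), div_mul_eq_mul_div, div_lt_iff₀ (by linarith)]
    nlinarith

end Cauchy

end MMKdV

namespace MMKdV

/-! ### The jump formula on the contour `Σ` -/

section Contour

theorem intervalIntegrable_of_bounded {u : ℝ → ℂ} {c d p₀ M : ℝ} (hcd : c ≤ d)
    (hu : ContinuousOn u (Set.Icc c d \ {p₀})) (hM : ∀ p ∈ Set.Icc c d \ {p₀}, ‖u p‖ ≤ M) :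
    IntervalIntegrable u volume c d := by
  rw [intervalIntegrable_iff_integrableOn_Icc_of_le hcd]
  have hms : MeasurableSet (Set.Icc c d \ {p₀}) := measurableSet_Icc.diff (measurableSet_singleton _)
  have hfin : volume (Set.Icc c d \ {p₀}) < ⊤ :=
    (measure_mono Set.sdiff_subset).trans_lt measure_Icc_lt_top
  have h1 : IntegrableOn u (Set.Icc c d \ {p₀}) :=
    IntegrableOn.of_bound hfin (hu.aestronglyMeasurable hms) M (ae_restrict_of_forall_mem hms hM)
  exact h1.congr_set_ae (sdiff_null_ae_eq_self (by simp)).symm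

variable {k₀ : ℝ}

theorem circleMap_im (r p : ℝ) : (circleMap 0 r p).im = r * Real.sin p := by
  simp [circleMap, Complex.exp_im]

theorem circleMap_re (r p : ℝ) : (circleMap 0 r p).re = r * Real.cos p := by
  simp [circleMap, Complex.exp_re]

theorem norm_circleMap {r : ℝ} (hr : 0 < r) (p : ℝ) : ‖circleMap 0 r p‖ = r := by
  rw [norm_circleMap_zero, abs_of_pos hr]

theorem cos_circleMap_eq_zero {r p : ℝ} (hr : 0 < r)
    (h : circleMap 0 r p = Complex.I * k₀ ∨ circleMap 0 r p = -(Complex.I * k₀)) :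
    Real.cos p = 0 := by
  have : (circleMap 0 r p).re = 0 := by rcases h with h | h <;> simp [h]
  rw [circleMap_re] at this
  exact (mul_eq_zero.1 this).resolve_left hr.ne'

theorem circleMap_mem_Omega (hk : 0 < k₀) {r p : ℝ} (hr : 0 < r)
    (h : 0 ≤ (r ^ 2 - k₀ ^ 2) * Real.sin p) (h' : ¬(Real.cos p = 0 ∧ r = k₀)) :
    circleMap 0 r p ∈ Omega k₀ := by
  have hn := norm_circleMap hr p
  have hne : ¬(circleMap 0 r p = Complex.I * k₀ ∨ circleMap 0 r p = -(Complex.I * k₀)) := by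
    intro h1
    refine h' ⟨cos_circleMap_eq_zero hr h1, ?_⟩
    rw [← hn]
    rcases h1 with h1 | h1 <;> simp only [h1, norm_neg, norm_I_mul hk]
  refine ⟨?_, fun h0 => ?_, fun h1 => hne (Or.inl h1), fun h1 => hne (Or.inr h1)⟩
  · rw [hn, circleMap_im, mul_left_comm]
    positivity
  · rw [h0, norm_zero] at hn; exact hr.ne hn

theorem circleMap_mem_Dplus {r p : ℝ} (hr : 0 < r)
    (h : 0 < (r ^ 2 - k₀ ^ 2) * Real.sin p) : circleMap 0 r p ∈ Dplus k₀ := by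
  change 0 < (‖circleMap 0 r p‖ ^ 2 - k₀ ^ 2) * (circleMap 0 r p).im
  rw [norm_circleMap hr, circleMap_im, mul_left_comm]
  positivity

theorem sin_nonpos_of_mem {p : ℝ} (hp : p ∈ Set.Icc Real.pi (2 * Real.pi)) : Real.sin p ≤ 0 := by
  have := Real.sin_nonneg_of_nonneg_of_le_pi (x := p - Real.pi) (by linarith [hp.1])
    (by linarith [hp.2])
  rw [Real.sin_sub_pi] at this; linarith

theorem cos_eq_zero_upper {p : ℝ} (hp : p ∈ Set.Icc 0 Real.pi) (h : Real.cos p = 0) :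
    p = Real.pi / 2 :=
  Real.injOn_cos hp ⟨by linarith [Real.pi_pos], by linarith [Real.pi_pos]⟩ (by simp [h])

theorem cos_eq_zero_lower {p : ℝ} (hp : p ∈ Set.Icc Real.pi (2 * Real.pi)) (h : Real.cos p = 0) :
    p = Real.pi + Real.pi / 2 := by
  have := cos_eq_zero_upper (p := p - Real.pi) ⟨by linarith [hp.1], by linarith [hp.2]⟩
    (by rw [Real.cos_sub_pi, h, neg_zero])
  linarith

/-- Functions on `Ω`, holomorphic inside, bounded near the branch points, with
prescribed behaviour at infinity and at the origin. -/
structure IsSectional (k₀ : ℝ) (g : ℂ → ℂ) (α β : ℂ) : Prop where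
  cont : ContinuousOn g (Omega k₀)
  diff : DifferentiableOn ℂ g (Dplus k₀)
  bdd : ∀ r R : ℝ, 0 < r → ∃ M, ∀ z ∈ Omega k₀, r ≤ ‖z‖ → ‖z‖ ≤ R → ‖g z‖ ≤ M
  inf : Tendsto (fun z => z * g z) (atInf k₀) (𝓝 α)
  zero : Tendsto (fun z => z * g z) (𝓝[Omega k₀] 0) (𝓝 β)

namespace IsSectional

variable {g : ℂ → ℂ} {α β : ℂ} (hg : IsSectional k₀ g α β) (hk : 0 < k₀)
include hg hk

/-- The two components of `D⁺`, outside the circle above the axis and inside it below the axis, are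
treated separately here and in `lower`. -/
theorem upper {R : ℝ} (hR : k₀ < R) :
    segIntegral g k₀ R + arcIntegral g R 0 Real.pi - arcIntegral g k₀ 0 Real.pi = 0 := by
  obtain ⟨M, hM⟩ := hg.bdd k₀ R hk
  have := cauchy_half_annulus (θ := 0) (σ := 1) hk hR (Or.inl rfl) (by simp) hg.cont hg.diff hM
    (fun r p hr hp hne => ?_) (fun r p hr hp => ?_)
  · simpa using this
  · rw [zero_add] at hp hne
    refine circleMap_mem_Omega hk (hk.trans_le hr.1) (mul_nonneg ?_
      (Real.sin_nonneg_of_nonneg_of_le_pi hp.1 hp.2)) fun h =>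
        hne ⟨cos_eq_zero_upper hp h.1, Or.inl h.2⟩
    nlinarith [hr.1]
  · rw [zero_add] at hp
    refine circleMap_mem_Dplus (hk.trans hr.1) (mul_pos ?_ (Real.sin_pos_of_pos_of_lt_pi hp.1 hp.2))
    nlinarith [hr.1]

theorem lower {r : ℝ} (h0 : 0 < r) (hr : r < k₀) :
    -segIntegral g r k₀ + arcIntegral g k₀ Real.pi (2 * Real.pi)
      - arcIntegral g r Real.pi (2 * Real.pi) = 0 := by
  obtain ⟨M, hM⟩ := hg.bdd r k₀ h0
  have := cauchy_half_annulus (θ := Real.pi) (σ := -1) h0 hr (Or.inr rfl) (by simp) hg.cont hg.diff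
    hM (fun r p hr hp hne => ?_) (fun r p hr hp => ?_)
  · rw [← two_mul] at this
    simpa using this
  · rw [← two_mul] at hp
    refine circleMap_mem_Omega hk (h0.trans_le hr.1) (mul_nonneg_of_nonpos_of_nonpos ?_
      (sin_nonpos_of_mem hp)) fun h => hne ⟨cos_eq_zero_lower hp h.1, Or.inr h.2⟩
    nlinarith [hr.1, hr.2]
  · have := Real.sin_pos_of_pos_of_lt_pi (x := p - Real.pi) (by linarith [hp.1])
      (by linarith [hp.2])
    rw [Real.sin_sub_pi] at this
    refine circleMap_mem_Dplus (h0.trans hr.1) (mul_pos_of_neg_of_neg ?_ (by linarith))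
    nlinarith [hr.1, hr.2]

theorem tendsto_upper : Tendsto (fun R => segIntegral g k₀ R) atTop
    (𝓝 (arcIntegral g k₀ 0 Real.pi - Complex.I * Real.pi * α)) := by
  have hmem : ∀ R > k₀, ∀ p ∈ Set.Icc 0 Real.pi, circleMap 0 R p ∈ Omega k₀ := fun R hR p hp =>
    circleMap_mem_Omega hk (hk.trans hR) (mul_nonneg (by nlinarith)
      (Real.sin_nonneg_of_nonneg_of_le_pi hp.1 hp.2)) fun h => hR.ne' h.2
  have h1 := tendsto_arcIntegral Real.pi_pos.le (l := atTop) hg.inf (fun s hs => ?_) ?_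
  · have h2 := (tendsto_const_nhds (x := arcIntegral g k₀ 0 Real.pi)).sub h1
    rw [Complex.ofReal_zero, sub_zero] at h2
    refine h2.congr' ?_
    filter_upwards [eventually_gt_atTop k₀] with R hR
    linear_combination -hg.upper hk hR
  · have hs' : ∃ T : ℝ, ∀ z ∈ Omega k₀, T ≤ ‖z‖ → z ∈ s := by
      rw [atInf, mem_inf_principal] at hs
      obtain ⟨T, -, hT⟩ := (hasBasis_cobounded_norm.mem_iff).1 hs
      exact ⟨T, fun z hz hn => hT hn hz⟩
    obtain ⟨T, hT⟩ := hs'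
    filter_upwards [eventually_gt_atTop k₀, eventually_ge_atTop T] with R hR hRT p hp
    exact hT _ (hmem R hR p hp) (by rwa [norm_circleMap (hk.trans hR)])
  · filter_upwards [eventually_gt_atTop k₀] with R hR
    exact hg.cont.comp (continuous_circleMap 0 R).continuousOn (hmem R hR)

theorem tendsto_lower : Tendsto (fun r => segIntegral g r k₀) (𝓝[>] 0)
    (𝓝 (arcIntegral g k₀ Real.pi (2 * Real.pi) - Complex.I * Real.pi * β)) := by
  have hmem : ∀ r ∈ Set.Ioo 0 k₀, ∀ p ∈ Set.Icc Real.pi (2 * Real.pi),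
      circleMap 0 r p ∈ Omega k₀ := fun R hR p hp =>
    circleMap_mem_Omega hk hR.1 (mul_nonneg_of_nonpos_of_nonpos (by nlinarith [hR.1, hR.2])
      (sin_nonpos_of_mem hp)) fun h => hR.2.ne h.2
  have hev : ∀ᶠ r in 𝓝[>] (0 : ℝ), r ∈ Set.Ioo 0 k₀ := Ioo_mem_nhdsGT hk
  have h1 := tendsto_arcIntegral (c := Real.pi) (d := 2 * Real.pi) (by linarith [Real.pi_pos])
    (l := 𝓝[>] 0) hg.zero (fun s hs => ?_) ?_
  · have h2 := (tendsto_const_nhds (x := arcIntegral g k₀ Real.pi (2 * Real.pi))).sub h1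
    have e : Complex.I * (((2 * Real.pi : ℝ) : ℂ) - Real.pi) * β = Complex.I * Real.pi * β := by
      push_cast; ring
    rw [e] at h2
    refine h2.congr' ?_
    filter_upwards [hev] with r hr
    linear_combination hg.lower hk hr.1 hr.2
  · obtain ⟨ε, hε, hs'⟩ := Metric.mem_nhdsWithin_iff.1 hs
    filter_upwards [hev, Ioo_mem_nhdsGT hε] with r hr hrε p hp
    refine hs' ⟨?_, hmem r hr p hp⟩
    rw [mem_ball_zero_iff, norm_circleMap hr.1]
    exact hrε.2
  · filter_upwards [hev] with r hr
    exact hg.cont.comp (continuous_circleMap 0 r).continuousOn (hmem r hr)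

theorem intervalIntegrable_upper :
    IntervalIntegrable (fun p => deriv (circleMap 0 k₀) p * g (circleMap 0 k₀ p)) volume
      0 Real.pi := by
  obtain ⟨M, hM⟩ := hg.bdd k₀ k₀ hk
  have hmem : ∀ p ∈ Set.Icc 0 Real.pi \ {Real.pi / 2}, circleMap 0 k₀ p ∈ Omega k₀ := fun p hp =>
    circleMap_mem_Omega hk hk (by simp) fun h => hp.2 (cos_eq_zero_upper hp.1 h.1)
  refine intervalIntegrable_of_bounded (p₀ := Real.pi / 2) (M := k₀ * M) Real.pi_pos.le ?_ ?_
  · simp only [deriv_circleMap]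
    exact ((continuous_circleMap 0 k₀).mul continuous_const).continuousOn.mul
      (hg.cont.comp (continuous_circleMap 0 k₀).continuousOn hmem)
  · intro p hp
    have hn := norm_circleMap hk p
    rw [norm_mul, deriv_circleMap, norm_mul, hn, Complex.norm_I, mul_one]
    exact mul_le_mul_of_nonneg_left (hM _ (hmem p hp) hn.ge hn.le) hk.le

theorem intervalIntegrable_lower :
    IntervalIntegrable (fun p => deriv (circleMap 0 k₀) p * g (circleMap 0 k₀ p)) volume
      Real.pi (2 * Real.pi) := by
  obtain ⟨M, hM⟩ := hg.bdd k₀ k₀ hk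
  have hmem : ∀ p ∈ Set.Icc Real.pi (2 * Real.pi) \ {Real.pi + Real.pi / 2},
      circleMap 0 k₀ p ∈ Omega k₀ := fun p hp =>
    circleMap_mem_Omega hk hk (by simp) fun h => hp.2 (cos_eq_zero_lower hp.1 h.1)
  refine intervalIntegrable_of_bounded (p₀ := Real.pi + Real.pi / 2) (M := k₀ * M)
    (by linarith [Real.pi_pos]) ?_ ?_
  · simp only [deriv_circleMap]
    exact ((continuous_circleMap 0 k₀).mul continuous_const).continuousOn.mul
      (hg.cont.comp (continuous_circleMap 0 k₀).continuousOn hmem)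
  · intro p hp
    have hn := norm_circleMap hk p
    rw [norm_mul, deriv_circleMap, norm_mul, hn, Complex.norm_I, mul_one]
    exact mul_le_mul_of_nonneg_left (hM _ (hmem p hp) hn.ge hn.le) hk.le

end IsSectional

theorem ofReal_mem_Sigma0 (hk : 0 < k₀) {s : ℝ} (hs : s ≠ 0) : (s : ℂ) ∈ Sigma0 k₀ := by
  refine ⟨Or.inl (Complex.ofReal_im s), by exact_mod_cast hs, fun h => ?_, fun h => ?_⟩
  · have := congrArg Complex.im h
    simp only [Complex.ofReal_im, Complex.mul_im, Complex.I_re, Complex.I_im, Complex.ofReal_re,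
      zero_mul, one_mul, zero_add] at this
    exact hk.ne this
  · have := congrArg Complex.im h
    simp only [Complex.neg_im, Complex.ofReal_im, Complex.mul_im, Complex.I_re, Complex.I_im,
      Complex.ofReal_re, zero_mul, one_mul, zero_add] at this
    linarith

theorem neg_mem_Sigma0 {z : ℂ} (h : z ∈ Sigma0 k₀) : -z ∈ Sigma0 k₀ :=
  ⟨by simpa using h.1, neg_ne_zero.2 h.2.1, fun e => h.2.2.2 (by rw [← e, neg_neg]),
    fun e => h.2.2.1 (neg_injective e)⟩

theorem circleMap_mem_Sigma0 (hk : 0 < k₀) {p : ℝ} (h : Real.cos p ≠ 0) :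
    circleMap 0 k₀ p ∈ Sigma0 k₀ :=
  ⟨Or.inr (norm_circleMap hk p), fun h0 => hk.ne' (by rw [← norm_circleMap hk p, h0, norm_zero]),
    fun e => h (cos_circleMap_eq_zero hk (Or.inl e)),
    fun e => h (cos_circleMap_eq_zero hk (Or.inr e))⟩

theorem ae_circleMap_mem_Sigma0 (hk : 0 < k₀) :
    ∀ᵐ p : ℝ, p ∈ Set.Icc 0 (2 * Real.pi) → circleMap 0 k₀ p ∈ Sigma0 k₀ := by
  have h1 : ∀ᵐ p : ℝ, p ≠ Real.pi / 2 := by rw [ae_iff]; simp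
  have h2 : ∀ᵐ p : ℝ, p ≠ Real.pi + Real.pi / 2 := by rw [ae_iff]; simp
  filter_upwards [h1, h2] with p h1 h2 hp
  refine circleMap_mem_Sigma0 hk fun h => ?_
  rcases le_total p Real.pi with h' | h'
  · exact h1 (cos_eq_zero_upper ⟨hp.1, h'⟩ h)
  · exact h2 (cos_eq_zero_lower ⟨h', hp.2⟩ h)

/-- The jump `k` across `Σ` of a sectionally holomorphic function, given by `g` in `D⁺`
and by `z ↦ h (-z)` in `D⁻`. -/
structure IsJump (k₀ : ℝ) (k g h : ℂ → ℂ) (α β α' β' : ℂ) : Prop where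
  left : IsSectional k₀ g α β
  right : IsSectional k₀ h α' β'
  eq : ∀ z ∈ Sigma0 k₀, k z = g z - h (-z)
  inf : ∃ C R : ℝ, ∀ s : ℝ, R ≤ |s| → ‖k s‖ ≤ C / s ^ 2
  zero : ∃ C ε : ℝ, 0 < ε ∧ ∀ s : ℝ, s ≠ 0 → |s| < ε → ‖k s‖ ≤ C

namespace IsJump

variable {k g h : ℂ → ℂ} {α β α' β' : ℂ} (H : IsJump k₀ k g h α β α' β') (hk : 0 < k₀)
include H hk

theorem continuousOn_real : ContinuousOn (fun s : ℝ => k s) {0}ᶜ := by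
  have h1 : ContinuousOn (fun s : ℝ => g s - h (-s)) {0}ᶜ :=
    (H.left.cont.comp Complex.continuous_ofReal.continuousOn fun s hs =>
      Sigma0_subset_Omega (ofReal_mem_Sigma0 hk hs)).sub
    (H.right.cont.comp Complex.continuous_ofReal.neg.continuousOn fun s hs =>
      Sigma0_subset_Omega (neg_mem_Sigma0 (ofReal_mem_Sigma0 hk hs)))
  exact h1.congr fun s hs => H.eq _ (ofReal_mem_Sigma0 hk hs)

/-- The two boundary values may decay only like `1/s` at infinity and grow like `1/s` at the origin.
Integrability is a property of the jump, through the bounds `inf` and `zero`. -/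
theorem integrable_real : Integrable (fun s : ℝ => k s) := by
  obtain ⟨C₁, R, h1⟩ := H.inf
  obtain ⟨C₂, ε, hε, h2⟩ := H.zero
  set R' := max R 1
  obtain ⟨M₁, hM₁⟩ := H.left.bdd ε R' hε
  obtain ⟨M₂, hM₂⟩ := H.right.bdd ε R' hε
  set B := |C₂| + |M₁| + |M₂| with hB
  have hbd : ∀ s : ℝ, s ≠ 0 → |s| ≤ R' → ‖k s‖ ≤ B := by
    intro s hs hsR
    rcases lt_or_ge |s| ε with h | h
    · refine (h2 s hs h).trans ?_
      linarith [le_abs_self C₂, abs_nonneg M₁, abs_nonneg M₂]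
    · have hm := ofReal_mem_Sigma0 hk hs
      have hn : ‖(s : ℂ)‖ = |s| := by simp
      rw [H.eq _ hm]
      have e1 := hM₁ s (Sigma0_subset_Omega hm) (by rwa [hn]) (by rwa [hn])
      have e2 := hM₂ (-s) (Sigma0_subset_Omega (neg_mem_Sigma0 hm)) (by rwa [norm_neg, hn])
        (by rwa [norm_neg, hn])
      refine (norm_sub_le _ _).trans ?_
      linarith [le_abs_self M₁, le_abs_self M₂, abs_nonneg C₂]
  have hR' : 1 ≤ R' := le_max_right _ _
  have hB0 : 0 ≤ B := by positivity
  have hmeas : AEStronglyMeasurable (fun s : ℝ => k s) volume := by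
    have := (H.continuousOn_real hk).aestronglyMeasurable (μ := volume)
      (measurableSet_singleton (0 : ℝ)).compl
    rwa [Measure.restrict_congr_set (t := Set.univ) (compl_mem_ae_iff.2 (by simp) |>
      eventuallyEq_univ.2), Measure.restrict_univ] at this
  refine ((integrable_inv_one_add_sq.const_mul (B * (1 + R' ^ 2) + 2 * |C₁|))).mono' hmeas ?_
  have hne : ∀ᵐ s : ℝ, s ≠ 0 := by rw [ae_iff]; simp
  filter_upwards [hne] with s hs
  rw [← div_eq_mul_inv, le_div_iff₀ (by positivity)]
  rcases le_total |s| R' with h | h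
  · have h3 : s ^ 2 ≤ R' ^ 2 := by rw [← sq_abs]; exact pow_le_pow_left₀ (abs_nonneg s) h 2
    have h4 : ‖k s‖ * (1 + s ^ 2) ≤ B * (1 + R' ^ 2) :=
      mul_le_mul (hbd s hs h) (by linarith) (by positivity) hB0
    linarith [abs_nonneg C₁]
  · have h3 : 1 ≤ s ^ 2 := by
      rw [← sq_abs]; exact one_le_pow₀ (hR'.trans h)
    have h4 := h1 s ((le_max_left _ _).trans h)
    have h5 : ‖k s‖ * s ^ 2 ≤ C₁ := (le_div_iff₀ (by linarith)).1 h4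
    have h6 : 0 ≤ B * (1 + R' ^ 2) := by positivity
    have h7 : ‖k s‖ ≤ ‖k s‖ * s ^ 2 := le_mul_of_one_le_right (norm_nonneg _) h3
    linarith [le_abs_self C₁]

theorem intervalIntegrable_upper :
    IntervalIntegrable (fun p => k (circleMap 0 k₀ p)) volume 0 Real.pi := by
  obtain ⟨M₁, hM₁⟩ := H.left.bdd k₀ k₀ hk
  obtain ⟨M₂, hM₂⟩ := H.right.bdd k₀ k₀ hk
  have hmem : ∀ p ∈ Set.Icc 0 Real.pi \ {Real.pi / 2}, circleMap 0 k₀ p ∈ Sigma0 k₀ := fun p hp =>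
    circleMap_mem_Sigma0 hk fun h => hp.2 (cos_eq_zero_upper hp.1 h)
  have hcm := (continuous_circleMap 0 k₀).continuousOn (s := Set.Icc 0 Real.pi \ {Real.pi / 2})
  refine intervalIntegrable_of_bounded (p₀ := Real.pi / 2) (M := M₁ + M₂) Real.pi_pos.le ?_ ?_
  · refine ContinuousOn.congr ?_ fun p hp => H.eq _ (hmem p hp)
    exact (H.left.cont.comp hcm fun p hp => Sigma0_subset_Omega (hmem p hp)).sub
      (H.right.cont.comp hcm.neg fun p hp => Sigma0_subset_Omega (neg_mem_Sigma0 (hmem p hp)))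
  · intro p hp
    have hn := norm_circleMap hk p
    rw [H.eq _ (hmem p hp)]
    exact (norm_sub_le _ _).trans (add_le_add
      (hM₁ _ (Sigma0_subset_Omega (hmem p hp)) hn.ge hn.le)
      (hM₂ _ (Sigma0_subset_Omega (neg_mem_Sigma0 (hmem p hp))) (by rw [norm_neg, hn])
        (by rw [norm_neg, hn])))

theorem intervalIntegrable_lower :
    IntervalIntegrable (fun p => k (circleMap 0 k₀ p)) volume Real.pi (2 * Real.pi) := by
  obtain ⟨M₁, hM₁⟩ := H.left.bdd k₀ k₀ hk
  obtain ⟨M₂, hM₂⟩ := H.right.bdd k₀ k₀ hk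
  have hmem : ∀ p ∈ Set.Icc Real.pi (2 * Real.pi) \ {Real.pi + Real.pi / 2},
      circleMap 0 k₀ p ∈ Sigma0 k₀ := fun p hp =>
    circleMap_mem_Sigma0 hk fun h => hp.2 (cos_eq_zero_lower hp.1 h)
  have hcm := (continuous_circleMap 0 k₀).continuousOn
    (s := Set.Icc Real.pi (2 * Real.pi) \ {Real.pi + Real.pi / 2})
  refine intervalIntegrable_of_bounded (p₀ := Real.pi + Real.pi / 2) (M := M₁ + M₂)
    (by linarith [Real.pi_pos]) ?_ ?_
  · refine ContinuousOn.congr ?_ fun p hp => H.eq _ (hmem p hp)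
    exact (H.left.cont.comp hcm fun p hp => Sigma0_subset_Omega (hmem p hp)).sub
      (H.right.cont.comp hcm.neg fun p hp => Sigma0_subset_Omega (neg_mem_Sigma0 (hmem p hp)))
  · intro p hp
    have hn := norm_circleMap hk p
    rw [H.eq _ (hmem p hp)]
    exact (norm_sub_le _ _).trans (add_le_add
      (hM₁ _ (Sigma0_subset_Omega (hmem p hp)) hn.ge hn.le)
      (hM₂ _ (Sigma0_subset_Omega (neg_mem_Sigma0 (hmem p hp))) (by rw [norm_neg, hn])
        (by rw [norm_neg, hn])))

omit hk H in
theorem circleMap_add_pi (r p : ℝ) : circleMap 0 r (p + Real.pi) = -circleMap 0 r p := by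
  rw [circleMap, circleMap, zero_add, zero_add]
  push_cast
  rw [add_mul, Complex.exp_add, Complex.exp_pi_mul_I]; ring

omit hk H in
theorem circleMap_sub_pi (r p : ℝ) : circleMap 0 r (p - Real.pi) = -circleMap 0 r p := by
  rw [← neg_neg (circleMap 0 r (p - Real.pi)), ← circleMap_add_pi, sub_add_cancel]

/-- The `D⁻` part is a function of `-z`, so its upper arc is the lower arc of `h`; two signs, from
the jump and from `dz`, combine to a plus. -/
theorem arc_upper : arcIntegral k k₀ 0 Real.pi
    = arcIntegral g k₀ 0 Real.pi + arcIntegral h k₀ Real.pi (2 * Real.pi) := by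
  have e1 : arcIntegral h k₀ Real.pi (2 * Real.pi)
      = ∫ p in (0 : ℝ)..Real.pi, deriv (circleMap 0 k₀) (p + Real.pi) *
        h (circleMap 0 k₀ (p + Real.pi)) := by
    rw [intervalIntegral.integral_comp_add_right (fun p => deriv (circleMap 0 k₀) p *
        h (circleMap 0 k₀ p)), zero_add, ← two_mul, arcIntegral]
  have i1 := H.left.intervalIntegrable_upper hk
  have i2 := (H.right.intervalIntegrable_lower hk).comp_add_right Real.pi
  rw [sub_self, two_mul, add_sub_cancel_right] at i2
  rw [e1, arcIntegral, arcIntegral, ← intervalIntegral.integral_add i1 i2]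
  refine intervalIntegral.integral_congr_ae ?_
  filter_upwards [ae_circleMap_mem_Sigma0 hk] with p hp hp'
  rw [Set.uIoc_of_le Real.pi_pos.le] at hp'
  rw [H.eq _ (hp ⟨hp'.1.le, by linarith [hp'.2, Real.pi_pos]⟩)]
  simp only [deriv_circleMap, circleMap_add_pi]
  ring

theorem arc_lower : arcIntegral k k₀ Real.pi (2 * Real.pi)
    = arcIntegral g k₀ Real.pi (2 * Real.pi) + arcIntegral h k₀ 0 Real.pi := by
  have e1 : arcIntegral h k₀ 0 Real.pi
      = ∫ p in Real.pi..(2 * Real.pi), deriv (circleMap 0 k₀) (p - Real.pi) *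
        h (circleMap 0 k₀ (p - Real.pi)) := by
    rw [intervalIntegral.integral_comp_sub_right (fun p => deriv (circleMap 0 k₀) p *
        h (circleMap 0 k₀ p)), sub_self, two_mul, add_sub_cancel_right, arcIntegral]
  have i1 := H.left.intervalIntegrable_lower hk
  have i2 := (H.right.intervalIntegrable_upper hk).comp_sub_right Real.pi
  rw [zero_add, ← two_mul] at i2
  rw [e1, arcIntegral, arcIntegral, ← intervalIntegral.integral_add i1 i2]
  refine intervalIntegral.integral_congr_ae ?_
  filter_upwards [ae_circleMap_mem_Sigma0 hk] with p hp hp'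
  rw [Set.uIoc_of_le (by linarith [Real.pi_pos])] at hp'
  rw [H.eq _ (hp ⟨by linarith [hp'.1, Real.pi_pos], hp'.2⟩)]
  simp only [deriv_circleMap, circleMap_sub_pi]
  ring

theorem segIntegral_eq {r₁ r₂ : ℝ} (h1 : 0 < r₁) (h2 : r₁ ≤ r₂) :
    segIntegral k r₁ r₂ = segIntegral g r₁ r₂ - segIntegral h r₁ r₂ := by
  have hmem : ∀ s ∈ Set.Icc r₁ r₂, (s : ℂ) ∈ Sigma0 k₀ := fun s hs =>
    ofReal_mem_Sigma0 hk (h1.trans_le hs.1).ne'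
  have hint : ∀ {f : ℂ → ℂ} {a b : ℂ}, IsSectional k₀ f a b →
      IntervalIntegrable (fun s : ℝ => f s + f (-s : ℝ)) volume r₁ r₂ := fun hf => by
    refine ContinuousOn.intervalIntegrable ?_
    rw [Set.uIcc_of_le h2]
    refine (hf.cont.comp Complex.continuous_ofReal.continuousOn fun s hs =>
      Sigma0_subset_Omega (hmem s hs)).add (hf.cont.comp (Complex.continuous_ofReal.comp
        continuous_neg).continuousOn fun s hs => ?_)
    simp only [Complex.ofReal_neg]
    exact Sigma0_subset_Omega (neg_mem_Sigma0 (hmem s hs))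
  rw [segIntegral, segIntegral, segIntegral, ← intervalIntegral.integral_sub (hint H.left)
    (hint H.right)]
  refine intervalIntegral.integral_congr fun s hs => ?_
  rw [Set.uIcc_of_le h2] at hs
  simp only [Complex.ofReal_neg]
  rw [H.eq _ (hmem s hs), H.eq _ (neg_mem_Sigma0 (hmem s hs)), neg_neg]
  ring

/-- The jump is absolutely integrable, so its integral is the limit over symmetric segments `k₀ ≤
|s| ≤ R`. On these the two boundary values can be separated, and each has a limit by Cauchy's
theorem even when it is not integrable. -/
theorem integral_outer : ∫ s in {s : ℝ | k₀ < |s|}, k s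
    = arcIntegral g k₀ 0 Real.pi - arcIntegral h k₀ 0 Real.pi - Complex.I * Real.pi * (α - α') := by
  have hi := H.integrable_real hk
  have hin : Integrable (fun s : ℝ => k (-s : ℝ)) := hi.comp_neg
  have hset : {s : ℝ | k₀ < |s|} = Set.Ioi k₀ ∪ Set.Iio (-k₀) := by
    ext s; simp only [Set.mem_ofPred_eq, Set.mem_union, Set.mem_Ioi, Set.mem_Iio, lt_abs]
    constructor <;> (rintro (h | h); exacts [Or.inl h, Or.inr (by linarith)])
  have e1 : ∫ s in {s : ℝ | k₀ < |s|}, k s = ∫ s in Set.Ioi k₀, (k s + k (-s : ℝ)) := by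
    rw [hset, setIntegral_union (Set.disjoint_left.2 fun s h1 h2 => by
        rw [Set.mem_Ioi] at h1; rw [Set.mem_Iio] at h2; linarith) measurableSet_Iio
      hi.integrableOn hi.integrableOn, integral_add hi.integrableOn hin.integrableOn,
      integral_comp_neg_Ioi k₀ (fun s : ℝ => k s), integral_Iic_eq_integral_Iio]
  have h1 := intervalIntegral_tendsto_integral_Ioi k₀ (hi.add hin).integrableOn tendsto_id
    (μ := volume)
  have h2 := (H.left.tendsto_upper hk).sub (H.right.tendsto_upper hk)
  rw [e1]
  refine (tendsto_nhds_unique h1 (h2.congr' ?_)).trans (by ring)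
  filter_upwards [eventually_ge_atTop k₀] with R hR
  exact (H.segIntegral_eq hk hk hR).symm

theorem integral_inner : ∫ s in {s : ℝ | |s| < k₀}, k s
    = arcIntegral g k₀ Real.pi (2 * Real.pi) - arcIntegral h k₀ Real.pi (2 * Real.pi)
      - Complex.I * Real.pi * (β - β') := by
  have hi := H.integrable_real hk
  have hin : Integrable (fun s : ℝ => k (-s : ℝ)) := hi.comp_neg
  have hii := hi.add hin
  have hset : {s : ℝ | |s| < k₀} = Set.Ioo (-k₀) k₀ := by
    ext s; simp only [Set.mem_ofPred_eq, Set.mem_Ioo, abs_lt]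
  have e1 : ∫ s in {s : ℝ | |s| < k₀}, k s = ∫ s : ℝ in (0 : ℝ)..k₀, (k s + k (-s : ℝ)) := by
    rw [hset, ← integral_Ioc_eq_integral_Ioo, ← intervalIntegral.integral_of_le (by linarith),
      intervalIntegral.integral_add hi.intervalIntegrable hin.intervalIntegrable,
      intervalIntegral.integral_comp_neg (fun s : ℝ => k s), neg_zero, add_comm,
      intervalIntegral.integral_add_adjacent_intervals hi.intervalIntegrable hi.intervalIntegrable]
  have h1 : Tendsto (fun r => segIntegral k r k₀) (𝓝[>] 0)
      (𝓝 (∫ s : ℝ in (0 : ℝ)..k₀, (k s + k (-s : ℝ)))) := by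
    have hc := intervalIntegral.continuousOn_primitive_interval_left (a := 0) (b := k₀)
      (f := fun s : ℝ => k s + k (-s : ℝ)) (μ := volume) hii.integrableOn
    rw [Set.uIcc_of_le hk.le] at hc
    refine (hc 0 ⟨le_rfl, hk.le⟩).tendsto.mono_left ?_
    exact nhdsWithin_le_of_mem (mem_of_superset (Ioo_mem_nhdsGT hk) fun s hs => ⟨hs.1.le, hs.2.le⟩)
  have h2 := (H.left.tendsto_lower hk).sub (H.right.tendsto_lower hk)
  rw [e1]
  refine (tendsto_nhds_unique h1 (h2.congr' ?_)).trans (by ring)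
  filter_upwards [Ioo_mem_nhdsGT hk] with r hr
  exact (H.segIntegral_eq hk hr.1 hr.2.le).symm

/-- With the orientation of `Σ` all arc integrals cancel, and only the coefficients of `1/z` at the
origin and at infinity remain. -/
theorem integral_contour :
    (∫ s in {s : ℝ | k₀ < |s|}, k s) - (∫ s in {s : ℝ | |s| < k₀}, k s)
      - arcIntegral k k₀ 0 Real.pi + arcIntegral k k₀ Real.pi (2 * Real.pi)
    = Complex.I * Real.pi * ((β - β') - (α - α')) := by
  rw [H.integral_outer hk, H.integral_inner hk, H.arc_upper hk, H.arc_lower hk]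
  ring

end IsJump

end Contour

end MMKdV

namespace MMKdV

/-! ### Construction of sectional functions: removable poles, bounds near the branch points,
symmetries -/

section Sectional

theorem exists_differentiableOn_of_removable {f : ℂ → ℂ} {U S : Set ℂ} (hU : IsOpen U)
    (hS : S.Finite) (hf : DifferentiableOn ℂ f (U \ S))
    (h0 : ∀ c ∈ S, Tendsto (fun z => (z - c) * f z) (𝓝[≠] c) (𝓝 0)) :
    ∃ g : ℂ → ℂ, DifferentiableOn ℂ g U ∧ ∀ z ∉ S, g z = f z := by
  classical
  refine ⟨fun z => if z ∈ S then limUnder (𝓝[≠] z) f else f z, fun z hz => ?_,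
    fun z hz => if_neg hz⟩
  refine DifferentiableAt.differentiableWithinAt ?_
  by_cases hzS : z ∈ S
  · set s := U ∩ (S \ {z})ᶜ
    have hs : s ∈ 𝓝 z := (hU.inter (hS.subset Set.sdiff_subset).isClosed.isOpen_compl).mem_nhds
      ⟨hz, fun h => h.2 rfl⟩
    have hd := Complex.differentiableOn_update_limUnder_of_isLittleO hs
      (hf.mono fun w hw => ⟨hw.1.1, fun h => hw.1.2 ⟨h, hw.2⟩⟩) ?_
    · refine (hd.differentiableAt hs).congr_of_eventuallyEq ?_
      filter_upwards [hs] with w hw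
      by_cases hwz : w = z
      · subst hwz; rw [if_pos hzS, Function.update_self]
      · rw [if_neg fun h => hw.2 ⟨h, hwz⟩, Function.update_of_ne hwz]
    · refine (Asymptotics.isLittleO_iff_tendsto' ?_).2 ?_
      · filter_upwards [self_mem_nhdsWithin] with w hw h
        exact absurd (inv_eq_zero.1 h) (sub_ne_zero.2 hw)
      · have h1 : Tendsto (fun w => (w - z) * f z) (𝓝[≠] z) (𝓝 0) := by
          have : Continuous fun w => (w - z) * f z := by fun_prop
          have := this.tendsto z
          rw [sub_self, zero_mul] at this
          exact this.mono_left nhdsWithin_le_nhds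
        have h2 := (h0 z hzS).sub h1
        rw [sub_zero] at h2
        refine h2.congr fun w => ?_
        rw [div_inv_eq_mul]; ring
  · have hs : U \ S ∈ 𝓝 z := (hU.sdiff hS.isClosed).mem_nhds ⟨hz, hzS⟩
    refine (hf.differentiableAt hs).congr_of_eventuallyEq ?_
    filter_upwards [hs] with w hw
    rw [if_neg hw.2]

variable {k₀ : ℝ}

theorem exists_norm_of_eventually_atInf {p : ℂ → Prop} (h : ∀ᶠ z in atInf k₀, p z) :
    ∃ T : ℝ, ∀ z ∈ Omega k₀, T ≤ ‖z‖ → p z := by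
  rw [atInf, eventually_inf_principal] at h
  obtain ⟨T, -, hT⟩ := (hasBasis_cobounded_norm.mem_iff).1 h
  exact ⟨T, fun z hz hn => hT hn hz⟩

theorem isCompact_annulus (r R : ℝ) : IsCompact
    ({z : ℂ | 0 ≤ (‖z‖ ^ 2 - k₀ ^ 2) * z.im} ∩ {z | r ≤ ‖z‖ ∧ ‖z‖ ≤ R}) := by
  refine Metric.isCompact_of_isClosed_isBounded (isClosed_lamNonneg.inter ?_) ?_
  · exact (isClosed_le continuous_const continuous_norm).inter
      (isClosed_le continuous_norm continuous_const)
  · refine (Metric.isBounded_closedBall (x := (0 : ℂ)) (r := R)).subset fun z hz => ?_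
    rw [mem_closedBall_zero_iff]; exact hz.2.2

/-- A continuous function on `Ω` which is bounded near the branch points is bounded on annuli. -/
theorem bounded_on_annulus {g : ℂ → ℂ} (hg : ContinuousOn g (Omega k₀))
    (hb : ∀ w : ℂ, w = Complex.I * k₀ ∨ w = -(Complex.I * k₀) →
      ∃ B : ℝ, ∀ᶠ z in 𝓝[Omega k₀] w, ‖g z‖ ≤ B) (r R : ℝ) (hr : 0 < r) :
    ∃ M, ∀ z ∈ Omega k₀, r ≤ ‖z‖ → ‖z‖ ≤ R → ‖g z‖ ≤ M := by
  have hK := isCompact_annulus (k₀ := k₀) r R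
  have := hK.induction_on (p := fun s => ∃ M, ∀ z ∈ s ∩ Omega k₀, ‖g z‖ ≤ M)
    ⟨0, fun z hz => hz.1.elim⟩ (fun s t hst ⟨M, hM⟩ => ⟨M, fun z hz => hM z ⟨hst hz.1, hz.2⟩⟩)
    (fun s t ⟨M, hM⟩ ⟨M', hM'⟩ => ⟨max M M', fun z hz => by
      rcases hz.1 with h | h
      · exact (hM z ⟨h, hz.2⟩).trans (le_max_left _ _)
      · exact (hM' z ⟨h, hz.2⟩).trans (le_max_right _ _)⟩)
    (fun w hw => by
      have key : ∃ B : ℝ, ∀ᶠ z in 𝓝[Omega k₀] w, ‖g z‖ ≤ B := by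
        by_cases hw' : w = Complex.I * k₀ ∨ w = -(Complex.I * k₀)
        · exact hb w hw'
        · have hwO : w ∈ Omega k₀ := ⟨hw.1, fun h0 => by
            have h2 := hw.2.1
            rw [h0, norm_zero] at h2
            linarith, fun h => hw' (Or.inl h), fun h => hw' (Or.inr h)⟩
          refine ⟨‖g w‖ + 1, ?_⟩
          exact ((hg w hwO).norm.eventually_lt_const (lt_add_one _)).mono fun z hz => hz.le
      obtain ⟨B, hB⟩ := key
      rw [eventually_nhdsWithin_iff] at hB
      exact ⟨{z | z ∈ Omega k₀ → ‖g z‖ ≤ B}, mem_nhdsWithin_of_mem_nhds hB, B,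
        fun z hz => hz.1 hz.2⟩)
  obtain ⟨M, hM⟩ := this
  exact ⟨M, fun z hz h1 h2 => hM z ⟨⟨hz.1, h1, h2⟩, hz⟩⟩

/-- The point `(1 + s Im z) z` with small `s > 0` leaves the circle outwards when `Im z > 0` and
inwards when `Im z < 0`, in both cases into `D⁺`. -/
theorem mem_closure_Dplus (hk : 0 < k₀) {z : ℂ} (hz : ‖z‖ = k₀) (him : z.im ≠ 0) :
    z ∈ closure (Dplus k₀) := by
  have hc : Continuous fun s : ℝ => ((1 + s * z.im : ℝ) : ℂ) * z := by fun_prop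
  have ht := hc.tendsto 0
  simp only [zero_mul, add_zero, Complex.ofReal_one, one_mul] at ht
  refine mem_closure_of_tendsto (ht.mono_left (nhdsWithin_le_nhds (s := Set.Ioi 0))) ?_
  have h1 : ∀ᶠ s : ℝ in 𝓝[>] 0, 0 < 1 + s * z.im := by
    have hc' : Continuous fun s : ℝ => 1 + s * z.im := by fun_prop
    have := hc'.tendsto 0
    simp only [zero_mul, add_zero] at this
    exact (this.eventually_const_lt one_pos).filter_mono nhdsWithin_le_nhds
  filter_upwards [h1, self_mem_nhdsWithin] with s hs hs0
  change 0 < (‖((1 + s * z.im : ℝ) : ℂ) * z‖ ^ 2 - k₀ ^ 2) * (((1 + s * z.im : ℝ) : ℂ) * z).im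
  rw [norm_mul, Complex.norm_real, Real.norm_of_nonneg hs.le, hz, Complex.im_ofReal_mul]
  have hs0' : (0 : ℝ) < s := hs0
  have : (((1 + s * z.im) * k₀) ^ 2 - k₀ ^ 2) * ((1 + s * z.im) * z.im)
      = (k₀ ^ 2 * (1 + s * z.im) * s) * (z.im ^ 2 * (1 + (1 + s * z.im))) := by ring
  rw [this]
  have : 0 < z.im ^ 2 := by positivity
  positivity

/-- The bound on `a⁻¹` near the branch points is assumed inside `D⁺` only. Nearby points of `Σ` lie
on the circle, hence in the closure of `D⁺`, and inherit it by continuity. -/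
theorem eventually_norm_le_of_Dplus (hk : 0 < k₀) {g : ℂ → ℂ} (hg : ContinuousOn g (Omega k₀))
    {w : ℂ} (hw : w = Complex.I * k₀ ∨ w = -(Complex.I * k₀)) {B : ℝ}
    (h : ∀ᶠ z in 𝓝[Dplus k₀] w, ‖g z‖ ≤ B) : ∀ᶠ z in 𝓝[Omega k₀] w, ‖g z‖ ≤ B := by
  have him : w.im ≠ 0 := by
    rcases hw with rfl | rfl <;> simp [hk.ne']
  have hopen : ∀ᶠ z in 𝓝 w, z.im ≠ 0 := Complex.continuous_im.continuousAt.eventually_ne him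
  rw [eventually_nhdsWithin_iff] at h ⊢
  obtain ⟨U, hU, hUo, hwU⟩ := eventually_nhds_iff.1 h
  filter_upwards [hopen, hUo.mem_nhds hwU] with z hz hzU hzO
  rw [Omega_eq hk] at hzO
  rcases hzO with hzD | hzS
  · exact hU z hzU hzD
  · have hcl := mem_closure_Dplus hk (hzS.1.resolve_left hz) hz
    have := mem_closure_iff_nhdsWithin_neBot.1 hcl
    have ht : Tendsto (fun z => ‖g z‖) (𝓝[Dplus k₀] z) (𝓝 ‖g z‖) :=
      ((hg z (Sigma0_subset_Omega hzS)).mono (Dplus_subset_Omega hk)).norm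
    refine le_of_tendsto ht ?_
    filter_upwards [self_mem_nhdsWithin, nhdsWithin_le_nhds (hUo.mem_nhds hzU)] with u hu huU
    exact hU u huU hu

namespace IsSectional

variable {f g : ℂ → ℂ} {α β α' β' : ℂ}

theorem add (hf : IsSectional k₀ f α β) (hg : IsSectional k₀ g α' β') :
    IsSectional k₀ (fun z => f z + g z) (α + α') (β + β') where
  cont := hf.cont.add hg.cont
  diff := hf.diff.add hg.diff
  bdd r R hr := by
    obtain ⟨M, hM⟩ := hf.bdd r R hr
    obtain ⟨M', hM'⟩ := hg.bdd r R hr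
    exact ⟨M + M', fun z hz h1 h2 => (norm_add_le _ _).trans
      (add_le_add (hM z hz h1 h2) (hM' z hz h1 h2))⟩
  inf := (hf.inf.add hg.inf).congr fun z => by ring
  zero := (hf.zero.add hg.zero).congr fun z => by ring

theorem neg (hf : IsSectional k₀ f α β) : IsSectional k₀ (fun z => -f z) (-α) (-β) where
  cont := hf.cont.neg
  diff := hf.diff.neg
  bdd r R hr := by
    obtain ⟨M, hM⟩ := hf.bdd r R hr
    exact ⟨M, fun z hz h1 h2 => (norm_neg _).trans_le (hM z hz h1 h2)⟩
  inf := hf.inf.neg.congr fun z => by ring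
  zero := hf.zero.neg.congr fun z => by ring

theorem sum {ι : Type*} (s : Finset ι) {F : ι → ℂ → ℂ} {a b : ι → ℂ}
    (h : ∀ n ∈ s, IsSectional k₀ (F n) (a n) (b n)) :
    IsSectional k₀ (fun z => ∑ n ∈ s, F n z) (∑ n ∈ s, a n) (∑ n ∈ s, b n) := by
  classical
  induction s using Finset.induction_on with
  | empty =>
    simp only [Finset.sum_empty]
    exact ⟨continuousOn_const, differentiableOn_const _, fun r R _ => ⟨0, fun z _ _ _ => by simp⟩,
      by simpa using tendsto_const_nhds, by simpa using tendsto_const_nhds⟩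
  | insert n s hn ih =>
    simp only [Finset.sum_insert hn]
    exact (h n (Finset.mem_insert_self n s)).add (ih fun i hi => h i (Finset.mem_insert_of_mem hi))

theorem neg_conj_mem_Omega {z : ℂ} (h : z ∈ Omega k₀) : starRingEnd ℂ (-z) ∈ Omega k₀ := by
  refine ⟨?_, fun h0 => h.2.1 ?_, fun e => h.2.2.1 ?_, fun e => h.2.2.2 ?_⟩
  · rw [RCLike.norm_conj, norm_neg, Complex.conj_im, Complex.neg_im, neg_neg]
    exact h.1
  · simpa using h0
  · have := congrArg (starRingEnd ℂ) e
    rw [Complex.conj_conj, map_mul, Complex.conj_I, Complex.conj_ofReal, neg_mul, neg_inj] at this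
    exact this
  · have := congrArg (starRingEnd ℂ) e
    rw [Complex.conj_conj, map_neg, map_mul, Complex.conj_I, Complex.conj_ofReal, neg_mul,
      neg_inj] at this
    exact this

theorem neg_conj_mem_Dplus {z : ℂ} (h : z ∈ Dplus k₀) : starRingEnd ℂ (-z) ∈ Dplus k₀ := by
  change 0 < (‖starRingEnd ℂ (-z)‖ ^ 2 - k₀ ^ 2) * (starRingEnd ℂ (-z)).im
  rw [RCLike.norm_conj, norm_neg, Complex.conj_im, Complex.neg_im, neg_neg]
  exact h

/-- The map `z ↦ -z*` preserves `D⁺`. Evaluated at `-z`, the new function is the conjugate of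
`f(z*)`, the form in which the `D⁻` part of the jump arises. -/
theorem conj_neg_conj (hf : IsSectional k₀ f α β) :
    IsSectional k₀ (fun z => starRingEnd ℂ (f (starRingEnd ℂ (-z))))
      (-starRingEnd ℂ α) (-starRingEnd ℂ β) := by
  have hc : Continuous fun z : ℂ => starRingEnd ℂ (-z) := Complex.continuous_conj.comp continuous_neg
  have hlim : ∀ {l : Filter ℂ} {a : ℂ}, Tendsto (fun z => z * f z) l (𝓝 a) →
      Tendsto (fun z => starRingEnd ℂ (-z)) l l →
      Tendsto (fun z => z * starRingEnd ℂ (f (starRingEnd ℂ (-z)))) l (𝓝 (-starRingEnd ℂ a)) := by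
    intro l a h1 h2
    refine ((((Complex.continuous_conj.tendsto a).comp h1).comp h2).neg).congr fun z => ?_
    simp
  refine ⟨?_, fun z hz => ?_, fun r R hr => ?_, hlim hf.inf ?_, hlim hf.zero ?_⟩
  · exact Complex.continuous_conj.comp_continuousOn (hf.cont.comp hc.continuousOn
      fun z hz => neg_conj_mem_Omega hz)
  · have h1 := (hf.diff.differentiableAt (isOpen_Dplus.mem_nhds (neg_conj_mem_Dplus hz))).hasDerivAt
    have h2 := h1.conj_conj
    rw [Complex.conj_conj] at h2
    exact (h2.comp z (hasDerivAt_neg z)).differentiableAt.differentiableWithinAt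
  · obtain ⟨M, hM⟩ := hf.bdd r R hr
    refine ⟨M, fun z hz h1 h2 => ?_⟩
    rw [RCLike.norm_conj]
    exact hM _ (neg_conj_mem_Omega hz) (by simpa using h1) (by simpa using h2)
  · refine tendsto_inf.2 ⟨?_, tendsto_principal.2 ?_⟩
    · rw [← tendsto_norm_atTop_iff_cobounded]
      have : Tendsto (fun z : ℂ => ‖z‖) (atInf k₀) atTop :=
        tendsto_norm_cobounded_atTop.mono_left inf_le_left
      exact this.congr fun z => by simp
    · exact eventually_mem_atInf.mono fun z hz => neg_conj_mem_Omega hz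
  · refine tendsto_nhdsWithin_iff.2 ⟨?_, ?_⟩
    · have := hc.tendsto 0
      simp only [neg_zero, map_zero] at this
      exact this.mono_left nhdsWithin_le_nhds
    · filter_upwards [self_mem_nhdsWithin] with z hz
      exact neg_conj_mem_Omega hz

theorem add_ne_zero_of_mem {z w : ℂ} (hz : z ∈ Omega k₀) (hw : w ∈ Dplus k₀) : z + w ≠ 0 := by
  intro h
  have h1 : z = -w := eq_neg_of_add_eq_zero_left h
  have h2 : 0 ≤ (‖z‖ ^ 2 - k₀ ^ 2) * z.im := hz.1
  have h3 : 0 < (‖w‖ ^ 2 - k₀ ^ 2) * w.im := hw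
  rw [h1, norm_neg, Complex.neg_im] at h2
  linarith

theorem tendsto_mul_inv_add (w c : ℂ) :
    Tendsto (fun z => z * (c * (z + w)⁻¹)) (Bornology.cobounded ℂ) (𝓝 c) := by
  have h1 : Tendsto (fun z : ℂ => (z + w)⁻¹) (Bornology.cobounded ℂ) (𝓝 0) :=
    tendsto_inv₀_cobounded.comp (tendsto_add_const_cobounded w)
  have h2 := ((h1.const_mul w).const_sub 1).const_mul c
  rw [mul_zero, sub_zero, mul_one] at h2
  refine h2.congr' ?_
  filter_upwards [(tendsto_add_const_cobounded w).eventually (Bornology.eventually_ne_cobounded 0)] with z hz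
  field_simp
  ring

/-- The pole lies at `-w`, outside `Ω`. Evaluated at `-z` the function is `-c/(z - w)`, a principal
part subtracted in `D⁺` as seen from `D⁻`, where it is holomorphic. -/
theorem pole (hk : 0 < k₀) {w : ℂ} (hw : w ∈ Dplus k₀) (c : ℂ) :
    IsSectional k₀ (fun z => c * (z + w)⁻¹) c 0 := by
  have hw0 : w ≠ 0 := (Dplus_subset_Omega hk hw).2.1
  have hc : ∀ z, z + w ≠ 0 → ContinuousAt (fun z => c * (z + w)⁻¹) z := fun z hz =>
    (((continuous_id.add continuous_const).continuousAt).inv₀ hz).const_mul c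
  have hcont : ContinuousOn (fun z => c * (z + w)⁻¹) (Omega k₀) := fun z hz =>
    (hc z (add_ne_zero_of_mem hz hw)).continuousWithinAt
  refine ⟨hcont, fun z hz => ?_, bounded_on_annulus hcont fun u hu => ?_, ?_, ?_⟩
  · exact ((differentiableAt_id.add_const w).fun_inv (add_ne_zero_of_mem (Dplus_subset_Omega hk hz)
      hw)).const_mul c |>.differentiableWithinAt
  · have hne : u + w ≠ 0 := by
      intro h
      have h3 : 0 < (‖w‖ ^ 2 - k₀ ^ 2) * w.im := hw
      have : ‖w‖ = k₀ := by
        rw [← norm_I_mul hk, ← norm_neg, ← eq_neg_of_add_eq_zero_left h]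
        rcases hu with rfl | rfl
        · rfl
        · rw [norm_neg]
      rw [this, sub_self, zero_mul] at h3
      exact h3.ne rfl
    refine ⟨‖c * (u + w)⁻¹‖ + 1, ?_⟩
    exact (((hc u hne).norm.eventually_lt_const (lt_add_one _)).mono fun z hz => hz.le).filter_mono
      nhdsWithin_le_nhds
  · exact (tendsto_mul_inv_add w c).mono_left inf_le_left
  · have h1 : ContinuousAt (fun z => z * (c * (z + w)⁻¹)) 0 :=
      continuousAt_id.mul (hc 0 (by rwa [zero_add]))
    have := h1.tendsto
    simp only [zero_mul] at this
    exact this.mono_left nhdsWithin_le_nhds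

end IsSectional

end Sectional

end MMKdV

namespace MMKdV

/-! ### The reconstruction formula -/

section Reconstruction

variable {m : ℕ} {k₀ : ℝ} {Q : ℝ → ℝ → Sq m} {Qm Qp : Sq m}

/-- The lower block of `Ŵ a⁻¹`. -/
noncomputable def transDn (k₀ : ℝ) (Q : ℝ → ℝ → Sq m) (Qm Qp : Sq m) (x t : ℝ) (z : ℂ) : Sq m :=
  (WHat k₀ Q Qm x t z * (aPlus k₀ Q Qm Qp z)⁻¹).toRows₂

/-- The residue of `transDn` at `w`, for the norming constant `C`. -/
noncomputable def resDn (k₀ : ℝ) (Q : ℝ → ℝ → Sq m) (Qp : Sq m) (x t : ℝ) (w : ℂ) (C : Sq m) :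
    Sq m :=
  Complex.exp (2 * Complex.I * theta k₀ x t w) • ((VHat k₀ Q Qp x t w).toRows₂ * C)

theorem tendsto_mul_entry {l : Filter ℂ} {F : ℂ → Sq m} {A : Sq m} {b : ℂ → ℂ}
    (hl : ∀ᶠ z in l, z ≠ 0) (h : (fun z => F z + (Complex.I / z) • A) =O[l] b)
    (hb : Tendsto (fun z => z * b z) l (𝓝 0)) (i j : Fin m) :
    Tendsto (fun z => z * F z i j) l (𝓝 (-(Complex.I * A i j))) := by
  have h1 : (fun z => F z i j + Complex.I / z * A i j) =O[l] b :=
    (IsBigO.of_bound 1 (Eventually.of_forall fun z => by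
      rw [one_mul]; exact norm_entry_le (F z + (Complex.I / z) • A) i j)).trans h
  have h2 := ((isBigO_refl (fun z : ℂ => z) l).mul h1).trans_tendsto hb
  have h3 := h2.sub_const (Complex.I * A i j)
  rw [zero_sub] at h3
  refine h3.congr' ?_
  filter_upwards [hl] with z hz
  field_simp
  ring

theorem tendsto_mul_entry_atInf {F : ℂ → Sq m} {A : Sq m}
    (h : (fun z => F z + (Complex.I / z) • A) =O[atInf k₀] (fun z : ℂ => (z ^ 2)⁻¹))
    (i j : Fin m) : Tendsto (fun z => z * F z i j) (atInf k₀) (𝓝 (-(Complex.I * A i j))) := by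
  refine tendsto_mul_entry (eventually_mem_atInf.mono fun z hz => hz.2.1) h ?_ i j
  refine (tendsto_inv_atInf (k₀ := k₀)).congr fun z => ?_
  by_cases hz : z = 0
  · simp [hz]
  · field_simp

theorem tendsto_mul_entry_zero {F : ℂ → Sq m} {A : Sq m}
    (h : (fun z => F z + (Complex.I / z) • A) =O[𝓝[Omega k₀] 0] (fun _ => (1 : ℂ)))
    (i j : Fin m) : Tendsto (fun z => z * F z i j) (𝓝[Omega k₀] 0) (𝓝 (-(Complex.I * A i j))) := by
  refine tendsto_mul_entry (by filter_upwards [self_mem_nhdsWithin] with z hz using hz.2.1) h ?_ i j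
  simp only [mul_one]
  exact tendsto_id.mono_left nhdsWithin_le_nhds

namespace IsPotential

variable (hQ : IsPotential k₀ Q Qm Qp) (hk : 0 < k₀)
include hQ hk

theorem differentiableAt_transmission {w : ℂ} (hw : w ∈ Dplus k₀)
    (hdet : (aPlus k₀ Q Qm Qp w).det ≠ 0) (x t : ℝ) :
    DifferentiableAt ℂ (fun z => WHat k₀ Q Qm x t z * (aPlus k₀ Q Qm Qp z)⁻¹) w := by
  have h1 := ((hQ.WHat_differentiableOn hk x t).differentiableAt
    (isOpen_Dplus.mem_nhds hw)).hasDerivAt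
  have h2 := (differentiableAt_adjugate (hQ.differentiableAt_aPlus hk hw)).hasDerivAt
  have h3 := ((hQ.differentiableAt_det_aPlus hk hw).fun_inv hdet)
  have h4 : ∀ i j, DifferentiableAt ℂ (fun z => (aPlus k₀ Q Qm Qp z)⁻¹ i j) w := fun i j => by
    refine (h3.mul (hasDerivAt_matrix_complex.1 h2 i j).differentiableAt).congr_of_eventuallyEq
      (Eventually.of_forall fun z => ?_)
    simp only [Matrix.inv_def, Ring.inverse_eq_inv']
    rfl
  exact (hasDerivAt_mul_matrix_complex h1
    (hasDerivAt_matrix_complex.2 fun i j => (h4 i j).hasDerivAt)).differentiableAt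

omit hk in
theorem continuousWithinAt_transmission {w : ℂ} (hw : w ∈ Omega k₀)
    (hdet : (aPlus k₀ Q Qm Qp w).det ≠ 0) (x t : ℝ) :
    ContinuousWithinAt (fun z => WHat k₀ Q Qm x t z * (aPlus k₀ Q Qm Qp z)⁻¹) (Omega k₀) w := by
  have h1 := (hQ.WHat_continuousOn x t w hw).tendsto
  have h2 := (hQ.aPlus_continuousOn w hw).tendsto
  have h3 := (((Continuous.matrix_det continuous_id).tendsto _).comp h2).inv₀ hdet
  have h4 := ((Continuous.matrix_adjugate continuous_id).tendsto _).comp h2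
  have h5 : Tendsto (fun z => (aPlus k₀ Q Qm Qp z)⁻¹) (𝓝[Omega k₀] w)
      (𝓝 (aPlus k₀ Q Qm Qp w)⁻¹) := by
    simp only [Matrix.inv_def, Ring.inverse_eq_inv']
    exact h3.smul h4
  exact tendsto_mul_matrix h1 h5

theorem VHat_isSectional (x t : ℝ) (i j : Fin m) :
    IsSectional k₀ (fun z => (VHat k₀ Q Qp x t z).toRows₁ i j)
      (-(Complex.I * Q x t i j)) (-(Complex.I * Qp i j)) where
  cont := continuousOn_matrix.1 (hQ.VHat_continuousOn x t) (Sum.inl i) j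
  diff := differentiableOn_matrix.1 (hQ.VHat_differentiableOn hk x t) (Sum.inl i) j
  bdd r R hr := by
    obtain ⟨C, hC⟩ := hQ.VHat_bounded x t (isCompact_annulus (k₀ := k₀) r R) (fun h => by
      have := h.2.1
      rw [norm_zero] at this
      linarith)
    exact ⟨C, fun z hz h1 h2 => (norm_entry_le (VHat k₀ Q Qp x t z) (Sum.inl i) j).trans
      (hC z ⟨⟨hz.1, h1, h2⟩, hz⟩)⟩
  inf := tendsto_mul_entry_atInf (hQ.VHat_isBigO x t).2 i j
  zero := tendsto_mul_entry_zero (hQ.VHat_isBigO_zero hk x t) i j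

variable (hS : NoSpectralSingularity k₀ Q Qm Qp)
include hS

omit hk in
theorem det_aPlus_ne_zero_of_mem_Sigma0 {z : ℂ} (hz : z ∈ Sigma0 k₀) :
    (aPlus k₀ Q Qm Qp z).det ≠ 0 := by
  rw [← hQ.scat_toBlocks₁₁ hz]; exact hS.1 z hz

omit hk in
-- This is the jump relation `Ŵ a⁻¹ = V̄ + e^{2iθ} V̂ ρ` in the lower block, with the lower block of
-- `V̄` rewritten through `kap`.
theorem kernelDn_eq {z : ℂ} (hz : z ∈ Sigma0 k₀) (x t : ℝ) :
    kernelDn k₀ Q Qm Qp x t z = transDn k₀ Q Qm Qp x t z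
      + cj (VHat k₀ Q Qp x t (starRingEnd ℂ z)).toRows₁ := by
  have hz' := Sigma0_subset_Omega (conj_mem_Sigma0 hz)
  have hdet := isUnit_iff_ne_zero.2 (hS.1 z hz)
  have h1 := (hQ.scat_spec hz x t).1
  have h2 : WHat k₀ Q Qm x t z * (aPlus k₀ Q Qm Qp z)⁻¹ = VBar k₀ Q Qp x t z
      + Complex.exp (2 * Complex.I * theta k₀ x t z) •
        (VHat k₀ Q Qp x t z * rho k₀ Q Qm Qp z) := by
    rw [← hQ.scat_toBlocks₁₁ hz, WHat, h1, VBar, VHat, rho, Matrix.smul_mul, Matrix.add_mul,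
      Matrix.mul_assoc, Matrix.mul_nonsing_inv _ hdet, Matrix.mul_one, smul_add, Matrix.smul_mul,
      smul_smul, ← Complex.exp_add, Matrix.mul_assoc]
    congr 3
    ring_nf
  have h3 : (VBar k₀ Q Qp x t z).toRows₂ = -cj (VHat k₀ Q Qp x t (starRingEnd ℂ z)).toRows₁ := by
    rw [hQ.VBar_eq hz', kap_eq, Matrix.toRows₂_fromRows]
  have h4 : transDn k₀ Q Qm Qp x t z = (VBar k₀ Q Qp x t z).toRows₂ + kernelDn k₀ Q Qm Qp x t z := by
    rw [transDn, h2]; rfl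
  rw [h4, h3]
  abel

variable {N : ℕ} {z : Fin N → ℂ} (hz : HasSimpleZeros k₀ Q Qm Qp z) {C : Fin N ⊕ Fin N → Sq m}
  (hC : ∀ n, IsNorming k₀ Q Qm Qp (zeta k₀ z n) (C n))
include hz hC

/-- Subtracting the principal parts makes the poles removable. It changes the coefficient of `1/z`
at infinity by the sum of the residues and leaves the one at the origin alone. -/
theorem exists_regularized (x t : ℝ) (i j : Fin m) : ∃ G : ℂ → ℂ,
    IsSectional k₀ G (-(Complex.I * (Q x t)ᴴ i j) -
      ∑ n, resDn k₀ Q Qp x t (zeta k₀ z n) (C n) i j) (-(Complex.I * Qpᴴ i j)) ∧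
    ∀ u ∉ Set.range (zeta k₀ z), G u = transDn k₀ Q Qm Qp x t u i j
      - ∑ n, resDn k₀ Q Qp x t (zeta k₀ z n) (C n) i j * (u + -zeta k₀ z n)⁻¹ := by
  set S := Set.range (zeta k₀ z) with hSdef
  set R := fun n => resDn k₀ Q Qp x t (zeta k₀ z n) (C n) i j with hR
  have hSfin : S.Finite := Set.finite_range _
  have hζ : ∀ n, zeta k₀ z n ∈ Dplus k₀ := fun n => (hQ.isSimpleZero_zeta hk hz n).mem
  have hSD : S ⊆ Dplus k₀ := by rintro _ ⟨n, rfl⟩; exact hζ n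
  have hsub : ∀ {u : ℂ}, u ∉ S → ∀ n, u + -zeta k₀ z n ≠ 0 := fun {u} hu n h =>
    hu ⟨n, (add_neg_eq_zero.1 h).symm⟩
  set P := fun u => ∑ n, R n * (u + -zeta k₀ z n)⁻¹ with hP
  have hPd : ∀ u ∉ S, DifferentiableAt ℂ P u := fun u hu =>
    DifferentiableAt.fun_sum fun n _ =>
      ((differentiableAt_id.add_const (-zeta k₀ z n)).fun_inv (z := u) (hsub hu n)).const_mul (R n)
  set f := fun u => transDn k₀ Q Qm Qp x t u i j - P u with hf
  have hdet : ∀ u ∈ Omega k₀, u ∉ S → (aPlus k₀ Q Qm Qp u).det ≠ 0 := fun u hu huS => by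
    rw [Omega_eq hk] at hu
    rcases hu with hu | hu
    · exact hQ.det_aPlus_ne_zero hk hz hu fun n h => huS ⟨n, h.symm⟩
    · exact hQ.det_aPlus_ne_zero_of_mem_Sigma0 hS hu
  obtain ⟨G, hGd, hGf⟩ := exists_differentiableOn_of_removable (f := f) isOpen_Dplus hSfin
    (fun u hu => by
      have h1 := hQ.differentiableAt_transmission hk hu.1
        (hdet u (Dplus_subset_Omega hk hu.1) hu.2) x t
      have h2 := (hasDerivAt_matrix_complex.1 h1.hasDerivAt (Sum.inr i) j).differentiableAt
      exact (h2.sub (hPd u hu.2)).differentiableWithinAt)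
    (by
      rintro _ ⟨n, rfl⟩
      have h1 := tendsto_matrix.1 (hC n x t) (Sum.inr i) j
      have h2 : Tendsto (fun u => (u - zeta k₀ z n) * P u) (𝓝[≠] zeta k₀ z n) (𝓝 (R n)) := by
        have h3 : ∀ l ∈ Finset.univ, Tendsto
            (fun u => (u - zeta k₀ z n) * (R l * (u + -zeta k₀ z l)⁻¹))
            (𝓝[≠] zeta k₀ z n) (𝓝 (if l = n then R n else 0)) := fun l _ => by
          split_ifs with h
          · subst h
            refine tendsto_const_nhds.congr' ?_
            filter_upwards [self_mem_nhdsWithin] with u hu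
            have : u - zeta k₀ z l ≠ 0 := sub_ne_zero.2 hu
            rw [← sub_eq_add_neg]
            field_simp
          · have hne : zeta k₀ z n + -zeta k₀ z l ≠ 0 := fun h' =>
              h (hQ.zeta_injective hk hz (add_neg_eq_zero.1 h').symm)
            have hc : ContinuousAt (fun u => (u - zeta k₀ z n) * (R l * (u + -zeta k₀ z l)⁻¹))
                (zeta k₀ z n) :=
              (continuousAt_id.sub continuousAt_const).mul
                (continuousAt_const.mul ((continuousAt_id.add continuousAt_const).inv₀ hne))
            have := hc.tendsto
            simp only [sub_self, zero_mul] at this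
            exact this.mono_left nhdsWithin_le_nhds
        have h4 := tendsto_finsetSum Finset.univ h3
        rw [Finset.sum_ite_eq' Finset.univ n, if_pos (Finset.mem_univ n)] at h4
        refine h4.congr fun u => ?_
        rw [hP, Finset.mul_sum]
      have h5 := h1.sub h2
      have h6 : (Complex.exp (2 * Complex.I * theta k₀ x t (zeta k₀ z n)) •
          (VHat k₀ Q Qp x t (zeta k₀ z n) * C n)) (Sum.inr i) j - R n = 0 := sub_self _
      rw [h6] at h5
      refine h5.congr fun u => ?_
      rw [hf, mul_sub]; rfl)
  have hGev : ∀ {l : Filter ℂ}, (∀ᶠ u in l, u ∉ S) → G =ᶠ[l] f := fun h => h.mono fun u hu => hGf u hu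
  have hScl : IsClosed S := hSfin.isClosed
  have hbr : ∀ w : ℂ, w = Complex.I * k₀ ∨ w = -(Complex.I * k₀) → w ∉ S := fun w hw h => by
    have := Dplus_subset_Omega hk (hSD h)
    rcases hw with hw | hw
    · exact this.2.2.1 hw
    · exact this.2.2.2 hw
  have hcont : ContinuousOn G (Omega k₀) := by
    intro u hu
    by_cases huS : u ∈ S
    · exact (hGd.differentiableAt (isOpen_Dplus.mem_nhds
        (hSD huS))).continuousAt.continuousWithinAt
    · have h1 := tendsto_matrix.1 (hQ.continuousWithinAt_transmission hu (hdet u hu huS) x t).tendsto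
        (Sum.inr i) j
      have h2 : ContinuousWithinAt f (Omega k₀) u :=
        ContinuousWithinAt.sub h1 (hPd u huS).continuousAt.continuousWithinAt
      exact h2.congr_of_eventuallyEq
        (hGev (nhdsWithin_le_nhds (hScl.isOpen_compl.mem_nhds huS))) (hGf u huS)
  refine ⟨G, ⟨hcont, hGd, bounded_on_annulus hcont fun w hw => ?_, ?_, ?_⟩, hGf⟩
  · obtain ⟨B, hB⟩ := hS.2 w hw
    -- Near a branch point `Ŵ` is bounded by the Volterra construction and `a⁻¹` by the spectral
    -- assumption; the principal parts are continuous there.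
    have hwn : ‖w‖ = k₀ := by
      rcases hw with rfl | rfl
      · exact norm_I_mul hk
      · rw [norm_neg]; exact norm_I_mul hk
    obtain ⟨D, hD⟩ := hQ.WHat_bounded x t (isCompact_closedBall w (k₀ / 2)) (fun h => by
      rw [mem_closedBall_iff_norm, zero_sub, norm_neg, hwn] at h
      linarith)
    refine ⟨D * (m * (m * B)) + (‖P w‖ + 1), eventually_norm_le_of_Dplus hk hcont hw ?_⟩
    have hPw : ∀ᶠ u in 𝓝[Dplus k₀] w, ‖P u‖ ≤ ‖P w‖ + 1 :=
      (((hPd w (hbr w hw)).continuousAt.norm.eventually_lt_const (lt_add_one _)).mono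
        fun u hu => hu.le).filter_mono nhdsWithin_le_nhds
    filter_upwards [hB, hPw, self_mem_nhdsWithin,
      nhdsWithin_le_nhds (hScl.isOpen_compl.mem_nhds (hbr w hw)),
      nhdsWithin_le_nhds (Metric.closedBall_mem_nhds w (half_pos hk))] with u h1 h2 h3 h4 h5
    rw [hGf u h4]
    refine (norm_sub_le _ _).trans (add_le_add ?_ h2)
    have e1 := hD u ⟨h5, Dplus_subset_Omega hk h3⟩
    have e2 : ‖(aPlus k₀ Q Qm Qp u)⁻¹‖ ≤ m * (m * B) := by
      have := norm_matrix_le_of_entry_le h1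
      rwa [Fintype.card_fin] at this
    refine (norm_entry_le (WHat k₀ Q Qm x t u * (aPlus k₀ Q Qm Qp u)⁻¹) (Sum.inr i) j).trans ?_
    exact (Matrix.linfty_opNorm_mul _ _).trans
      (mul_le_mul e1 e2 (norm_nonneg _) ((norm_nonneg _).trans e1))
  · have h1 := tendsto_mul_entry_atInf (hQ.transmission_isBigO x t).2 i j
    have h2 := tendsto_finsetSum Finset.univ fun n (_ : n ∈ Finset.univ) =>
      (IsSectional.tendsto_mul_inv_add (-zeta k₀ z n) (R n)).mono_left
        (inf_le_left : atInf k₀ ≤ Bornology.cobounded ℂ)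
    have hev : ∀ᶠ u in atInf k₀, u ∉ S :=
      mem_inf_of_left (Bornology.isBounded_def.1 hSfin.isBounded)
    refine (h1.sub h2).congr' ?_
    filter_upwards [hev] with u hu
    rw [hGf u hu, hf, mul_sub, hP, Finset.mul_sum]
    rfl
  · have h1 := tendsto_mul_entry_zero (hQ.transmission_isBigO_zero hk x t) i j
    have h0 : (0 : ℂ) ∉ S := fun h => (Dplus_subset_Omega hk (hSD h)).2.1 rfl
    have h2 : Tendsto (fun u => u * P u) (𝓝[Omega k₀] 0) (𝓝 0) := by
      have := (continuousAt_id.mul (hPd 0 h0).continuousAt).tendsto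
      simp only [Pi.mul_apply, id, zero_mul] at this
      exact this.mono_left nhdsWithin_le_nhds
    have h3 := h1.sub h2
    rw [sub_zero] at h3
    refine h3.congr' ?_
    filter_upwards [nhdsWithin_le_nhds (hScl.isOpen_compl.mem_nhds h0)] with u hu
    rw [hGf u hu, hf, mul_sub]
    rfl

/-- The kernel is unchanged when the principal parts are subtracted from the `D⁺` function and added
back through the `D⁻` function, to which they belong as holomorphic terms. -/
theorem exists_isJump (x t : ℝ) (i j : Fin m) : ∃ g h : ℂ → ℂ,
    IsJump k₀ (fun u => kernelDn k₀ Q Qm Qp x t u i j) g h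
      (-(Complex.I * (Q x t)ᴴ i j) - ∑ n, resDn k₀ Q Qp x t (zeta k₀ z n) (C n) i j)
      (-(Complex.I * Qpᴴ i j))
      (Complex.I * (Q x t)ᴴ i j + ∑ n, resDn k₀ Q Qp x t (zeta k₀ z n) (C n) i j)
      (Complex.I * Qpᴴ i j) := by
  obtain ⟨G, hG, hGf⟩ := hQ.exists_regularized hk hS hz hC x t i j
  have hζ : ∀ n, zeta k₀ z n ∈ Dplus k₀ := fun n => (hQ.isSimpleZero_zeta hk hz n).mem
  have hcjQ : starRingEnd ℂ (Q x t i j) = (Q x t)ᴴ i j := by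
    rw [← cj_apply, cj_of_symm (hQ.symm x t)]
  have hcjQp : starRingEnd ℂ (Qp i j) = Qpᴴ i j := by
    rw [← cj_apply, cj_of_symm hQ.symm_plus]
  have hh := (hQ.VHat_isSectional hk x t i j).conj_neg_conj.neg.add
    (IsSectional.sum Finset.univ fun n _ => IsSectional.pole hk (hζ n)
      (resDn k₀ Q Qp x t (zeta k₀ z n) (C n) i j))
  have hα : -(-starRingEnd ℂ (-(Complex.I * Q x t i j))) = Complex.I * (Q x t)ᴴ i j := by
    rw [neg_neg, map_neg, map_mul, Complex.conj_I, hcjQ, neg_mul, neg_neg]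
  have hβ : -(-starRingEnd ℂ (-(Complex.I * Qp i j))) = Complex.I * Qpᴴ i j := by
    rw [neg_neg, map_neg, map_mul, Complex.conj_I, hcjQp, neg_mul, neg_neg]
  rw [hα, hβ, Finset.sum_const_zero, add_zero] at hh
  -- On the real axis the terms `(i/s) A†` from the two boundary values cancel. With `A = Q(x, t)`
  -- this gives decay like `1/s²` at infinity, with `A = Qp` boundedness at the origin.
  have hreal : ∀ s : ℝ, s ≠ 0 → ∀ A : Sq m, Aᵀ = A → kernelDn k₀ Q Qm Qp x t s i j
      = (transDn k₀ Q Qm Qp x t s + (Complex.I / s) • Aᴴ) i j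
        + starRingEnd ℂ (((VHat k₀ Q Qp x t s).toRows₁ + (Complex.I / s) • A) i j) := by
    intro s hs A hA
    have hA' : starRingEnd ℂ (A i j) = Aᴴ i j := by rw [← cj_apply, cj_of_symm hA]
    rw [hQ.kernelDn_eq hS (ofReal_mem_Sigma0 hk hs), Complex.conj_ofReal, Matrix.add_apply,
      Matrix.add_apply, Matrix.add_apply, map_add, Matrix.smul_apply, Matrix.smul_apply,
      smul_eq_mul, smul_eq_mul, map_mul, map_div₀, Complex.conj_I, Complex.conj_ofReal, hA',
      cj_apply]
    ring
  have hbound : ∀ (s : ℝ), s ≠ 0 → ∀ A : Sq m, Aᵀ = A → ‖kernelDn k₀ Q Qm Qp x t s i j‖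
      ≤ ‖transDn k₀ Q Qm Qp x t s + (Complex.I / s) • Aᴴ‖
        + ‖(VHat k₀ Q Qp x t s).toRows₁ + (Complex.I / s) • A‖ := fun s hs A hA => by
    rw [hreal s hs A hA]
    refine (norm_add_le _ _).trans (add_le_add (norm_entry_le _ i j) ?_)
    rw [RCLike.norm_conj]
    exact norm_entry_le _ i j
  refine ⟨G, _, hG, hh, fun u hu => ?_, ?_, ?_⟩
  · have huS : u ∉ Set.range (zeta k₀ z) := by
      rintro ⟨n, rfl⟩
      have h1 : 0 < (‖zeta k₀ z n‖ ^ 2 - k₀ ^ 2) * (zeta k₀ z n).im := hζ n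
      rcases hu.1 with h | h
      · rw [h, mul_zero] at h1; exact h1.ne rfl
      · rw [h, sub_self, zero_mul] at h1; exact h1.ne rfl
    rw [hGf u huS, hQ.kernelDn_eq hS hu, neg_neg, Matrix.add_apply, cj_apply]
    have : ∀ n, (-u + zeta k₀ z n)⁻¹ = -(u + -zeta k₀ z n)⁻¹ := fun n => by
      rw [← inv_neg]; congr 1; ring
    simp only [this, mul_neg, Finset.sum_neg_distrib]
    ring
  · obtain ⟨c₁, h1⟩ := (hQ.transmission_isBigO x t).2.bound
    obtain ⟨c₂, h2⟩ := (hQ.VHat_isBigO x t).2.bound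
    obtain ⟨T, hT⟩ := exists_norm_of_eventually_atInf (h1.and h2)
    refine ⟨c₁ + c₂, max T 1, fun s hs => ?_⟩
    have hs0 : s ≠ 0 := fun h => by
      have := (le_max_right T 1).trans hs
      rw [h, abs_zero] at this
      linarith
    obtain ⟨e1, e2⟩ := hT s (Sigma0_subset_Omega (ofReal_mem_Sigma0 hk hs0)) (by
      rw [Complex.norm_real]; exact (le_max_left T 1).trans hs)
    refine (hbound s hs0 _ (hQ.symm x t)).trans ((add_le_add e1 e2).trans (le_of_eq ?_))
    rw [norm_inv, norm_pow, Complex.norm_real, Real.norm_eq_abs, sq_abs]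
    ring
  · obtain ⟨c₁, h1⟩ := (hQ.transmission_isBigO_zero hk x t).bound
    obtain ⟨c₂, h2⟩ := (hQ.VHat_isBigO_zero hk x t).bound
    obtain ⟨ε, hε, hT⟩ := Metric.mem_nhdsWithin_iff.1 (h1.and h2)
    refine ⟨c₁ + c₂, ε, hε, fun s hs0 hs => ?_⟩
    obtain ⟨e1, e2⟩ := hT ⟨by simpa using hs, Sigma0_subset_Omega (ofReal_mem_Sigma0 hk hs0)⟩
    rw [norm_one, mul_one] at e1 e2
    exact (hbound s hs0 _ hQ.symm_plus).trans (add_le_add e1 e2)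

theorem integrableSigma_kernelDn (x t : ℝ) : IntegrableSigma k₀ (kernelDn k₀ Q Qm Qp x t) := by
  intro i j
  obtain ⟨g, h, H⟩ := hQ.exists_isJump hk hS hz hC x t i j
  exact ⟨H.integrable_real hk, (H.intervalIntegrable_upper hk).trans (H.intervalIntegrable_lower hk)⟩

/-- Here `α' = -α` and `β' = -β`, so the two sides of the contour contribute equally and the result
is `2πi (β - α)`. -/
theorem integralSigma_kernelDn (x t : ℝ) : integralSigma k₀ (kernelDn k₀ Q Qm Qp x t)
    = (2 * (Real.pi : ℂ)) • (Qpᴴ - (Q x t)ᴴ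
      + Complex.I • ∑ n, resDn k₀ Q Qp x t (zeta k₀ z n) (C n)) := by
  ext i j
  obtain ⟨g, h, H⟩ := hQ.exists_isJump hk hS hz hC x t i j
  refine (H.integral_contour hk).trans ?_
  simp only [Matrix.smul_apply, Matrix.add_apply, Matrix.sub_apply, Matrix.sum_apply, smul_eq_mul]
  linear_combination (-(2 * Real.pi * (Qpᴴ i j - (Q x t)ᴴ i j))) * Complex.I_sq

omit hk hz hC hS in
theorem kernelUp_eq {u : ℂ} (hu : u ∈ Sigma0 k₀) (x t : ℝ) : kernelUp k₀ Q Qm Qp x t u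
    = -cj (kernelDn k₀ Q Qm Qp x t (starRingEnd ℂ u)) := by
  rw [kernelUp, kernelDn, hQ.rhoBar_eq hu,
    hQ.VBar_eq (Sigma0_subset_Omega (conj_mem_Sigma0 hu)), kap_eq, Matrix.toRows₁_fromRows, cj_smul,
    exp_two_theta_conj, Complex.conj_conj, cj_mul, Matrix.mul_neg, smul_neg]

end IsPotential

theorem conj_circleMap (r p : ℝ) :
    starRingEnd ℂ (circleMap 0 r p) = circleMap 0 r (2 * Real.pi - p) := by
  rw [circleMap, circleMap, zero_add, zero_add, map_mul, Complex.conj_ofReal, ← Complex.exp_conj,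
    map_mul, Complex.conj_ofReal, Complex.conj_I]
  congr 1
  push_cast
  rw [sub_mul, Complex.exp_sub, Complex.exp_two_pi_mul_I, mul_neg, Complex.exp_neg, one_div]

theorem deriv_circleMap_sub (r p : ℝ) : deriv (circleMap 0 r) (2 * Real.pi - p)
    = -starRingEnd ℂ (deriv (circleMap 0 r) p) := by
  rw [deriv_circleMap, deriv_circleMap, map_mul, conj_circleMap, Complex.conj_I]; ring

/-! ### The contour integral under complex conjugation -/

section ContourConj

variable {f f' : ℂ → Sq m} (hk : 0 < k₀) (h : ∀ u ∈ Sigma0 k₀, f' u = -cj (f (starRingEnd ℂ u)))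
include hk h

theorem conj_real_ae (i j : Fin m) : ∀ᵐ s : ℝ, f' s i j = -starRingEnd ℂ (f s i j) := by
  have hne : ∀ᵐ s : ℝ, s ≠ 0 := by rw [ae_iff]; simp
  filter_upwards [hne] with s hs
  rw [h _ (ofReal_mem_Sigma0 hk hs), Complex.conj_ofReal]; rfl

theorem conj_circle_ae (i j : Fin m) : ∀ᵐ p : ℝ, p ∈ Set.Icc 0 (2 * Real.pi) →
    f' (circleMap 0 k₀ p) i j
      = -starRingEnd ℂ (f (circleMap 0 k₀ (2 * Real.pi - p)) i j) := by
  filter_upwards [ae_circleMap_mem_Sigma0 hk] with p hp hp'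
  rw [h _ (hp hp'), conj_circleMap]; rfl

theorem IntegrableSigma.conj (hf : IntegrableSigma k₀ f) : IntegrableSigma k₀ f' := by
  intro i j
  obtain ⟨h1, h2⟩ := hf i j
  have hpi := Real.pi_pos
  refine ⟨?_, ?_⟩
  · exact ((Complex.conjCLE.toContinuousLinearMap.integrable_comp h1).neg).congr
      ((conj_real_ae hk h i j).mono fun s hs => hs.symm)
  · have h3 := h2.comp_sub_left (2 * Real.pi)
    rw [sub_zero, sub_self] at h3
    have h4 : IntervalIntegrable (fun p => -starRingEnd ℂ (f (circleMap 0 k₀ (2 * Real.pi - p)) i j))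
        volume 0 (2 * Real.pi) := by
      have h5 := h3.symm
      rw [intervalIntegrable_iff] at h5 ⊢
      exact (Complex.conjCLE.toContinuousLinearMap.integrable_comp h5).neg
    refine h4.congr_ae ?_
    rw [Filter.EventuallyEq, ae_restrict_iff' measurableSet_uIoc]
    filter_upwards [conj_circle_ae hk h i j] with p hp hp'
    rw [Set.uIoc_of_le (by linarith)] at hp'
    exact (hp ⟨hp'.1.le, hp'.2⟩).symm

theorem arc_conj (i j : Fin m) {c d : ℝ} (hcd : c ≤ d) (hc : 0 ≤ c) (hd : d ≤ 2 * Real.pi) :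
    (∫ p in c..d, deriv (circleMap 0 k₀) p * f' (circleMap 0 k₀ p) i j)
      = starRingEnd ℂ (∫ p in (2 * Real.pi - d)..(2 * Real.pi - c),
        deriv (circleMap 0 k₀) p * f (circleMap 0 k₀ p) i j) := by
  rw [← intervalIntegral.integral_comp_sub_left (fun p => deriv (circleMap 0 k₀) p *
    f (circleMap 0 k₀ p) i j) (2 * Real.pi), intervalIntegral.integral_of_le hcd,
    intervalIntegral.integral_of_le hcd, ← integral_conj, ← intervalIntegral.integral_of_le hcd,
    ← intervalIntegral.integral_of_le hcd]
  refine intervalIntegral.integral_congr_ae ?_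
  filter_upwards [conj_circle_ae hk h i j] with p hp hp'
  rw [Set.uIoc_of_le hcd] at hp'
  rw [hp ⟨hc.trans hp'.1.le, hp'.2.trans hd⟩, map_mul, deriv_circleMap_sub, map_neg,
    Complex.conj_conj]
  ring

/-- Conjugation fixes the real axis and exchanges the two arcs. These carry opposite signs in the
contour integral, matching the sign in the hypothesis. -/
theorem integralSigma_conj : integralSigma k₀ f' = -cj (integralSigma k₀ f) := by
  ext i j
  have hpi := Real.pi_pos
  have h1 : ∀ s : Set ℝ, (∫ u in s, f' (u : ℝ) i j) = -starRingEnd ℂ (∫ u in s, f (u : ℝ) i j) := by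
    intro s
    rw [← integral_conj, ← integral_neg]
    exact integral_congr_ae (ae_restrict_of_ae (conj_real_ae hk h i j))
  have h2 := arc_conj hk h i j hpi.le le_rfl (by linarith)
  have h3 := arc_conj hk h i j (c := Real.pi) (d := 2 * Real.pi) (by linarith) hpi.le le_rfl
  have e : 2 * Real.pi - Real.pi = Real.pi := by ring
  rw [e, sub_zero] at h2
  rw [e, sub_self] at h3
  simp only [integralSigma, Matrix.neg_apply, cj_apply, Matrix.of_apply, h1, h2, h3, map_add,
    map_sub]
  ring

end ContourConj

end Reconstruction

end MMKdV

end

/-! ### The reconstruction formula -/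

theorem proposition3p4 {m N : ℕ} (k₀ : ℝ) (hk₀ : 0 < k₀)
    (Q : ℝ → ℝ → MMKdV.Sq m) (Qm Qp : MMKdV.Sq m)
    (hQ : MMKdV.IsPotential k₀ Q Qm Qp)
    (hS : MMKdV.NoSpectralSingularity k₀ Q Qm Qp)
    (z : Fin N → ℂ) (hz : MMKdV.HasSimpleZeros k₀ Q Qm Qp z) :
    (∃! C : Fin N ⊕ Fin N → MMKdV.Sq m,
      ∀ n, MMKdV.IsNorming k₀ Q Qm Qp (MMKdV.zeta k₀ z n) (C n)) ∧
    (∃! Cbar : Fin N ⊕ Fin N → MMKdV.Sq m,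
      ∀ n, MMKdV.IsNormingBar k₀ Q Qm Qp (starRingEnd ℂ (MMKdV.zeta k₀ z n)) (Cbar n)) ∧
    ∀ C Cbar : Fin N ⊕ Fin N → MMKdV.Sq m,
      (∀ n, MMKdV.IsNorming k₀ Q Qm Qp (MMKdV.zeta k₀ z n) (C n)) →
      (∀ n, MMKdV.IsNormingBar k₀ Q Qm Qp (starRingEnd ℂ (MMKdV.zeta k₀ z n)) (Cbar n)) →
      (∀ x t : ℝ,
        MMKdV.IntegrableSigma k₀ (MMKdV.kernelUp k₀ Q Qm Qp x t) ∧
        Q x t = Qp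
          + Complex.I • ∑ n, Complex.exp
              (-(2 * Complex.I * MMKdV.theta k₀ x t (starRingEnd ℂ (MMKdV.zeta k₀ z n)))) •
              ((MMKdV.VBar k₀ Q Qp x t (starRingEnd ℂ (MMKdV.zeta k₀ z n))).toRows₁ * Cbar n)
          + (1 / (2 * (Real.pi : ℂ))) •
              MMKdV.integralSigma k₀ (MMKdV.kernelUp k₀ Q Qm Qp x t) ∧
        MMKdV.IntegrableSigma k₀ (MMKdV.kernelDn k₀ Q Qm Qp x t) ∧
        Matrix.conjTranspose (Q x t) = Matrix.conjTranspose Qp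
          + Complex.I • ∑ n, Complex.exp
              (2 * Complex.I * MMKdV.theta k₀ x t (MMKdV.zeta k₀ z n)) •
              ((MMKdV.VHat k₀ Q Qp x t (MMKdV.zeta k₀ z n)).toRows₂ * C n)
          - (1 / (2 * (Real.pi : ℂ))) •
              MMKdV.integralSigma k₀ (MMKdV.kernelDn k₀ Q Qm Qp x t)) ∧
      ∀ n, Cbar n = -Matrix.conjTranspose (C n) := by
  have hζ := fun n => hQ.isSimpleZero_zeta hk₀ hz n
  have hbar : ∀ n (A B : MMKdV.Sq m), MMKdV.IsNorming k₀ Q Qm Qp (MMKdV.zeta k₀ z n) A →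
      MMKdV.IsNormingBar k₀ Q Qm Qp (starRingEnd ℂ (MMKdV.zeta k₀ z n)) B → B = -MMKdV.cj A := by
    intro n A B hA hB
    rw [hQ.isNorming_unique hk₀ (hζ n).mem hA ((hQ.isNormingBar_iff hk₀ (hζ n).mem).1 hB),
      MMKdV.cj_neg, MMKdV.cj_cj, neg_neg]
  choose C₀ hC₀ using fun n => hQ.exists_isNorming hk₀ (hζ n)
  refine ⟨⟨C₀, hC₀, fun C hC => funext fun n =>
      hQ.isNorming_unique hk₀ (hζ n).mem (hC n) (hC₀ n)⟩,
    ⟨fun n => -MMKdV.cj (C₀ n), fun n => (hQ.isNormingBar_iff hk₀ (hζ n).mem).2 ?_,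
      fun B hB => funext fun n => hbar n _ _ (hC₀ n) (hB n)⟩, ?_⟩
  · rw [MMKdV.cj_neg, MMKdV.cj_cj, neg_neg]; exact hC₀ n
  intro C Cbar hC hCbar
  have hCC : ∀ n, Cbar n = -MMKdV.cj (C n) := fun n => hbar n _ _ (hC n) (hCbar n)
  refine ⟨fun x t => ?_, fun n => ?_⟩
  · have hkup : ∀ u ∈ MMKdV.Sigma0 k₀, MMKdV.kernelUp k₀ Q Qm Qp x t u
        = -MMKdV.cj (MMKdV.kernelDn k₀ Q Qm Qp x t (starRingEnd ℂ u)) :=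
      fun u hu => hQ.kernelUp_eq hu x t
    have hi := hQ.integrableSigma_kernelDn hk₀ hS hz hC x t
    have hpi : (2 * (Real.pi : ℂ)) ≠ 0 :=
      mul_ne_zero two_ne_zero (Complex.ofReal_ne_zero.2 Real.pi_ne_zero)
    have hdn : (Q x t)ᴴ = Qpᴴ + Complex.I • ∑ n, MMKdV.resDn k₀ Q Qp x t (MMKdV.zeta k₀ z n) (C n)
        - (1 / (2 * (Real.pi : ℂ))) •
          MMKdV.integralSigma k₀ (MMKdV.kernelDn k₀ Q Qm Qp x t) := by
      rw [hQ.integralSigma_kernelDn hk₀ hS hz hC x t, smul_smul, one_div, inv_mul_cancel₀ hpi,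
        one_smul]
      abel
    refine ⟨hi.conj hk₀ hkup, ?_, hi, hdn⟩
    -- The formula for `Q` is the entrywise conjugate of the one for `Q†`; symmetry of `Q` and `Qp`
    -- turns the adjoints back into the matrices themselves.
    have hup := congrArg MMKdV.cj hdn
    rw [MMKdV.conjTranspose_cj, hQ.symm, MMKdV.cj_sub, MMKdV.cj_add, MMKdV.conjTranspose_cj,
      hQ.symm_plus, MMKdV.cj_smul, MMKdV.cj_smul, MMKdV.cj_sum, Complex.conj_I] at hup
    have hc : starRingEnd ℂ (1 / (2 * (Real.pi : ℂ))) = 1 / (2 * (Real.pi : ℂ)) := by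
      rw [map_div₀, map_mul, Complex.conj_ofReal, map_one, map_ofNat]
    have hres : ∀ n, Complex.exp
        (-(2 * Complex.I * MMKdV.theta k₀ x t (starRingEnd ℂ (MMKdV.zeta k₀ z n)))) •
        ((MMKdV.VBar k₀ Q Qp x t (starRingEnd ℂ (MMKdV.zeta k₀ z n))).toRows₁ * Cbar n)
        = -MMKdV.cj (MMKdV.resDn k₀ Q Qp x t (MMKdV.zeta k₀ z n) (C n)) := fun n => by
      have hO := MMKdV.Dplus_subset_Omega hk₀ (hζ n).mem
      rw [hQ.VBar_eq (by rwa [Complex.conj_conj]), Complex.conj_conj, MMKdV.kap_eq,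
        Matrix.toRows₁_fromRows, hCC, MMKdV.resDn, MMKdV.cj_smul, MMKdV.IsPotential.exp_two_theta_conj,
        MMKdV.cj_mul, Matrix.mul_neg, smul_neg]
    rw [MMKdV.integralSigma_conj hk₀ hkup, Finset.sum_congr rfl fun n _ => hres n,
      Finset.sum_neg_distrib]
    rw [hc] at hup
    refine hup.trans ?_
    module
  -- Conjugation symmetry alone gives `C̄ = -conj C`; the adjoint appears because `C` is symmetric.
  · rw [hCC, ← MMKdV.transpose_cj, hQ.isNorming_transpose hk₀ (hζ n) (hC n)]
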